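/- Let $R$ be either the polynomial ring $K[x_1,\dots,x_n]$ over a field $K$ with $\operatorname{char}(K)=0$, or the exterior algebra $\bigoplus_{j}\bigwedge^j V$ of an $n$-dimensional vector space $V$ with basis $e_1,\dots,e_n$ over an infinite field $K$, with the standard grading. For a graded $R$-module $M$ let $\beta_{i,j}^R(M)=\dim_K \operatorname{Tor}_i^R(K,M)_j$ be its graded Betti numbers. For a graded ideal $I\subset R$ let $\operatorname{Gin}(I)$ be its generic initial ideal with respect to the (degree) reverse lexicographic order induced by $x_1>\cdots>x_n$ (resp. $e_1>\cdots>e_n$), that is, the unique ideal $J$ for which there is a nonempty Zariski open subset $U\subset GL_n(K)$ such that the initial ideal of $gI$ is $J$ for all $g\in U$ (such a $J$ exists). Let $I_{\langle d\rangle}$ be the ideal of $R$ generated by all homogeneous elements of degree $d$ in $I$; we say that it has a linear resolution if $\beta_{i,j}^R(I_{\langle d\rangle})=0$ for all $i\ge 0$ and all $j\neq i+d$ (in particular, this holds if $I_{\langle d\rangle}=0$). Let $I\subset R$ be a graded ideal and let $k\ge 0$ be an integer. Then the following conditions are equivalent: (i) $\beta_{i,i+k}^R(R/I)=\beta_{i,i+k}^R(R/\operatorname{Gin}(I))$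 for all $i\ge 1$; (ii) $I_{\langle k\rangle}$ and $I_{\langle k+1\rangle}$ have a linear resolution; (iii) $\beta_{1,k+1}^R(R/I)=\beta_{1,k+1}^R(R/\operatorname{Gin}(I))$ and $\beta_{1,k+2}^R(R/I)=\beta_{1,k+2}^R(R/\operatorname{Gin}(I))$. -/

import Mathlib

open scoped TensorProduct

universe u v w

noncomputable section

namespace LinearStrand

/-! ### Graded Betti numbers

`R` is a (possibly noncommutative) `K`-algebra with an `ℕ`-grading `𝒜` whose degree-zero part is
`K`, and `M` is a left `R`-module with an `ℕ`-grading `ℳ`.  The spaces `Tor_i^R(K, M)_j` are the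
homology of the normalized bar complex

  `⋯ ⟶ R₊ ⊗ R₊ ⊗ M ⟶ R₊ ⊗ M ⟶ M`   (tensor products over `K`, `R₊ = ⨁_{a ≥ 1} 𝒜 a`)

which is `K ⊗_R (normalized bar resolution of M)`, in internal degree `j`. -/

section Betti

variable {K : Type u} [Field K] {R : Type v} [Ring R] [Algebra K R]

/-- A left `R`-module with its underlying `K`-vector space structure. -/
structure BarObj (K : Type u) [Field K] (R : Type v) [Ring R] [Algebra K R] where
  carrier : Type v
  [addCommGroup : AddCommGroup carrier]
  [moduleBase : Module K carrier]
  [module : Module R carrier]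
  [isScalarTower : IsScalarTower K R carrier]

attribute [instance] BarObj.addCommGroup BarObj.moduleBase BarObj.module BarObj.isScalarTower

variable (K R) in
/-- `barObj K R M i` is `R ⊗ ⋯ ⊗ R ⊗ M` with `i` factors `R`, and `R` acting by multiplication on
the first factor (on `M` itself if `i = 0`). -/
def barObj (M : Type v) [AddCommGroup M] [Module K M] [Module R M] [IsScalarTower K R M] :
    ℕ → BarObj K R
  | 0 => { carrier := M }
  | i + 1 => { carrier := R ⊗[K] (barObj M i).carrier }

section

variable (K R) (M : Type v) [AddCommGroup M] [Module K M] [Module R M] [IsScalarTower K R M]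

/-- The `K`-bilinear map `(r, x) ↦ r ⊗ x`. -/
def barTmul (i : ℕ) :
    R →ₗ[K] (barObj K R M i).carrier →ₗ[K] (barObj K R M (i + 1)).carrier :=
  TensorProduct.mk K R (barObj K R M i).carrier

/-- The bar differential, given by `d (r ⊗ m) = r • m` and `d (r ⊗ x) = r • x - r ⊗ d x`, so that
`d (r₁ ⊗ ⋯ ⊗ rᵢ ⊗ m) = ∑ₛ (-1)^(s-1) r₁ ⊗ ⋯ ⊗ rₛ rₛ₊₁ ⊗ ⋯ ⊗ m + (-1)^(i-1) r₁ ⊗ ⋯ ⊗ rᵢ m`. -/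
def barDiff : ∀ i : ℕ, (barObj K R M (i + 1)).carrier →ₗ[K] (barObj K R M i).carrier
  | 0 => TensorProduct.lift (Algebra.lsmul K K M).toLinearMap
  | i + 1 => TensorProduct.lift
      ((Algebra.lsmul K K (barObj K R M (i + 1)).carrier).toLinearMap -
        (barTmul K R M i).compl₂ (barDiff i))

/-- The kernel of the differential that leaves homological degree `i`. -/
def barKer : ∀ i : ℕ, Submodule K (barObj K R M i).carrier
  | 0 => ⊤
  | i + 1 => LinearMap.ker (barDiff K R M i)

variable {R M}

/-- The component of internal degree `j` of `R₊ ⊗ ⋯ ⊗ R₊ ⊗ M` (`i` factors `R₊`): it is spanned by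
the `r₁ ⊗ ⋯ ⊗ rᵢ ⊗ m` with homogeneous entries, all `rₛ` of positive degree, of total degree `j`. -/
def barDeg (𝒜 : ℕ → Submodule K R) (ℳ : ℕ → Submodule K M) :
    ∀ i : ℕ, ℕ → Submodule K (barObj K R M i).carrier
  | 0, j => ℳ j
  | i + 1, j => ⨆ (a : ℕ) (b : ℕ) (_ : 1 ≤ a) (_ : a + b = j),
      Submodule.map₂ (barTmul K R M i) (𝒜 a) (barDeg 𝒜 ℳ i b)

/-- Cycles of homological degree `i` and internal degree `j`. -/
def barCycles (𝒜 : ℕ → Submodule K R) (ℳ : ℕ → Submodule K M) (i j : ℕ) :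
    Submodule K (barObj K R M i).carrier :=
  barDeg K 𝒜 ℳ i j ⊓ barKer K R M i

/-- Boundaries of homological degree `i` and internal degree `j`. -/
def barBoundaries (𝒜 : ℕ → Submodule K R) (ℳ : ℕ → Submodule K M) (i j : ℕ) :
    Submodule K (barObj K R M i).carrier :=
  (barDeg K 𝒜 ℳ (i + 1) j).map (barDiff K R M i)

/-- `Tor_i^R(K, M)_j`. -/
abbrev TorDeg (𝒜 : ℕ → Submodule K R) (ℳ : ℕ → Submodule K M) (i j : ℕ) : Type v :=
  barCycles K 𝒜 ℳ i j ⧸ (barBoundaries K 𝒜 ℳ i j).submoduleOf (barCycles K 𝒜 ℳ i j)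

/-- The graded Betti number `β_{i,j}^R(M) = dim_K Tor_i^R(K, M)_j`. -/
def betti (𝒜 : ℕ → Submodule K R) (ℳ : ℕ → Submodule K M) (i j : ℕ) : ℕ :=
  Module.finrank K (TorDeg K 𝒜 ℳ i j)

end

/-- The grading of `R ⧸ I` induced by a grading of `R`. -/
def quotGrading (𝒜 : ℕ → Submodule K R) (I : Ideal R) (j : ℕ) : Submodule K (R ⧸ I) :=
  (𝒜 j).map ((Submodule.mkQ I).restrictScalars K)

/-- The grading of the ideal `I`, as an `R`-module, induced by a grading of `R`. -/
def idealGrading (𝒜 : ℕ → Submodule K R) (I : Ideal R) (j : ℕ) : Submodule K I :=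
  (𝒜 j).comap ((Submodule.subtype I).restrictScalars K)

/-- `β_{i,j}^R(R/I)`. -/
def bettiQuot (𝒜 : ℕ → Submodule K R) (I : Ideal R) (i j : ℕ) : ℕ :=
  betti K 𝒜 (quotGrading 𝒜 I) i j

/-- `I_{⟨d⟩}`, the ideal generated by the homogeneous elements of degree `d` in `I`. -/
def component (𝒜 : ℕ → Submodule K R) (I : Ideal R) (d : ℕ) : Ideal R :=
  Ideal.span {f | f ∈ I ∧ f ∈ 𝒜 d}

/-- The graded ideal `I` has a `d`-linear resolution: `β_{i,j}^R(I) = 0` unless `j = i + d`.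
(The zero ideal has a `d`-linear resolution for every `d`.) -/
def HasLinearResolution (𝒜 : ℕ → Submodule K R) (I : Ideal R) (d : ℕ) : Prop :=
  ∀ i j : ℕ, j ≠ i + d → betti K 𝒜 (idealGrading 𝒜 I) i j = 0

end Betti

/-! ### Generic initial ideals -/

section Gin

variable {K : Type u} [Field K] {n : ℕ}

/-- The (degree) reverse lexicographic order on exponent vectors, induced by
`x_1 > x_2 > ⋯ > x_n`: `RevLexLT a b` says that the monomial `x^a` is smaller than `x^b`. -/
def RevLexLT (a b : Fin n → ℕ) : Prop :=
  ∑ i, a i < ∑ i, b i ∨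
    (∑ i, a i = ∑ i, b i ∧ ∃ i, b i < a i ∧ ∀ j, i < j → a j = b j)

variable {R : Type v} [Ring R] [Algebra K R] {σ : Type w}

/-- The basis monomial with index `s` is the initial monomial of `f`.  Here `b` is the `K`-basis of
monomials of `R`, and `expo` gives the exponent vectors of the monomials. -/
def IsInitialMonomial (b : Module.Basis σ K R) (expo : σ → Fin n → ℕ) (f : R) (s : σ) : Prop :=
  b.repr f s ≠ 0 ∧ ∀ t, b.repr f t ≠ 0 → t ≠ s → RevLexLT (expo t) (expo s)

/-- The initial ideal `in(I)` with respect to the reverse lexicographic order. -/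
def initialIdeal (b : Module.Basis σ K R) (expo : σ → Fin n → ℕ) (I : Ideal R) : Ideal R :=
  Ideal.span (b '' {s | ∃ f ∈ I, IsInitialMonomial b expo f s})

/-- Zariski open subsets of `GL_n(K)`. -/
def IsZariskiOpen (U : Set (GL (Fin n) K)) : Prop :=
  ∃ P : Set (MvPolynomial (Fin n × Fin n) K),
    U = {g | ∃ p ∈ P, MvPolynomial.eval (fun ij => g.val ij.1 ij.2) p ≠ 0}

/-- `J` is the generic initial ideal of `I`: it is the initial ideal of `g I` for all `g` in a
nonempty Zariski open subset of `GL_n(K)`.  The map `Φ g` is the coordinate change given by `g`. -/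
def IsGenericInitialIdeal (b : Module.Basis σ K R) (expo : σ → Fin n → ℕ)
    (Φ : GL (Fin n) K → R →ₐ[K] R) (I J : Ideal R) : Prop :=
  ∃ U : Set (GL (Fin n) K), IsZariskiOpen U ∧ U.Nonempty ∧
    ∀ g ∈ U, initialIdeal b expo (I.map (Φ g)) = J

end Gin

/-! ### The polynomial ring -/

section Poly

variable (K : Type u) [Field K] (n : ℕ)

/-- The standard grading of `S = K[x_1, …, x_n]`. -/
def polyGrading : ℕ → Submodule K (MvPolynomial (Fin n) K) :=
  MvPolynomial.homogeneousSubmodule (Fin n) K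

instance : GradedAlgebra (polyGrading K n) :=
  MvPolynomial.gradedAlgebra

variable {K n}

/-- The linear change of coordinates `x_j ↦ ∑ i, g i j x_i` of `S`. -/
def polyCoordChange (g : GL (Fin n) K) : MvPolynomial (Fin n) K →ₐ[K] MvPolynomial (Fin n) K :=
  MvPolynomial.aeval fun j => ∑ i, MvPolynomial.C (g.val i j) * MvPolynomial.X i

/-- `J = Gin(I)` in the polynomial ring. -/
def IsPolyGin (I J : Ideal (MvPolynomial (Fin n) K)) : Prop :=
  IsGenericInitialIdeal (MvPolynomial.basisMonomials (Fin n) K) (fun a => ⇑a) polyCoordChange I J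

end Poly

/-! ### The exterior algebra -/

section Ext

variable {K : Type u} [Field K] {n : ℕ} {V : Type v} [AddCommGroup V] [Module K V]

variable (K V) in
/-- The standard grading `E = ⨁ ⋀^j V` of the exterior algebra of `V`. -/
def extGrading : ℕ → Submodule K (ExteriorAlgebra K V) :=
  fun j => ⋀[K]^j V

instance : GradedAlgebra (extGrading K V) :=
  ExteriorAlgebra.gradedAlgebra K V

/-- The linear change of coordinates `e_j ↦ ∑ i, g i j e_i` of `E`. -/
def extCoordChange (e : Module.Basis (Fin n) K V) (g : GL (Fin n) K) :
    ExteriorAlgebra K V →ₐ[K] ExteriorAlgebra K V :=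
  ExteriorAlgebra.map (Matrix.toLin e e g.val)

/-- `J = Gin(I)` in the exterior algebra of `V`, where `V` has the basis `e_1, …, e_n`. The basis
`e.ExteriorAlgebra` consists of the monomials `e_S`, whose exponent vectors are the indicators of
the sets `S`. -/
def IsExtGin (e : Module.Basis (Fin n) K V) (I J : Ideal (ExteriorAlgebra K V)) : Prop :=
  IsGenericInitialIdeal e.ExteriorAlgebra (fun S i => if i ∈ S then 1 else 0)
    (extCoordChange e) I J

end Ext

end LinearStrand

end

/-!
# Linear components and generic initial ideals

Both rings are treated at once. A `KoszulModel` records what polynomial rings (`ε = 1`, `η = 0`) and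
exterior algebras (`ε = -1`, `η = 1`) have in common: linear forms commute with homogeneous elements
up to sign, and the colon ideal of a linear form `y` modulo a space `Λ` of linear forms that does
not contain it is generated by `Λ` and `η y`. Graded Betti numbers are computed as the relative
homology `relBetti P Q` of the bar constructions of graded submodules `Q ≤ P` of a fixed module, so
that long exact sequences involve no quotient modules.

*Reduction to components.* Comparing the truncations of an ideal `I` in degrees `≥ k` and
`≥ k + 1` expresses `β_{i,i+k}(R / I)` by `dim I_k` and the linear strands of the ideals `(I_k)` and
`(I_{k+1})` (`KoszulModel.relBetti_ideal`). Let `J = Gin(I)`, which has the same Hilbert function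
as `I`. The theorem follows (`KoszulModel.tfae_of_strand`) if for every `d`, with `W = I_d` and
`W' = J_d`, the ideal `(W)` has a linear resolution exactly when `dim 𝒜_1 W = dim 𝒜_1 W'`, and if
then `(W)` and `(W')` have the same linear strand.

*Flags.* Reduction of `(W)` modulo the members of a flag of linear forms bounds `dim 𝒜_1 W` from
below by a sum of dimensions of images of `W`, with equality exactly when the flag satisfies the
star condition `StarCond` (`KoszulModel.flagSum_le`). A flag with the star condition forces `(W)` to
have a linear resolution (`KoszulModel.isLinear_of_starCond`, which climbs up the flag by
`KoszulModel.isLinear_of_quotient`), and then the dimensions of the images of `W` determine all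
graded Betti numbers (`KoszulModel.relBetti_eq_of_starCond`). Conversely, if `(W)` has a linear
resolution, then a flag of general linear forms satisfies the star condition
(`KoszulModel.exists_flag`). In the polynomial case a general linear form is a nonzerodivisor in
degrees `≥ d`, because a linear resolution leaves no room for socle elements there
(`KoszulModel.mem_of_socle`). In the exterior case multiplication by a general linear form is exact
in degrees `> d`: the Cartan complex is exact there (`HasContractions.exists_cartan`), and general
elements of a linear family of maps are detected by cocycles (`exists_generic_cocycle`).

*Generic initial ideals.* The initial monomials of `g W` are determined by the ranks of the
projections of `g W` to spans of upper sets of monomials. If `g` is general these ranks are maximal,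
and an infinitesimal exchange of variables shows that the initial monomials form a strongly stable
set (`MonomialModel.mem_inSet_of_exchange`; here the characteristic is zero or the monomials are
squarefree). Hence the flag of the last variables satisfies the star condition for `W'`
(`MonomialModel.starCond_of_stable`). By the properties of the reverse lexicographic order the
images of `W'` modulo the last variables have the same dimensions as those of `g W`
(`MonomialModel.restrictedRank_eq`), and these are maximal among all flags
(`MonomialModel.restrictedRank_le`). So `dim 𝒜_1 W' ≤ dim 𝒜_1 W`, with equality if and only if some
flag satisfies the star condition for `W`, that is, if and only if `(W)` has a linear resolution
(`MonomialModel.finrank_smulSpan_eq`, `MonomialModel.isLinear_of_finrank_eq`). The generic initial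
ideal exists because finitely many degrees suffice in a noetherian ring
(`MonomialModel.exists_isGenericInitialIdeal`), and it is unique because nonempty Zariski open
subsets of `GL n K` meet.
-/

noncomputable section

set_option linter.unusedSectionVars false

namespace LinearStrand

/-! ### The bar construction -/

section Bar
variable {K : Type u} [Field K] {R : Type v} [Ring R] [Algebra K R]
variable {M : Type v} [AddCommGroup M] [Module K M] [Module R M] [IsScalarTower K R M]
variable {N : Type v} [AddCommGroup N] [Module K N] [Module R N] [IsScalarTower K R N]

theorem barDiff_succ_tmul (i : ℕ) (r : R) (x : (barObj K R M (i + 1)).carrier) :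
    barDiff K R M (i + 1) (barTmul K R M (i + 1) r x) =
      r • x - barTmul K R M i r (barDiff K R M i x) :=
  rfl

theorem smul_barTmul (i : ℕ) (r s : R) (x : (barObj K R M i).carrier) :
    r • barTmul K R M i s x = barTmul K R M i (r * s) x :=
  rfl

theorem bar_hom_ext {X : Type w} [AddCommGroup X] [Module K X] {i : ℕ}
    {f g : (barObj K R M (i + 1)).carrier →ₗ[K] X}
    (h : ∀ r x, f (barTmul K R M i r x) = g (barTmul K R M i r x)) : f = g :=
  TensorProduct.ext' h

/-- The action of `r` on the first factor of the bar construction. -/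
def barSmul (i : ℕ) (r : R) : (barObj K R M i).carrier →ₗ[K] (barObj K R M i).carrier :=
  Algebra.lsmul K K (barObj K R M i).carrier r

theorem barDiff_smul (i : ℕ) (r : R) (x : (barObj K R M (i + 1)).carrier) :
    barDiff K R M i (r • x) = r • barDiff K R M i x := by
  suffices h : barDiff K R M i ∘ₗ barSmul (i + 1) r = barSmul i r ∘ₗ barDiff K R M i from
    congrArg (fun f => f x) h
  refine bar_hom_ext fun s x => ?_
  change barDiff K R M i (r • barTmul K R M i s x) = r • barDiff K R M i (barTmul K R M i s x)
  rw [smul_barTmul]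
  cases i with
  | zero => exact mul_smul r s (x : M)
  | succ i =>
    rw [barDiff_succ_tmul, barDiff_succ_tmul, smul_sub, smul_barTmul, mul_smul]

theorem barDiff_barDiff (i : ℕ) (x : (barObj K R M (i + 2)).carrier) :
    barDiff K R M i (barDiff K R M (i + 1) x) = 0 := by
  suffices h : barDiff K R M i ∘ₗ barDiff K R M (i + 1) = 0 from congrArg (fun f => f x) h
  clear x
  induction i with
  | zero =>
    refine bar_hom_ext fun s x => ?_
    change barDiff K R M 0 (barDiff K R M 1 (barTmul K R M 1 s x)) = 0
    rw [barDiff_succ_tmul, map_sub, barDiff_smul]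
    exact sub_self _
  | succ i ih =>
    refine bar_hom_ext fun s x => ?_
    change barDiff K R M (i + 1) (barDiff K R M (i + 2) (barTmul K R M (i + 2) s x)) = 0
    rw [barDiff_succ_tmul, map_sub, barDiff_smul, barDiff_succ_tmul]
    have : barDiff K R M i (barDiff K R M (i + 1) x) = 0 := congrArg (fun f => f x) ih
    rw [this, map_zero, sub_zero, sub_self]

/-- The map of bar constructions induced by an `R`-linear map. -/
def barMap (f : M →ₗ[R] N) : ∀ i, (barObj K R M i).carrier →ₗ[K] (barObj K R N i).carrier
  | 0 => f.restrictScalars K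
  | i + 1 => TensorProduct.lift ((barTmul K R N i).compl₂ (barMap f i))

theorem barMap_tmul (f : M →ₗ[R] N) (i : ℕ) (r : R) (x : (barObj K R M i).carrier) :
    barMap f (i + 1) (barTmul K R M i r x) = barTmul K R N i r (barMap f i x) := rfl

theorem barMap_smul (f : M →ₗ[R] N) (i : ℕ) (r : R) (x : (barObj K R M i).carrier) :
    barMap f i (r • x) = r • barMap f i x := by
  cases i with
  | zero => exact f.map_smul r x
  | succ i =>
    suffices h : barMap f (i + 1) ∘ₗ barSmul (i + 1) r = barSmul (i + 1) r ∘ₗ barMap f (i + 1) from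
      congrArg (fun f => f x) h
    exact bar_hom_ext fun s x => rfl

theorem barMap_barDiff (f : M →ₗ[R] N) (i : ℕ) (x : (barObj K R M (i + 1)).carrier) :
    barMap f i (barDiff K R M i x) = barDiff K R N i (barMap f (i + 1) x) := by
  suffices h : barMap f i ∘ₗ barDiff K R M i = barDiff K R N i ∘ₗ barMap f (i + 1) from
    congrArg (fun f => f x) h
  clear x
  induction i with
  | zero => exact bar_hom_ext fun s x => f.map_smul s x
  | succ i ih =>
    refine bar_hom_ext fun s x => ?_
    change barMap f (i + 1) (barDiff K R M (i + 1) (barTmul K R M (i + 1) s x)) =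
      barDiff K R N (i + 1) (barMap f (i + 2) (barTmul K R M (i + 1) s x))
    rw [barDiff_succ_tmul, barMap_tmul, barDiff_succ_tmul, map_sub, barMap_smul, barMap_tmul]
    have : barMap f i (barDiff K R M i x) = barDiff K R N i (barMap f (i + 1) x) :=
      congrArg (fun f => f x) ih
    rw [this]

/-- Contraction of the first factor of the bar construction with a linear form on `R`. -/
def barContract (φ : R →ₗ[K] K) (i : ℕ) :
    (barObj K R M (i + 1)).carrier →ₗ[K] (barObj K R M i).carrier :=
  TensorProduct.lift ((LinearMap.lsmul K (barObj K R M i).carrier) ∘ₗ φ)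

theorem barContract_tmul (φ : R →ₗ[K] K) (i : ℕ) (r : R) (x : (barObj K R M i).carrier) :
    barContract φ i (barTmul K R M i r x) = φ r • x := rfl

theorem barMap_barContract (f : M →ₗ[R] N) (φ : R →ₗ[K] K) (i : ℕ)
    (x : (barObj K R M (i + 1)).carrier) :
    barMap f i (barContract φ i x) = barContract φ i (barMap f (i + 1) x) := by
  suffices h : barMap f i ∘ₗ barContract φ i = barContract φ i ∘ₗ barMap f (i + 1) from
    congrArg (fun f => f x) h
  exact bar_hom_ext fun s x => (barMap f i).map_smul (φ s) x

/-- Elements of the bar construction are recovered from their contractions with the dual of a basis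
of `R`. -/
theorem exists_bar_eq_sum {σ : Type*} (b : Module.Basis σ K R) (i : ℕ)
    (z : (barObj K R M (i + 1)).carrier) :
    ∃ S : Finset σ, z = ∑ s ∈ S, barTmul K R M i (b s) (barContract (b.coord s) i z) := by
  classical
  let e := TensorProduct.equivFinsuppOfBasisLeft (N := (barObj K R M i).carrier) b
  have h1 : ∀ s, barContract (b.coord s) i = (Finsupp.lapply s) ∘ₗ e.toLinearMap := by
    intro s
    refine bar_hom_ext fun r x => ?_
    change b.repr r s • x = e (r ⊗ₜ x) s
    simp [e]
  refine ⟨(e z).support, ?_⟩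
  have h2 : z = e.symm (e z) := (e.symm_apply_apply z).symm
  conv_lhs => rw [h2]
  rw [TensorProduct.equivFinsuppOfBasisLeft_symm_apply, Finsupp.sum]
  refine Finset.sum_congr rfl fun s _ => ?_
  rw [h1 s]
  rfl

/-! ### Graded families and the relative homology of the bar construction -/

variable {𝒜 : ℕ → Submodule K R}

variable (𝒜 M) in
/-- A graded submodule of the `R`-module `M`: a family of `K`-subspaces of `M` on which the
homogeneous elements of `R` act with the expected degrees. The sum of the members of the family
is not required to be direct. -/
structure GradedFamily where
  /-- The homogeneous components. -/
  toFun : ℕ → Submodule K M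
  smul_mem' : ∀ {a c : ℕ} {r : R} {m : M}, r ∈ 𝒜 a → m ∈ toFun c → r • m ∈ toFun (a + c)

namespace GradedFamily

instance : CoeFun (GradedFamily M 𝒜) fun _ => ℕ → Submodule K M := ⟨toFun⟩

theorem smul_mem (P : GradedFamily M 𝒜) {a c : ℕ} {r : R} {m : M} (hr : r ∈ 𝒜 a) (hm : m ∈ P c) :
    r • m ∈ P (a + c) := P.smul_mem' hr hm

instance : LE (GradedFamily M 𝒜) := ⟨fun P Q => ∀ j, P j ≤ Q j⟩

theorem le_refl (P : GradedFamily M 𝒜) : P ≤ P := fun _ => le_rfl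

instance : Bot (GradedFamily M 𝒜) :=
  ⟨{ toFun := fun _ => ⊥
     smul_mem' := by
      intro a c r m _ hm
      rw [Submodule.mem_bot] at hm ⊢
      rw [hm, smul_zero] }⟩

theorem bot_le (P : GradedFamily M 𝒜) : ⊥ ≤ P := fun _ => _root_.bot_le

theorem bot_apply (j : ℕ) : (⊥ : GradedFamily M 𝒜) j = ⊥ := rfl

instance : Max (GradedFamily M 𝒜) :=
  ⟨fun P Q =>
    { toFun := fun j => P j ⊔ Q j
      smul_mem' := by
        intro a c r m hr hm
        obtain ⟨p, hp, q, hq, rfl⟩ := Submodule.mem_sup.1 hm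
        rw [smul_add]
        exact Submodule.add_mem_sup (P.smul_mem hr hp) (Q.smul_mem hr hq) }⟩

theorem sup_apply (P Q : GradedFamily M 𝒜) (j : ℕ) : (P ⊔ Q) j = P j ⊔ Q j := rfl

theorem le_sup_left (P Q : GradedFamily M 𝒜) : P ≤ P ⊔ Q := fun _ => _root_.le_sup_left

theorem le_sup_right (P Q : GradedFamily M 𝒜) : Q ≤ P ⊔ Q := fun _ => _root_.le_sup_right

instance : Min (GradedFamily M 𝒜) :=
  ⟨fun P Q =>
    { toFun := fun j => P j ⊓ Q j
      smul_mem' := fun hr hm => ⟨P.smul_mem hr hm.1, Q.smul_mem hr hm.2⟩ }⟩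

theorem inf_apply (P Q : GradedFamily M 𝒜) (j : ℕ) : (P ⊓ Q) j = P j ⊓ Q j := rfl

theorem inf_le_left (P Q : GradedFamily M 𝒜) : P ⊓ Q ≤ P := fun _ => _root_.inf_le_left

/-- The family is finite-dimensional in each degree. -/
def FinDim (P : GradedFamily M 𝒜) : Prop := ∀ j, Module.Finite K (P j)

end GradedFamily

open GradedFamily

theorem tmul_mem_barDeg {P : ℕ → Submodule K M} {i a c : ℕ} (ha : 1 ≤ a) {r : R} (hr : r ∈ 𝒜 a)
    {x : (barObj K R M i).carrier} (hx : x ∈ barDeg K 𝒜 P i c) :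
    barTmul K R M i r x ∈ barDeg K 𝒜 P (i + 1) (a + c) := by
  refine Submodule.mem_iSup_of_mem a (Submodule.mem_iSup_of_mem c (Submodule.mem_iSup_of_mem ha
    (Submodule.mem_iSup_of_mem rfl ?_)))
  exact Submodule.apply_mem_map₂ _ hr hx

theorem barDeg_succ_le {P : ℕ → Submodule K M} {i j : ℕ}
    {S : Submodule K (barObj K R M (i + 1)).carrier} :
    barDeg K 𝒜 P (i + 1) j ≤ S ↔ ∀ a c, 1 ≤ a → a + c = j → ∀ r ∈ 𝒜 a,
      ∀ x ∈ barDeg K 𝒜 P i c, barTmul K R M i r x ∈ S := by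
  change (⨆ (a : ℕ) (b : ℕ) (_ : 1 ≤ a) (_ : a + b = j),
      Submodule.map₂ (barTmul K R M i) (𝒜 a) (barDeg K 𝒜 P i b)) ≤ S ↔ _
  simp only [iSup_le_iff, Submodule.map₂_le]

theorem barDeg_mono {P Q : ℕ → Submodule K M} {j : ℕ} (h : ∀ c ≤ j, P c ≤ Q c) (i : ℕ) :
    barDeg K 𝒜 P i j ≤ barDeg K 𝒜 Q i j := by
  induction i generalizing j with
  | zero => exact h j le_rfl
  | succ i ih =>
    rw [barDeg_succ_le]
    rintro a c ha rfl r hr x hx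
    exact tmul_mem_barDeg ha hr (ih (fun d hd => h d (by omega)) hx)

/-- Only the components of degree `≤ j - i` enter the bar construction in homological degree `i`
and internal degree `j`. -/
theorem barDeg_mono' {P Q : ℕ → Submodule K M} {i j : ℕ} (h : ∀ c, c + i ≤ j → P c ≤ Q c) :
    barDeg K 𝒜 P i j ≤ barDeg K 𝒜 Q i j := by
  induction i generalizing j with
  | zero => exact h j le_rfl
  | succ i ih =>
    rw [barDeg_succ_le]
    rintro a c ha rfl r hr x hx
    exact tmul_mem_barDeg ha hr (ih (fun d hd => h d (by omega)) hx)

theorem barDeg_bot (i j : ℕ) : barDeg K 𝒜 (⊥ : GradedFamily M 𝒜) i j = ⊥ := by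
  induction i generalizing j with
  | zero => rfl
  | succ i ih =>
    rw [eq_bot_iff, barDeg_succ_le]
    rintro a c ha rfl r hr x hx
    rw [ih, Submodule.mem_bot] at hx
    rw [hx, map_zero]
    exact zero_mem _

theorem barDeg_finite [∀ a, Module.Finite K (𝒜 a)] {P : GradedFamily M 𝒜} (hP : P.FinDim)
    (i j : ℕ) : Module.Finite K (barDeg K 𝒜 P i j) := by
  induction i generalizing j with
  | zero => exact hP j
  | succ i ih =>
    have hle : barDeg K 𝒜 P (i + 1) j ≤ ⨆ a : Fin (j + 1),
        Submodule.map₂ (barTmul K R M i) (𝒜 a) (barDeg K 𝒜 P i (j - a)) := by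
      rw [barDeg_succ_le]
      rintro a c ha rfl r hr x hx
      refine Submodule.mem_iSup_of_mem (⟨a, by omega⟩ : Fin (a + c + 1)) ?_
      have : a + c - a = c := by omega
      simp only [this]
      exact Submodule.apply_mem_map₂ _ hr hx
    have hfin : ∀ a : Fin (j + 1), Module.Finite K
        (Submodule.map₂ (barTmul K R M i) (𝒜 a) (barDeg K 𝒜 P i (j - a))) := by
      intro a
      have := ih (j - a)
      exact Module.Finite.iff_fg.2 (Submodule.FG.map₂ _ (Module.Finite.iff_fg.1 inferInstance)
        (Module.Finite.iff_fg.1 this))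
    have := Submodule.finite_iSup (fun a : Fin (j + 1) =>
      Submodule.map₂ (barTmul K R M i) (𝒜 a) (barDeg K 𝒜 P i (j - a)))
    exact Submodule.finiteDimensional_of_le hle

variable [GradedAlgebra 𝒜]

theorem smul_mem_barDeg (P : GradedFamily M 𝒜) {a c i : ℕ} {r : R} (hr : r ∈ 𝒜 a)
    {x : (barObj K R M i).carrier} (hx : x ∈ barDeg K 𝒜 P i c) :
    r • x ∈ barDeg K 𝒜 P i (a + c) := by
  cases i with
  | zero => exact P.smul_mem hr hx
  | succ i =>
    suffices h : barDeg K 𝒜 P (i + 1) c ≤ (barDeg K 𝒜 P (i + 1) (a + c)).comap (barSmul (i + 1) r)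
      from h hx
    clear hx x
    rw [barDeg_succ_le]
    rintro a' c ha rfl s hs x hx
    change r • barTmul K R M i s x ∈ barDeg K 𝒜 P (i + 1) (a + (a' + c))
    rw [smul_barTmul, ← add_assoc]
    exact tmul_mem_barDeg (by omega) (SetLike.mul_mem_graded hr hs) hx

theorem barDiff_mem_barDeg (P : GradedFamily M 𝒜) {i j : ℕ}
    {x : (barObj K R M (i + 1)).carrier} (hx : x ∈ barDeg K 𝒜 P (i + 1) j) :
    barDiff K R M i x ∈ barDeg K 𝒜 P i j := by
  suffices h : barDeg K 𝒜 P (i + 1) j ≤ (barDeg K 𝒜 P i j).comap (barDiff K R M i) from h hx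
  clear hx x
  induction i generalizing j with
  | zero =>
    rw [barDeg_succ_le]
    rintro a c ha rfl s hs x hx
    exact P.smul_mem hs hx
  | succ i ih =>
    rw [barDeg_succ_le]
    rintro a c ha rfl s hs x hx
    change barDiff K R M (i + 1) (barTmul K R M (i + 1) s x) ∈ barDeg K 𝒜 P (i + 1) (a + c)
    rw [barDiff_succ_tmul]
    exact sub_mem (smul_mem_barDeg P hs hx) (tmul_mem_barDeg ha hs (ih hx))

end Bar

open GradedFamily

/-! ### Dimensions in exact sequences, and subquotients -/

section ExactSequences

variable {K : Type u} [Field K] {A B C D : Type*} [AddCommGroup A] [AddCommGroup B]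
  [AddCommGroup C] [AddCommGroup D] [Module K A] [Module K B] [Module K C] [Module K D]

theorem finrank_le_add_of_exact [Module.Finite K A] [Module.Finite K B] [Module.Finite K C]
    {f : A →ₗ[K] B} {g : B →ₗ[K] C} (h : Function.Exact f g) :
    Module.finrank K B ≤ Module.finrank K A + Module.finrank K C := by
  have h1 := g.finrank_range_add_finrank_ker
  rw [LinearMap.exact_iff.1 h] at h1
  have h2 := f.finrank_range_le
  have h3 := (LinearMap.range g).finrank_le
  omega

theorem finrank_four_term [Module.Finite K A] [Module.Finite K B] [Module.Finite K C]
    [Module.Finite K D] {f : A →ₗ[K] B} {g : B →ₗ[K] C} {h : C →ₗ[K] D}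
    (hf : Function.Injective f) (hfg : Function.Exact f g) (hgh : Function.Exact g h)
    (hh : Function.Surjective h) :
    Module.finrank K A + Module.finrank K C = Module.finrank K B + Module.finrank K D := by
  have h1 := g.finrank_range_add_finrank_ker
  have h2 := h.finrank_range_add_finrank_ker
  rw [LinearMap.exact_iff.1 hfg] at h1
  rw [LinearMap.exact_iff.1 hgh] at h2
  rw [LinearMap.finrank_range_of_inj hf] at h1
  rw [LinearMap.range_eq_top.2 hh, finrank_top] at h2
  omega

theorem finrank_three_term [Module.Finite K A] [Module.Finite K B] [Module.Finite K C]
    {f : A →ₗ[K] B} {g : B →ₗ[K] C}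
    (hf : Function.Injective f) (hfg : Function.Exact f g) (hg : Function.Surjective g) :
    Module.finrank K B = Module.finrank K A + Module.finrank K C := by
  have h1 := g.finrank_range_add_finrank_ker
  rw [LinearMap.exact_iff.1 hfg, LinearMap.finrank_range_of_inj hf, LinearMap.range_eq_top.2 hg,
    finrank_top] at h1
  omega

/-- The map induced on subquotients `Z / (Z ∩ B)` by a linear map of the ambient spaces. -/
def subquotientMap (f : A →ₗ[K] B) {Z₁ B₁ : Submodule K A} {Z₂ B₂ : Submodule K B}
    (hZ : ∀ z ∈ Z₁, f z ∈ Z₂) (hB : ∀ z ∈ Z₁, z ∈ B₁ → f z ∈ B₂) :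
    (Z₁ ⧸ B₁.submoduleOf Z₁) →ₗ[K] (Z₂ ⧸ B₂.submoduleOf Z₂) :=
  Submodule.mapQ _ _ (f.restrict hZ) fun z hz => hB z z.2 hz

variable {f : A →ₗ[K] B} {g : B →ₗ[K] C} {Z₁ B₁ : Submodule K A} {Z₂ B₂ : Submodule K B}
  {Z₃ B₃ : Submodule K C}

theorem subquotientMap_exact {hZ : ∀ z ∈ Z₁, f z ∈ Z₂} {hB : ∀ z ∈ Z₁, z ∈ B₁ → f z ∈ B₂}
    {hZ' : ∀ z ∈ Z₂, g z ∈ Z₃} {hB' : ∀ z ∈ Z₂, z ∈ B₂ → g z ∈ B₃}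
    (h0 : ∀ z ∈ Z₁, g (f z) ∈ B₃)
    (h1 : ∀ z ∈ Z₂, g z ∈ B₃ → ∃ w ∈ Z₁, z - f w ∈ B₂) :
    Function.Exact (subquotientMap f hZ hB) (subquotientMap g hZ' hB') := by
  intro x
  constructor
  · intro hx
    obtain ⟨⟨z, hz⟩, rfl⟩ := Submodule.mkQ_surjective _ x
    have hx' : g z ∈ B₃ := (Submodule.Quotient.mk_eq_zero (B₃.submoduleOf Z₃)).1 hx
    obtain ⟨w, hw, hzw⟩ := h1 z hz hx'
    refine ⟨Submodule.mkQ _ ⟨w, hw⟩, ?_⟩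
    refine ((Submodule.Quotient.eq _).2 ?_).symm
    exact hzw
  · rintro ⟨y, rfl⟩
    obtain ⟨⟨z, hz⟩, rfl⟩ := Submodule.mkQ_surjective _ y
    exact (Submodule.Quotient.mk_eq_zero _).2 (h0 z hz)

theorem subquotientMap_surjective {hZ : ∀ z ∈ Z₁, f z ∈ Z₂} {hB : ∀ z ∈ Z₁, z ∈ B₁ → f z ∈ B₂}
    (h1 : ∀ z ∈ Z₂, ∃ w ∈ Z₁, z - f w ∈ B₂) :
    Function.Surjective (subquotientMap f hZ hB) := by
  intro x
  obtain ⟨⟨z, hz⟩, rfl⟩ := Submodule.mkQ_surjective _ x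
  obtain ⟨w, hw, hzw⟩ := h1 z hz
  exact ⟨Submodule.mkQ _ ⟨w, hw⟩, ((Submodule.Quotient.eq (B₂.submoduleOf Z₂)).2 hzw).symm⟩

theorem subquotientMap_injective {hZ : ∀ z ∈ Z₁, f z ∈ Z₂} {hB : ∀ z ∈ Z₁, z ∈ B₁ → f z ∈ B₂}
    (h1 : ∀ z ∈ Z₁, f z ∈ B₂ → z ∈ B₁) :
    Function.Injective (subquotientMap f hZ hB) := by
  rw [injective_iff_map_eq_zero]
  intro x hx
  obtain ⟨⟨z, hz⟩, rfl⟩ := Submodule.mkQ_surjective _ x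
  exact (Submodule.Quotient.mk_eq_zero _).2
    (h1 z hz ((Submodule.Quotient.mk_eq_zero (B₂.submoduleOf Z₂)).1 hx))

end ExactSequences

/-! ### Relative homology and long exact sequences -/

section RelTor

variable {K : Type u} [Field K] {R : Type v} [Ring R] [Algebra K R]
variable {M : Type v} [AddCommGroup M] [Module K M] [Module R M] [IsScalarTower K R M]
variable {𝒜 : ℕ → Submodule K R}

/-- Relative cycles: elements of the bar construction of `P` whose differential lies in the bar
construction of `Q`. -/
def relCycles (P Q : GradedFamily M 𝒜) : ∀ i : ℕ, ℕ → Submodule K (barObj K R M i).carrier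
  | 0, j => barDeg K 𝒜 P 0 j
  | i + 1, j => barDeg K 𝒜 P (i + 1) j ⊓ (barDeg K 𝒜 Q i j).comap (barDiff K R M i)

/-- Relative boundaries of the pair `(P, Q)`. -/
def relBoundaries (P Q : GradedFamily M 𝒜) (i j : ℕ) : Submodule K (barObj K R M i).carrier :=
  (barDeg K 𝒜 P (i + 1) j).map (barDiff K R M i) ⊔ barDeg K 𝒜 Q i j

/-- `Tor_i^R(K, P / Q)_j` for graded submodules `Q ≤ P` of a common ambient module, as the homology
of the quotient of the bar construction of `P` by the one of `Q`. -/
abbrev RelTor (P Q : GradedFamily M 𝒜) (i j : ℕ) : Type v :=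
  relCycles P Q i j ⧸ (relBoundaries P Q i j).submoduleOf (relCycles P Q i j)

/-- The graded Betti number `β_{i,j}(P / Q)` for graded submodules `Q ≤ P`. -/
def relBetti (P Q : GradedFamily M 𝒜) (i j : ℕ) : ℕ :=
  Module.finrank K (RelTor P Q i j)

theorem relCycles_le (P Q : GradedFamily M 𝒜) (i j : ℕ) : relCycles P Q i j ≤ barDeg K 𝒜 P i j := by
  cases i with
  | zero => exact le_rfl
  | succ i => exact inf_le_left

variable [∀ a, Module.Finite K (𝒜 a)]

theorem relTor_finite {P : GradedFamily M 𝒜} (hP : P.FinDim) (Q : GradedFamily M 𝒜) (i j : ℕ) :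
    Module.Finite K (RelTor P Q i j) := by
  have h := barDeg_finite hP i j
  have : Module.Finite K (relCycles P Q i j) :=
    Submodule.finiteDimensional_of_le (relCycles_le P Q i j)
  infer_instance

theorem GradedFamily.FinDim.mono {P Q : GradedFamily M 𝒜} (hP : P.FinDim) (h : Q ≤ P) :
    Q.FinDim := fun j =>
  have := hP j
  Submodule.finiteDimensional_of_le (h j)

theorem relBetti_eq_zero_iff {P : GradedFamily M 𝒜} (hP : P.FinDim) (Q : GradedFamily M 𝒜)
    (i j : ℕ) : relBetti P Q i j = 0 ↔ relCycles P Q i j ≤ relBoundaries P Q i j := by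
  have := relTor_finite hP Q i j
  rw [relBetti, Module.finrank_zero_iff, Submodule.Quotient.subsingleton_iff,
    Submodule.submoduleOf_eq_top]

theorem relBetti_eq_zero_of_barDeg_le {P Q : GradedFamily M 𝒜} {i j : ℕ}
    (h : barDeg K 𝒜 P i j ≤ barDeg K 𝒜 Q i j) : relBetti P Q i j = 0 := by
  have h1 : relCycles P Q i j ≤ relBoundaries P Q i j :=
    (relCycles_le P Q i j).trans (h.trans le_sup_right)
  have : Subsingleton (RelTor P Q i j) := by
    rw [Submodule.Quotient.subsingleton_iff, Submodule.submoduleOf_eq_top]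
    exact h1
  exact Module.finrank_zero_of_subsingleton

/-- If `P / Q` vanishes in degrees `< k`, then `β_{i,j}(P / Q) = 0` for `j < i + k`. -/
theorem relBetti_eq_zero_of_lt {P Q : GradedFamily M 𝒜} {k : ℕ} (h : ∀ c < k, P c ≤ Q c)
    {i j : ℕ} (hj : j < i + k) : relBetti P Q i j = 0 :=
  relBetti_eq_zero_of_barDeg_le (barDeg_mono' fun c hc => h c (by omega))

/-- Only the components of degree `≤ j - i` matter for `β_{i,j}`. -/
theorem relBetti_eq_zero_of_le {P Q : GradedFamily M 𝒜} {i j : ℕ} (h : ∀ c, c + i ≤ j → P c ≤ Q c) :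
    relBetti P Q i j = 0 :=
  relBetti_eq_zero_of_barDeg_le (barDeg_mono' h)

variable [GradedAlgebra 𝒜] {P P' Q : GradedFamily M 𝒜}

theorem relCycles_mono_left (hPP' : P ≤ P') (i j : ℕ) :
    relCycles P Q i j ≤ relCycles P' Q i j := by
  cases i with
  | zero => exact hPP' j
  | succ i => exact inf_le_inf_right _ (barDeg_mono (fun c _ => hPP' c) _)

theorem relCycles_mono_right {Q' : GradedFamily M 𝒜} (hQ : Q ≤ Q') (i j : ℕ) :
    relCycles P Q i j ≤ relCycles P Q' i j := by
  cases i with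
  | zero => exact le_rfl
  | succ i => exact inf_le_inf_left _ (Submodule.comap_mono (barDeg_mono (fun c _ => hQ c) _))

theorem relBoundaries_mono_left (hPP' : P ≤ P') (i j : ℕ) :
    relBoundaries P Q i j ≤ relBoundaries P' Q i j :=
  sup_le_sup_right (Submodule.map_mono (barDeg_mono (fun c _ => hPP' c) _)) _

theorem relBoundaries_mono_right {Q' : GradedFamily M 𝒜} (hQ : Q ≤ Q') (i j : ℕ) :
    relBoundaries P Q i j ≤ relBoundaries P Q' i j :=
  sup_le_sup_left (barDeg_mono (fun c _ => hQ c) _) _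

/-- The map `Tor_i(P / Q) → Tor_i(P' / Q)` for `P ≤ P'`. -/
def relTorIncl (hPP' : P ≤ P') (i j : ℕ) : RelTor P Q i j →ₗ[K] RelTor P' Q i j :=
  subquotientMap LinearMap.id (fun _ hz => relCycles_mono_left hPP' i j hz)
    (fun _ _ hz => relBoundaries_mono_left hPP' i j hz)

/-- The map `Tor_i(P' / Q) → Tor_i(P' / P)` for `Q ≤ P`. -/
def relTorProj (hQP : Q ≤ P) (i j : ℕ) : RelTor P' Q i j →ₗ[K] RelTor P' P i j :=
  subquotientMap LinearMap.id (fun _ hz => relCycles_mono_right hQP i j hz)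
    (fun _ _ hz => relBoundaries_mono_right hQP i j hz)

/-- The connecting map `Tor_{i+1}(P' / P) → Tor_i(P / Q)`, which is induced by the bar
differential. -/
def relTorConn (P' P Q : GradedFamily M 𝒜) (i j : ℕ) :
    RelTor P' P (i + 1) j →ₗ[K] RelTor P Q i j :=
  subquotientMap (barDiff K R M i)
    (fun z hz => by
      cases i with
      | zero => exact hz.2
      | succ i =>
        refine ⟨hz.2, ?_⟩
        change barDiff K R M i (barDiff K R M (i + 1) z) ∈ barDeg K 𝒜 Q i j
        rw [barDiff_barDiff]
        exact zero_mem _)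
    (fun z _ hz => by
      obtain ⟨x, hx, y, hy, rfl⟩ := Submodule.mem_sup.1 hz
      obtain ⟨x, hx, rfl⟩ := hx
      rw [map_add, barDiff_barDiff, zero_add]
      exact Submodule.mem_sup_left ⟨y, hy, rfl⟩)

/-- Exactness of `Tor_i(P / Q) → Tor_i(P' / Q) → Tor_i(P' / P)`, part of the long exact sequence of
`Q ≤ P ≤ P'`. -/
theorem relTor_exact_mid (hQP : Q ≤ P) (hPP' : P ≤ P') (i j : ℕ) :
    Function.Exact (relTorIncl (Q := Q) hPP' i j) (relTorProj (P' := P') hQP i j) := by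
  refine subquotientMap_exact (fun z hz => Submodule.mem_sup_right (relCycles_le _ _ _ _ hz)) ?_
  intro z hz hz'
  obtain ⟨x, hx, y, hy, rfl⟩ := Submodule.mem_sup.1 hz'
  obtain ⟨x, hx, rfl⟩ := hx
  refine ⟨y, ?_, ?_⟩
  · cases i with
    | zero => exact hy
    | succ i =>
      refine ⟨hy, ?_⟩
      have h := hz.2
      change barDiff K R M i (barDiff K R M (i + 1) x + y) ∈ barDeg K 𝒜 Q i j at h
      rw [map_add, barDiff_barDiff, zero_add] at h
      exact h
  · refine Submodule.mem_sup_left ⟨x, hx, ?_⟩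
    simp

/-- Exactness of `Tor_{i+1}(P' / Q) → Tor_{i+1}(P' / P) → Tor_i(P / Q)`. -/
theorem relTor_exact_right (hQP : Q ≤ P) (hPP' : P ≤ P') (i j : ℕ) :
    Function.Exact (relTorProj (P' := P') hQP (i + 1) j) (relTorConn P' P Q i j) := by
  refine subquotientMap_exact (fun z hz => Submodule.mem_sup_right hz.2) ?_
  intro z hz hz'
  obtain ⟨x, hx, y, hy, hxy⟩ := Submodule.mem_sup.1 hz'
  obtain ⟨x, hx, rfl⟩ := hx
  have hx' : x ∈ barDeg K 𝒜 P' (i + 1) j := barDeg_mono (fun c _ => hPP' c) _ hx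
  refine ⟨z - x, ⟨sub_mem hz.1 hx', ?_⟩, ?_⟩
  · change barDiff K R M i (z - x) ∈ barDeg K 𝒜 Q i j
    rw [map_sub, ← hxy, add_sub_cancel_left]
    exact hy
  · refine Submodule.mem_sup_right ?_
    simpa using hx

/-- Exactness of `Tor_{i+1}(P' / P) → Tor_i(P / Q) → Tor_i(P' / Q)`. -/
theorem relTor_exact_left (hQP : Q ≤ P) (hPP' : P ≤ P') (i j : ℕ) :
    Function.Exact (relTorConn P' P Q i j) (relTorIncl (Q := Q) hPP' i j) := by
  refine subquotientMap_exact (fun z hz => Submodule.mem_sup_left ⟨z, hz.1, rfl⟩) ?_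
  intro z hz hz'
  obtain ⟨x, hx, y, hy, hxy⟩ := Submodule.mem_sup.1 hz'
  obtain ⟨x, hx, rfl⟩ := hx
  change _ = z at hxy
  refine ⟨x, ⟨hx, ?_⟩, ?_⟩
  · change barDiff K R M i x ∈ barDeg K 𝒜 P i j
    have : barDiff K R M i x = z - y := by rw [← hxy, add_sub_cancel_right]
    rw [this]
    exact sub_mem (relCycles_le _ _ _ _ hz) (barDeg_mono (fun c _ => hQP c) _ hy)
  · rw [← hxy, add_sub_cancel_left]
    exact Submodule.mem_sup_right hy

theorem relTorProj_zero_surjective (hQP : Q ≤ P) (j : ℕ) :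
    Function.Surjective (relTorProj (P' := P') hQP 0 j) :=
  subquotientMap_surjective fun z hz => ⟨z, hz, by simp⟩

theorem relBetti_le_add (hQP : Q ≤ P) (hPP' : P ≤ P') (hP' : P'.FinDim) (i j : ℕ) :
    relBetti P' Q i j ≤ relBetti P Q i j + relBetti P' P i j := by
  have := relTor_finite hP' Q i j
  have := relTor_finite hP' P i j
  have := relTor_finite (hP'.mono hPP') Q i j
  exact finrank_le_add_of_exact (relTor_exact_mid hQP hPP' i j)

theorem relBetti_quot_le_add (hQP : Q ≤ P) (hPP' : P ≤ P') (hP' : P'.FinDim) (i j : ℕ) :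
    relBetti P' P (i + 1) j ≤ relBetti P' Q (i + 1) j + relBetti P Q i j := by
  have := relTor_finite hP' Q (i + 1) j
  have := relTor_finite hP' P (i + 1) j
  have := relTor_finite (hP'.mono hPP') Q i j
  exact finrank_le_add_of_exact (relTor_exact_right hQP hPP' i j)

theorem relBetti_sub_le_add (hQP : Q ≤ P) (hPP' : P ≤ P') (hP' : P'.FinDim) (i j : ℕ) :
    relBetti P Q i j ≤ relBetti P' P (i + 1) j + relBetti P' Q i j := by
  have := relTor_finite hP' Q i j
  have := relTor_finite hP' P (i + 1) j
  have := relTor_finite (hP'.mono hPP') Q i j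
  exact finrank_le_add_of_exact (relTor_exact_left hQP hPP' i j)

theorem relBetti_quot_zero_le (hQP : Q ≤ P) (hP' : P'.FinDim) (j : ℕ) :
    relBetti P' P 0 j ≤ relBetti P' Q 0 j := by
  have := relTor_finite hP' Q 0 j
  exact LinearMap.finrank_le_finrank_of_surjective (relTorProj_zero_surjective hQP j)

theorem subsingleton_relTor {P : GradedFamily M 𝒜} (hP : P.FinDim) {Q : GradedFamily M 𝒜}
    {i j : ℕ} (h : relBetti P Q i j = 0) : Subsingleton (RelTor P Q i j) :=
  have := relTor_finite hP Q i j
  Module.finrank_zero_iff.1 h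

theorem injective_of_exact_of_subsingleton {A B C : Type*} [AddCommGroup A] [AddCommGroup B]
    [AddCommGroup C] [Module K A] [Module K B] [Module K C] [Subsingleton A] {f : A →ₗ[K] B}
    {g : B →ₗ[K] C} (h : Function.Exact f g) : Function.Injective g := by
  rw [injective_iff_map_eq_zero]
  intro b hb
  obtain ⟨a, rfl⟩ := (h b).1 hb
  rw [Subsingleton.elim a 0, map_zero]

theorem surjective_of_exact_of_subsingleton {A B C : Type*} [AddCommGroup A] [AddCommGroup B]
    [AddCommGroup C] [Module K A] [Module K B] [Module K C] [Subsingleton C] {f : A →ₗ[K] B}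
    {g : B →ₗ[K] C} (h : Function.Exact f g) : Function.Surjective f := fun b =>
  (h b).1 (Subsingleton.elim _ _)

theorem relBetti_add_zero (hQP : Q ≤ P) (hPP' : P ≤ P') (hP' : P'.FinDim) {j : ℕ}
    (h1 : relBetti P' P 1 j = 0) :
    relBetti P' Q 0 j = relBetti P Q 0 j + relBetti P' P 0 j := by
  have := relTor_finite hP' Q 0 j
  have := relTor_finite hP' P 0 j
  have := relTor_finite (hP'.mono hPP') Q 0 j
  have := subsingleton_relTor hP' h1
  exact finrank_three_term (injective_of_exact_of_subsingleton (relTor_exact_left hQP hPP' 0 j))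
    (relTor_exact_mid hQP hPP' 0 j) (relTorProj_zero_surjective hQP j)

theorem relBetti_add_succ (hQP : Q ≤ P) (hPP' : P ≤ P') (hP' : P'.FinDim) {i j : ℕ}
    (h1 : relBetti P' P (i + 2) j = 0) (h2 : relBetti P Q i j = 0) :
    relBetti P' Q (i + 1) j = relBetti P Q (i + 1) j + relBetti P' P (i + 1) j := by
  have := relTor_finite hP' Q (i + 1) j
  have := relTor_finite hP' P (i + 1) j
  have := relTor_finite (hP'.mono hPP') Q (i + 1) j
  have := subsingleton_relTor hP' h1
  have := subsingleton_relTor (hP'.mono hPP') h2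
  exact finrank_three_term
    (injective_of_exact_of_subsingleton (relTor_exact_left hQP hPP' (i + 1) j))
    (relTor_exact_mid hQP hPP' (i + 1) j)
    (surjective_of_exact_of_subsingleton (relTor_exact_right hQP hPP' i j))

/-- The long exact sequence breaks up when `Tor_{i+1}(P / Q)` and `Tor_i(P' / P)` vanish in degree
`j`: what remains is
`0 → Tor_{i+1}(P' / Q) → Tor_{i+1}(P' / P) → Tor_i(P / Q) → Tor_i(P' / Q) → 0`. -/
theorem relBetti_four_term (hQP : Q ≤ P) (hPP' : P ≤ P') (hP' : P'.FinDim) {i j : ℕ}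
    (h1 : relBetti P Q (i + 1) j = 0) (h2 : relBetti P' P i j = 0) :
    relBetti P' Q (i + 1) j + relBetti P Q i j =
      relBetti P' P (i + 1) j + relBetti P' Q i j := by
  have := relTor_finite hP' Q (i + 1) j
  have := relTor_finite hP' P (i + 1) j
  have := relTor_finite hP' Q i j
  have := relTor_finite (hP'.mono hPP') Q i j
  have := subsingleton_relTor hP' h2
  have := subsingleton_relTor (hP'.mono hPP') h1
  exact finrank_four_term
    (injective_of_exact_of_subsingleton (relTor_exact_mid hQP hPP' (i + 1) j))
    (relTor_exact_right hQP hPP' i j) (relTor_exact_left hQP hPP' i j)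
    (surjective_of_exact_of_subsingleton (relTor_exact_mid hQP hPP' i j))

end RelTor

/-! ### Maps that preserve graded Betti numbers -/

section ShiftIso

variable {K : Type u} [Field K] {R : Type v} [Ring R] [Algebra K R]
variable {M : Type v} [AddCommGroup M] [Module K M] [Module R M] [IsScalarTower K R M]
variable {N : Type v} [AddCommGroup N] [Module K N] [Module R N] [IsScalarTower K R N]
variable {𝒜 : ℕ → Submodule K R} [GradedAlgebra 𝒜]

variable (𝒜) in
theorem exists_homogeneous_basis :
    ∃ (σ : Type v) (b : Module.Basis σ K R) (dg : σ → ℕ), (∀ s, b s ∈ 𝒜 (dg s)) ∧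
      ∀ s a, ∀ r ∈ 𝒜 a, dg s ≠ a → b.coord s r = 0 := by
  have hint := DirectSum.Decomposition.isInternal 𝒜
  let bb := fun a => Module.Basis.ofVectorSpace K (𝒜 a)
  refine ⟨_, hint.collectedBasis bb, Sigma.fst, fun s => hint.collectedBasis_mem bb s, ?_⟩
  intro s a r hr h
  exact hint.collectedBasis_repr_of_mem_ne bb (a := s.2) (Ne.symm h) hr

variable {P Q : GradedFamily M 𝒜} {P' Q' : GradedFamily N 𝒜} {f : M →ₗ[R] N} {s : ℕ}

theorem barContract_mem {σ : Type v} {b : Module.Basis σ K R} {dg : σ → ℕ}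
    (hb : ∀ s a, ∀ r ∈ 𝒜 a, dg s ≠ a → b.coord s r = 0) {i j : ℕ}
    {z : (barObj K R M (i + 1)).carrier} (hz : z ∈ barDeg K 𝒜 P (i + 1) j) (s : σ) :
    (1 ≤ dg s → ∀ c, dg s + c = j → barContract (b.coord s) i z ∈ barDeg K 𝒜 P i c) ∧
      ((∀ c, 1 ≤ dg s → dg s + c ≠ j) → barContract (b.coord s) i z = 0) := by
  constructor
  · rintro hs c rfl
    suffices h : barDeg K 𝒜 P (i + 1) (dg s + c) ≤
      (barDeg K 𝒜 P i c).comap (barContract (b.coord s) i) from h hz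
    rw [barDeg_succ_le]
    intro a c' ha hac r hr x hx
    change barContract (b.coord s) i (barTmul K R M i r x) ∈ barDeg K 𝒜 P i c
    rw [barContract_tmul]
    by_cases h : dg s = a
    · obtain rfl : c' = c := by omega
      exact Submodule.smul_mem _ _ hx
    · rw [hb s a r hr h, zero_smul]
      exact zero_mem _
  · intro hs
    suffices h : barDeg K 𝒜 P (i + 1) j ≤ LinearMap.ker (barContract (b.coord s) i) from h hz
    rw [barDeg_succ_le]
    intro a c' ha hac r hr x hx
    rw [LinearMap.mem_ker, barContract_tmul]
    have h : dg s ≠ a := by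
      rintro rfl
      exact hs c' ha hac
    rw [hb s a r hr h, zero_smul]

theorem barMap_mem (h1 : ∀ j, ∀ x ∈ P j, f x ∈ P' (j + s)) {i j : ℕ}
    {z : (barObj K R M i).carrier} (hz : z ∈ barDeg K 𝒜 P i j) :
    barMap f i z ∈ barDeg K 𝒜 P' i (j + s) := by
  induction i generalizing j with
  | zero => exact h1 j z hz
  | succ i ih =>
    suffices h : barDeg K 𝒜 P (i + 1) j ≤ (barDeg K 𝒜 P' (i + 1) (j + s)).comap (barMap f (i + 1))
      from h hz
    rw [barDeg_succ_le]
    rintro a c ha rfl r hr x hx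
    change barMap f (i + 1) (barTmul K R M i r x) ∈ barDeg K 𝒜 P' (i + 1) (a + c + s)
    rw [barMap_tmul, add_assoc]
    exact tmul_mem_barDeg ha hr (ih hx)

theorem mem_barDeg_of_barMap_mem (h2 : ∀ j, ∀ x ∈ P j, f x ∈ Q' (j + s) → x ∈ Q j) {i j : ℕ}
    {z : (barObj K R M i).carrier} (hz : z ∈ barDeg K 𝒜 P i j)
    (hfz : barMap f i z ∈ barDeg K 𝒜 Q' i (j + s)) : z ∈ barDeg K 𝒜 Q i j := by
  induction i generalizing j with
  | zero => exact h2 j z hz hfz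
  | succ i ih =>
    obtain ⟨σ, b, dg, hb1, hb2⟩ := exists_homogeneous_basis 𝒜
    obtain ⟨S, hS⟩ := exists_bar_eq_sum b i z
    rw [hS]
    refine Submodule.sum_mem _ fun s' _ => ?_
    have hz' := barContract_mem hb2 hz s'
    have hfz' := barContract_mem hb2 hfz s'
    by_cases h : ∃ c, 1 ≤ dg s' ∧ dg s' + c = j
    · obtain ⟨c, hc, rfl⟩ := h
      refine tmul_mem_barDeg hc (hb1 s') (ih (hz'.1 hc c rfl) ?_)
      rw [barMap_barContract]
      exact hfz'.1 hc (c + s) (by omega)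
    · rw [hz'.2 fun c hc hcj => h ⟨c, hc, hcj⟩, map_zero]
      exact zero_mem _

theorem exists_barMap_sub_mem (h3 : ∀ j, ∀ y ∈ P' (j + s), ∃ x ∈ P j, y - f x ∈ Q' (j + s))
    (h4 : ∀ j < s, P' j ≤ Q' j) {i j : ℕ}
    {y : (barObj K R N i).carrier} (hy : y ∈ barDeg K 𝒜 P' i (j + s)) :
    ∃ x ∈ barDeg K 𝒜 P i j, y - barMap f i x ∈ barDeg K 𝒜 Q' i (j + s) := by
  suffices h : barDeg K 𝒜 P' i (j + s) ≤
      (barDeg K 𝒜 P i j).map (barMap f i) ⊔ barDeg K 𝒜 Q' i (j + s) by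
    obtain ⟨_, ⟨x, hx, rfl⟩, q, hq, hy⟩ := Submodule.mem_sup.1 (h hy)
    exact ⟨x, hx, by rwa [← hy, add_sub_cancel_left]⟩
  clear hy y
  induction i generalizing j with
  | zero =>
    intro y hy
    obtain ⟨x, hx, hxy⟩ := h3 j y hy
    exact Submodule.mem_sup.2 ⟨f x, ⟨x, hx, rfl⟩, (show N from y) - f x, hxy,
      add_sub_cancel (f x) (show N from y)⟩
  | succ i ih =>
    rw [barDeg_succ_le]
    intro a c ha hac r hr y hy
    by_cases hc : c < s
    · refine Submodule.mem_sup_right ?_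
      rw [← hac]
      exact tmul_mem_barDeg ha hr (barDeg_mono (fun d hd => h4 d (by omega)) i hy)
    · obtain ⟨c', rfl⟩ : ∃ c', c = c' + s := ⟨c - s, by omega⟩
      obtain rfl : a + c' = j := by omega
      obtain ⟨_, ⟨x, hx, rfl⟩, q, hq, rfl⟩ := Submodule.mem_sup.1 (ih hy)
      rw [map_add]
      refine Submodule.add_mem_sup ⟨barTmul K R M i r x, tmul_mem_barDeg ha hr hx, rfl⟩ ?_
      rw [add_assoc]
      exact tmul_mem_barDeg ha hr hq

/-- An `R`-linear map of degree `s` that is bijective from `P / Q` to `P' / Q'` preserves graded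
Betti numbers up to the shift by `s`. -/
theorem relBetti_eq_of_bijective (f : M →ₗ[R] N) (s : ℕ) (hQP : Q ≤ P)
    (h1 : ∀ j, ∀ x ∈ P j, f x ∈ P' (j + s))
    (h2 : ∀ j, ∀ x ∈ P j, f x ∈ Q' (j + s) ↔ x ∈ Q j)
    (h3 : ∀ j, ∀ y ∈ P' (j + s), ∃ x ∈ P j, y - f x ∈ Q' (j + s))
    (h4 : ∀ j < s, P' j ≤ Q' j) (i j : ℕ) : relBetti P' Q' i (j + s) = relBetti P Q i j := by
  have hQ : ∀ j, ∀ x ∈ Q j, f x ∈ Q' (j + s) := fun j x hx => (h2 j x (hQP j hx)).2 hx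
  have h2' : ∀ j, ∀ x ∈ P j, f x ∈ Q' (j + s) → x ∈ Q j := fun j x hx => (h2 j x hx).1
  have hZ : ∀ z ∈ relCycles P Q i j, barMap f i z ∈ relCycles P' Q' i (j + s) := by
    intro z hz
    cases i with
    | zero => exact h1 j z hz
    | succ i =>
      refine ⟨barMap_mem h1 hz.1, ?_⟩
      change barDiff K R N i (barMap f (i + 1) z) ∈ barDeg K 𝒜 Q' i (j + s)
      rw [← barMap_barDiff]
      exact barMap_mem hQ hz.2
  have hB : ∀ z ∈ relCycles P Q i j, z ∈ relBoundaries P Q i j →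
      barMap f i z ∈ relBoundaries P' Q' i (j + s) := by
    intro z _ hz
    obtain ⟨_, ⟨x, hx, rfl⟩, y, hy, rfl⟩ := Submodule.mem_sup.1 hz
    rw [map_add, barMap_barDiff]
    exact Submodule.add_mem_sup ⟨_, barMap_mem h1 hx, rfl⟩ (barMap_mem hQ hy)
  refine (LinearEquiv.finrank_eq (LinearEquiv.ofBijective
    (subquotientMap (barMap f i) hZ hB) ⟨?_, ?_⟩)).symm
  · refine subquotientMap_injective fun z hz hfz => ?_
    obtain ⟨_, ⟨w, hw, rfl⟩, q, hq, hwq⟩ := Submodule.mem_sup.1 hfz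
    obtain ⟨x, hx, hxw⟩ := exists_barMap_sub_mem h3 h4 hw
    have hd : z - barDiff K R M i x ∈ barDeg K 𝒜 Q i j := by
      refine mem_barDeg_of_barMap_mem h2' (sub_mem (relCycles_le _ _ _ _ hz)
        (barDiff_mem_barDeg P hx)) ?_
      have : barMap f i (z - barDiff K R M i x) =
          barDiff K R N i (w - barMap f (i + 1) x) + q := by
        rw [map_sub, map_sub, barMap_barDiff, ← hwq]
        abel
      rw [this]
      exact add_mem (barDiff_mem_barDeg Q' hxw) hq
    have : z = barDiff K R M i x + (z - barDiff K R M i x) := by abel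
    rw [this]
    exact Submodule.add_mem_sup ⟨x, hx, rfl⟩ hd
  · refine subquotientMap_surjective fun y hy => ?_
    obtain ⟨x, hx, hxy⟩ := exists_barMap_sub_mem h3 h4 (relCycles_le _ _ _ _ hy)
    refine ⟨x, ?_, Submodule.mem_sup_right hxy⟩
    cases i with
    | zero => exact hx
    | succ i =>
      refine ⟨hx, ?_⟩
      refine mem_barDeg_of_barMap_mem h2' (barDiff_mem_barDeg P hx) ?_
      rw [barMap_barDiff]
      have : barDiff K R N i (barMap f (i + 1) x) =
        barDiff K R N i y - barDiff K R N i (y - barMap f (i + 1) x) := by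
        rw [map_sub]; abel
      rw [this]
      exact sub_mem hy.2 (barDiff_mem_barDeg Q' hxy)

theorem relBetti_eq_of_bijective_zero (f : M →ₗ[R] N) (hQP : Q ≤ P)
    (h1 : ∀ j, ∀ x ∈ P j, f x ∈ P' j) (h2 : ∀ j, ∀ x ∈ P j, f x ∈ Q' j ↔ x ∈ Q j)
    (h3 : ∀ j, ∀ y ∈ P' j, ∃ x ∈ P j, y - f x ∈ Q' j) (i j : ℕ) :
    relBetti P' Q' i j = relBetti P Q i j :=
  relBetti_eq_of_bijective f 0 hQP h1 h2 h3 (fun _ h => absurd h (Nat.not_lt_zero _)) i j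

/-- The second isomorphism theorem. -/
theorem relBetti_sup_left {M : Type v} [AddCommGroup M] [Module K M] [Module R M]
    [IsScalarTower K R M] (P Q : GradedFamily M 𝒜) (i j : ℕ) :
    relBetti (P ⊔ Q) Q i j = relBetti P (P ⊓ Q) i j := by
  refine relBetti_eq_of_bijective_zero (LinearMap.id : M →ₗ[R] M) (GradedFamily.inf_le_left _ _)
    (fun j x hx => GradedFamily.le_sup_left P Q j hx)
    (fun j x hx => ⟨fun h => ⟨hx, h⟩, fun h => h.2⟩) ?_ i j
  intro j y hy
  obtain ⟨p, hp, q, hq, rfl⟩ := Submodule.mem_sup.1 hy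
  exact ⟨p, hp, by simpa using hq⟩

end ShiftIso

/-! ### Free modules -/

section Free

variable {K : Type u} [Field K] {R : Type v} [Ring R] [Algebra K R]
variable {M : Type v} [AddCommGroup M] [Module K M] [Module R M] [IsScalarTower K R M]
variable {𝒜 : ℕ → Submodule K R} [GradedAlgebra 𝒜]

theorem relBetti_eq_zero_of_relCycles_le {P Q : GradedFamily M 𝒜} {i j : ℕ}
    (h : relCycles P Q i j ≤ relBoundaries P Q i j) : relBetti P Q i j = 0 := by
  have : Subsingleton (RelTor P Q i j) := by
    rw [Submodule.Quotient.subsingleton_iff, Submodule.submoduleOf_eq_top]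
    exact h
  exact Module.finrank_zero_of_subsingleton

variable (𝒜) (U : Type v) [AddCommGroup U] [Module K U] (k : ℕ)

/-- The grading of the free module `R ⊗ U` whose generators `U` are placed in degree `k`. -/
def freeFamily : GradedFamily (R ⊗[K] U) 𝒜 where
  toFun j := ⨆ (a : ℕ) (_ : a + k = j), Submodule.map₂ (TensorProduct.mk K R U) (𝒜 a) ⊤
  smul_mem' := by
    intro a c r m hr hm
    suffices h : (⨆ (a : ℕ) (_ : a + k = c), Submodule.map₂ (TensorProduct.mk K R U) (𝒜 a) ⊤) ≤
      (⨆ (b : ℕ) (_ : b + k = a + c), Submodule.map₂ (TensorProduct.mk K R U) (𝒜 b) ⊤).comap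
        (Algebra.lsmul K K (R ⊗[K] U) r) from h hm
    simp only [iSup_le_iff, Submodule.map₂_le]
    rintro b rfl s hs u _
    refine Submodule.mem_iSup_of_mem (a + b) (Submodule.mem_iSup_of_mem (by omega) ?_)
    exact Submodule.apply_mem_map₂ (TensorProduct.mk K R U) (SetLike.mul_mem_graded hr hs)
      (Submodule.mem_top (x := u))

variable {𝒜 U k}

theorem tmul_mem_freeFamily {a : ℕ} {r : R} (hr : r ∈ 𝒜 a) (u : U) :
    r ⊗ₜ[K] u ∈ freeFamily 𝒜 U k (a + k) :=
  Submodule.mem_iSup_of_mem a (Submodule.mem_iSup_of_mem rfl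
    (Submodule.apply_mem_map₂ (TensorProduct.mk K R U) hr (Submodule.mem_top (x := u))))

theorem freeFamily_le {j : ℕ} {S : Submodule K (R ⊗[K] U)} :
    freeFamily 𝒜 U k j ≤ S ↔ ∀ a, a + k = j → ∀ r ∈ 𝒜 a, ∀ u : U, r ⊗ₜ[K] u ∈ S := by
  change (⨆ (a : ℕ) (_ : a + k = j), Submodule.map₂ (TensorProduct.mk K R U) (𝒜 a) ⊤) ≤ S ↔ _
  simp only [iSup_le_iff, Submodule.map₂_le, Submodule.mem_top, forall_true_left]
  rfl

theorem freeFamily_eq_bot {j : ℕ} (hj : j < k) : freeFamily 𝒜 U k j = ⊥ := by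
  rw [eq_bot_iff, freeFamily_le]
  intro a ha
  omega

theorem freeFamily_finDim [∀ a, Module.Finite K (𝒜 a)] [Module.Finite K U] :
    (freeFamily 𝒜 U k).FinDim := by
  intro j
  by_cases h : k ≤ j
  · have hle : freeFamily 𝒜 U k j ≤ Submodule.map₂ (TensorProduct.mk K R U) (𝒜 (j - k)) ⊤ := by
      rw [freeFamily_le]
      rintro a rfl r hr u
      rw [Nat.add_sub_cancel]
      exact Submodule.apply_mem_map₂ (TensorProduct.mk K R U) hr (Submodule.mem_top (x := u))
    have : Module.Finite K (Submodule.map₂ (TensorProduct.mk K R U) (𝒜 (j - k)) ⊤) :=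
      Module.Finite.iff_fg.2 (Submodule.FG.map₂ _ (Module.Finite.iff_fg.1 inferInstance)
        (Module.Finite.iff_fg.1 inferInstance))
    exact Submodule.finiteDimensional_of_le hle
  · rw [freeFamily_eq_bot (by omega)]
    infer_instance

variable (𝒜) in
/-- The projection of `R` onto the sum of its components of positive degree. -/
def posProj : R →ₗ[K] R := LinearMap.id - GradedAlgebra.proj 𝒜 0

theorem posProj_of_mem_zero {r : R} (hr : r ∈ 𝒜 0) : posProj 𝒜 r = 0 := by
  simp [posProj, GradedAlgebra.proj_apply, DirectSum.decompose_of_mem_same 𝒜 hr]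

theorem posProj_of_mem {r : R} {a : ℕ} (ha : 1 ≤ a) (hr : r ∈ 𝒜 a) : posProj 𝒜 r = r := by
  simp [posProj, GradedAlgebra.proj_apply, DirectSum.decompose_of_mem_ne 𝒜 hr (by omega : a ≠ 0)]

variable (𝒜 U) in
/-- The contracting homotopy of the bar construction of a free module: up to sign it moves the
positive part of the last entry to the left of the last tensor sign. -/
def freeHomotopy : ∀ i, (barObj K R (R ⊗[K] U) i).carrier →ₗ[K]
    (barObj K R (R ⊗[K] U) (i + 1)).carrier
  | 0 => TensorProduct.lift ((TensorProduct.mk K R (R ⊗[K] U)).compl₁₂ (posProj 𝒜)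
      (TensorProduct.mk K R U 1))
  | i + 1 => -TensorProduct.lift ((barTmul K R (R ⊗[K] U) (i + 1)).compl₂ (freeHomotopy i))

theorem freeHomotopy_zero_tmul (r : R) (u : U) :
    freeHomotopy 𝒜 U 0 (r ⊗ₜ[K] u) =
      barTmul K R (R ⊗[K] U) 0 (posProj 𝒜 r) ((1 : R) ⊗ₜ[K] u) := rfl

theorem freeHomotopy_succ_tmul (i : ℕ) (r : R) (x : (barObj K R (R ⊗[K] U) i).carrier) :
    freeHomotopy 𝒜 U (i + 1) (barTmul K R (R ⊗[K] U) i r x) =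
      -barTmul K R (R ⊗[K] U) (i + 1) r (freeHomotopy 𝒜 U i x) := rfl

theorem freeHomotopy_smul (i : ℕ) (r : R) (x : (barObj K R (R ⊗[K] U) (i + 1)).carrier) :
    freeHomotopy 𝒜 U (i + 1) (r • x) = r • freeHomotopy 𝒜 U (i + 1) x := by
  suffices h : freeHomotopy 𝒜 U (i + 1) ∘ₗ barSmul (i + 1) r =
      barSmul (i + 2) r ∘ₗ freeHomotopy 𝒜 U (i + 1) from congrArg (fun f => f x) h
  refine bar_hom_ext fun s x => ?_
  change freeHomotopy 𝒜 U (i + 1) (barTmul K R (R ⊗[K] U) i (r * s) x) =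
    r • freeHomotopy 𝒜 U (i + 1) (barTmul K R (R ⊗[K] U) i s x)
  rw [freeHomotopy_succ_tmul, freeHomotopy_succ_tmul, smul_neg, smul_barTmul]

theorem freeHomotopy_mem {i j : ℕ} {z : (barObj K R (R ⊗[K] U) i).carrier}
    (hz : z ∈ barDeg K 𝒜 (freeFamily 𝒜 U k) i j) :
    freeHomotopy 𝒜 U i z ∈ barDeg K 𝒜 (freeFamily 𝒜 U k) (i + 1) j := by
  suffices h : barDeg K 𝒜 (freeFamily 𝒜 U k) i j ≤
    (barDeg K 𝒜 (freeFamily 𝒜 U k) (i + 1) j).comap (freeHomotopy 𝒜 U i) from h hz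
  clear hz z
  induction i generalizing j with
  | zero =>
    refine freeFamily_le.2 ?_
    rintro a rfl r hr u
    change freeHomotopy 𝒜 U 0 (r ⊗ₜ[K] u) ∈ barDeg K 𝒜 (freeFamily 𝒜 U k) 1 (a + k)
    rw [freeHomotopy_zero_tmul]
    rcases Nat.eq_zero_or_pos a with rfl | ha
    · rw [posProj_of_mem_zero hr, map_zero]
      exact zero_mem _
    · rw [posProj_of_mem ha hr]
      refine tmul_mem_barDeg ha hr ?_
      have := tmul_mem_freeFamily (k := k) (SetLike.GradedOne.one_mem (A := 𝒜)) u
      rwa [zero_add] at this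
  | succ i ih =>
    rw [barDeg_succ_le]
    rintro a c ha rfl s hs x hx
    change freeHomotopy 𝒜 U (i + 1) (barTmul K R (R ⊗[K] U) i s x) ∈
      barDeg K 𝒜 (freeFamily 𝒜 U k) (i + 2) (a + c)
    rw [freeHomotopy_succ_tmul]
    exact neg_mem (tmul_mem_barDeg ha hs (ih hx))

/-- In positive homological degrees `freeHomotopy` is a contracting homotopy. -/
theorem freeHomotopy_spec (h0 : 𝒜 0 ≤ Submodule.span K {1}) {i j : ℕ}
    {z : (barObj K R (R ⊗[K] U) (i + 1)).carrier}
    (hz : z ∈ barDeg K 𝒜 (freeFamily 𝒜 U k) (i + 1) j) :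
    barDiff K R (R ⊗[K] U) (i + 1) (freeHomotopy 𝒜 U (i + 1) z) +
      freeHomotopy 𝒜 U i (barDiff K R (R ⊗[K] U) i z) = z := by
  suffices h : barDeg K 𝒜 (freeFamily 𝒜 U k) (i + 1) j ≤ LinearMap.eqLocus
      (barDiff K R (R ⊗[K] U) (i + 1) ∘ₗ freeHomotopy 𝒜 U (i + 1) +
        freeHomotopy 𝒜 U i ∘ₗ barDiff K R (R ⊗[K] U) i) LinearMap.id from h hz
  clear hz z
  induction i generalizing j with
  | zero =>
    rw [barDeg_succ_le]
    rintro a c ha rfl r hr x hx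
    suffices h : freeFamily 𝒜 U k c ≤ (LinearMap.eqLocus
      (barDiff K R (R ⊗[K] U) 1 ∘ₗ freeHomotopy 𝒜 U 1 +
        freeHomotopy 𝒜 U 0 ∘ₗ barDiff K R (R ⊗[K] U) 0) LinearMap.id).comap
        (barTmul K R (R ⊗[K] U) 0 r) from h hx
    refine freeFamily_le.2 ?_
    rintro b rfl s hs u
    have key : -((r * posProj 𝒜 s) ⊗ₜ[K] ((1 : R) ⊗ₜ[K] u) -
        r ⊗ₜ[K] (posProj 𝒜 s • ((1 : R) ⊗ₜ[K] u))) + posProj 𝒜 (r * s) ⊗ₜ[K] ((1 : R) ⊗ₜ[K] u) =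
        r ⊗ₜ[K] (s ⊗ₜ[K] u) := by
      rw [posProj_of_mem (by omega) (SetLike.mul_mem_graded hr hs), TensorProduct.smul_tmul']
      rcases Nat.eq_zero_or_pos b with rfl | hb
      · rw [posProj_of_mem_zero hs, mul_zero, zero_smul, TensorProduct.zero_tmul,
          TensorProduct.zero_tmul, TensorProduct.tmul_zero, sub_zero, neg_zero, zero_add]
        obtain ⟨c, rfl⟩ := Submodule.mem_span_singleton.1 (h0 hs)
        rw [mul_smul_comm, mul_one, ← TensorProduct.smul_tmul', ← TensorProduct.smul_tmul',
          TensorProduct.tmul_smul]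
      · rw [posProj_of_mem hb hs, smul_eq_mul, mul_one]
        abel
    exact Eq.trans (congrArg₂ HAdd.hAdd (map_neg (barDiff K R (R ⊗[K] U) 1)
      (barTmul K R (R ⊗[K] U) 1 r (freeHomotopy 𝒜 U 0 (s ⊗ₜ[K] u)))) rfl) key
  | succ i ih =>
    rw [barDeg_succ_le]
    rintro a c ha rfl r hr x hx
    have hx' : barDiff K R (R ⊗[K] U) (i + 1) (freeHomotopy 𝒜 U (i + 1) x) +
      freeHomotopy 𝒜 U i (barDiff K R (R ⊗[K] U) i x) = x := ih hx
    change barDiff K R (R ⊗[K] U) (i + 2) (freeHomotopy 𝒜 U (i + 2)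
        (barTmul K R (R ⊗[K] U) (i + 1) r x)) + freeHomotopy 𝒜 U (i + 1)
        (barDiff K R (R ⊗[K] U) (i + 1) (barTmul K R (R ⊗[K] U) (i + 1) r x)) =
        barTmul K R (R ⊗[K] U) (i + 1) r x
    rw [freeHomotopy_succ_tmul, map_neg, barDiff_succ_tmul, barDiff_succ_tmul, map_sub,
      freeHomotopy_smul, freeHomotopy_succ_tmul]
    conv_rhs => rw [← hx', map_add]
    abel

/-- Free modules have no higher `Tor`. -/
theorem relBetti_freeFamily (h0 : 𝒜 0 ≤ Submodule.span K {1}) (i j : ℕ) :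
    relBetti (freeFamily 𝒜 U k) ⊥ (i + 1) j = 0 := by
  refine relBetti_eq_zero_of_relCycles_le fun z hz => Submodule.mem_sup_left ?_
  refine ⟨freeHomotopy 𝒜 U (i + 1) z, freeHomotopy_mem hz.1, ?_⟩
  have h1 := freeHomotopy_spec h0 hz.1
  have h2 : barDiff K R (R ⊗[K] U) i z ∈ barDeg K 𝒜 (⊥ : GradedFamily (R ⊗[K] U) 𝒜) i j := hz.2
  rw [barDeg_bot, Submodule.mem_bot] at h2
  rwa [h2, map_zero, add_zero] at h1

/-- The span of the products `r • m` with `r ∈ S` and `m ∈ N`. -/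
def smulSpan (S : Submodule K R) (N : Submodule K M) : Submodule K M :=
  Submodule.map₂ (Algebra.lsmul K K M).toLinearMap S N

theorem smul_mem_smulSpan {S : Submodule K R} {N : Submodule K M} {r : R} {m : M} (hr : r ∈ S)
    (hm : m ∈ N) : r • m ∈ smulSpan S N :=
  Submodule.apply_mem_map₂ (Algebra.lsmul K K M).toLinearMap hr hm

theorem smulSpan_le {S : Submodule K R} {N X : Submodule K M} :
    smulSpan S N ≤ X ↔ ∀ r ∈ S, ∀ m ∈ N, r • m ∈ X := Submodule.map₂_le

theorem smulSpan_mono_right (S : Submodule K R) {N N' : Submodule K M} (h : N ≤ N') :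
    smulSpan S N ≤ smulSpan S N' := Submodule.map₂_le_map₂_right h

theorem smulSpan_eq_mul (S N : Submodule K R) : smulSpan S N = S * N := by
  rw [Submodule.mul_eq_map₂]
  rfl

theorem smulSpan_le_family (P : GradedFamily M 𝒜) (a c : ℕ) : smulSpan (𝒜 a) (P c) ≤ P (a + c) :=
  smulSpan_le.2 fun _ hr _ hm => P.smul_mem hr hm

/-- There are no generators of `P / Q` in degree `j + 1` when `𝒜 1` carries the degree `j`
component of `P` onto the next one modulo `Q`. -/
theorem relBetti_zero_succ_eq_zero_iff [∀ a, Module.Finite K (𝒜 a)]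
    (hgen : ∀ a, 𝒜 (a + 1) ≤ 𝒜 1 * 𝒜 a) {P : GradedFamily M 𝒜} (hP : P.FinDim)
    (Q : GradedFamily M 𝒜) (j : ℕ) :
    relBetti P Q 0 (j + 1) = 0 ↔ P (j + 1) ≤ smulSpan (𝒜 1) (P j) ⊔ Q (j + 1) := by
  rw [relBetti_eq_zero_iff hP]
  have : (barDeg K 𝒜 P 1 (j + 1)).map (barDiff K R M 0) = smulSpan (𝒜 1) (P j) := by
    refine le_antisymm ?_ ?_
    · let d : (barObj K R M 1).carrier →ₗ[K] M := barDiff K R M 0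
      suffices h : barDeg K 𝒜 P 1 (j + 1) ≤ Submodule.comap d (smulSpan (𝒜 1) (P j)) by
        rintro _ ⟨x, hx, rfl⟩
        exact h hx
      refine barDeg_succ_le.2 ?_
      intro a c ha hac r hr x hx
      obtain ⟨a, rfl⟩ : ∃ b, a = b + 1 := ⟨a - 1, by omega⟩
      obtain rfl : a + c = j := by omega
      have aux : ∀ m ∈ P c, ∀ r ∈ 𝒜 1 * 𝒜 a, r • m ∈ smulSpan (𝒜 1) (P (a + c)) := by
        intro m hm r hr
        induction hr using Submodule.mul_induction_on' with
        | mem_mul_mem v hv s hs =>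
          rw [mul_smul]
          exact smul_mem_smulSpan hv (P.smul_mem hs hm)
        | add x _ y _ hx hy => rw [add_smul]; exact add_mem hx hy
      exact aux x hx r (hgen a hr)
    · refine smulSpan_le.2 ?_
      intro r hr m hm
      refine ⟨barTmul K R M 0 r m, ?_, rfl⟩
      have h : barTmul K R M 0 r m ∈ barDeg K 𝒜 P 1 (1 + j) :=
        tmul_mem_barDeg (P := P) (x := (show (barObj K R M 0).carrier from m)) le_rfl hr hm
      exact add_comm 1 j ▸ h
  rw [relBoundaries, this]
  rfl

theorem relBetti_zero_zero_eq_zero_iff [∀ a, Module.Finite K (𝒜 a)] {P : GradedFamily M 𝒜}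
    (hP : P.FinDim) (Q : GradedFamily M 𝒜) : relBetti P Q 0 0 = 0 ↔ P 0 ≤ Q 0 := by
  rw [relBetti_eq_zero_iff hP]
  have : (barDeg K 𝒜 P 1 0).map (barDiff K R M 0) = ⊥ := by
    rw [eq_bot_iff, Submodule.map_le_iff_le_comap, barDeg_succ_le]
    intro a c ha hac
    omega
  rw [relBoundaries, this, bot_sup_eq]
  rfl

end Free

/-! ### Generated submodules and images -/

section Generated

variable {K : Type u} [Field K] {R : Type v} [Ring R] [Algebra K R]
variable {M : Type v} [AddCommGroup M] [Module K M] [Module R M] [IsScalarTower K R M]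
variable {N : Type v} [AddCommGroup N] [Module K N] [Module R N] [IsScalarTower K R N]
variable {𝒜 : ℕ → Submodule K R} [GradedAlgebra 𝒜]

@[ext]
theorem GradedFamily.ext {P Q : GradedFamily M 𝒜} (h : ∀ j, P j = Q j) : P = Q := by
  cases P
  cases Q
  congr
  exact funext h

theorem GradedFamily.le_antisymm {P Q : GradedFamily M 𝒜} (h : P ≤ Q) (h' : Q ≤ P) : P = Q :=
  GradedFamily.ext fun j => _root_.le_antisymm (h j) (h' j)

theorem GradedFamily.le_trans {P Q S : GradedFamily M 𝒜} (h : P ≤ Q) (h' : Q ≤ S) : P ≤ S :=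
  fun j => _root_.le_trans (h j) (h' j)

theorem GradedFamily.sup_le {P Q S : GradedFamily M 𝒜} (h : P ≤ S) (h' : Q ≤ S) : P ⊔ Q ≤ S :=
  fun j => _root_.sup_le (h j) (h' j)

theorem GradedFamily.le_inf {P Q S : GradedFamily M 𝒜} (h : S ≤ P) (h' : S ≤ Q) : S ≤ P ⊓ Q :=
  fun j => _root_.le_inf (h j) (h' j)

theorem GradedFamily.sup_eq_left {P Q : GradedFamily M 𝒜} (h : Q ≤ P) : P ⊔ Q = P :=
  GradedFamily.le_antisymm (GradedFamily.sup_le (GradedFamily.le_refl _) h)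
    (GradedFamily.le_sup_left _ _)

variable (𝒜) in
/-- The submodule generated by the subspace `N`, placed in degree `k`. -/
def genFam (k : ℕ) (N : Submodule K M) : GradedFamily M 𝒜 where
  toFun j := ⨆ (a : ℕ) (_ : a + k = j), smulSpan (𝒜 a) N
  smul_mem' := by
    intro a c r m hr hm
    suffices h : (⨆ (a : ℕ) (_ : a + k = c), smulSpan (𝒜 a) N) ≤
      (⨆ (b : ℕ) (_ : b + k = a + c), smulSpan (𝒜 b) N).comap
        (Algebra.lsmul K K M r) from h hm
    simp only [iSup_le_iff, smulSpan_le]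
    rintro b rfl s hs u hu
    refine Submodule.mem_iSup_of_mem (a + b) (Submodule.mem_iSup_of_mem (by omega) ?_)
    change r • s • u ∈ _
    rw [← mul_smul]
    exact smul_mem_smulSpan (SetLike.mul_mem_graded hr hs) hu

theorem smul_mem_genFam {k a : ℕ} {N : Submodule K M} {r : R} {m : M} (hr : r ∈ 𝒜 a)
    (hm : m ∈ N) : r • m ∈ genFam 𝒜 k N (a + k) :=
  Submodule.mem_iSup_of_mem a (Submodule.mem_iSup_of_mem rfl (smul_mem_smulSpan hr hm))

theorem mem_genFam {k : ℕ} {N : Submodule K M} {m : M} (hm : m ∈ N) : m ∈ genFam 𝒜 k N k := by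
  have := smul_mem_genFam (k := k) (SetLike.GradedOne.one_mem (A := 𝒜)) hm
  rwa [zero_add, one_smul] at this

theorem genFam_le_iff {k j : ℕ} {N S : Submodule K M} :
    genFam 𝒜 k N j ≤ S ↔ ∀ a, a + k = j → ∀ r ∈ 𝒜 a, ∀ m ∈ N, r • m ∈ S := by
  change (⨆ (a : ℕ) (_ : a + k = j), smulSpan (𝒜 a) N) ≤ S ↔ _
  simp only [iSup_le_iff, smulSpan_le]

/-- The submodule generated by `N` is the smallest one that contains `N`. -/
theorem genFam_le {k : ℕ} {N : Submodule K M} {P : GradedFamily M 𝒜} (h : N ≤ P k) :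
    genFam 𝒜 k N ≤ P := fun j => genFam_le_iff.2 fun a ha r hr m hm => by
  rw [← ha]
  exact P.smul_mem hr (h hm)

theorem genFam_mono {k : ℕ} {N N' : Submodule K M} (h : N ≤ N') :
    genFam 𝒜 k N ≤ genFam 𝒜 k N' :=
  genFam_le fun _ hm => mem_genFam (h hm)

theorem genFam_add (k a : ℕ) (N : Submodule K M) :
    genFam 𝒜 k N (a + k) = smulSpan (𝒜 a) N := by
  refine le_antisymm (genFam_le_iff.2 ?_) (smulSpan_le.2 fun r hr m hm => smul_mem_genFam hr hm)
  intro b hb r hr m hm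
  obtain rfl : b = a := by omega
  exact smul_mem_smulSpan hr hm

theorem genFam_eq_bot {k j : ℕ} (N : Submodule K M) (h : j < k) : genFam 𝒜 k N j = ⊥ := by
  rw [eq_bot_iff, genFam_le_iff]
  intro a ha
  omega

theorem genFam_self (h0 : 𝒜 0 ≤ Submodule.span K {1}) (k : ℕ) (N : Submodule K M) :
    genFam 𝒜 k N k = N := by
  refine le_antisymm (genFam_le_iff.2 ?_) fun m hm => mem_genFam hm
  intro a ha r hr m hm
  obtain rfl : a = 0 := by omega
  obtain ⟨c, rfl⟩ := Submodule.mem_span_singleton.1 (h0 hr)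
  rw [smul_assoc, one_smul]
  exact N.smul_mem c hm

theorem genFam_bot (k : ℕ) : genFam 𝒜 k (⊥ : Submodule K M) = ⊥ :=
  GradedFamily.le_antisymm (genFam_le _root_.bot_le) (GradedFamily.bot_le _)

theorem genFam_sup (k : ℕ) (N N' : Submodule K M) :
    genFam 𝒜 k (N ⊔ N') = genFam 𝒜 k N ⊔ genFam 𝒜 k N' := by
  refine GradedFamily.le_antisymm (genFam_le ?_)
    (GradedFamily.sup_le (genFam_mono le_sup_left) (genFam_mono le_sup_right))
  exact sup_le_sup (fun m hm => mem_genFam hm) (fun m hm => mem_genFam hm)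

theorem mem_genFam_span_singleton {k a : ℕ} {p m : M} :
    m ∈ genFam 𝒜 k (Submodule.span K {p}) (a + k) ↔ ∃ r ∈ 𝒜 a, r • p = m := by
  rw [genFam_add]
  constructor
  · intro h
    suffices h' : smulSpan (𝒜 a) (Submodule.span K {p}) ≤
        (𝒜 a).map (((LinearMap.toSpanSingleton R M p).restrictScalars K)) by
      obtain ⟨r, hr, h⟩ := h' h
      exact ⟨r, hr, h⟩
    refine smulSpan_le.2 fun r hr m hm => ?_
    obtain ⟨c, rfl⟩ := Submodule.mem_span_singleton.1 hm
    refine ⟨c • r, Submodule.smul_mem _ c hr, ?_⟩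
    change (c • r) • p = r • c • p
    rw [smul_assoc, smul_algebra_smul_comm]
  · rintro ⟨r, hr, rfl⟩
    exact smul_mem_smulSpan hr (Submodule.mem_span_singleton_self p)

/-- The image of a graded submodule under an `R`-linear map of degree `1`. -/
def imFam (μ : M →ₗ[R] N) (P : GradedFamily M 𝒜) : GradedFamily N 𝒜 where
  toFun j := ⨆ (c : ℕ) (_ : c + 1 = j), (P c).map (μ.restrictScalars K)
  smul_mem' := by
    intro a j r m hr hm
    suffices h : (⨆ (c : ℕ) (_ : c + 1 = j), (P c).map (μ.restrictScalars K)) ≤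
      (⨆ (c : ℕ) (_ : c + 1 = a + j), (P c).map (μ.restrictScalars K)).comap
        (Algebra.lsmul K K N r) from h hm
    simp only [iSup_le_iff]
    rintro c rfl _ ⟨x, hx, rfl⟩
    refine Submodule.mem_iSup_of_mem (a + c) (Submodule.mem_iSup_of_mem (by omega) ?_)
    exact ⟨r • x, P.smul_mem hr hx, map_smul μ r x⟩

theorem map_mem_imFam (μ : M →ₗ[R] N) {P : GradedFamily M 𝒜} {j : ℕ} {x : M} (hx : x ∈ P j) :
    μ x ∈ imFam μ P (j + 1) :=
  Submodule.mem_iSup_of_mem j (Submodule.mem_iSup_of_mem rfl ⟨x, hx, rfl⟩)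

theorem imFam_zero (μ : M →ₗ[R] N) (P : GradedFamily M 𝒜) : imFam μ P 0 = ⊥ := by
  rw [eq_bot_iff]
  change (⨆ (c : ℕ) (_ : c + 1 = 0), (P c).map (μ.restrictScalars K)) ≤ ⊥
  simp

theorem mem_imFam_succ {μ : M →ₗ[R] N} {P : GradedFamily M 𝒜} {j : ℕ} {y : N} :
    y ∈ imFam μ P (j + 1) ↔ ∃ x ∈ P j, μ x = y := by
  constructor
  · intro h
    suffices h' : imFam μ P (j + 1) ≤ (P j).map (μ.restrictScalars K) from h' h
    change (⨆ (c : ℕ) (_ : c + 1 = j + 1), (P c).map (μ.restrictScalars K)) ≤ _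
    simp only [iSup_le_iff]
    intro c hc
    obtain rfl : c = j := by omega
    exact le_rfl
  · rintro ⟨x, hx, rfl⟩
    exact map_mem_imFam μ hx

theorem imFam_le {μ : M →ₗ[R] N} {P : GradedFamily M 𝒜} {Q : GradedFamily N 𝒜}
    (h : ∀ j, ∀ x ∈ P j, μ x ∈ Q (j + 1)) : imFam μ P ≤ Q := by
  rintro (_ | j)
  · rw [imFam_zero]
    exact _root_.bot_le
  · intro y hy
    obtain ⟨x, hx, rfl⟩ := mem_imFam_succ.1 hy
    exact h j x hx

theorem imFam_mono (μ : M →ₗ[R] N) {P P' : GradedFamily M 𝒜} (h : P ≤ P') :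
    imFam μ P ≤ imFam μ P' := imFam_le fun j _ hx => map_mem_imFam μ (h j hx)

variable (𝒜) in
/-- The ring itself, as a graded module. -/
def wholeFam : GradedFamily R 𝒜 where
  toFun := 𝒜
  smul_mem' hr hm := SetLike.mul_mem_graded hr hm

theorem wholeFam_finDim [∀ a, Module.Finite K (𝒜 a)] : (wholeFam 𝒜).FinDim :=
  fun j => inferInstanceAs (Module.Finite K (𝒜 j))

theorem genFam_le_wholeFam {k : ℕ} {N : Submodule K R} (h : N ≤ 𝒜 k) :
    genFam 𝒜 k N ≤ wholeFam 𝒜 := genFam_le h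

end Generated

/-! ### Polynomial rings and exterior algebras -/

section KoszulModel

variable {K : Type u} [Field K] {R : Type v} [Ring R] [Algebra K R]
variable {M : Type v} [AddCommGroup M] [Module K M] [Module R M] [IsScalarTower K R M]

/-- The common features of polynomial rings (`ε = 1`, `η = 0`) and exterior algebras (`ε = -1`,
`η = 1`) in `n` variables: linear forms commute with homogeneous elements up to a power of the sign
`ε`, and the colon ideal of a linear form `y` modulo a space `Λ` of linear forms that does not
contain `y` is generated by `Λ` and `η y`. -/
structure KoszulModel (𝒜 : ℕ → Submodule K R) (n : ℕ) (ε η : K) : Prop where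
  zero_deg : 𝒜 0 ≤ Submodule.span K {1}
  succ_deg : ∀ a, 𝒜 (a + 1) ≤ 𝒜 1 * 𝒜 a
  finrank_one : Module.finrank K (𝒜 1) = n
  comm : ∀ {a : ℕ} {f v : R}, f ∈ 𝒜 a → v ∈ 𝒜 1 → f * v = ε ^ a • (v * f)
  sign : ε * ε = 1
  eta : η = 0 ∨ η = 1
  sq : ∀ v ∈ 𝒜 1, η • (v * v) = 0
  colon : ∀ {Λ : Submodule K R} {y f : R} {j : ℕ}, Λ ≤ 𝒜 1 → y ∈ 𝒜 1 → y ∉ Λ → f ∈ 𝒜 j →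
    f * y ∈ smulSpan (𝒜 j) Λ → f ∈ (⨆ (a : ℕ) (_ : a + 1 = j),
      smulSpan (𝒜 a) (Λ ⊔ Submodule.span K {η • y}))

/-- Right multiplication by `y`. -/
abbrev rmul (y : R) : R →ₗ[R] R := LinearMap.toSpanSingleton R R y

theorem rmul_apply (x y : R) : rmul y x = x * y := rfl

variable {𝒜 : ℕ → Submodule K R} [GradedAlgebra 𝒜] {n : ℕ} {ε η : K}

theorem KoszulModel.mem_colon (h : KoszulModel 𝒜 n ε η) {Λ : Submodule K R} {y f : R} {j : ℕ}
    (hΛ : Λ ≤ 𝒜 1) (hy : y ∈ 𝒜 1) (hyΛ : y ∉ Λ) (hf : f ∈ 𝒜 j)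
    (hfy : f * y ∈ genFam 𝒜 1 Λ (j + 1)) :
    f ∈ genFam 𝒜 1 (Λ ⊔ Submodule.span K {η • y}) j :=
  h.colon hΛ hy hyΛ hf (by rwa [genFam_add] at hfy)

theorem KoszulModel.eps_ne_zero (h : KoszulModel 𝒜 n ε η) : ε ≠ 0 := by
  intro h0
  have := h.sign
  rw [h0, zero_mul] at this
  exact zero_ne_one this

theorem KoszulModel.eps_pow_mul_self (h : KoszulModel 𝒜 n ε η) (a : ℕ) : ε ^ a * ε ^ a = 1 := by
  rw [← mul_pow, h.sign, one_pow]

theorem KoszulModel.mul_mem (h : KoszulModel 𝒜 n ε η) {P : GradedFamily R 𝒜} (hP : P ≤ wholeFam 𝒜)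
    {j : ℕ} {x y : R} (hx : x ∈ P j) (hy : y ∈ 𝒜 1) : x * y ∈ P (j + 1) := by
  rw [h.comm (hP j hx) hy, add_comm]
  exact Submodule.smul_mem _ _ (P.smul_mem hy hx)

theorem KoszulModel.comm' (h : KoszulModel 𝒜 n ε η) {a : ℕ} {f v : R} (hf : f ∈ 𝒜 a)
    (hv : v ∈ 𝒜 1) : v * f = ε ^ a • (f * v) := by
  rw [h.comm hf hv, smul_smul, h.eps_pow_mul_self, one_smul]

theorem KoszulModel.succ_deg' (h : KoszulModel 𝒜 n ε η) (a : ℕ) : 𝒜 (a + 1) ≤ 𝒜 a * 𝒜 1 := by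
  refine (h.succ_deg a).trans (Submodule.mul_le.2 fun v hv f (hf : f ∈ 𝒜 a) => ?_)
  rw [h.comm' hf hv]
  exact Submodule.smul_mem _ _ (Submodule.mul_mem_mul hf hv)

theorem KoszulModel.genFam_one_succ (h : KoszulModel 𝒜 n ε η) (a : ℕ) :
    genFam 𝒜 1 (𝒜 1) (a + 1) = 𝒜 (a + 1) := by
  refine le_antisymm (genFam_le_wholeFam le_rfl (a + 1)) ?_
  rw [genFam_add, smulSpan_eq_mul]
  exact h.succ_deg' a

theorem KoszulModel.mul_mem_of_mem_colon (h : KoszulModel 𝒜 n ε η) {Λ : Submodule K R} {x y : R}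
    {j : ℕ} (hΛ : Λ ≤ 𝒜 1) (hy : y ∈ 𝒜 1)
    (hx : x ∈ genFam 𝒜 1 (Λ ⊔ Submodule.span K {η • y}) j) : x * y ∈ genFam 𝒜 1 Λ (j + 1) := by
  suffices h' : genFam 𝒜 1 (Λ ⊔ Submodule.span K {η • y}) j ≤
    (genFam 𝒜 1 Λ (j + 1)).comap ((rmul y).restrictScalars K) from h' hx
  refine genFam_le_iff.2 ?_
  rintro a rfl r hr m hm
  obtain ⟨v, hv, w, hw, rfl⟩ := Submodule.mem_sup.1 hm
  obtain ⟨c, rfl⟩ := Submodule.mem_span_singleton.1 hw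
  change r * (v + c • η • y) * y ∈ genFam 𝒜 1 Λ (a + 1 + 1)
  have : (v + c • η • y) * y = (ε ^ 1) • (y * v) := by
    rw [add_mul, smul_mul_assoc, smul_mul_assoc, h.sq y hy, smul_zero, add_zero,
      h.comm (hΛ hv) hy]
  rw [mul_assoc, this, mul_smul_comm, ← mul_assoc]
  exact Submodule.smul_mem _ _ (smul_mem_genFam (𝒜 := 𝒜) (SetLike.mul_mem_graded hr hy) hv)

theorem KoszulModel.colon_le (_ : KoszulModel 𝒜 n ε η) {Λ : Submodule K R} {y : R}
    (hΛ : Λ ≤ 𝒜 1) (hy : y ∈ 𝒜 1) : Λ ⊔ Submodule.span K {η • y} ≤ 𝒜 1 := by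
  refine sup_le hΛ ?_
  rw [Submodule.span_singleton_le_iff_mem]
  exact Submodule.smul_mem _ _ hy

/-- The colon ideal is `Λ` itself for polynomial rings and `Λ + (y)` for exterior algebras. -/
theorem KoszulModel.colon_cases (h : KoszulModel 𝒜 n ε η) (Λ : Submodule K R) (y : R) :
    Λ ⊔ Submodule.span K {η • y} = Λ ∨ Λ ⊔ Submodule.span K {η • y} = Λ ⊔ Submodule.span K {y} := by
  rcases h.eta with rfl | rfl
  · left
    simp
  · right
    rw [one_smul]

variable [∀ a, Module.Finite K (𝒜 a)]

/-- The ring is a free module over itself, hence has no higher `Tor`. -/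
theorem relBetti_whole_bot (h0 : 𝒜 0 ≤ Submodule.span K {1}) (i j : ℕ) :
    relBetti (wholeFam 𝒜) ⊥ (i + 1) j = 0 := by
  let U : Submodule K R := Submodule.span K {1}
  let u₀ : U := ⟨1, Submodule.mem_span_singleton_self 1⟩
  let g : R ⊗[K] U →ₗ[K] R := TensorProduct.lift ((LinearMap.mul K R).compl₂ U.subtype)
  have hg : ∀ r (u : U), g (r ⊗ₜ u) = r * u := fun r u => rfl
  rw [← relBetti_freeFamily (U := U) (k := 0) h0 i j]
  symm
  refine relBetti_eq_of_bijective_zero (LinearMap.toSpanSingleton R (R ⊗[K] U) (1 ⊗ₜ u₀))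
    (GradedFamily.bot_le _) ?_ ?_ ?_ _ _
  · intro j x hx
    rw [LinearMap.toSpanSingleton_apply, TensorProduct.smul_tmul', smul_eq_mul, mul_one]
    exact tmul_mem_freeFamily (𝒜 := 𝒜) (k := 0) hx u₀
  · intro j x _
    rw [LinearMap.toSpanSingleton_apply, TensorProduct.smul_tmul', smul_eq_mul, mul_one,
      bot_apply, bot_apply, Submodule.mem_bot, Submodule.mem_bot]
    constructor
    · intro hx
      have := congrArg g hx
      rw [hg, map_zero] at this
      simpa [u₀] using this
    · rintro rfl
      rw [TensorProduct.zero_tmul]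
  · intro j
    have key : freeFamily 𝒜 U 0 j ≤ (𝒜 j).map (((LinearMap.toSpanSingleton R (R ⊗[K] U)
        (1 ⊗ₜ u₀))).restrictScalars K) := by
      rw [freeFamily_le]
      rintro a rfl r hr ⟨u, hu⟩
      obtain ⟨c, rfl⟩ := Submodule.mem_span_singleton.1 hu
      refine ⟨c • r, Submodule.smul_mem _ _ hr, ?_⟩
      change (c • r) • ((1 : R) ⊗ₜ[K] u₀) = _
      rw [TensorProduct.smul_tmul', smul_eq_mul, mul_one, ← TensorProduct.smul_tmul',
        ← TensorProduct.tmul_smul]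
      rfl
    intro y hy
    obtain ⟨x, hx, rfl⟩ := key hy
    exact ⟨x, hx, by simp [bot_apply]⟩

theorem KoszulModel.relBetti_whole_bot_eq_zero (h : KoszulModel 𝒜 n ε η) {i j : ℕ} (hij : j ≠ i) :
    relBetti (wholeFam 𝒜) ⊥ i j = 0 := by
  obtain _ | i := i
  · obtain _ | j := j
    · exact absurd rfl hij
    · rw [relBetti_zero_succ_eq_zero_iff h.succ_deg wholeFam_finDim]
      refine le_sup_of_le_left ?_
      change 𝒜 (j + 1) ≤ smulSpan (𝒜 1) (𝒜 j)
      rw [smulSpan_eq_mul]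
      exact h.succ_deg j
  · exact relBetti_whole_bot h.zero_deg _ _

/-- In its lowest degree `k`, the module `P / Q` consists of minimal generators. -/
theorem relBetti_zero_of_mem {P Q : GradedFamily M 𝒜} {k : ℕ} (hP : P.FinDim)
    (hQP : Q ≤ P) (hk : ∀ j < k, P j ≤ Q j) :
    relBetti P Q 0 k + Module.finrank K (Q k) = Module.finrank K (P k) := by
  have := hP k
  have e : relBoundaries P Q 0 k = Q k := by
    have : (barDeg K 𝒜 P 1 k).map (barDiff K R M 0) ≤ Q k := by
      let d : (barObj K R M 1).carrier →ₗ[K] M := barDiff K R M 0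
      suffices h : barDeg K 𝒜 P 1 k ≤ Submodule.comap d (Q k) by
        rintro _ ⟨x, hx, rfl⟩
        exact h hx
      refine barDeg_succ_le.2 ?_
      intro a c ha hac r hr x hx
      change r • x ∈ Q k
      rw [← hac]
      exact Q.smul_mem hr (hk c (by omega) hx)
    exact sup_eq_right.2 this
  have e2 : relCycles P Q 0 k = P k := rfl
  change Module.finrank K (relCycles P Q 0 k ⧸
    (relBoundaries P Q 0 k).submoduleOf (relCycles P Q 0 k)) + _ = _
  rw [e]
  change Module.finrank K (P k ⧸ (Q k).submoduleOf (P k)) + _ = _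
  have h1 := Submodule.finrank_quotient_add_finrank ((Q k).submoduleOf (P k))
  rwa [(Submodule.submoduleOfEquivOfLe (hQP k)).finrank_eq] at h1

/-- Multiplication by a linear form `y` identifies the quotient of `R` by the colon ideal with
`(Λ, y) / (Λ)`. -/
theorem KoszulModel.relBetti_step (h : KoszulModel 𝒜 n ε η) {Λ : Submodule K R} {y : R}
    (hΛ : Λ ≤ 𝒜 1) (hy : y ∈ 𝒜 1) (hyΛ : y ∉ Λ) (i j : ℕ) :
    relBetti (genFam 𝒜 1 (Λ ⊔ Submodule.span K {y})) (genFam 𝒜 1 Λ) i (j + 1) =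
      relBetti (wholeFam 𝒜) (genFam 𝒜 1 (Λ ⊔ Submodule.span K {η • y})) i j := by
  have hC := genFam_le_wholeFam (h.colon_le hΛ hy)
  refine relBetti_eq_of_bijective (rmul y) 1 hC ?_ ?_ ?_ ?_ i j
  · intro j x hx
    exact smul_mem_genFam hx (Submodule.mem_sup_right (Submodule.mem_span_singleton_self y))
  · intro j x hx
    exact ⟨fun hxy => h.mem_colon hΛ hy hyΛ hx hxy, fun hxC => h.mul_mem_of_mem_colon hΛ hy hxC⟩
  · intro j w hw
    rw [genFam_sup, sup_apply] at hw
    obtain ⟨a, ha, b, hb, rfl⟩ := Submodule.mem_sup.1 hw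
    obtain ⟨r, hr, rfl⟩ := mem_genFam_span_singleton.1 hb
    exact ⟨r, hr, by rw [rmul_apply, smul_eq_mul, add_sub_cancel_right]; exact ha⟩
  · intro j hj
    rw [genFam_eq_bot _ hj]
    exact _root_.bot_le

/-- Induction on finite-dimensional subspaces by adjoining one vector at a time. -/
theorem induction_sup_span_singleton {V : Type*} [AddCommGroup V] [Module K V]
    {A : Submodule K V} [Module.Finite K A] {motive : ∀ Λ : Submodule K V, Λ ≤ A → Prop}
    (bot : motive ⊥ bot_le)
    (sup : ∀ Λ y, ∀ (hΛ : Λ ≤ A) (hy : y ∈ A), y ∉ Λ → motive Λ hΛ →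
      motive (Λ ⊔ Submodule.span K {y})
        (sup_le hΛ ((Submodule.span_singleton_le_iff_mem _ _).2 hy)))
    (Λ : Submodule K V) (hΛ : Λ ≤ A) : motive Λ hΛ := by
  have : Module.Finite K Λ := Submodule.finiteDimensional_of_le hΛ
  obtain ⟨s, rfl⟩ := Module.Finite.iff_fg.1 this
  clear this
  classical
  induction s using Finset.induction_on with
  | empty => simpa using bot
  | insert a s ha ih =>
    have e : Submodule.span K ((insert a s : Finset V) : Set V) =
        Submodule.span K (s : Set V) ⊔ Submodule.span K {a} := by
      rw [Finset.coe_insert, Submodule.span_insert, sup_comm]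
    revert hΛ
    rw [e]
    intro hΛ
    have h1 := le_sup_left.trans hΛ
    have h2 : a ∈ A := hΛ (Submodule.mem_sup_right (Submodule.mem_span_singleton_self a))
    by_cases h : a ∈ Submodule.span K (s : Set V)
    · have e' := sup_eq_left.2 ((Submodule.span_singleton_le_iff_mem _ _).2 h)
      revert hΛ
      rw [e']
      exact fun _ => ih _
    · exact sup _ _ h1 h2 h (ih h1)

/-- `R / (Λ)` has a linear resolution when `Λ` consists of linear forms. -/
theorem KoszulModel.relBetti_whole_genFam (h : KoszulModel 𝒜 n ε η) {Λ : Submodule K R}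
    (hΛ : Λ ≤ 𝒜 1) : ∀ i j, j ≠ i → relBetti (wholeFam 𝒜) (genFam 𝒜 1 Λ) i j = 0 := by
  induction Λ, hΛ using induction_sup_span_singleton with
  | bot =>
    intro i j hij
    rw [genFam_bot]
    exact h.relBetti_whole_bot_eq_zero hij
  | sup Λ y hΛ hy hyΛ ih =>
    have hle : genFam 𝒜 1 Λ ≤ genFam 𝒜 1 (Λ ⊔ Submodule.span K {y}) := genFam_mono le_sup_left
    have hle' : genFam 𝒜 1 (Λ ⊔ Submodule.span K {y}) ≤ wholeFam 𝒜 :=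
      genFam_le_wholeFam (sup_le hΛ ((Submodule.span_singleton_le_iff_mem _ _).2 hy))
    intro i
    induction i with
    | zero =>
      intro j hj
      exact Nat.eq_zero_of_le_zero ((relBetti_quot_zero_le hle wholeFam_finDim j).trans
        (ih 0 j hj).le)
    | succ i ihi =>
      intro j hj
      refine Nat.eq_zero_of_le_zero ((relBetti_quot_le_add hle hle' wholeFam_finDim i j).trans ?_)
      rw [ih (i + 1) j hj, zero_add]
      obtain _ | j := j
      · refine (relBetti_eq_zero_of_lt (k := 1) ?_ (by omega)).le
        intro c hc
        rw [genFam_eq_bot _ hc]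
        exact _root_.bot_le
      · rw [h.relBetti_step hΛ hy hyΛ]
        rcases h.colon_cases Λ y with e | e
        · rw [e, ih i j (by omega)]
        · rw [e, ihi j (by omega)]

theorem finrank_sup_span_singleton' {V : Type*} [AddCommGroup V] [Module K V]
    {A Λ : Submodule K V} [Module.Finite K A] {y : V} (hΛ : Λ ≤ A) (hyΛ : y ∉ Λ) :
    Module.finrank K ↥(Λ ⊔ Submodule.span K {y}) = Module.finrank K Λ + 1 := by
  have : Module.Finite K Λ := Submodule.finiteDimensional_of_le hΛ
  have h1 := Submodule.finrank_sup_add_finrank_inf_eq Λ (Submodule.span K {y})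
  have h2 : Λ ⊓ Submodule.span K {y} = ⊥ := by
    rw [eq_bot_iff]
    rintro x ⟨hx, hx'⟩
    obtain ⟨c, rfl⟩ := Submodule.mem_span_singleton.1 hx'
    by_cases hc : c = 0
    · simp [hc]
    · exact absurd ((Submodule.smul_mem_iff _ hc).1 hx) hyΛ
  rw [h2, finrank_bot, finrank_span_singleton (by rintro rfl; exact hyΛ (zero_mem _))] at h1
  omega

/-- Over a polynomial ring, `Tor` of `R / (Λ)` is concentrated in homological degrees at most
`dim Λ`, and it does not vanish there. -/
theorem KoszulModel.relBetti_whole_genFam_poly [Nontrivial R] (h : KoszulModel 𝒜 n ε (0 : K))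
    {Λ : Submodule K R} (hΛ : Λ ≤ 𝒜 1) :
    (∀ i j, Module.finrank K Λ < i → relBetti (wholeFam 𝒜) (genFam 𝒜 1 Λ) i j = 0) ∧
      relBetti (wholeFam 𝒜) (genFam 𝒜 1 Λ) (Module.finrank K Λ) (Module.finrank K Λ) ≠ 0 := by
  induction Λ, hΛ using induction_sup_span_singleton with
  | bot =>
    rw [genFam_bot, finrank_bot]
    refine ⟨fun i j hi => ?_, ?_⟩
    · obtain ⟨i, rfl⟩ : ∃ i', i = i' + 1 := ⟨i - 1, by omega⟩
      exact relBetti_whole_bot h.zero_deg i j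
    · rw [Ne, relBetti_zero_zero_eq_zero_iff wholeFam_finDim]
      intro h0
      exact one_ne_zero ((Submodule.mem_bot K).1 (h0 (SetLike.GradedOne.one_mem (A := 𝒜))))
  | sup Λ y hΛ hy hyΛ ih =>
    have hle : genFam 𝒜 1 Λ ≤ genFam 𝒜 1 (Λ ⊔ Submodule.span K {y}) := genFam_mono le_sup_left
    have hle' : genFam 𝒜 1 (Λ ⊔ Submodule.span K {y}) ≤ wholeFam 𝒜 :=
      genFam_le_wholeFam (sup_le hΛ ((Submodule.span_singleton_le_iff_mem _ _).2 hy))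
    have hs := h.relBetti_step hΛ hy hyΛ
    rw [zero_smul, Submodule.span_zero_singleton, sup_bot_eq] at hs
    rw [finrank_sup_span_singleton' hΛ hyΛ]
    refine ⟨fun i j hi => ?_, fun h0 => ih.2 ?_⟩
    · obtain ⟨i, rfl⟩ : ∃ i', i = i' + 1 := ⟨i - 1, by omega⟩
      refine Nat.eq_zero_of_le_zero ((relBetti_quot_le_add hle hle' wholeFam_finDim i j).trans ?_)
      rw [ih.1 (i + 1) j (by omega), zero_add]
      obtain _ | j := j
      · refine (relBetti_eq_zero_of_lt (k := 1) ?_ (by omega)).le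
        intro c hc
        rw [genFam_eq_bot _ hc]
        exact _root_.bot_le
      · rw [hs, ih.1 i j (by omega)]
    · have h1 := relBetti_sub_le_add hle hle' wholeFam_finDim (Module.finrank K Λ)
        (Module.finrank K Λ + 1)
      rw [hs, h0, zero_add, h.relBetti_whole_genFam hΛ (Module.finrank K Λ)
        (Module.finrank K Λ + 1) (by omega)] at h1
      omega

/-- The graded Betti numbers of the residue field. -/
def residueBetti (𝒜 : ℕ → Submodule K R) [GradedAlgebra 𝒜] (i : ℕ) : ℕ :=
  relBetti (wholeFam 𝒜) (genFam 𝒜 1 (𝒜 1)) i i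

/-- `P / Q` has a `k`-linear resolution. -/
def IsLinear (k : ℕ) (P Q : GradedFamily M 𝒜) : Prop :=
  ∀ i j, j ≠ i + k → relBetti P Q i j = 0

/-- A module concentrated in degree `k` is a direct sum of copies of the residue field. -/
theorem KoszulModel.relBetti_concentrated (h : KoszulModel 𝒜 n ε η) {P Q : GradedFamily M 𝒜}
    (hP : P.FinDim) {k : ℕ} (hQP : Q ≤ P) (hk : ∀ j, j ≠ k → P j ≤ Q j) :
    IsLinear k P Q ∧ ∀ i, relBetti P Q i (i + k) + residueBetti 𝒜 i * Module.finrank K (Q k) =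
      residueBetti 𝒜 i * Module.finrank K (P k) := by
  have := hP k
  obtain ⟨d, hd⟩ : ∃ d, Module.finrank K (P k) = Module.finrank K (Q k) + d :=
    ⟨_, (Nat.add_sub_cancel' (Submodule.finrank_mono (hQP k))).symm⟩
  suffices H : IsLinear k P Q ∧ ∀ i, relBetti P Q i (i + k) = residueBetti 𝒜 i * d by
    refine ⟨H.1, fun i => ?_⟩
    rw [H.2, hd]
    ring
  induction d generalizing Q with
  | zero =>
    have : P ≤ Q := by
      have := hP.mono hQP k
      intro j
      by_cases hj : j = k
      · subst hj
        exact (Submodule.eq_of_le_of_finrank_eq (hQP j) hd.symm).ge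
      · exact hk j hj
    have h0 : ∀ i j, relBetti P Q i j = 0 := fun i j => relBetti_eq_zero_of_le fun c _ => this c
    exact ⟨fun i j _ => h0 i j, fun i => by rw [h0, mul_zero]⟩
  | succ d ih =>
    obtain ⟨p, hp, hpQ⟩ : ∃ p ∈ P k, p ∉ Q k := by
      by_contra! hc
      have := hP.mono hQP k
      have := Submodule.finrank_mono (show P k ≤ Q k from hc)
      omega
    -- enlarge `Q` by one vector `p` of degree `k`; the quotient is a copy of the residue field,
    -- shifted by `k`
    set Q' := Q ⊔ genFam 𝒜 k (Submodule.span K {p}) with hQ'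
    have hQQ' : Q ≤ Q' := GradedFamily.le_sup_left _ _
    have hQ'P : Q' ≤ P := GradedFamily.sup_le hQP
      (genFam_le ((Submodule.span_singleton_le_iff_mem _ _).2 hp))
    have hQ'k : Q' k = Q k ⊔ Submodule.span K {p} := by
      rw [hQ', sup_apply, genFam_self h.zero_deg]
    obtain ⟨l1, l2⟩ := ih hQ'P (fun j hj => (hk j hj).trans (hQQ' j)) (by
      rw [hQ'k, finrank_sup_span_singleton' (hQP k) hpQ]
      omega)
    have e : ∀ i j, relBetti Q' Q i (j + k) = relBetti (wholeFam 𝒜) (genFam 𝒜 1 (𝒜 1)) i j := by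
      refine relBetti_eq_of_bijective (LinearMap.toSpanSingleton R M p) k
        (genFam_le_wholeFam le_rfl) ?_ ?_ ?_ ?_
      · intro j x hx
        exact GradedFamily.le_sup_right _ _ _
          (smul_mem_genFam hx (Submodule.mem_span_singleton_self p))
      · intro j x hx
        rw [LinearMap.toSpanSingleton_apply]
        obtain _ | j := j
        · obtain ⟨c, rfl⟩ := Submodule.mem_span_singleton.1 (h.zero_deg hx)
          rw [smul_assoc, one_smul, genFam_eq_bot _ one_pos, Submodule.mem_bot, zero_add]
          constructor
          · intro hc
            by_cases hc0 : c = 0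
            · rw [hc0, zero_smul]
            · exact absurd ((Submodule.smul_mem_iff _ hc0).1 hc) hpQ
          · intro hc
            rw [← one_smul R p, ← smul_assoc, hc, zero_smul]
            exact zero_mem _
        · rw [h.genFam_one_succ]
          exact ⟨fun _ => hx, fun _ => hk _ (by omega) (P.smul_mem hx hp)⟩
      · intro j y hy
        obtain ⟨q, hq, b, hb, rfl⟩ := Submodule.mem_sup.1 hy
        obtain ⟨r, hr, rfl⟩ := mem_genFam_span_singleton.1 hb
        exact ⟨r, hr, by rw [LinearMap.toSpanSingleton_apply, add_sub_cancel_right]; exact hq⟩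
      · intro j hj
        rw [hQ', sup_apply, genFam_eq_bot _ hj, sup_bot_eq]
    have e' : IsLinear k Q' Q := by
      intro i j hj
      by_cases hjk : k ≤ j
      · obtain ⟨j, rfl⟩ : ∃ j', j = j' + k := ⟨j - k, by omega⟩
        rw [e]
        exact h.relBetti_whole_genFam le_rfl _ _ (by omega)
      · refine relBetti_eq_zero_of_lt (k := k) ?_ (by omega)
        intro c hc
        rw [hQ', sup_apply, genFam_eq_bot _ hc, sup_bot_eq]
    refine ⟨fun i j hj => Nat.eq_zero_of_le_zero ((relBetti_le_add hQQ' hQ'P hP i j).trans ?_),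
      fun i => ?_⟩
    · rw [e' i j hj, l1 i j hj]
    · rw [mul_add, mul_one, ← l2 i]
      have e2 : relBetti Q' Q i (i + k) = residueBetti 𝒜 i := e i i
      obtain _ | i := i
      · rw [relBetti_add_zero hQQ' hQ'P hP (l1 1 _ (by omega)), e2, add_comm]
      · rw [relBetti_add_succ hQQ' hQ'P hP (l1 (i + 2) _ (by omega)) (e' i _ (by omega)), e2,
          add_comm]

/-- `k`-linear resolutions in a short exact sequence: the graded Betti numbers add up. -/
theorem IsLinear.trans {P P' Q : GradedFamily M 𝒜} {k : ℕ} (h : IsLinear k P Q)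
    (h' : IsLinear k P' P) (hQP : Q ≤ P) (hPP' : P ≤ P') (hP' : P'.FinDim) :
    IsLinear k P' Q ∧ ∀ i, relBetti P' Q i (i + k) =
      relBetti P Q i (i + k) + relBetti P' P i (i + k) := by
  refine ⟨fun i j hj => Nat.eq_zero_of_le_zero ((relBetti_le_add hQP hPP' hP' i j).trans ?_),
    fun i => ?_⟩
  · rw [h i j hj, h' i j hj]
  · obtain _ | i := i
    · exact relBetti_add_zero hQP hPP' hP' (h' 1 _ (by omega))
    · exact relBetti_add_succ hQP hPP' hP' (h' (i + 2) _ (by omega)) (h i _ (by omega))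

end KoszulModel

/-! ### Linear forms that act regularly up to a linear part -/

section FreeMul

variable {K : Type u} [Field K] {R : Type v} [Ring R] [Algebra K R]
variable {𝒜 : ℕ → Submodule K R} [GradedAlgebra 𝒜] {n : ℕ} {ε η : K}
variable (U : Type v) [AddCommGroup U] [Module K U] {k : ℕ}

variable (K) in
/-- Right multiplication by `y` on the free module `R ⊗ U`. -/
def freeMul (y : R) : R ⊗[K] U →ₗ[R] R ⊗[K] U :=
  TensorProduct.AlgebraTensorModule.map (rmul y) LinearMap.id

variable {U}

theorem freeMul_tmul (y r : R) (u : U) : freeMul K U y (r ⊗ₜ u) = (r * y) ⊗ₜ u := rfl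

theorem freeMul_mem {y : R} (hy : y ∈ 𝒜 1) {j : ℕ} {x : R ⊗[K] U}
    (hx : x ∈ freeFamily 𝒜 U k j) : freeMul K U y x ∈ freeFamily 𝒜 U k (j + 1) := by
  suffices h : freeFamily 𝒜 U k j ≤ (freeFamily 𝒜 U k (j + 1)).comap
    ((freeMul K U y).restrictScalars K) from h hx
  rw [freeFamily_le]
  rintro a rfl r hr u
  have := tmul_mem_freeFamily (k := k) (SetLike.mul_mem_graded hr hy : r * y ∈ 𝒜 (a + 1)) u
  rwa [add_right_comm] at this

theorem freeMul_freeMul (y : R) (x : R ⊗[K] U) :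
    freeMul K U y (freeMul K U y x) = freeMul K U (y * y) x := by
  induction x with
  | zero => simp
  | add a b ha hb => rw [map_add, map_add, map_add, ha, hb]
  | tmul r u => rw [freeMul_tmul, freeMul_tmul, freeMul_tmul, mul_assoc]

theorem KoszulModel.smul_freeMul_freeMul (h : KoszulModel 𝒜 n ε η) {y : R} (hy : y ∈ 𝒜 1)
    (x : R ⊗[K] U) : η • freeMul K U y (freeMul K U y x) = 0 := by
  rw [freeMul_freeMul]
  induction x with
  | zero => simp
  | add a b ha hb => rw [map_add, smul_add, ha, hb, add_zero]
  | tmul r u => rw [freeMul_tmul, TensorProduct.smul_tmul', ← mul_smul_comm, h.sq y hy, mul_zero,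
      TensorProduct.zero_tmul]

/-- The kernel of multiplication by a linear form on a free module. -/
theorem KoszulModel.exists_of_freeMul_eq_zero [Module.Finite K U] (h : KoszulModel 𝒜 n ε η) {y : R}
    (hy : y ∈ 𝒜 1) (hy0 : y ≠ 0) {j : ℕ} {x : R ⊗[K] U} (hx : x ∈ freeFamily 𝒜 U k j)
    (hxy : freeMul K U y x = 0) :
    ∃ w ∈ imFam (freeMul K U y) (freeFamily 𝒜 U k) j, x = η • w := by
  by_cases hjk : j < k
  · rw [freeFamily_eq_bot hjk, Submodule.mem_bot] at hx
    exact ⟨0, zero_mem _, by rw [hx, smul_zero]⟩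
  obtain ⟨a, rfl⟩ : ∃ a, j = a + k := ⟨j - k, by omega⟩
  -- argue coordinatewise: the coordinates of `x` lie in the annihilator of `y` in `R`
  let b := Module.finBasis K U
  let c : Fin (Module.finrank K U) → R ⊗[K] U →ₗ[K] R := fun i =>
    TensorProduct.lift ((LinearMap.lsmul K R).flip.compl₂ (b.coord i))
  have hc : ∀ i r (u : U), c i (r ⊗ₜ u) = b.coord i u • r := fun i r u => rfl
  have hsum : ∀ z, z = ∑ i, c i z ⊗ₜ[K] b i := by
    intro z
    induction z with
    | zero => simp
    | add p q hp hq =>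
      conv_lhs => rw [hp, hq]
      rw [← Finset.sum_add_distrib]
      exact Finset.sum_congr rfl fun i _ => by rw [map_add, TensorProduct.add_tmul]
    | tmul r u =>
      conv_lhs => rw [← b.sum_repr u, TensorProduct.tmul_sum]
      refine Finset.sum_congr rfl fun i _ => ?_
      rw [hc, TensorProduct.smul_tmul]
      rfl
  have hcy : ∀ i z, c i (freeMul K U y z) = c i z * y := by
    intro i z
    induction z with
    | zero => simp
    | add p q hp hq => rw [map_add, map_add, map_add, hp, hq, add_mul]
    | tmul r u => rw [freeMul_tmul, hc, hc, smul_mul_assoc]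
  have hcm : ∀ i, c i x ∈ 𝒜 a := by
    intro i
    suffices h' : freeFamily 𝒜 U k (a + k) ≤ (𝒜 a).comap (c i) from h' hx
    rw [freeFamily_le]
    intro a' ha' r hr u
    obtain rfl : a' = a := by omega
    exact Submodule.smul_mem _ (b.coord i u) hr
  have hcol : ∀ i, c i x ∈ genFam 𝒜 1 (⊥ ⊔ Submodule.span K {η • y}) a := by
    intro i
    refine h.mem_colon _root_.bot_le hy (by rwa [Submodule.mem_bot]) (hcm i) ?_
    rw [← hcy, hxy, map_zero]
    exact zero_mem _
  rw [bot_sup_eq] at hcol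
  obtain _ | a := a
  · refine ⟨0, zero_mem _, ?_⟩
    rw [smul_zero, hsum x]
    refine Finset.sum_eq_zero fun i _ => ?_
    have := hcol i
    rw [genFam_eq_bot _ one_pos, Submodule.mem_bot] at this
    rw [this, TensorProduct.zero_tmul]
  · choose s hs hse using fun i => mem_genFam_span_singleton.1 (hcol i)
    refine ⟨freeMul K U y (∑ i, s i ⊗ₜ b i), ?_, ?_⟩
    · have : (∑ i, s i ⊗ₜ b i) ∈ freeFamily 𝒜 U k (a + k) :=
        Submodule.sum_mem _ fun i _ => tmul_mem_freeFamily (hs i) _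
      have := map_mem_imFam (freeMul K U y) this
      rwa [add_right_comm] at this
    · conv_lhs => rw [hsum x]
      rw [map_sum, Finset.smul_sum]
      refine Finset.sum_congr rfl fun i _ => ?_
      rw [freeMul_tmul, TensorProduct.smul_tmul', ← hse, smul_eq_mul, mul_smul_comm]

variable [∀ a, Module.Finite K (𝒜 a)]

theorem KoszulModel.isLinear_freeFamily [Module.Finite K U] (h : KoszulModel 𝒜 n ε η) :
    IsLinear k (freeFamily 𝒜 U k) ⊥ := by
  rintro (_ | i) j hj
  · by_cases hjk : j < k
    · exact relBetti_eq_zero_of_lt (fun c hc => (freeFamily_eq_bot hc).le) (by omega)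
    · obtain ⟨j, rfl⟩ : ∃ j', j = j' + 1 := ⟨j - 1, by omega⟩
      rw [relBetti_zero_succ_eq_zero_iff h.succ_deg freeFamily_finDim]
      refine le_sup_of_le_left (freeFamily_le.2 ?_)
      intro a ha r hr u
      obtain ⟨a, rfl⟩ : ∃ a', a = a' + 1 := ⟨a - 1, by omega⟩
      obtain rfl : a + k = j := by omega
      suffices h' : 𝒜 1 * 𝒜 a ≤ (smulSpan (𝒜 1) (freeFamily 𝒜 U k (a + k))).comap
        ((TensorProduct.mk K R U).flip u) from h' (h.succ_deg a hr)
      refine Submodule.mul_le.2 fun v hv s (hs : s ∈ 𝒜 a) => ?_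
      exact smul_mem_smulSpan (m := s ⊗ₜ u) hv (tmul_mem_freeFamily hs u)
  · exact relBetti_freeFamily h.zero_deg i j

theorem imFam_freeMul_le {y : R} (hy : y ∈ 𝒜 1) :
    imFam (freeMul K U y) (freeFamily 𝒜 U k) ≤ freeFamily 𝒜 U k :=
  imFam_le fun _ _ hx => freeMul_mem hy hx

/-- For a nonzero linear form `y`, the quotient `F / F y` of a free module `F` has a linear
resolution: multiplication by `y` is injective on `F` in the polynomial case, and its kernel is
`F y` in the exterior case. -/
theorem KoszulModel.isLinear_freeFamily_imFam [Module.Finite K U] (h : KoszulModel 𝒜 n ε η)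
    {y : R} (hy : y ∈ 𝒜 1) (hy0 : y ≠ 0) :
    IsLinear k (freeFamily 𝒜 U k) (imFam (freeMul K U y) (freeFamily 𝒜 U k)) := by
  have hF := h.isLinear_freeFamily (U := U) (k := k)
  have hle := imFam_freeMul_le (U := U) (k := k) hy
  intro i
  induction i with
  | zero =>
    intro j hj
    exact Nat.eq_zero_of_le_zero ((relBetti_quot_zero_le (GradedFamily.bot_le _) freeFamily_finDim
      j).trans (hF 0 j hj).le)
  | succ i ih =>
    intro j hj
    refine Nat.eq_zero_of_le_zero ((relBetti_quot_le_add (GradedFamily.bot_le _) hle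
      freeFamily_finDim i j).trans ?_)
    rw [hF _ _ hj, zero_add]
    obtain _ | j := j
    · exact (relBetti_eq_zero_of_lt (k := 1) (fun c hc => by
        obtain rfl : c = 0 := by omega
        rw [imFam_zero]; exact _root_.bot_le) (by omega)).le
    · have key : ∀ C : GradedFamily (R ⊗[K] U) 𝒜, C ≤ freeFamily 𝒜 U k →
          (∀ j, ∀ x ∈ freeFamily 𝒜 U k j, freeMul K U y x = 0 ↔ x ∈ C j) →
          relBetti (imFam (freeMul K U y) (freeFamily 𝒜 U k)) ⊥ i (j + 1) =
            relBetti (freeFamily 𝒜 U k) C i j := by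
        intro C hC hker
        refine relBetti_eq_of_bijective (freeMul K U y) 1 hC
          (fun j x hx => map_mem_imFam _ hx)
          (fun j x hx => (Submodule.mem_bot K).trans (hker j x hx)) ?_ ?_ i j
        · intro j w hw
          obtain ⟨x, hx, rfl⟩ := mem_imFam_succ.1 hw
          exact ⟨x, hx, by rw [sub_self]; exact zero_mem _⟩
        · intro c hc
          obtain rfl : c = 0 := by omega
          rw [imFam_zero]
          exact _root_.bot_le
      rcases h.eta with rfl | rfl
      · rw [key ⊥ (GradedFamily.bot_le _) ?_, hF i j (by omega)]
        intro j x hx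
        rw [bot_apply, Submodule.mem_bot]
        constructor
        · intro hxy
          obtain ⟨w, -, hw⟩ := h.exists_of_freeMul_eq_zero hy hy0 hx hxy
          rw [hw, zero_smul]
        · rintro rfl
          rw [map_zero]
      · rw [key _ hle ?_, ih j (by omega)]
        intro j x hx
        constructor
        · intro hxy
          obtain ⟨w, hw, rfl⟩ := h.exists_of_freeMul_eq_zero hy hy0 hx hxy
          rwa [one_smul]
        · intro hx
          obtain _ | j := j
          · rw [imFam_zero, Submodule.mem_bot] at hx
            rw [hx, map_zero]
          · obtain ⟨z, -, rfl⟩ := mem_imFam_succ.1 hx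
            simpa using h.smul_freeMul_freeMul hy z

end FreeMul

/-! ### Presentations and quotients by linear forms -/

section Presentation

variable {K : Type u} [Field K] {R : Type v} [Ring R] [Algebra K R]
variable {M : Type v} [AddCommGroup M] [Module K M] [Module R M] [IsScalarTower K R M]
variable {N : Type v} [AddCommGroup N] [Module K N] [Module R N] [IsScalarTower K R N]
variable {𝒜 : ℕ → Submodule K R} [GradedAlgebra 𝒜] {n : ℕ} {ε η : K} {k : ℕ}

/-- The preimage of `Q` in `F` under an `R`-linear map of degree `0`. -/
def preFam (π : N →ₗ[R] M) (F : GradedFamily N 𝒜) (Q : GradedFamily M 𝒜) : GradedFamily N 𝒜 where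
  toFun j := F j ⊓ (Q j).comap (π.restrictScalars K)
  smul_mem' := by
    rintro a c r m hr ⟨hm, hm'⟩
    refine ⟨F.smul_mem hr hm, ?_⟩
    change π (r • m) ∈ Q (a + c)
    rw [map_smul]
    exact Q.smul_mem hr hm'

theorem preFam_le (π : N →ₗ[R] M) (F : GradedFamily N 𝒜) (Q : GradedFamily M 𝒜) :
    preFam π F Q ≤ F := fun _ _ hx => hx.1

/-- The `R`-linear map `R ⊗ U → M` that extends a `K`-linear map `U → M`. -/
def freeLift {U : Type v} [AddCommGroup U] [Module K U] (g : U →ₗ[K] M) : R ⊗[K] U →ₗ[R] M where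
  __ := TensorProduct.lift ((Algebra.lsmul K K M).toLinearMap.compl₂ g)
  map_smul' r x := by
    change TensorProduct.lift ((Algebra.lsmul K K M).toLinearMap.compl₂ g) (r • x) =
      r • TensorProduct.lift ((Algebra.lsmul K K M).toLinearMap.compl₂ g) x
    induction x with
    | zero => simp
    | add a b ha hb => rw [smul_add, map_add, map_add, smul_add, ha, hb]
    | tmul s u => exact mul_smul r s (g u)

theorem freeLift_tmul {U : Type v} [AddCommGroup U] [Module K U] (g : U →ₗ[K] M) (r : R) (u : U) :
    freeLift g (r ⊗ₜ u) = r • g u := rfl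

variable {P Q : GradedFamily M 𝒜}

/-- If `P / Q` is generated in degree `k`, then it has a presentation `P / Q ≅ F / A` with
`F = R ⊗ U` free, generated in degree `k`, and `A` living in degrees greater than `k`. -/
theorem exists_presentation (h0 : 𝒜 0 ≤ Submodule.span K {1}) (hP : P.FinDim)
    (hgen : P ≤ genFam 𝒜 k (P k) ⊔ Q) :
    ∃ U : Submodule K M, Module.Finite K U ∧ U ≤ P k ∧
      (∀ j, ∀ x ∈ freeFamily 𝒜 U k j, freeLift U.subtype x ∈ P j) ∧
      (∀ j, ∀ y ∈ P j, ∃ x ∈ freeFamily 𝒜 U k j, y - freeLift U.subtype x ∈ Q j) ∧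
      ∀ j < k + 1, preFam (freeLift U.subtype) (freeFamily 𝒜 U k) Q j ≤ ⊥ := by
  obtain ⟨U', hU'⟩ := Submodule.exists_isCompl ((Q k).submoduleOf (P k))
  let U : Submodule K M := U'.map (P k).subtype
  have hUP : U ≤ P k := Submodule.map_subtype_le _ _
  have := hP k
  have hfin : Module.Finite K U := Submodule.finiteDimensional_of_le hUP
  have hsup : P k ≤ U ⊔ Q k := by
    intro x hx
    have : (⟨x, hx⟩ : P k) ∈ (Q k).submoduleOf (P k) ⊔ U' := by rw [hU'.sup_eq_top]; trivial
    obtain ⟨q, hq, u, hu, hqu⟩ := Submodule.mem_sup.1 this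
    refine Submodule.mem_sup.2 ⟨u, ⟨u, hu, rfl⟩, q, hq, ?_⟩
    rw [add_comm]
    exact congrArg Subtype.val hqu
  have hinf : ∀ x ∈ U, x ∈ Q k → x = 0 := by
    rintro _ ⟨x, hx, rfl⟩ hxQ
    have : x ∈ (Q k).submoduleOf (P k) ⊓ U' := ⟨hxQ, hx⟩
    rw [hU'.inf_eq_bot, Submodule.mem_bot] at this
    rw [this, map_zero]
  refine ⟨U, hfin, hUP, ?_, ?_, ?_⟩
  · intro j x hx
    suffices h : freeFamily 𝒜 U k j ≤ (P j).comap ((freeLift U.subtype).restrictScalars K) from h hx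
    rw [freeFamily_le]
    rintro a rfl r hr u
    exact P.smul_mem hr (hUP u.2)
  · intro j
    suffices h : P j ≤ (freeFamily 𝒜 U k j).map ((freeLift U.subtype).restrictScalars K) ⊔ Q j by
      intro y hy
      obtain ⟨_, ⟨x, hx, rfl⟩, q, hq, rfl⟩ := Submodule.mem_sup.1 (h hy)
      exact ⟨x, hx, by
        change freeLift U.subtype x + q - freeLift U.subtype x ∈ Q j
        rwa [add_sub_cancel_left]⟩
    refine (hgen j).trans (sup_le ?_ le_sup_right)
    rw [genFam_le_iff]
    rintro a rfl r hr m hm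
    obtain ⟨u, hu, q, hq, rfl⟩ := Submodule.mem_sup.1 (hsup hm)
    rw [smul_add]
    exact Submodule.add_mem_sup ⟨r ⊗ₜ (⟨u, hu⟩ : U), tmul_mem_freeFamily hr _, rfl⟩
      (Q.smul_mem hr hq)
  · rintro j hj x ⟨hx, hxQ⟩
    rcases Nat.lt_succ_iff_lt_or_eq.1 hj with hjk | rfl
    · rwa [freeFamily_eq_bot hjk] at hx
    · obtain ⟨u, rfl⟩ : ∃ u : U, (1 : R) ⊗ₜ u = x := by
        suffices h : freeFamily 𝒜 U j j ≤ LinearMap.range (TensorProduct.mk K R U 1) from h hx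
        rw [freeFamily_le]
        intro a ha r hr u
        obtain rfl : a = 0 := by omega
        obtain ⟨c, rfl⟩ := Submodule.mem_span_singleton.1 (h0 hr)
        exact ⟨c • u, by rw [TensorProduct.mk_apply, TensorProduct.tmul_smul,
          TensorProduct.smul_tmul']⟩
      have : (u : M) = 0 := hinf u u.2 (by simpa [freeLift_tmul] using hxQ)
      rw [Submodule.mem_bot, show u = 0 from Subtype.ext this, TensorProduct.tmul_zero]

/-- A presentation of `P / Q` as `F / A` preserves graded Betti numbers. -/
theorem relBetti_preFam {π : N →ₗ[R] M} {F : GradedFamily N 𝒜}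
    (h1 : ∀ j, ∀ x ∈ F j, π x ∈ P j) (h2 : ∀ j, ∀ y ∈ P j, ∃ x ∈ F j, y - π x ∈ Q j) (i j : ℕ) :
    relBetti F (preFam π F Q) i j = relBetti P Q i j :=
  (relBetti_eq_of_bijective_zero π (preFam_le _ _ _) h1
    (fun _ _ hx => ⟨fun h => ⟨hx, h⟩, fun h => h.2⟩) h2 i j).symm

variable [∀ a, Module.Finite K (𝒜 a)]

/-- If `t_0 (P / Q)` is concentrated in degree `k`, then `P / Q` is generated in degree `k`. -/
theorem KoszulModel.le_genFam_sup (h : KoszulModel 𝒜 n ε η) (hP : P.FinDim)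
    (h0 : ∀ j, j ≠ k → relBetti P Q 0 j = 0) : P ≤ genFam 𝒜 k (P k) ⊔ Q := by
  intro j
  rw [sup_apply]
  induction j with
  | zero =>
    by_cases hk : 0 = k
    · subst hk
      exact le_sup_of_le_left fun x hx => mem_genFam hx
    · exact le_sup_of_le_right ((relBetti_zero_zero_eq_zero_iff hP Q).1 (h0 0 hk))
  | succ j ih =>
    by_cases hk : j + 1 = k
    · subst hk
      exact le_sup_of_le_left fun x hx => mem_genFam hx
    · refine ((relBetti_zero_succ_eq_zero_iff h.succ_deg hP Q j).1 (h0 _ hk)).trans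
        (sup_le ?_ le_sup_right)
      refine (smulSpan_mono_right _ ih).trans ?_
      have := smulSpan_le_family (genFam 𝒜 k (P k) ⊔ Q) 1 j
      rwa [add_comm 1 j] at this

/-- If `P / Q` is generated in degree `k`, then `t_0 (P / Q)` is concentrated in degree `k`. -/
theorem KoszulModel.relBetti_zero_eq_zero (h : KoszulModel 𝒜 n ε η) (hP : P.FinDim)
    {W : Submodule K M} (hW : W ≤ P k) (hgen : P ≤ genFam 𝒜 k W ⊔ Q) {j : ℕ} (hj : j ≠ k) :
    relBetti P Q 0 j = 0 := by
  by_cases hjk : j < k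
  · refine relBetti_eq_zero_of_lt (k := k) (fun c hc => ?_) (by omega)
    have := hgen c
    rwa [sup_apply, genFam_eq_bot _ hc, bot_sup_eq] at this
  · obtain ⟨a, rfl⟩ : ∃ a, j = a + 1 + k := ⟨j - k - 1, by omega⟩
    rw [show a + 1 + k = a + k + 1 by ring, relBetti_zero_succ_eq_zero_iff h.succ_deg hP]
    refine (hgen _).trans (sup_le_sup_right ?_ _)
    rw [show a + k + 1 = a + 1 + k by ring, genFam_add, smulSpan_le]
    intro r hr m hm
    suffices h' : 𝒜 1 * 𝒜 a ≤ (smulSpan (𝒜 1) (P (a + k))).comap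
      ((Algebra.lsmul K K M).toLinearMap.flip m) from h' (h.succ_deg a hr)
    refine Submodule.mul_le.2 fun v hv s (hs : s ∈ 𝒜 a) => ?_
    change (v * s) • m ∈ smulSpan (𝒜 1) (P (a + k))
    rw [mul_smul]
    exact smul_mem_smulSpan hv (P.smul_mem hs (hW hm))

/-- Nakayama's lemma: generators of `P / (Q + μ P)` in degree `k` generate `P / Q`. -/
theorem KoszulModel.le_genFam_sup_of_quotient (h : KoszulModel 𝒜 n ε η) (hP : P.FinDim)
    {μ : M →ₗ[R] M} {y : R} (hy : y ∈ 𝒜 1) (hμQ : ∀ j, ∀ x ∈ Q j, μ x ∈ Q (j + 1))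
    (hlin : IsLinear k P (Q ⊔ imFam μ P)) (hμk : ∀ x ∈ P k, μ x = y • x) :
    P ≤ genFam 𝒜 k (P k) ⊔ Q := by
  have h1 := h.le_genFam_sup (k := k) hP fun j hj => hlin 0 j (by omega)
  have hS : ∀ j, ∀ x ∈ (genFam 𝒜 k (P k) ⊔ Q) j, μ x ∈ (genFam 𝒜 k (P k) ⊔ Q) (j + 1) := by
    intro j
    suffices h : (genFam 𝒜 k (P k) ⊔ Q) j ≤
        ((genFam 𝒜 k (P k) ⊔ Q) (j + 1)).comap (μ.restrictScalars K) from fun x hx => h hx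
    rw [sup_apply]
    refine sup_le (genFam_le_iff.2 ?_) fun x hx => GradedFamily.le_sup_right _ _ _ (hμQ j x hx)
    rintro a rfl r hr m hm
    refine GradedFamily.le_sup_left _ _ _ ?_
    change μ (r • m) ∈ genFam 𝒜 k (P k) (a + k + 1)
    rw [map_smul, hμk m hm, ← mul_smul, add_right_comm]
    exact smul_mem_genFam (𝒜 := 𝒜) (SetLike.mul_mem_graded hr hy) hm
  intro j
  induction j with
  | zero =>
    have := h1 0
    rwa [sup_apply, sup_apply, imFam_zero, sup_bot_eq] at this
  | succ j ih =>
    intro x hx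
    have hx' := h1 (j + 1) hx
    rw [sup_apply, sup_apply] at hx'
    obtain ⟨g, hg, w', hw', rfl⟩ := Submodule.mem_sup.1 hx'
    obtain ⟨q, hq, w, hw, rfl⟩ := Submodule.mem_sup.1 hw'
    obtain ⟨p, hp, rfl⟩ := mem_imFam_succ.1 hw
    exact add_mem (GradedFamily.le_sup_left _ _ _ hg)
      (add_mem (GradedFamily.le_sup_right _ _ _ hq) (hS j p (ih hp)))

/-- Let `μ` be an endomorphism of degree `1` of `P / Q` that acts on the generators in degree `k`
like a linear form `y`. If `P / (Q + μ P)` has a `k`-linear resolution, and the kernel of `μ` is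
as small as possible except in degree `k`, then `P / Q` has a `k`-linear resolution. -/
theorem KoszulModel.isLinear_of_quotient (h : KoszulModel 𝒜 n ε η) (hP : P.FinDim) (hQP : Q ≤ P)
    {μ : M →ₗ[R] M} {y : R} (hy : y ∈ 𝒜 1) (hy0 : y ≠ 0) (hlo : ∀ j < k, P j ≤ Q j)
    (hμP : ∀ j, ∀ x ∈ P j, μ x ∈ P (j + 1)) (hμQ : ∀ j, ∀ x ∈ Q j, μ x ∈ Q (j + 1))
    (hlin : IsLinear k P (Q ⊔ imFam μ P))
    (hinj : ∀ j, j ≠ k → ∀ x ∈ P j, μ x ∈ Q (j + 1) → ∃ w ∈ imFam μ P j, x - η • w ∈ Q j)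
    (hμk : ∀ x ∈ P k, μ x = y • x) : IsLinear k P Q := by
  intro i
  induction i generalizing M k y with
  | zero =>
    intro j hj
    exact h.relBetti_zero_eq_zero hP le_rfl
      (h.le_genFam_sup_of_quotient hP hy hμQ hlin hμk) (by omega)
  | succ i ih =>
    intro j hj
    -- write `P / Q` as `F / A` with `F` free on generators of degree `k`, so that
    -- `Tor_{i+1}(P / Q) = Tor_i(A)`, and lift `μ` to right multiplication `ν` by `y`; the
    -- induction hypothesis will be applied to `A`, `ν` and `k + 1`
    obtain ⟨U, hUfin, hUP, hF1, hF2, hA0⟩ := exists_presentation h.zero_deg hP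
      (h.le_genFam_sup_of_quotient hP hy hμQ hlin hμk)
    set π := freeLift (R := R) U.subtype with hπ
    set F := freeFamily 𝒜 U k with hFdef
    set A := preFam π F Q with hA
    set ν := freeMul K U y with hν
    have hFfin : F.FinDim := freeFamily_finDim
    have hAF : A ≤ F := preFam_le _ _ _
    have hAfin : A.FinDim := hFfin.mono hAF
    have hνF : ∀ j, ∀ x ∈ F j, ν x ∈ F (j + 1) := fun j x hx => freeMul_mem hy hx
    have hπν : ∀ x, π (ν x) = μ (π x) := by
      intro x
      induction x with
      | zero => simp
      | add a b ha hb => simp only [map_add, ha, hb]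
      | tmul r u =>
        change (r * y) • (u : M) = μ (r • (u : M))
        rw [map_smul, hμk _ (hUP u.2), mul_smul]
    have hνA : ∀ j, ∀ x ∈ A j, ν x ∈ A (j + 1) := by
      rintro j x ⟨hx, hxQ⟩
      refine ⟨hνF j x hx, ?_⟩
      change π (ν x) ∈ Q (j + 1)
      rw [hπν]
      exact hμQ j _ hxQ
    have hνFF : imFam ν F ≤ F := imFam_le hνF
    -- an element of `A` that is a multiple `ν g` is one with `g ∈ A`, except in degree `k + 1`
    have hlift : ∀ j, j ≠ k → ∀ g ∈ F j, ν g ∈ A (j + 1) → ∃ g' ∈ A j, ν g' = ν g := by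
      intro j hjk g hg hνg
      have h1 : μ (π g) ∈ Q (j + 1) := by
        rw [← hπν]
        exact hνg.2
      obtain ⟨w, hw, hwQ⟩ := hinj j hjk (π g) (hF1 j g hg) h1
      obtain _ | j := j
      · rw [imFam_zero, Submodule.mem_bot] at hw
        rw [hw, smul_zero, sub_zero] at hwQ
        exact ⟨g, ⟨hg, hwQ⟩, rfl⟩
      · obtain ⟨p, hp, rfl⟩ := mem_imFam_succ.1 hw
        obtain ⟨f, hf, hfQ⟩ := hF2 j p hp
        refine ⟨g - η • ν f, ⟨sub_mem hg (Submodule.smul_mem _ _ (hνF j f hf)), ?_⟩, ?_⟩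
        · change π (g - η • ν f) ∈ Q (j + 1)
          have : π (g - η • ν f) = (π g - η • μ p) + η • μ (p - π f) := by
            rw [map_sub, ← LinearMap.coe_restrictScalars K π, map_smul,
              LinearMap.coe_restrictScalars, hπν, map_sub, smul_sub]
            abel
          rw [this]
          exact add_mem hwQ (Submodule.smul_mem _ _ (hμQ j _ hfQ))
        · rw [map_sub, ← LinearMap.coe_restrictScalars K ν, map_smul,
            LinearMap.coe_restrictScalars, h.smul_freeMul_freeMul hy, sub_zero]
    -- `A / (A ∩ ν F)` is the kernel of the surjection from `F / ν F` to `P / (Q + μ P)`, and both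
    -- have `k`-linear resolutions
    have hquot : IsLinear (k + 1) A (A ⊓ imFam ν F) := by
      have hq : ∀ i j, j ≠ i + 1 + k → relBetti F (A ⊔ imFam ν F) (i + 1) j = 0 := by
        intro i j hj
        have e : A ⊔ imFam ν F = preFam π F (Q ⊔ imFam μ P) := by
          refine GradedFamily.le_antisymm (GradedFamily.sup_le ?_ ?_) ?_
          · exact fun j x hx => ⟨hx.1, GradedFamily.le_sup_left _ _ _ hx.2⟩
          · refine imFam_le fun j x hx => ⟨hνF j x hx, GradedFamily.le_sup_right _ _ _ ?_⟩
            change π (ν x) ∈ imFam μ P (j + 1)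
            rw [hπν]
            exact map_mem_imFam _ (hF1 j x hx)
          · rintro j x ⟨hx, hxQ⟩
            obtain ⟨q, hq, w, hw, hqw⟩ := Submodule.mem_sup.1 hxQ
            change q + w = π x at hqw
            obtain _ | j := j
            · rw [imFam_zero, Submodule.mem_bot] at hw
              refine GradedFamily.le_sup_left _ _ _ ⟨hx, ?_⟩
              change π x ∈ Q 0
              rwa [← hqw, hw, add_zero]
            · obtain ⟨p, hp, rfl⟩ := mem_imFam_succ.1 hw
              obtain ⟨f, hf, hfQ⟩ := hF2 j p hp
              rw [← sub_add_cancel x (ν f)]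
              refine Submodule.add_mem_sup ⟨sub_mem hx (hνF j f hf), ?_⟩ (map_mem_imFam _ hf)
              change π (x - ν f) ∈ Q (j + 1)
              rw [map_sub, hπν, ← hqw, add_sub_assoc, ← map_sub]
              exact add_mem hq (hμQ j _ hfQ)
        rw [e, relBetti_preFam hF1, hlin _ _ hj]
        intro j y hy
        obtain ⟨x, hx, hxQ⟩ := hF2 j y hy
        exact ⟨x, hx, GradedFamily.le_sup_left _ _ _ hxQ⟩
      intro i j hj
      rw [← relBetti_sup_left]
      by_cases hjk : j < i + (k + 1)
      · refine relBetti_eq_zero_of_lt (k := k + 1) ?_ hjk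
        intro c hc
        rw [sup_apply]
        exact sup_le ((hA0 c hc).trans _root_.bot_le) le_rfl
      · refine Nat.eq_zero_of_le_zero ((relBetti_sub_le_add (GradedFamily.le_sup_right _ _)
          (GradedFamily.sup_le hAF hνFF) hFfin i j).trans ?_)
        rw [hq i j (by omega), h.isLinear_freeFamily_imFam hy hy0 i j (by omega)]
    -- `(A ∩ ν F) / ν A` is concentrated in degree `k + 1`, by `hlift`
    have hconc : IsLinear (k + 1) (A ⊓ imFam ν F) (imFam ν A) := by
      refine (h.relBetti_concentrated (hAfin.mono (GradedFamily.inf_le_left _ _))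
        (GradedFamily.le_inf (imFam_le hνA) (imFam_mono ν hAF)) ?_).1
      rintro j hj x ⟨hxA, hxν⟩
      obtain _ | j := j
      · rwa [imFam_zero] at hxν ⊢
      · obtain ⟨g, hg, rfl⟩ := mem_imFam_succ.1 hxν
        obtain ⟨g', hg', hgg'⟩ := hlift j (by omega) g hg hxA
        exact hgg' ▸ map_mem_imFam ν hg'
    have hlinA : IsLinear (k + 1) A (⊥ ⊔ imFam ν A) := by
      have e : (⊥ : GradedFamily (R ⊗[K] U) 𝒜) ⊔ imFam ν A = imFam ν A :=
        GradedFamily.ext fun j => by rw [sup_apply, bot_apply, bot_sup_eq]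
      rw [e]
      exact (hconc.trans hquot (GradedFamily.le_inf (imFam_le hνA) (imFam_mono ν hAF))
        (GradedFamily.inf_le_left _ _) hAfin).1
    -- `F` is a left module and `ν` multiplies from the right: on the generators of `A`, of degree
    -- `k + 1`, it agrees with left multiplication by `ε y`
    have key : relBetti A ⊥ i j = 0 := by
      refine ih hAfin (GradedFamily.bot_le _) (μ := ν) (y := ε • y) (Submodule.smul_mem _ _ hy)
        (smul_ne_zero h.eps_ne_zero hy0) hA0 hνA ?_ hlinA ?_ ?_ j (by omega)
      · intro j x hx
        rw [bot_apply, Submodule.mem_bot] at hx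
        rw [hx, map_zero]
        exact zero_mem _
      · intro j hj x hx hνx
        rw [bot_apply, Submodule.mem_bot] at hνx
        obtain ⟨w, hw, hxw⟩ := h.exists_of_freeMul_eq_zero hy hy0 hx.1 hνx
        rcases h.eta with rfl | rfl
        · exact ⟨0, zero_mem _, by rw [hxw, zero_smul, zero_smul, sub_self]; exact zero_mem _⟩
        · obtain _ | j := j
          · rw [imFam_zero, Submodule.mem_bot] at hw
            exact ⟨0, zero_mem _, by rw [hxw, hw, sub_self]; exact zero_mem _⟩
          · obtain ⟨g, hg, rfl⟩ := mem_imFam_succ.1 hw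
            rw [one_smul] at hxw
            obtain ⟨g', hg', hgg'⟩ := hlift j (by omega) g hg (by
              change freeMul K U y g ∈ A (j + 1)
              rw [← hxw]
              exact hx)
            exact ⟨ν g', map_mem_imFam ν hg', by
              rw [hxw, hgg', one_smul, sub_self]; exact zero_mem _⟩
      · intro x hx
        suffices h' : F (k + 1) ≤ LinearMap.eqLocus (ν.restrictScalars K)
          (Algebra.lsmul K K (R ⊗[K] U) (ε • y)) from h' hx.1
        rw [hFdef, freeFamily_le]
        intro a ha r hr u
        obtain rfl : a = 1 := by omega
        change (r * y) ⊗ₜ[K] u = (ε • y) • (r ⊗ₜ[K] u)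
        rw [h.comm hr hy, pow_one, TensorProduct.smul_tmul', smul_eq_mul, smul_mul_assoc]
    have e := relBetti_preFam hF1 hF2 (i + 1) j
    rw [← e]
    refine Nat.eq_zero_of_le_zero ((relBetti_quot_le_add (GradedFamily.bot_le _) hAF hFfin
      i j).trans ?_)
    rw [key, h.isLinear_freeFamily _ _ (by omega)]

end Presentation

/-! ### Linear resolutions along a flag of linear forms -/

section Flag

variable {K : Type u} [Field K] {R : Type v} [Ring R] [Algebra K R]
variable {𝒜 : ℕ → Submodule K R} [GradedAlgebra 𝒜] {n : ℕ} {ε η : K} {k : ℕ}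

variable (𝒜) in
/-- The elements of degree `k + 1` of `(W) + (Λ)` that lie in `(Λ, y)` lie already in
`W y + (Λ)`. -/
def StarCond (k : ℕ) (W Λ : Submodule K R) (y : R) : Prop :=
  ∀ r ∈ smulSpan (𝒜 1) W ⊔ genFam 𝒜 1 Λ (k + 1),
    r ∈ genFam 𝒜 1 (Λ ⊔ Submodule.span K {y}) (k + 1) →
      r ∈ W.map ((rmul y).restrictScalars K) ⊔ genFam 𝒜 1 Λ (k + 1)

variable (𝒜) in
/-- The dimension of the image in `R / (Λ)` of a subspace `W` of degree `k`. -/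
def restrictedRank (k : ℕ) (W Λ : Submodule K R) : ℕ :=
  Module.finrank K ↥(W ⊔ genFam 𝒜 1 Λ k) - Module.finrank K (genFam 𝒜 1 Λ k)

variable [∀ a, Module.Finite K (𝒜 a)] {W Λ : Submodule K R} {y : R}

theorem finite_of_le_deg {d : ℕ} {X : Submodule K R} (h : X ≤ 𝒜 d) : Module.Finite K X :=
  Submodule.finiteDimensional_of_le h

theorem restrictedRank_add (hW : W ≤ 𝒜 k) (hΛ : Λ ≤ 𝒜 1) :
    restrictedRank 𝒜 k W Λ + Module.finrank K (genFam 𝒜 1 Λ k) =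
      Module.finrank K ↥(W ⊔ genFam 𝒜 1 Λ k) := by
  have : Module.Finite K ↥(W ⊔ genFam 𝒜 1 Λ k) :=
    finite_of_le_deg (sup_le hW (genFam_le_wholeFam hΛ k : _ ≤ 𝒜 k))
  exact Nat.sub_add_cancel (Submodule.finrank_mono le_sup_right)

theorem restrictedRank_add_inf (hW : W ≤ 𝒜 k) (hΛ : Λ ≤ 𝒜 1) :
    restrictedRank 𝒜 k W Λ + Module.finrank K ↥(W ⊓ genFam 𝒜 1 Λ k) = Module.finrank K W := by
  have := finite_of_le_deg hW
  have := finite_of_le_deg (𝒜 := 𝒜) (genFam_le_wholeFam hΛ k)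
  have h1 := restrictedRank_add hW hΛ
  have h2 := Submodule.finrank_sup_add_finrank_inf_eq W (genFam 𝒜 1 Λ k)
  omega

variable (𝒜) in
/-- The graded module `(W) + (Λ)`. -/
abbrev idealSum (k : ℕ) (W Λ : Submodule K R) : GradedFamily R 𝒜 :=
  genFam 𝒜 k W ⊔ genFam 𝒜 1 Λ

theorem idealSum_le (hW : W ≤ 𝒜 k) (hΛ : Λ ≤ 𝒜 1) : idealSum 𝒜 k W Λ ≤ wholeFam 𝒜 :=
  GradedFamily.sup_le (genFam_le_wholeFam hW) (genFam_le_wholeFam hΛ)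

theorem idealSum_finDim (hW : W ≤ 𝒜 k) (hΛ : Λ ≤ 𝒜 1) : (idealSum 𝒜 k W Λ).FinDim :=
  wholeFam_finDim.mono (idealSum_le hW hΛ)

theorem idealSum_sup {Λ' : Submodule K R} (h : Λ ≤ Λ') :
    idealSum 𝒜 k W Λ ⊔ genFam 𝒜 1 Λ' = idealSum 𝒜 k W Λ' := by
  refine GradedFamily.ext fun j => ?_
  rw [sup_apply, sup_apply, sup_apply, sup_assoc, sup_eq_right.2 (genFam_mono h j)]

theorem KoszulModel.sup_span_le (_ : KoszulModel 𝒜 n ε η) (hΛ : Λ ≤ 𝒜 1) (hy : y ∈ 𝒜 1) :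
    Λ ⊔ Submodule.span K {y} ≤ 𝒜 1 :=
  sup_le hΛ ((Submodule.span_singleton_le_iff_mem _ _).2 hy)

/-- The quotient of `(W) + (Λ)` by its intersection with `(Λ')` is `((W) + (Λ')) / (Λ')`. -/
theorem relBetti_idealSum_inf (Λ' : Submodule K R) (h : Λ ≤ Λ') (i j : ℕ) :
    relBetti (idealSum 𝒜 k W Λ) (idealSum 𝒜 k W Λ ⊓ genFam 𝒜 1 Λ') i j =
      relBetti (idealSum 𝒜 k W Λ') (genFam 𝒜 1 Λ') i j := by
  rw [← relBetti_sup_left, idealSum_sup h]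

/-- Outside degree `k`, the part of `(W) + (Λ)` in `(Λ, y)` is `y ((W) + (Λ)) + (Λ)`. In degree
`k + 1` this is the star condition, and no further generators are possible in higher degrees, since
`((W) + (Λ)) ∩ (Λ, y)` modulo `(Λ)` is generated in degrees `k` and `k + 1`. -/
theorem KoszulModel.idealSum_inf_le (h : KoszulModel 𝒜 n ε η) (hW : W ≤ 𝒜 k) (hΛ : Λ ≤ 𝒜 1)
    (hstar : StarCond 𝒜 k W Λ y)
    (hlin : IsLinear k (idealSum 𝒜 k W (Λ ⊔ Submodule.span K {y}))
      (genFam 𝒜 1 (Λ ⊔ Submodule.span K {y}))) {j : ℕ} (hj : j ≠ k) :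
    (idealSum 𝒜 k W Λ ⊓ genFam 𝒜 1 (Λ ⊔ Submodule.span K {y})) j ≤
      (genFam 𝒜 1 Λ ⊔ imFam (rmul y) (idealSum 𝒜 k W Λ)) j := by
  set Λ' := Λ ⊔ Submodule.span K {y} with hΛ'
  set P := idealSum 𝒜 k W Λ with hP
  set L := genFam 𝒜 1 Λ with hL
  have hPfin : P.FinDim := idealSum_finDim hW hΛ
  have hLP : L ≤ P := GradedFamily.le_sup_right _ _
  have hWP : W ≤ P k := fun x hx => GradedFamily.le_sup_left _ _ _ (mem_genFam hx)
  rcases lt_or_ge j k with hjk | hjk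
  · intro x hx
    refine GradedFamily.le_sup_left _ _ _ ?_
    have := hx.1
    rwa [hP, sup_apply, genFam_eq_bot _ hjk, bot_sup_eq] at this
  have hB0 : ∀ j, j ≠ k → j ≠ k + 1 → relBetti (P ⊓ genFam 𝒜 1 Λ') L 0 j = 0 := by
    intro j h1 h2
    refine Nat.eq_zero_of_le_zero ((relBetti_sub_le_add (GradedFamily.le_inf hLP
      (genFam_mono le_sup_left)) (GradedFamily.inf_le_left _ _) hPfin 0 j).trans ?_)
    rw [relBetti_idealSum_inf _ le_sup_left, hlin _ _ (by omega),
      h.relBetti_zero_eq_zero hPfin hWP (GradedFamily.le_refl _) h1]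
  obtain ⟨a, rfl⟩ : ∃ a, j = k + 1 + a := ⟨j - (k + 1), by omega⟩
  clear hj hjk
  induction a with
  | zero =>
    rintro x ⟨hx, hx'⟩
    have hx2 : x ∈ smulSpan (𝒜 1) W ⊔ L (k + 1) := by
      have := genFam_add (𝒜 := 𝒜) k 1 W
      rw [add_comm] at this
      rw [← this]
      exact hx
    obtain ⟨_, ⟨w, hw, rfl⟩, l, hl, rfl⟩ := Submodule.mem_sup.1 (hstar x hx2 hx')
    exact add_mem (GradedFamily.le_sup_right _ _ _ (map_mem_imFam (rmul y) (hWP hw)))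
      (GradedFamily.le_sup_left _ _ _ hl)
  | succ a ih =>
    have h1 := (relBetti_zero_succ_eq_zero_iff h.succ_deg
      (hPfin.mono (GradedFamily.inf_le_left _ _)) _ _).1
      (hB0 (k + 1 + a + 1) (by omega) (by omega))
    refine h1.trans (sup_le ?_ (GradedFamily.le_sup_left _ _ _))
    refine (smulSpan_mono_right _ ih).trans ?_
    have := smulSpan_le_family (L ⊔ imFam (rmul y) P) 1 (k + 1 + a)
    rwa [add_comm 1 (k + 1 + a)] at this

/-- The graded module `(Λ) + y ((W) + (Λ))` lies in `((W) + (Λ)) ∩ (Λ, y)`. -/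
theorem KoszulModel.sup_imFam_le (h : KoszulModel 𝒜 n ε η) (hW : W ≤ 𝒜 k) (hΛ : Λ ≤ 𝒜 1)
    (hy : y ∈ 𝒜 1) : genFam 𝒜 1 Λ ⊔ imFam (rmul y) (idealSum 𝒜 k W Λ) ≤
      idealSum 𝒜 k W Λ ⊓ genFam 𝒜 1 (Λ ⊔ Submodule.span K {y}) := by
  refine GradedFamily.sup_le (GradedFamily.le_inf (GradedFamily.le_sup_right _ _)
    (genFam_mono le_sup_left)) (imFam_le fun j x hx => ⟨?_, ?_⟩)
  · exact h.mul_mem (idealSum_le hW hΛ) hx hy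
  · exact smul_mem_genFam (idealSum_le hW hΛ j hx)
      (Submodule.mem_sup_right (Submodule.mem_span_singleton_self y))

/-- In degree `k`, the module `(Λ) + y ((W) + (Λ))` is just `(Λ)`. -/
theorem KoszulModel.sup_imFam_apply (h : KoszulModel 𝒜 n ε η) (hΛ : Λ ≤ 𝒜 1)
    (hy : y ∈ 𝒜 1) : (genFam 𝒜 1 Λ ⊔ imFam (rmul y) (idealSum 𝒜 k W Λ)) k = genFam 𝒜 1 Λ k := by
  rw [sup_apply]
  refine _root_.sup_eq_left.2 ?_
  obtain _ | k := k
  · rw [imFam_zero]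
    exact _root_.bot_le
  · intro x hx
    obtain ⟨x, hx', rfl⟩ := mem_imFam_succ.1 hx
    rw [sup_apply, genFam_eq_bot _ (Nat.lt_succ_self k), bot_sup_eq] at hx'
    exact h.mul_mem (genFam_le_wholeFam hΛ) hx' hy

/-- Under the star condition, `((W) + (Λ)) ∩ (Λ, y)` modulo `y ((W) + (Λ)) + (Λ)` is concentrated
in degree `k`. -/
theorem KoszulModel.concentrated_step (h : KoszulModel 𝒜 n ε η) (hW : W ≤ 𝒜 k) (hΛ : Λ ≤ 𝒜 1)
    (hy : y ∈ 𝒜 1) (hstar : StarCond 𝒜 k W Λ y)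
    (hlin : IsLinear k (idealSum 𝒜 k W (Λ ⊔ Submodule.span K {y}))
      (genFam 𝒜 1 (Λ ⊔ Submodule.span K {y}))) :
    IsLinear k (idealSum 𝒜 k W Λ ⊓ genFam 𝒜 1 (Λ ⊔ Submodule.span K {y}))
      (genFam 𝒜 1 Λ ⊔ imFam (rmul y) (idealSum 𝒜 k W Λ)) ∧ ∀ i,
    relBetti (idealSum 𝒜 k W Λ ⊓ genFam 𝒜 1 (Λ ⊔ Submodule.span K {y}))
        (genFam 𝒜 1 Λ ⊔ imFam (rmul y) (idealSum 𝒜 k W Λ)) i (i + k) +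
      residueBetti 𝒜 i * Module.finrank K (genFam 𝒜 1 Λ k) = residueBetti 𝒜 i * Module.finrank K
        ((idealSum 𝒜 k W Λ ⊓ genFam 𝒜 1 (Λ ⊔ Submodule.span K {y})) k) := by
  rw [← h.sup_imFam_apply (W := W) (k := k) hΛ hy]
  exact h.relBetti_concentrated
    ((idealSum_finDim hW hΛ).mono (GradedFamily.inf_le_left _ _))
    (h.sup_imFam_le hW hΛ hy) (fun _ hj => h.idealSum_inf_le hW hΛ hstar hlin hj)

/-- Under the star condition, reduction modulo `y` of `((W) + (Λ)) / (Λ)` differs from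
`((W) + (Λ, y)) / (Λ, y)` only by a module that is concentrated in degree `k`. -/
theorem KoszulModel.isLinear_sup_imFam (h : KoszulModel 𝒜 n ε η) (hW : W ≤ 𝒜 k) (hΛ : Λ ≤ 𝒜 1)
    (hy : y ∈ 𝒜 1) (hstar : StarCond 𝒜 k W Λ y)
    (hlin : IsLinear k (idealSum 𝒜 k W (Λ ⊔ Submodule.span K {y}))
      (genFam 𝒜 1 (Λ ⊔ Submodule.span K {y}))) :
    IsLinear k (idealSum 𝒜 k W Λ) (genFam 𝒜 1 Λ ⊔ imFam (rmul y) (idealSum 𝒜 k W Λ)) ∧ ∀ i,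
      relBetti (idealSum 𝒜 k W Λ) (genFam 𝒜 1 Λ ⊔ imFam (rmul y) (idealSum 𝒜 k W Λ)) i (i + k) =
        relBetti (idealSum 𝒜 k W Λ ⊓ genFam 𝒜 1 (Λ ⊔ Submodule.span K {y}))
          (genFam 𝒜 1 Λ ⊔ imFam (rmul y) (idealSum 𝒜 k W Λ)) i (i + k) +
        relBetti (idealSum 𝒜 k W Λ)
          (idealSum 𝒜 k W Λ ⊓ genFam 𝒜 1 (Λ ⊔ Submodule.span K {y})) i (i + k) :=
  (h.concentrated_step hW hΛ hy hstar hlin).1.trans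
    (fun i j hj => (relBetti_idealSum_inf _ le_sup_left i j).trans (hlin i j hj))
    (h.sup_imFam_le hW hΛ hy) (GradedFamily.inf_le_left _ _) (idealSum_finDim hW hΛ)

/-- The kernel of multiplication by `y` on `((W) + (Λ)) / (Λ)` is the part in `(Λ, η y)`. -/
theorem KoszulModel.mul_mem_iff (h : KoszulModel 𝒜 n ε η) (hW : W ≤ 𝒜 k) (hΛ : Λ ≤ 𝒜 1)
    (hy : y ∈ 𝒜 1) (hyΛ : y ∉ Λ) {j : ℕ} {x : R} (hx : x ∈ idealSum 𝒜 k W Λ j) :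
    rmul y x ∈ genFam 𝒜 1 Λ (j + 1) ↔ x ∈ genFam 𝒜 1 (Λ ⊔ Submodule.span K {η • y}) j :=
  ⟨fun hxy => h.mem_colon hΛ hy hyΛ (idealSum_le hW hΛ j hx) hxy,
    fun hx => h.mul_mem_of_mem_colon hΛ hy hx⟩

/-- If `(W)` has a `k`-linear resolution modulo `(Λ, y)` and the star condition holds, then it
has a `k`-linear resolution modulo `(Λ)`. -/
theorem KoszulModel.isLinear_idealSum_step (h : KoszulModel 𝒜 n ε η) (hW : W ≤ 𝒜 k) (hΛ : Λ ≤ 𝒜 1)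
    (hy : y ∈ 𝒜 1) (hyΛ : y ∉ Λ) (hstar : StarCond 𝒜 k W Λ y)
    (hlin : IsLinear k (idealSum 𝒜 k W (Λ ⊔ Submodule.span K {y}))
      (genFam 𝒜 1 (Λ ⊔ Submodule.span K {y}))) :
    IsLinear k (idealSum 𝒜 k W Λ) (genFam 𝒜 1 Λ) := by
  refine h.isLinear_of_quotient (μ := rmul y) (y := ε ^ k • y) (idealSum_finDim hW hΛ)
    (GradedFamily.le_sup_right _ _) (Submodule.smul_mem _ _ hy)
    (smul_ne_zero (pow_ne_zero _ h.eps_ne_zero) (by rintro rfl; exact hyΛ (zero_mem _))) ?_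
    (fun j x hx => h.mul_mem (idealSum_le hW hΛ) hx hy)
    (fun j x hx => h.mul_mem (genFam_le_wholeFam hΛ) hx hy)
    (h.isLinear_sup_imFam hW hΛ hy hstar hlin).1 ?_ ?_
  · intro j hj
    rw [sup_apply, genFam_eq_bot _ hj, bot_sup_eq]
  · intro j hj x hx hxy
    have hC := (h.mul_mem_iff hW hΛ hy hyΛ hx).1 hxy
    rcases h.eta with rfl | rfl
    · refine ⟨0, zero_mem _, ?_⟩
      rw [zero_smul, Submodule.span_zero_singleton, sup_bot_eq] at hC
      rwa [smul_zero, sub_zero]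
    · rw [one_smul] at hC
      obtain ⟨l, hl, w, hw, rfl⟩ := Submodule.mem_sup.1
        (h.idealSum_inf_le hW hΛ hstar hlin hj ⟨hx, hC⟩)
      exact ⟨w, hw, by rwa [one_smul, add_sub_cancel_right]⟩
  · intro x hx
    rw [rmul_apply, h.comm (idealSum_le hW hΛ k hx) hy, smul_eq_mul, smul_mul_assoc]

/-- Multiplication by `y` identifies the quotient of `(W) + (Λ)` by the colon ideal with
`y ((W) + (Λ)) + (Λ)` modulo `(Λ)`. -/
theorem KoszulModel.relBetti_imFam (h : KoszulModel 𝒜 n ε η) (hW : W ≤ 𝒜 k) (hΛ : Λ ≤ 𝒜 1)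
    (hy : y ∈ 𝒜 1) (hyΛ : y ∉ Λ) (i j : ℕ) :
    relBetti ((genFam 𝒜 1 Λ) ⊔ imFam (rmul y) (idealSum 𝒜 k W Λ)) (genFam 𝒜 1 Λ) i (j + 1) =
      relBetti (idealSum 𝒜 k W (Λ ⊔ Submodule.span K {η • y}))
        (genFam 𝒜 1 (Λ ⊔ Submodule.span K {η • y})) i j := by
  rw [← relBetti_idealSum_inf (Λ ⊔ Submodule.span K {η • y}) le_sup_left]
  refine relBetti_eq_of_bijective (rmul y) 1 (GradedFamily.inf_le_left _ _)
    (fun j x hx => GradedFamily.le_sup_right _ _ _ (map_mem_imFam _ hx)) ?_ ?_ ?_ i j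
  · intro j x hx
    rw [h.mul_mem_iff hW hΛ hy hyΛ hx]
    exact ⟨fun hx' => ⟨hx, hx'⟩, fun hx' => hx'.2⟩
  · intro j w hw
    obtain ⟨l, hl, m, hm, rfl⟩ := Submodule.mem_sup.1 hw
    obtain ⟨x, hx, rfl⟩ := mem_imFam_succ.1 hm
    exact ⟨x, hx, by rwa [add_sub_cancel_right]⟩
  · intro j hj
    obtain rfl : j = 0 := by omega
    rw [sup_apply, imFam_zero, sup_bot_eq]

/-- The recursion for the graded Betti numbers of `((W) + (Λ)) / (Λ)` along a flag. -/
theorem KoszulModel.relBetti_idealSum_step (h : KoszulModel 𝒜 n ε η) (hW : W ≤ 𝒜 k) (hΛ : Λ ≤ 𝒜 1)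
    (hy : y ∈ 𝒜 1) (hyΛ : y ∉ Λ) (hstar : StarCond 𝒜 k W Λ y)
    (hlin : IsLinear k (idealSum 𝒜 k W (Λ ⊔ Submodule.span K {y}))
      (genFam 𝒜 1 (Λ ⊔ Submodule.span K {y})))
    (hlinC : IsLinear k (idealSum 𝒜 k W (Λ ⊔ Submodule.span K {η • y}))
      (genFam 𝒜 1 (Λ ⊔ Submodule.span K {η • y}))) (i : ℕ) :
    relBetti (idealSum 𝒜 k W Λ) (genFam 𝒜 1 Λ) (i + 1) (i + 1 + k) +
      relBetti (idealSum 𝒜 k W (Λ ⊔ Submodule.span K {η • y}))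
        (genFam 𝒜 1 (Λ ⊔ Submodule.span K {η • y})) i (i + k) +
      residueBetti 𝒜 (i + 1) * restrictedRank 𝒜 k W (Λ ⊔ Submodule.span K {y}) =
    relBetti (idealSum 𝒜 k W (Λ ⊔ Submodule.span K {y}))
        (genFam 𝒜 1 (Λ ⊔ Submodule.span K {y})) (i + 1) (i + 1 + k) +
      residueBetti 𝒜 (i + 1) * restrictedRank 𝒜 k W Λ := by
  have hlin0 := h.isLinear_idealSum_step hW hΛ hy hyΛ hstar hlin
  obtain ⟨hG, hGa⟩ := h.isLinear_sup_imFam hW hΛ hy hstar hlin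
  have hconc := (h.concentrated_step hW hΛ hy hstar hlin).2 (i + 1)
  set Λ' := Λ ⊔ Submodule.span K {y} with hΛ'
  have hΛΛ' : Λ ≤ Λ' := le_sup_left
  have hΛ'1 : Λ' ≤ 𝒜 1 := h.sup_span_le hΛ hy
  have hPfin : (idealSum 𝒜 k W Λ).FinDim := idealSum_finDim hW hΛ
  have hμ := h.relBetti_imFam hW hΛ hy hyΛ
  -- the long exact sequence of `(Λ) ≤ y ((W) + (Λ)) + (Λ) ≤ (W) + (Λ)`; the lower quotient has a
  -- `(k + 1)`-linear resolution
  have h4 := relBetti_four_term (GradedFamily.le_sup_left _ _)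
    (GradedFamily.le_trans (h.sup_imFam_le hW hΛ hy) (GradedFamily.inf_le_left _ _)) hPfin
    (i := i) (j := i + k + 1) (by rw [hμ]; exact hlinC _ _ (by omega)) (hG _ _ (by omega))
  rw [hμ, hlin0 i _ (by omega), add_zero] at h4
  have e1 := hGa (i + 1)
  rw [relBetti_idealSum_inf _ hΛΛ'] at e1
  have hdim : Module.finrank K (((idealSum 𝒜 k W Λ) ⊓ genFam 𝒜 1 Λ') k) + restrictedRank 𝒜 k W Λ' =
      Module.finrank K ((genFam 𝒜 1 Λ) k) + restrictedRank 𝒜 k W Λ := by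
    have hPk : (idealSum 𝒜 k W Λ) k = W ⊔ (genFam 𝒜 1 Λ) k := by
      rw [sup_apply, genFam_self h.zero_deg]
    have hsup : (idealSum 𝒜 k W Λ) k ⊔ genFam 𝒜 1 Λ' k = W ⊔ genFam 𝒜 1 Λ' k := by
      rw [hPk, sup_assoc, sup_eq_right.2 (genFam_mono hΛΛ' k)]
    have := hPfin k
    have := finite_of_le_deg (𝒜 := 𝒜) (genFam_le_wholeFam hΛ'1 k)
    have a1 := Submodule.finrank_sup_add_finrank_inf_eq (idealSum 𝒜 k W Λ k) (genFam 𝒜 1 Λ' k)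
    have a2 := restrictedRank_add hW hΛ
    have a3 := restrictedRank_add hW hΛ'1
    rw [hsup] at a1
    rw [← hPk] at a2
    rw [inf_apply]
    omega
  have hdim' := congrArg (residueBetti 𝒜 (i + 1) * ·) hdim
  simp only [mul_add] at hdim'
  rw [show i + 1 + k = i + k + 1 by ring] at *
  omega

theorem KoszulModel.relBetti_idealSum_zero (h : KoszulModel 𝒜 n ε η) (hW : W ≤ 𝒜 k)
    (hΛ : Λ ≤ 𝒜 1) : relBetti (idealSum 𝒜 k W Λ) (genFam 𝒜 1 Λ) 0 k = restrictedRank 𝒜 k W Λ := by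
  have h1 := relBetti_zero_of_mem (k := k) (idealSum_finDim hW hΛ)
    (GradedFamily.le_sup_right (genFam 𝒜 k W) (genFam 𝒜 1 Λ)) (by
      intro j hj
      rw [sup_apply, genFam_eq_bot _ hj, bot_sup_eq])
  have h2 := restrictedRank_add hW hΛ
  rw [sup_apply, genFam_self h.zero_deg] at h1
  omega

/-- Modulo all linear forms, `(W)` is concentrated in degree `k`. -/
theorem KoszulModel.idealSum_top (h : KoszulModel 𝒜 n ε η) (hW : W ≤ 𝒜 k) :
    IsLinear k (idealSum 𝒜 k W (𝒜 1)) (genFam 𝒜 1 (𝒜 1)) ∧ ∀ i,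
      relBetti (idealSum 𝒜 k W (𝒜 1)) (genFam 𝒜 1 (𝒜 1)) i (i + k) =
        residueBetti 𝒜 i * restrictedRank 𝒜 k W (𝒜 1) := by
  obtain ⟨h1, h2⟩ := h.relBetti_concentrated (k := k)
    (idealSum_finDim hW (le_refl (𝒜 1))) (GradedFamily.le_sup_right _ _) (by
      rintro (_ | j) hj
      · rw [sup_apply, genFam_eq_bot _ (by omega), bot_sup_eq]
      · rw [h.genFam_one_succ]
        exact idealSum_le hW le_rfl _)
  refine ⟨h1, fun i => ?_⟩
  have h3 := h2 i
  have h4 := congrArg (residueBetti 𝒜 i * ·) (restrictedRank_add hW (le_refl (𝒜 1)))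
  rw [sup_apply, genFam_self h.zero_deg] at h3
  simp only [mul_add] at h4
  omega

/-- The linear forms `z 0, …, z (i - 1)` span this subspace. -/
def flagSpan (z : ℕ → R) (i : ℕ) : Submodule K R := Submodule.span K (z '' Set.Iio i)

theorem flagSpan_zero (z : ℕ → R) : flagSpan (K := K) z 0 = ⊥ := by
  simp [flagSpan]

theorem flagSpan_succ (z : ℕ → R) (i : ℕ) :
    flagSpan (K := K) z (i + 1) = flagSpan z i ⊔ Submodule.span K {z i} := by
  rw [flagSpan, flagSpan, ← Submodule.span_union, ← Set.image_singleton, ← Set.image_union]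
  congr 2
  ext j
  simp only [Set.mem_Iio, Set.mem_union, Set.mem_singleton_iff]
  omega

variable (𝒜) in
/-- The linear forms `z 0, …, z (n - 1)` are linearly independent. -/
def IsFlag (n : ℕ) (z : ℕ → R) : Prop := ∀ i < n, z i ∈ 𝒜 1 ∧ z i ∉ flagSpan (K := K) z i

theorem IsFlag.flagSpan_le {z : ℕ → R} (hz : IsFlag 𝒜 n z) {i : ℕ} (hi : i ≤ n) :
    flagSpan z i ≤ 𝒜 1 := by
  rw [flagSpan, Submodule.span_le]
  rintro _ ⟨j, hj, rfl⟩
  exact (hz j (lt_of_lt_of_le hj hi)).1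

theorem IsFlag.finrank_flagSpan {z : ℕ → R} (hz : IsFlag 𝒜 n z) {i : ℕ} (hi : i ≤ n) :
    Module.finrank K (flagSpan (K := K) z i) = i := by
  induction i with
  | zero => rw [flagSpan_zero, finrank_bot]
  | succ i ih =>
    rw [flagSpan_succ, finrank_sup_span_singleton' (hz.flagSpan_le (by omega : i ≤ n))
      (hz i (by omega)).2, ih (by omega)]

theorem IsFlag.flagSpan_eq {z : ℕ → R} (hz : IsFlag 𝒜 n z) (h : KoszulModel 𝒜 n ε η) :
    flagSpan z n = 𝒜 1 :=
  Submodule.eq_of_le_of_finrank_eq (hz.flagSpan_le le_rfl)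
    (by rw [hz.finrank_flagSpan le_rfl, h.finrank_one])

/-- If the star condition holds along a complete flag, then `(W)` has a `k`-linear resolution
modulo all members of the flag. -/
theorem KoszulModel.isLinear_of_starCond (h : KoszulModel 𝒜 n ε η) (hW : W ≤ 𝒜 k) {z : ℕ → R}
    (hz : IsFlag 𝒜 n z) (hstar : ∀ i < n, StarCond 𝒜 k W (flagSpan z i) (z i)) {i : ℕ}
    (hi : i ≤ n) : IsLinear k (idealSum 𝒜 k W (flagSpan z i)) (genFam 𝒜 1 (flagSpan z i)) := by
  induction hi using Nat.decreasingInduction with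
  | self =>
    rw [hz.flagSpan_eq h]
    exact (h.idealSum_top hW).1
  | of_succ i hi ih =>
    rw [flagSpan_succ] at ih
    exact h.isLinear_idealSum_step hW (hz.flagSpan_le hi.le) (hz i hi).1 (hz i hi).2
      (hstar i hi) ih

/-- Under the star condition, the graded Betti numbers of `(W)` are determined by the dimensions
of the images of `W` modulo the members of the flag. -/
theorem KoszulModel.relBetti_eq_of_starCond (h : KoszulModel 𝒜 n ε η) {W' : Submodule K R}
    (hW : W ≤ 𝒜 k) (hW' : W' ≤ 𝒜 k) {z z' : ℕ → R} (hz : IsFlag 𝒜 n z) (hz' : IsFlag 𝒜 n z')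
    (hstar : ∀ i < n, StarCond 𝒜 k W (flagSpan z i) (z i))
    (hstar' : ∀ i < n, StarCond 𝒜 k W' (flagSpan z' i) (z' i))
    (hrank : ∀ i ≤ n, restrictedRank 𝒜 k W (flagSpan z i) = restrictedRank 𝒜 k W' (flagSpan z' i))
    {r : ℕ} (hr : r ≤ n) : ∀ i,
      relBetti (idealSum 𝒜 k W (flagSpan z r)) (genFam 𝒜 1 (flagSpan z r)) i (i + k) =
        relBetti (idealSum 𝒜 k W' (flagSpan z' r)) (genFam 𝒜 1 (flagSpan z' r)) i (i + k) := by
  induction hr using Nat.decreasingInduction with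
  | self =>
    intro i
    have := hrank n le_rfl
    rw [hz.flagSpan_eq h, hz'.flagSpan_eq h] at this ⊢
    rw [(h.idealSum_top hW).2, (h.idealSum_top hW').2, this]
  | of_succ r hr ih =>
    have hlin := fun {i} => h.isLinear_of_starCond (i := i) hW hz hstar
    have hlin' := fun {i} => h.isLinear_of_starCond (i := i) hW' hz' hstar'
    have hC : ∀ (V : Submodule K R) (x : ℕ → R), (∀ {i}, i ≤ n →
        IsLinear k (idealSum 𝒜 k V (flagSpan x i)) (genFam 𝒜 1 (flagSpan x i))) →
        IsLinear k (idealSum 𝒜 k V (flagSpan x r ⊔ Submodule.span K {η • x r}))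
          (genFam 𝒜 1 (flagSpan x r ⊔ Submodule.span K {η • x r})) := by
      intro V x hV
      rcases h.colon_cases (flagSpan x r) (x r) with e | e
      · rw [e]
        exact hV hr.le
      · rw [e, ← flagSpan_succ]
        exact hV hr
    intro i
    induction i with
    | zero =>
      rw [zero_add, h.relBetti_idealSum_zero hW (hz.flagSpan_le hr.le),
        h.relBetti_idealSum_zero hW' (hz'.flagSpan_le hr.le), hrank r hr.le]
    | succ i ihi =>
      have e1 := h.relBetti_idealSum_step hW (hz.flagSpan_le hr.le) (hz r hr).1 (hz r hr).2
        (hstar r hr) (by rw [← flagSpan_succ]; exact hlin hr) (hC W z hlin) i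
      have e2 := h.relBetti_idealSum_step hW' (hz'.flagSpan_le hr.le) (hz' r hr).1 (hz' r hr).2
        (hstar' r hr) (by rw [← flagSpan_succ]; exact hlin' hr) (hC W' z' hlin') i
      have e3 : relBetti (idealSum 𝒜 k W (flagSpan z r ⊔ Submodule.span K {η • z r}))
          (genFam 𝒜 1 (flagSpan z r ⊔ Submodule.span K {η • z r})) i (i + k) =
          relBetti (idealSum 𝒜 k W' (flagSpan z' r ⊔ Submodule.span K {η • z' r}))
          (genFam 𝒜 1 (flagSpan z' r ⊔ Submodule.span K {η • z' r})) i (i + k) := by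
        rcases h.eta with rfl | rfl
        · simpa using ihi
        · rw [one_smul, one_smul, ← flagSpan_succ, ← flagSpan_succ]
          exact ih i
      rw [← flagSpan_succ, ih (i + 1), e3, hrank r hr.le, hrank (r + 1) hr] at e1
      rw [← flagSpan_succ] at e2
      omega

end Flag

/-! ### The dimension of `𝒜 1 W` -/

section Dimension

variable {K : Type u} [Field K] {R : Type v} [Ring R] [Algebra K R]
variable {𝒜 : ℕ → Submodule K R} [GradedAlgebra 𝒜] {n : ℕ} {ε η : K} {k : ℕ}

theorem finrank_map_add_inf_ker {V V' : Type*} [AddCommGroup V] [Module K V] [AddCommGroup V']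
    [Module K V'] (f : V →ₗ[K] V') (W : Submodule K V) [Module.Finite K W] :
    Module.finrank K (W.map f) + Module.finrank K ↥(W ⊓ LinearMap.ker f) = Module.finrank K W := by
  have h := LinearMap.finrank_range_add_finrank_ker (f.domRestrict W)
  rw [LinearMap.range_domRestrict, LinearMap.ker_domRestrict] at h
  rw [← h, ← Submodule.map_comap_subtype, Submodule.finrank_map_subtype_eq]

variable [∀ a, Module.Finite K (𝒜 a)] {W Λ : Submodule K R} {y : R}

theorem smulSpan_one_le (hW : W ≤ 𝒜 k) : smulSpan (𝒜 1) W ≤ 𝒜 (k + 1) := by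
  rw [add_comm]
  exact smulSpan_le.2 fun r hr m hm => SetLike.mul_mem_graded hr (hW hm)

/-- The dimension of `W y` modulo `(Λ)`. -/
theorem KoszulModel.finrank_map_rmul_sup (h : KoszulModel 𝒜 n ε η) (hW : W ≤ 𝒜 k) (hΛ : Λ ≤ 𝒜 1)
    (hy : y ∈ 𝒜 1) (hyΛ : y ∉ Λ) :
    Module.finrank K ↥(W.map ((rmul y).restrictScalars K) ⊔ genFam 𝒜 1 Λ (k + 1)) =
      restrictedRank 𝒜 k W (Λ ⊔ Submodule.span K {η • y}) +
        Module.finrank K (genFam 𝒜 1 Λ (k + 1)) := by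
  set f : R →ₗ[K] R := (rmul y).restrictScalars K with hf
  set C := Λ ⊔ Submodule.span K {η • y} with hC
  set L := genFam 𝒜 1 Λ (k + 1) with hL
  have hWf : W.map f ≤ 𝒜 (k + 1) := by
    rintro _ ⟨w, hw, rfl⟩
    exact SetLike.mul_mem_graded (hW hw) hy
  have hLe : L ≤ 𝒜 (k + 1) := genFam_le_wholeFam hΛ (k + 1)
  have := finite_of_le_deg hW
  have := finite_of_le_deg hWf
  have := finite_of_le_deg hLe
  have e1 := Submodule.finrank_sup_add_finrank_inf_eq (W.map f) L
  have e2 : W.map f ⊓ L = (W ⊓ genFam 𝒜 1 C k).map f := by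
    refine le_antisymm ?_ ?_
    · rintro _ ⟨⟨w, hw, rfl⟩, hwL⟩
      exact ⟨w, ⟨hw, h.mem_colon hΛ hy hyΛ (hW hw) hwL⟩, rfl⟩
    · rintro _ ⟨w, ⟨hw, hwC⟩, rfl⟩
      exact ⟨⟨w, hw, rfl⟩, h.mul_mem_of_mem_colon hΛ hy hwC⟩
  have e3 : W ⊓ genFam 𝒜 1 C k ⊓ LinearMap.ker f = W ⊓ LinearMap.ker f := by
    refine le_antisymm (inf_le_inf_right _ inf_le_left) ?_
    rintro w ⟨hw, hwf⟩
    refine ⟨⟨hw, h.mem_colon hΛ hy hyΛ (hW hw) ?_⟩, hwf⟩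
    have : w * y = 0 := hwf
    rw [this]
    exact zero_mem _
  have : Module.Finite K ↥(W ⊓ genFam 𝒜 1 C k) := finite_of_le_deg (inf_le_left.trans hW)
  have e4 := finrank_map_add_inf_ker f W
  have e5 := finrank_map_add_inf_ker f (W ⊓ genFam 𝒜 1 C k)
  have e6 := restrictedRank_add_inf hW (h.colon_le hΛ hy)
  rw [← hC] at e6
  rw [e3, ← e2] at e5
  omega

/-- One step of the lower bound for `dim 𝒜 1 W`; equality is the star condition. -/
theorem KoszulModel.restrictedRank_step (h : KoszulModel 𝒜 n ε η) (hW : W ≤ 𝒜 k) (hΛ : Λ ≤ 𝒜 1)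
    (hy : y ∈ 𝒜 1) (hyΛ : y ∉ Λ) :
    restrictedRank 𝒜 (k + 1) (smulSpan (𝒜 1) W) (Λ ⊔ Submodule.span K {y}) +
        restrictedRank 𝒜 k W (Λ ⊔ Submodule.span K {η • y}) ≤
      restrictedRank 𝒜 (k + 1) (smulSpan (𝒜 1) W) Λ ∧
    (restrictedRank 𝒜 (k + 1) (smulSpan (𝒜 1) W) (Λ ⊔ Submodule.span K {y}) +
        restrictedRank 𝒜 k W (Λ ⊔ Submodule.span K {η • y}) =
      restrictedRank 𝒜 (k + 1) (smulSpan (𝒜 1) W) Λ ↔ StarCond 𝒜 k W Λ y) := by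
  have hE := smulSpan_one_le hW
  set Λ' := Λ ⊔ Submodule.span K {y} with hΛ'
  have hΛ'1 : Λ' ≤ 𝒜 1 := h.sup_span_le hΛ hy
  set E := smulSpan (𝒜 1) W with hEdef
  set L := genFam 𝒜 1 Λ (k + 1) with hL
  set L' := genFam 𝒜 1 Λ' (k + 1) with hL'
  have hLe : L ≤ 𝒜 (k + 1) := genFam_le_wholeFam hΛ (k + 1)
  have hL'e : L' ≤ 𝒜 (k + 1) := genFam_le_wholeFam hΛ'1 (k + 1)
  have hLL' : L ≤ L' := genFam_mono _root_.le_sup_left (k + 1)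
  have := finite_of_le_deg (sup_le hE hLe)
  have := finite_of_le_deg hL'e
  -- the star condition says that `W y + (Λ)`, which always lies in `(E + (Λ)) ∩ (Λ, y)`, is all of
  -- it; `e1` to `e4` compute the two dimensions
  have e1 := Submodule.finrank_sup_add_finrank_inf_eq (E ⊔ L) L'
  rw [sup_assoc, sup_eq_right.2 hLL'] at e1
  have e2 := restrictedRank_add hE hΛ
  have e3 := restrictedRank_add hE hΛ'1
  have e4 := h.finrank_map_rmul_sup hW hΛ hy hyΛ
  rw [← hL] at e2 e4
  rw [← hL'] at e3
  have hle : W.map ((rmul y).restrictScalars K) ⊔ L ≤ (E ⊔ L) ⊓ L' := by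
    refine sup_le ?_ (le_inf le_sup_right hLL')
    rintro _ ⟨w, hw, rfl⟩
    change w * y ∈ _
    refine ⟨Submodule.mem_sup_left ?_, smul_mem_genFam (hW hw)
      (Submodule.mem_sup_right (Submodule.mem_span_singleton_self y))⟩
    rw [h.comm (hW hw) hy]
    exact Submodule.smul_mem _ _ (smul_mem_smulSpan hy hw)
  have : Module.Finite K ↥((E ⊔ L) ⊓ L') := finite_of_le_deg (inf_le_right.trans hL'e)
  have e5 := Submodule.finrank_mono hle
  refine ⟨by omega, ?_⟩
  have : StarCond 𝒜 k W Λ y ↔ (E ⊔ L) ⊓ L' ≤ W.map ((rmul y).restrictScalars K) ⊔ L :=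
    ⟨fun hs r hr => hs r hr.1 hr.2, fun hs r h1 h2 => hs ⟨h1, h2⟩⟩
  rw [this]
  constructor
  · intro he
    exact (Submodule.eq_of_le_of_finrank_eq hle (by omega)).ge
  · intro he
    rw [le_antisymm hle he] at e4
    omega

/-- The expected dimension of `𝒜 1 W` in terms of a flag. -/
def flagSum (𝒜 : ℕ → Submodule K R) [GradedAlgebra 𝒜] (n : ℕ) (η : K) (k : ℕ) (W : Submodule K R)
    (z : ℕ → R) : ℕ :=
  ∑ i ∈ Finset.range n, restrictedRank 𝒜 k W (flagSpan z i ⊔ Submodule.span K {η • z i})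

/-- Lower bound for `dim 𝒜 1 W`, obtained by reduction modulo the members of a flag. Equality holds
exactly when the star condition holds along the flag. -/
theorem KoszulModel.flagSum_le (h : KoszulModel 𝒜 n ε η) (hW : W ≤ 𝒜 k) {z : ℕ → R}
    (hz : IsFlag 𝒜 n z) : flagSum 𝒜 n η k W z ≤ Module.finrank K (smulSpan (𝒜 1) W) ∧
      (flagSum 𝒜 n η k W z = Module.finrank K (smulSpan (𝒜 1) W) ↔
        ∀ i < n, StarCond 𝒜 k W (flagSpan z i) (z i)) := by
  have hE := smulSpan_one_le hW
  have key : ∀ r ≤ n, restrictedRank 𝒜 (k + 1) (smulSpan (𝒜 1) W) (flagSpan z r) +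
      ∑ i ∈ Finset.range r, restrictedRank 𝒜 k W (flagSpan z i ⊔ Submodule.span K {η • z i}) ≤
        Module.finrank K (smulSpan (𝒜 1) W) ∧
      (restrictedRank 𝒜 (k + 1) (smulSpan (𝒜 1) W) (flagSpan z r) +
      ∑ i ∈ Finset.range r, restrictedRank 𝒜 k W (flagSpan z i ⊔ Submodule.span K {η • z i}) =
        Module.finrank K (smulSpan (𝒜 1) W) ↔
        ∀ i < r, StarCond 𝒜 k W (flagSpan z i) (z i)) := by
    intro r
    induction r with
    | zero =>
      intro _
      have e := restrictedRank_add_inf hE (_root_.bot_le : (⊥ : Submodule K R) ≤ 𝒜 1)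
      rw [genFam_bot, bot_apply, inf_bot_eq, finrank_bot, add_zero] at e
      rw [flagSpan_zero, Finset.sum_range_zero, e]
      simp
    | succ r ih =>
      intro hr
      obtain ⟨i1, i2⟩ := ih (by omega)
      obtain ⟨s1, s2⟩ := h.restrictedRank_step hW (hz.flagSpan_le (by omega : r ≤ n))
        (hz r (by omega)).1 (hz r (by omega)).2
      rw [Finset.sum_range_succ, flagSpan_succ]
      refine ⟨by omega, ?_⟩
      have : (∀ i < r + 1, StarCond 𝒜 k W (flagSpan z i) (z i)) ↔
          (∀ i < r, StarCond 𝒜 k W (flagSpan z i) (z i)) ∧ StarCond 𝒜 k W (flagSpan z r) (z r) := by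
        constructor
        · exact fun hs => ⟨fun i hi => hs i (by omega), hs r (by omega)⟩
        · rintro ⟨h1, h2⟩ i hi
          rcases Nat.lt_succ_iff_lt_or_eq.1 hi with hi | rfl
          · exact h1 i hi
          · exact h2
      rw [this, ← i2, ← s2]
      omega
  obtain ⟨k1, k2⟩ := key n le_rfl
  have e0 : restrictedRank 𝒜 (k + 1) (smulSpan (𝒜 1) W) (flagSpan z n) = 0 := by
    rw [hz.flagSpan_eq h, restrictedRank, h.genFam_one_succ, sup_eq_right.2 hE, Nat.sub_self]
  rw [e0, zero_add] at k1 k2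
  exact ⟨k1, k2⟩

theorem KoszulModel.flagSum_mono (h : KoszulModel 𝒜 n ε η) {W' : Submodule K R} {z z' : ℕ → R}
    (hrank : ∀ i ≤ n, restrictedRank 𝒜 k W (flagSpan z i) ≤ restrictedRank 𝒜 k W' (flagSpan z' i)) :
    flagSum 𝒜 n η k W z ≤ flagSum 𝒜 n η k W' z' := by
  refine Finset.sum_le_sum fun i hi => ?_
  have hi := Finset.mem_range.1 hi
  rcases h.eta with rfl | rfl
  · simpa using hrank i hi.le
  · rw [one_smul, one_smul, ← flagSpan_succ, ← flagSpan_succ]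
    exact hrank (i + 1) hi

end Dimension

/-! ### Truncations -/

section Truncation

variable {K : Type u} [Field K] {R : Type v} [Ring R] [Algebra K R]
variable {M : Type v} [AddCommGroup M] [Module K M] [Module R M] [IsScalarTower K R M]
variable {𝒜 : ℕ → Submodule K R} [GradedAlgebra 𝒜] {n : ℕ} {ε η : K} {k : ℕ}

/-- The part of a graded module in degrees `≥ c`. -/
def trunc (P : GradedFamily M 𝒜) (c : ℕ) : GradedFamily M 𝒜 where
  toFun j := if c ≤ j then P j else ⊥
  smul_mem' := by
    intro a j r m hr hm
    by_cases hj : c ≤ j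
    · rw [if_pos hj] at hm
      rw [if_pos (by omega)]
      exact P.smul_mem hr hm
    · rw [if_neg hj, Submodule.mem_bot] at hm
      rw [hm, smul_zero]
      exact zero_mem _

theorem trunc_of_le (P : GradedFamily M 𝒜) {c j : ℕ} (h : c ≤ j) : trunc P c j = P j := if_pos h

theorem trunc_of_lt (P : GradedFamily M 𝒜) {c j : ℕ} (h : j < c) : trunc P c j = ⊥ :=
  if_neg (by omega)

theorem trunc_le (P : GradedFamily M 𝒜) (c : ℕ) : trunc P c ≤ P := by
  intro j
  by_cases h : c ≤ j
  · rw [trunc_of_le P h]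
  · rw [trunc_of_lt P (by omega)]
    exact _root_.bot_le

theorem trunc_succ_le (P : GradedFamily M 𝒜) (c : ℕ) : trunc P (c + 1) ≤ trunc P c := by
  intro j
  by_cases h : c + 1 ≤ j
  · rw [trunc_of_le P h, trunc_of_le P (by omega)]
  · rw [trunc_of_lt P (by omega)]
    exact _root_.bot_le

theorem trunc_zero (P : GradedFamily M 𝒜) : trunc P 0 = P :=
  GradedFamily.ext fun j => trunc_of_le P (Nat.zero_le j)

variable [∀ a, Module.Finite K (𝒜 a)] {P Q : GradedFamily M 𝒜}

/-- A module that lives in degrees `< N` is an iterated extension of modules concentrated in a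
single degree, which have linear resolutions. -/
theorem KoszulModel.relBetti_eq_zero_of_bounded (h : KoszulModel 𝒜 n ε η) (hP : P.FinDim)
    (hQP : Q ≤ P) {N : ℕ} (hN : ∀ j, N ≤ j → P j ≤ Q j) {i j : ℕ}
    (hij : ∀ c < N, j = i + c → residueBetti 𝒜 i = 0) : relBetti P Q i j = 0 := by
  have key : ∀ c ≤ N, relBetti P (Q ⊔ trunc P c) i j = 0 := by
    intro c
    induction c with
    | zero =>
      intro _
      refine relBetti_eq_zero_of_le fun c _ => ?_
      rw [trunc_zero]
      exact GradedFamily.le_sup_right _ _ c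
    | succ c ih =>
      intro hc
      have h1 : Q ⊔ trunc P (c + 1) ≤ Q ⊔ trunc P c :=
        GradedFamily.sup_le (GradedFamily.le_sup_left _ _)
          (GradedFamily.le_trans (trunc_succ_le P c) (GradedFamily.le_sup_right _ _))
      have h2 : Q ⊔ trunc P c ≤ P := GradedFamily.sup_le hQP (trunc_le P c)
      refine Nat.eq_zero_of_le_zero ((relBetti_le_add h1 h2 hP i j).trans ?_)
      rw [ih (by omega), add_zero]
      obtain ⟨c1, c2⟩ := h.relBetti_concentrated (k := c) (hP.mono h2) h1 (by
        intro j hj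
        rw [sup_apply, sup_apply]
        refine sup_le_sup_left ?_ _
        rcases lt_or_ge j c with hjc | hjc
        · rw [trunc_of_lt P hjc]
          exact _root_.bot_le
        · rw [trunc_of_le P hjc, trunc_of_le P (by omega)])
      by_cases hjc : j = i + c
      · subst hjc
        have := c2 i
        rw [hij c (by omega) rfl, zero_mul, zero_mul, add_zero] at this
        exact this.le
      · exact (c1 i j hjc).le
  have e : Q ⊔ trunc P N = Q := by
    refine GradedFamily.sup_eq_left fun j => ?_
    by_cases hj : N ≤ j
    · rw [trunc_of_le P hj]
      exact hN j hj
    · rw [trunc_of_lt P (by omega)]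
      exact _root_.bot_le
  rw [← e]
  exact key N le_rfl

/-- Modules have no `Tor` in homological degrees where the residue field has none. -/
theorem KoszulModel.relBetti_eq_zero_of_residueBetti (h : KoszulModel 𝒜 n ε η) (hP : P.FinDim)
    (hQP : Q ≤ P) {i : ℕ} (hi : residueBetti 𝒜 i = 0) (j : ℕ) : relBetti P Q i j = 0 := by
  have h2 : Q ⊔ trunc P (j + 1) ≤ P := GradedFamily.sup_le hQP (trunc_le P _)
  refine Nat.eq_zero_of_le_zero ((relBetti_le_add (GradedFamily.le_sup_left _ _) h2 hP
    i j).trans ?_)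
  rw [h.relBetti_eq_zero_of_bounded hP h2 (N := j + 1) ?_ (fun _ _ _ => hi), add_zero]
  · refine (relBetti_eq_zero_of_le fun c hc => ?_).le
    rw [sup_apply, trunc_of_lt P (by omega), sup_bot_eq]
  · intro c hc
    rw [sup_apply, trunc_of_le P hc]
    exact le_sup_right

/-- The part of the linear strand of a module that comes from the generators of lowest degree. -/
theorem relBetti_eq_genFam (hP : P.FinDim)
    (hlo : ∀ j < k, P j = ⊥) (i : ℕ) :
    relBetti P ⊥ i (i + k) = relBetti (genFam 𝒜 k (P k)) ⊥ i (i + k) := by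
  have hle : genFam 𝒜 k (P k) ≤ P := genFam_le le_rfl
  have hz : ∀ c < k + 1, P c ≤ genFam 𝒜 k (P k) c := by
    intro c hc
    rcases Nat.lt_succ_iff_lt_or_eq.1 hc with hc | rfl
    · rw [hlo c hc]
      exact _root_.bot_le
    · exact fun x hx => mem_genFam hx
  have h1 := relBetti_le_add (GradedFamily.bot_le _) hle hP i (i + k)
  have h2 := relBetti_sub_le_add (GradedFamily.bot_le _) hle hP i (i + k)
  rw [relBetti_eq_zero_of_lt hz (by omega)] at h1 h2
  omega

/-- The graded Betti number `β_{i, i + k}` of the ideal generated by a subspace `W` of degree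
`k`. -/
def strandBetti (𝒜 : ℕ → Submodule K R) [GradedAlgebra 𝒜] (k : ℕ) (W : Submodule K R) (i : ℕ) : ℕ :=
  relBetti (genFam 𝒜 k W) ⊥ i (i + k)

/-- The graded Betti numbers of an ideal in terms of the linear strands of its components. -/
theorem KoszulModel.relBetti_ideal (h : KoszulModel 𝒜 n ε η) {I : GradedFamily R 𝒜}
    (hI : I ≤ wholeFam 𝒜) (i : ℕ) :
    strandBetti 𝒜 k (I k) (i + 1) + strandBetti 𝒜 (k + 1) (I (k + 1)) i =
      residueBetti 𝒜 (i + 1) * Module.finrank K (I k) + relBetti I ⊥ i (i + k + 1) := by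
  have hIfin : I.FinDim := wholeFam_finDim.mono hI
  have hJ : (trunc I k).FinDim := hIfin.mono (trunc_le I k)
  -- truncation below degree `k` does not change `β_{i,i+k+1}`: `I / I_{≥ k}` lives in degrees
  -- `< k`, so its `Tor_i` lives in degrees `< i + k`
  have b1 : relBetti (trunc I k) ⊥ i (i + k + 1) = relBetti I ⊥ i (i + k + 1) := by
    have z1 : ∀ i' j', j' ≠ i' → ∀ m, j' = i' + m → k ≤ m → relBetti I (trunc I k) i' j' = 0 := by
      intro i' j' _ m hm hkm
      refine h.relBetti_eq_zero_of_bounded hIfin (trunc_le I k) (N := k) ?_ ?_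
      · intro j hj
        rw [trunc_of_le I hj]
      · intro c hc hjc
        omega
    have h1 := relBetti_le_add (GradedFamily.bot_le _) (trunc_le I k) hIfin i (i + k + 1)
    have h2 := relBetti_sub_le_add (GradedFamily.bot_le _) (trunc_le I k) hIfin i (i + k + 1)
    rw [z1 i _ (by omega) (k + 1) (by omega) (by omega)] at h1
    by_cases hk : k = 0
    · subst hk
      rw [trunc_zero]
    · rw [z1 (i + 1) _ (by omega) k (by omega) le_rfl] at h2
      omega
  -- the lowest linear strands of `I_{≥ k}` and `I_{≥ k + 1}` are those of `(I_k)` and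
  -- `(I_{k + 1})`
  have c1 : relBetti (trunc I k) ⊥ (i + 1) (i + k + 1) = strandBetti 𝒜 k (I k) (i + 1) := by
    have := relBetti_eq_genFam (k := k) hJ (fun j hj => trunc_of_lt I hj) (i + 1)
    rw [strandBetti, show i + k + 1 = i + 1 + k by ring]
    rwa [trunc_of_le I le_rfl] at this
  have c2 : relBetti (trunc I (k + 1)) ⊥ i (i + k + 1) = strandBetti 𝒜 (k + 1) (I (k + 1)) i := by
    have := relBetti_eq_genFam (k := k + 1) (hIfin.mono (trunc_le I (k + 1)))
      (fun j hj => trunc_of_lt I hj) i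
    rwa [trunc_of_le I le_rfl] at this
  -- compare the two truncations; their quotient is concentrated in degree `k`
  obtain ⟨d1, d2⟩ := h.relBetti_concentrated (k := k) hJ (trunc_succ_le I k) (by
    intro j hj
    rcases lt_or_ge j k with hjc | hjc
    · rw [trunc_of_lt I hjc]
      exact _root_.bot_le
    · rw [trunc_of_le I hjc, trunc_of_le I (by omega)])
  have d3 := d2 (i + 1)
  rw [trunc_of_lt I (Nat.lt_succ_self k), trunc_of_le I le_rfl, finrank_bot, mul_zero,
    add_zero, show i + 1 + k = i + k + 1 by ring] at d3
  have z1 : relBetti (trunc I (k + 1)) ⊥ (i + 1) (i + k + 1) = 0 :=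
    relBetti_eq_zero_of_lt (k := k + 1) (fun c hc => (trunc_of_lt I hc).le) (by omega)
  have z2 : relBetti (trunc I k) (trunc I (k + 1)) i (i + k + 1) = 0 := d1 _ _ (by omega)
  have h4 := relBetti_four_term (GradedFamily.bot_le _) (trunc_succ_le I k) hJ z1 z2
  rw [c1, c2, d3, b1] at h4
  exact h4

/-- The graded Betti numbers of `R / I` are those of `I`. -/
theorem KoszulModel.relBetti_whole_ideal (h : KoszulModel 𝒜 n ε η) {I : GradedFamily R 𝒜}
    (hI : I ≤ wholeFam 𝒜) (i : ℕ) {j : ℕ} (hj : j ≠ i) :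
    relBetti (wholeFam 𝒜) I (i + 1) j = relBetti I ⊥ i j := by
  have h1 := relBetti_quot_le_add (GradedFamily.bot_le _) hI wholeFam_finDim i j
  have h2 := relBetti_sub_le_add (GradedFamily.bot_le _) hI wholeFam_finDim i j
  rw [relBetti_whole_bot h.zero_deg] at h1
  rw [h.relBetti_whole_bot_eq_zero hj] at h2
  omega

theorem KoszulModel.strandBetti_zero (h : KoszulModel 𝒜 n ε η) {W : Submodule K R}
    (hW : W ≤ 𝒜 k) : strandBetti 𝒜 k W 0 = Module.finrank K W := by
  have := relBetti_zero_of_mem (k := k) (wholeFam_finDim.mono (genFam_le_wholeFam hW))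
    (GradedFamily.bot_le _) (fun j hj => (genFam_eq_bot W hj).le)
  rw [bot_apply, finrank_bot, add_zero, genFam_self h.zero_deg] at this
  rwa [strandBetti, zero_add]

/-- The linear syzygies of `W` measure the failure of `𝒜 1 ⊗ W → 𝒜 1 W` to be injective. -/
theorem KoszulModel.strandBetti_one (h : KoszulModel 𝒜 n ε η) {W : Submodule K R}
    (hW : W ≤ 𝒜 k) : strandBetti 𝒜 k W 1 + Module.finrank K (smulSpan (𝒜 1) W) =
      residueBetti 𝒜 1 * Module.finrank K W := by
  have e := h.relBetti_ideal (k := k) (genFam_le_wholeFam hW) 0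
  have hfin := (wholeFam_finDim (𝒜 := 𝒜)).mono (genFam_le_wholeFam hW)
  rw [genFam_self h.zero_deg, h.relBetti_zero_eq_zero (k := k) (W := W) hfin
    (fun x hx => mem_genFam hx) (GradedFamily.le_sup_left _ _) (by omega), add_zero] at e
  have e2 := genFam_add (𝒜 := 𝒜) k 1 W
  rw [add_comm] at e2
  rw [e2, h.strandBetti_zero (smulSpan_one_le hW)] at e
  exact e

/-- The equivalence of the three conditions, for two ideals `I` and `J` with the same Hilbert
function such that the linear strands of `I` in degree `d` are controlled by the dimension of
`𝒜 1 (I d)`. -/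
theorem KoszulModel.tfae_of_strand (h : KoszulModel 𝒜 n ε η) {I J : GradedFamily R 𝒜}
    (hI : I ≤ wholeFam 𝒜) (hJ : J ≤ wholeFam 𝒜)
    (hdim : ∀ d, Module.finrank K (I d) = Module.finrank K (J d))
    (hlin : ∀ d, IsLinear d (genFam 𝒜 d (I d)) ⊥ →
      Module.finrank K (smulSpan (𝒜 1) (I d)) = Module.finrank K (smulSpan (𝒜 1) (J d)))
    (hstrand : ∀ d,
      Module.finrank K (smulSpan (𝒜 1) (I d)) = Module.finrank K (smulSpan (𝒜 1) (J d)) →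
        IsLinear d (genFam 𝒜 d (I d)) ⊥ ∧ strandBetti 𝒜 d (I d) = strandBetti 𝒜 d (J d)) (k : ℕ) :
    List.TFAE [
      ∀ i, 1 ≤ i → relBetti (wholeFam 𝒜) I i (i + k) = relBetti (wholeFam 𝒜) J i (i + k),
      IsLinear k (genFam 𝒜 k (I k)) ⊥ ∧ IsLinear (k + 1) (genFam 𝒜 (k + 1) (I (k + 1))) ⊥,
      relBetti (wholeFam 𝒜) I 1 (k + 1) = relBetti (wholeFam 𝒜) J 1 (k + 1) ∧
        relBetti (wholeFam 𝒜) I 1 (k + 2) = relBetti (wholeFam 𝒜) J 1 (k + 2)] := by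
  have hβ : ∀ {I : GradedFamily R 𝒜}, I ≤ wholeFam 𝒜 → ∀ d i,
      strandBetti 𝒜 d (I d) (i + 1) + strandBetti 𝒜 (d + 1) (I (d + 1)) i =
        residueBetti 𝒜 (i + 1) * Module.finrank K (I d) +
          relBetti (wholeFam 𝒜) I (i + 1) (i + 1 + d) := by
    intro I hI d i
    rw [h.relBetti_whole_ideal hI i (by omega), h.relBetti_ideal hI,
      show i + 1 + d = i + d + 1 by ring]
  -- `β_{1,d+1}(R / I) = dim I_{d+1} - dim 𝒜_1 I_d`, so equal Betti numbers mean equal dimensions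
  have h1 : ∀ d, relBetti (wholeFam 𝒜) I 1 (d + 1) = relBetti (wholeFam 𝒜) J 1 (d + 1) →
      Module.finrank K (smulSpan (𝒜 1) (I d)) = Module.finrank K (smulSpan (𝒜 1) (J d)) := by
    intro d hd
    have a1 := hβ hI d 0
    have a2 := hβ hJ d 0
    have a3 := h.strandBetti_one (hI d)
    have a4 := h.strandBetti_one (hJ d)
    rw [h.strandBetti_zero (hI (d + 1)), zero_add, add_comm 1 d] at a1
    rw [h.strandBetti_zero (hJ (d + 1)), zero_add, add_comm 1 d, ← hd] at a2
    have d1 := hdim d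
    have d2 := hdim (d + 1)
    rw [← d1] at a2 a4
    omega
  -- once the strands in degree `k` agree, `β_{2,k+2}` determines the linear syzygies of
  -- `(I_{k+1})`, and these determine `β_{1,k+2}`
  tfae_have 1 → 3 := by
    intro hi
    have hi1 := hi 1 le_rfl
    have hi2 := hi 2 (by omega)
    rw [add_comm 1 k] at hi1
    refine ⟨hi1, ?_⟩
    have s := (hstrand k (h1 k hi1)).2
    have a1 := hβ hI k 1
    have a2 := hβ hJ k 1
    have a3 := hβ hI (k + 1) 0
    have a4 := hβ hJ (k + 1) 0
    rw [h.strandBetti_zero (hI _)] at a3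
    rw [h.strandBetti_zero (hJ _)] at a4
    rw [← s, ← hdim] at a2
    rw [← hdim, ← hdim] at a4
    simp only [zero_add, one_add_one_eq_two] at a1 a2 a3 a4
    rw [show 1 + (k + 1) = k + 2 by ring] at a3 a4
    omega
  tfae_have 3 → 2 := fun hi => ⟨(hstrand _ (h1 k hi.1)).1, (hstrand _ (h1 (k + 1) hi.2)).1⟩
  tfae_have 2 → 1 := by
    intro hi i hi1
    obtain ⟨i, rfl⟩ : ∃ i', i = i' + 1 := ⟨i - 1, by omega⟩
    have s1 := (hstrand k (hlin k hi.1)).2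
    have s2 := (hstrand (k + 1) (hlin (k + 1) hi.2)).2
    have a1 := hβ hI k i
    have a2 := hβ hJ k i
    rw [s1, s2, hdim k] at a1
    omega
  tfae_finish

end Truncation

/-! ### Ideals and their homogeneous components -/

section ToIdeal

variable {K : Type u} [Field K] {R : Type v} [Ring R] [Algebra K R]
variable {𝒜 : ℕ → Submodule K R} [GradedAlgebra 𝒜]

/-- The ideal generated by the components of a graded family in `R`. -/
def toIdeal (P : GradedFamily R 𝒜) : Ideal R := Ideal.span {f | ∃ j, f ∈ P j}

theorem mem_toIdeal_of_mem {P : GradedFamily R 𝒜} {j : ℕ} {f : R} (hf : f ∈ P j) : f ∈ toIdeal P :=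
  Ideal.subset_span ⟨j, hf⟩

theorem decompose_mem_of_mem_toIdeal {P : GradedFamily R 𝒜} (hP : P ≤ wholeFam 𝒜) {f : R}
    (hf : f ∈ toIdeal P) (j : ℕ) : (DirectSum.decompose 𝒜 f j : R) ∈ P j := by
  induction hf using Submodule.span_induction generalizing j with
  | mem f hf =>
    obtain ⟨c, hc⟩ := hf
    by_cases hcj : c = j
    · subst hcj
      rwa [DirectSum.decompose_of_mem_same 𝒜 (hP c hc)]
    · rw [DirectSum.decompose_of_mem_ne 𝒜 (hP c hc) hcj]
      exact zero_mem _
  | zero =>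
    rw [DirectSum.decompose_zero]
    exact zero_mem (P j)
  | add f g _ _ hf hg =>
    rw [DirectSum.decompose_add]
    exact add_mem (hf j) (hg j)
  | smul r f _ hf =>
    rw [smul_eq_mul]
    induction r using DirectSum.Decomposition.inductionOn 𝒜 generalizing j with
    | zero =>
      rw [zero_mul, DirectSum.decompose_zero]
      exact zero_mem (P j)
    | @homogeneous a r =>
      by_cases haj : a ≤ j
      · rw [DirectSum.coe_decompose_mul_of_left_mem_of_le 𝒜 r.2 haj]
        have := P.smul_mem r.2 (hf (j - a))
        rwa [Nat.add_sub_cancel' haj] at this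
      · rw [DirectSum.coe_decompose_mul_of_left_mem_of_not_le 𝒜 r.2 haj]
        exact zero_mem _
    | add r s hr hs =>
      rw [add_mul, DirectSum.decompose_add]
      exact add_mem (hr j) (hs j)

theorem mem_toIdeal_iff_of_mem {P : GradedFamily R 𝒜} (hP : P ≤ wholeFam 𝒜) {j : ℕ} {f : R}
    (hf : f ∈ 𝒜 j) : f ∈ toIdeal P ↔ f ∈ P j := by
  refine ⟨fun h => ?_, mem_toIdeal_of_mem⟩
  have := decompose_mem_of_mem_toIdeal hP h j
  rwa [DirectSum.decompose_of_mem_same 𝒜 hf] at this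

theorem mem_toIdeal_iff {P : GradedFamily R 𝒜} (hP : P ≤ wholeFam 𝒜) {f : R} :
    f ∈ toIdeal P ↔ ∀ j, (DirectSum.decompose 𝒜 f j : R) ∈ P j := by
  classical
  refine ⟨fun h => decompose_mem_of_mem_toIdeal hP h, fun h => ?_⟩
  rw [← DirectSum.sum_support_decompose 𝒜 f]
  exact sum_mem fun j _ => mem_toIdeal_of_mem (h j)

end ToIdeal

/-! ### Generic linear forms -/

section Step

variable {K : Type u} [Field K] {R : Type v} [Ring R] [Algebra K R]
variable {𝒜 : ℕ → Submodule K R} [GradedAlgebra 𝒜] {n : ℕ} {ε η : K} {k : ℕ}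
variable [∀ a, Module.Finite K (𝒜 a)] {W Λ : Submodule K R} {y : R}

variable (𝒜) in
/-- In degrees greater than `k`, the elements of `(W) + (Λ)` that lie in `(Λ, y)` lie in
`y ((W) + (Λ)) + (Λ)`. -/
def IsGoodForm (k : ℕ) (W Λ : Submodule K R) (y : R) : Prop :=
  ∀ j, k < j → ∀ r ∈ idealSum 𝒜 k W Λ j, r ∈ genFam 𝒜 1 (Λ ⊔ Submodule.span K {y}) j →
    r ∈ (genFam 𝒜 1 Λ ⊔ imFam (rmul y) (idealSum 𝒜 k W Λ)) j

/-- The star condition is the part of `IsGoodForm` in degree `k + 1`. -/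
theorem KoszulModel.starCond_of_isGoodForm (h : KoszulModel 𝒜 n ε η) (hΛ : Λ ≤ 𝒜 1)
    (hy : y ∈ 𝒜 1) (hgood : IsGoodForm 𝒜 k W Λ y) : StarCond 𝒜 k W Λ y := by
  intro r hr hr'
  have e := genFam_add (𝒜 := 𝒜) k 1 W
  rw [add_comm] at e
  rw [← e] at hr
  obtain ⟨l, hl, w, hw, rfl⟩ := Submodule.mem_sup.1 (hgood (k + 1) (by omega) r hr hr')
  obtain ⟨x, hx, rfl⟩ := mem_imFam_succ.1 hw
  clear hw
  rw [sup_apply, genFam_self h.zero_deg] at hx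
  obtain ⟨w, hw, l', hl', rfl⟩ := Submodule.mem_sup.1 hx
  rw [map_add, add_left_comm]
  exact Submodule.add_mem_sup ⟨w, hw, rfl⟩
    (add_mem hl (h.mul_mem (genFam_le_wholeFam hΛ) hl' hy))

/-- Reduction modulo a good linear form preserves `k`-linear resolutions. -/
theorem KoszulModel.isLinear_of_isGoodForm (h : KoszulModel 𝒜 n ε η) (hW : W ≤ 𝒜 k) (hΛ : Λ ≤ 𝒜 1)
    (hy : y ∈ 𝒜 1) (hyΛ : y ∉ Λ) (hgood : IsGoodForm 𝒜 k W Λ y)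
    (hlin : IsLinear k (idealSum 𝒜 k W Λ) (genFam 𝒜 1 Λ)) :
    IsLinear k (idealSum 𝒜 k W (Λ ⊔ Submodule.span K {y}))
      (genFam 𝒜 1 (Λ ⊔ Submodule.span K {y})) := by
  have hPfin : (idealSum 𝒜 k W Λ).FinDim := idealSum_finDim hW hΛ
  have hQB := h.sup_imFam_le hW hΛ hy
  have hQP := GradedFamily.le_trans hQB (GradedFamily.inf_le_left _ _)
  have hLQ : genFam 𝒜 1 Λ ≤ genFam 𝒜 1 Λ ⊔ imFam (rmul y) (idealSum 𝒜 k W Λ) :=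
    GradedFamily.le_sup_left _ _
  have hlow : ∀ j < k, idealSum 𝒜 k W Λ j ≤ genFam 𝒜 1 Λ j := by
    intro j hj
    rw [sup_apply, genFam_eq_bot _ hj, bot_sup_eq]
  -- the kernel of the surjection from reduction modulo `y` to `((W) + (Λ, y)) / (Λ, y)` is
  -- concentrated in degree `k`
  have hN := (h.relBetti_concentrated (k := k) (hPfin.mono (GradedFamily.inf_le_left _ _)) hQB (by
    intro j hj r hr
    rcases lt_or_gt_of_ne hj with hj | hj
    · exact hLQ j (hlow j hj hr.1)
    · exact hgood j hj r hr.1 hr.2)).1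
  have hμ : ∀ i j, relBetti (genFam 𝒜 1 Λ ⊔ imFam (rmul y) (idealSum 𝒜 k W Λ)) (genFam 𝒜 1 Λ) i
      (j + 1) = relBetti (idealSum 𝒜 k W (Λ ⊔ Submodule.span K {η • y}))
        (genFam 𝒜 1 (Λ ⊔ Submodule.span K {η • y})) i j :=
    h.relBetti_imFam hW hΛ hy hyΛ
  intro i
  induction i with
  | zero =>
    intro j hj
    rw [← relBetti_idealSum_inf _ le_sup_left]
    exact Nat.eq_zero_of_le_zero ((relBetti_quot_zero_le (GradedFamily.le_trans hLQ hQB)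
      hPfin j).trans (hlin 0 j hj).le)
  | succ i ih =>
    intro j hj
    rw [← relBetti_idealSum_inf _ le_sup_left]
    by_cases hjk : j < i + 1 + k
    · refine relBetti_eq_zero_of_lt (k := k) (fun c hc => ?_) hjk
      exact (hlow c hc).trans (GradedFamily.le_trans hLQ hQB c)
    refine Nat.eq_zero_of_le_zero ((relBetti_quot_le_add hQB (GradedFamily.inf_le_left _ _)
      hPfin i j).trans ?_)
    rw [hN i j (by omega), add_zero]
    refine (relBetti_quot_le_add hLQ hQP hPfin i j).trans ?_
    rw [hlin _ _ hj, zero_add]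
    obtain ⟨j, rfl⟩ : ∃ j', j = j' + 1 := ⟨j - 1, by omega⟩
    rw [hμ]
    rcases h.colon_cases Λ y with e | e
    · rw [e]
      exact (hlin i j (by omega)).le
    · rw [e]
      exact (ih j (by omega)).le

/-- If good linear forms exist, then a `k`-linear resolution gives a flag with the star
condition. -/
theorem KoszulModel.exists_flag (h : KoszulModel 𝒜 n ε η) (hW : W ≤ 𝒜 k)
    (hlin : IsLinear k (genFam 𝒜 k W) ⊥)
    (hgood : ∀ Λ ≤ 𝒜 1, Λ ≠ 𝒜 1 → IsLinear k (idealSum 𝒜 k W Λ) (genFam 𝒜 1 Λ) →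
      ∃ y ∈ 𝒜 1, y ∉ Λ ∧ IsGoodForm 𝒜 k W Λ y) :
    ∃ z : ℕ → R, IsFlag 𝒜 n z ∧ ∀ i < n, StarCond 𝒜 k W (flagSpan z i) (z i) := by
  -- choose the members of the flag one at a time, keeping the linear resolution
  have key : ∀ m ≤ n, ∃ z : ℕ → R, IsFlag 𝒜 m z ∧
      (∀ i < m, StarCond 𝒜 k W (flagSpan z i) (z i)) ∧
      IsLinear k (idealSum 𝒜 k W (flagSpan z m)) (genFam 𝒜 1 (flagSpan z m)) := by
    intro m
    induction m with
    | zero =>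
      intro _
      refine ⟨fun _ => 0, fun i hi => absurd hi (by omega), fun i hi => absurd hi (by omega), ?_⟩
      rw [flagSpan_zero, idealSum, genFam_bot, GradedFamily.sup_eq_left (GradedFamily.bot_le _)]
      exact hlin
    | succ m ih =>
      intro hm
      obtain ⟨z, hz, hs, hl⟩ := ih (by omega)
      have hle : flagSpan z m ≤ 𝒜 1 := hz.flagSpan_le le_rfl
      have hne : flagSpan z m ≠ 𝒜 1 := by
        intro he
        have := hz.finrank_flagSpan (K := K) le_rfl
        rw [he, h.finrank_one] at this
        omega
      obtain ⟨y, hy, hyΛ, hg⟩ := hgood _ hle hne hl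
      have hspan : ∀ i ≤ m, flagSpan (K := K) (Function.update z m y) i = flagSpan z i := by
        intro i hi
        rw [flagSpan, flagSpan]
        congr 1
        refine Set.image_congr fun j hj => Function.update_of_ne ?_ _ _
        have : j < i := hj
        omega
      have hval : ∀ i < m, Function.update z m y i = z i :=
        fun i hi => Function.update_of_ne (by omega) _ _
      refine ⟨Function.update z m y, ?_, ?_, ?_⟩
      · intro i hi
        rcases Nat.lt_succ_iff_lt_or_eq.1 hi with hi | rfl
        · rw [hval i hi, hspan i hi.le]
          exact hz i hi
        · rw [Function.update_self, hspan i le_rfl]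
          exact ⟨hy, hyΛ⟩
      · intro i hi
        rcases Nat.lt_succ_iff_lt_or_eq.1 hi with hi | rfl
        · rw [hval i hi, hspan i hi.le]
          exact hs i hi
        · rw [Function.update_self, hspan i le_rfl]
          exact h.starCond_of_isGoodForm hle hy hg
      · rw [flagSpan_succ, Function.update_self, hspan m le_rfl]
        exact h.isLinear_of_isGoodForm hW hle hy hyΛ hg hl
  obtain ⟨z, hz, hs, -⟩ := key n le_rfl
  exact ⟨z, hz, hs⟩

end Step

/-! ### Generic linear forms in polynomial rings -/

section Poly

variable {K : Type u} [Field K] [Infinite K] {R : Type v} [CommRing R] [Algebra K R]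
variable {𝒜 : ℕ → Submodule K R} [GradedAlgebra 𝒜] {n : ℕ} {ε : K} {k : ℕ}
variable [∀ a, Module.Finite K (𝒜 a)] {W Λ : Submodule K R}

theorem exists_mem_notMem_of_finite {V : Type*} [AddCommGroup V] [Module K V] {A : Submodule K V}
    {S : Set (Submodule K V)} (hS : S.Finite) (h : ∀ p ∈ S, ¬ A ≤ p) :
    ∃ y ∈ A, ∀ p ∈ S, y ∉ p := by
  classical
  let s : Finset (Subspace K A) := hS.toFinset.image fun p => p.comap A.subtype
  have htop : ⊤ ∉ s := by
    intro ht
    obtain ⟨p, hp, hpt⟩ := Finset.mem_image.1 ht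
    exact h p (hS.mem_toFinset.1 hp) (Submodule.comap_subtype_eq_top.1 hpt)
  have := Subspace.biUnion_ne_univ_of_top_notMem htop
  obtain ⟨y, hy⟩ := (Set.ne_univ_iff_exists_notMem _).1 this
  refine ⟨y, y.2, fun p hp hyp => hy ?_⟩
  refine Set.mem_biUnion (Finset.mem_coe.2 (Finset.mem_image_of_mem _ (hS.mem_toFinset.2 hp))) ?_
  exact hyp

/-- Modulo an ideal with a `k`-linear resolution there is no socle in degrees `≥ k`. -/
theorem KoszulModel.mem_of_socle [Nontrivial R] (h : KoszulModel 𝒜 n ε (0 : K)) (hW : W ≤ 𝒜 k)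
    (hΛ : Λ ≤ 𝒜 1) (hne : Λ ≠ 𝒜 1) (hlin : IsLinear k (idealSum 𝒜 k W Λ) (genFam 𝒜 1 Λ)) {j : ℕ}
    (hj : k ≤ j) {f : R} (hf : f ∈ 𝒜 j) (hsoc : ∀ v ∈ 𝒜 1, v * f ∈ idealSum 𝒜 k W Λ (1 + j)) :
    f ∈ idealSum 𝒜 k W Λ j := by
  by_contra hfQ
  have hPw := idealSum_le (𝒜 := 𝒜) hW hΛ
  -- in degree `0` only `k = 0` and `W = 0` are possible, and then `Λ` contains all linear forms
  obtain _ | j := j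
  · obtain rfl : k = 0 := by omega
    obtain ⟨c, rfl⟩ := Submodule.mem_span_singleton.1 (h.zero_deg hf)
    have hc : c ≠ 0 := by
      rintro rfl
      exact hfQ (by rw [zero_smul]; exact zero_mem _)
    have hW0 : W = ⊥ := by
      rw [eq_bot_iff]
      intro w hw
      obtain ⟨c', rfl⟩ := Submodule.mem_span_singleton.1 (h.zero_deg (hW hw))
      by_cases hc' : c' = 0
      · simp [hc']
      · refine absurd (GradedFamily.le_sup_left _ _ _ (mem_genFam ?_)) hfQ
        have := W.smul_mem (c * c'⁻¹) hw
        rwa [smul_smul, mul_assoc, inv_mul_cancel₀ hc', mul_one] at this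
    refine hne (le_antisymm hΛ fun v hv => ?_)
    have := hsoc v hv
    rw [hW0, sup_apply, genFam_bot, bot_apply, bot_sup_eq, add_zero, genFam_self h.zero_deg,
      mul_smul_comm, mul_one] at this
    exact (Submodule.smul_mem_iff _ hc).1 this
  have hQfin := idealSum_finDim (𝒜 := 𝒜) hW hΛ
  -- a socle element `f` spans a copy of the residue field in `R / Q`, where `Q = (W) + (Λ)`; since
  -- `Tor_{n+1}` vanishes, its nonzero `Tor_n` embeds into `Tor_n(R / Q)`, in a degree `n + deg f`
  -- that is too large for the linear resolution of `Q / (Λ)`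
  have hD1 : residueBetti 𝒜 (n + 1) = 0 := by
    refine (h.relBetti_whole_genFam_poly (le_refl (𝒜 1))).1 _ _ ?_
    rw [h.finrank_one]
    omega
  have hD : residueBetti 𝒜 n ≠ 0 := by
    have := (h.relBetti_whole_genFam_poly (le_refl (𝒜 1))).2
    rwa [h.finrank_one] at this
  have hn : n ≠ 0 := by
    rintro rfl
    have : 𝒜 1 = ⊥ := Submodule.finrank_eq_zero.1 h.finrank_one
    rw [this] at hne hΛ
    exact hne (le_bot_iff.1 hΛ)
  obtain ⟨n, rfl⟩ : ∃ n', n = n' + 1 := ⟨n - 1, by omega⟩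
  set Q := idealSum 𝒜 k W Λ with hQ
  set Q' := Q ⊔ genFam 𝒜 (j + 1) (Submodule.span K {f}) with hQ'
  have hQQ' : Q ≤ Q' := GradedFamily.le_sup_left _ _
  have hQ'w : Q' ≤ wholeFam 𝒜 := GradedFamily.sup_le hPw
    (genFam_le_wholeFam ((Submodule.span_singleton_le_iff_mem _ _).2 hf))
  have hc := (h.relBetti_concentrated (k := j + 1) (wholeFam_finDim.mono hQ'w) hQQ' (by
    intro c hc
    rw [hQ', sup_apply]
    refine sup_le le_rfl ?_
    rcases lt_or_gt_of_ne hc with hc | hc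
    · rw [genFam_eq_bot _ hc]
      exact _root_.bot_le
    · obtain ⟨a, rfl⟩ : ∃ a, c = a + 1 + (j + 1) := ⟨c - j - 2, by omega⟩
      intro x hx
      obtain ⟨r, hr, rfl⟩ := mem_genFam_span_singleton.1 hx
      suffices h' : 𝒜 a * 𝒜 1 ≤ (Q (a + 1 + (j + 1))).comap
        ((LinearMap.mul K R).flip f) from h' (h.succ_deg' a hr)
      refine Submodule.mul_le.2 fun s (hs : s ∈ 𝒜 a) v hv => ?_
      change s * v * f ∈ Q (a + 1 + (j + 1))
      rw [mul_assoc, add_assoc]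
      exact Q.smul_mem hs (hsoc v hv))).2 (n + 1)
  have e : Q' (j + 1) = Q (j + 1) ⊔ Submodule.span K {f} := by
    rw [hQ', sup_apply, genFam_self h.zero_deg]
  have := wholeFam_finDim (𝒜 := 𝒜) (j + 1)
  rw [e, finrank_sup_span_singleton' (hPw (j + 1)) hfQ, mul_add, mul_one] at hc
  have h1 := relBetti_sub_le_add hQQ' hQ'w wholeFam_finDim (n + 1) (n + 1 + (j + 1))
  rw [h.relBetti_eq_zero_of_residueBetti wholeFam_finDim hQ'w hD1, zero_add] at h1
  have h2 : relBetti (wholeFam 𝒜) Q (n + 1) (n + 1 + (j + 1)) ≤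
      relBetti (wholeFam 𝒜) (genFam 𝒜 1 Λ) (n + 1) (n + 1 + (j + 1)) +
        relBetti Q (genFam 𝒜 1 Λ) n (n + 1 + (j + 1)) :=
    relBetti_quot_le_add (GradedFamily.le_sup_right (genFam 𝒜 k W) (genFam 𝒜 1 Λ)) hPw
    wholeFam_finDim n (n + 1 + (j + 1))
  rw [h.relBetti_whole_genFam hΛ _ _ (by omega), hlin _ _ (by omega)] at h2
  omega

/-- In a polynomial ring a general linear form is a nonzerodivisor modulo `(W) + (Λ)` in
degrees `≥ k`. -/
theorem KoszulModel.exists_isGoodForm_poly [Nontrivial R] [IsNoetherianRing R]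
    (h : KoszulModel 𝒜 n ε (0 : K)) (hW : W ≤ 𝒜 k) (hΛ : Λ ≤ 𝒜 1) (hne : Λ ≠ 𝒜 1)
    (hlin : IsLinear k (idealSum 𝒜 k W Λ) (genFam 𝒜 1 Λ)) :
    ∃ y ∈ 𝒜 1, y ∉ Λ ∧ IsGoodForm 𝒜 k W Λ y := by
  set Q := idealSum 𝒜 k W Λ with hQ
  have hQw : Q ≤ wholeFam 𝒜 := idealSum_le hW hΛ
  -- choose `y` outside `Λ` and outside the associated primes of the part of `R / Q` in degrees
  -- `≥ k`; none of these primes contains all linear forms, because there is no socle in degrees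
  -- `≥ k`
  let T : Submodule R (R ⧸ toIdeal Q) :=
    Submodule.map (toIdeal Q).mkQ (toIdeal (trunc (wholeFam 𝒜) k))
  have hfin := associatedPrimes.finite R T
  let S : Set (Submodule K R) :=
    insert Λ ((fun p : Ideal R => p.restrictScalars K) '' associatedPrimes R T)
  obtain ⟨y, hy, hyS⟩ := exists_mem_notMem_of_finite (A := 𝒜 1) (S := S)
    ((hfin.image _).insert Λ) (by
      rintro p (rfl | ⟨p, hp, rfl⟩)
      · exact fun hle => hne (le_antisymm hΛ hle)
      · intro hle
        obtain ⟨hprime, ⟨t, ht⟩, rfl⟩ := (isAssociatedPrime_iff).1 hp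
        obtain ⟨f, hf, rfl⟩ := ht
        have hzero : ∀ v ∈ 𝒜 1, v * f ∈ toIdeal Q := by
          intro v hv
          have h1 := hle hv
          have h2 := Submodule.mem_colon_singleton.1 h1
          have h3 : v • (toIdeal Q).mkQ f = 0 := congrArg Subtype.val h2
          rw [← map_smul, Submodule.mkQ_apply, Submodule.Quotient.mk_eq_zero] at h3
          exact h3
        have hfQ : f ∈ toIdeal Q := by
          rw [mem_toIdeal_iff hQw]
          intro j
          rcases lt_or_ge j k with hj | hj
          · have := (mem_toIdeal_iff (trunc_le _ _)).1 hf j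
            rw [trunc_of_lt _ hj, Submodule.mem_bot] at this
            rw [this]
            exact zero_mem _
          · refine h.mem_of_socle hW hΛ hne hlin hj (SetLike.coe_mem _) fun v hv => ?_
            have := (mem_toIdeal_iff hQw).1 (hzero v hv) (1 + j)
            rwa [DirectSum.coe_decompose_mul_add_of_left_mem 𝒜 hv] at this
        refine hprime.ne_top ?_
        rw [Ideal.eq_top_iff_one, Submodule.mem_colon_singleton, one_smul, Submodule.mem_bot]
        refine Subtype.ext ?_
        change (toIdeal Q).mkQ f = 0
        rwa [Submodule.mkQ_apply, Submodule.Quotient.mk_eq_zero])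
  refine ⟨y, hy, hyS Λ (Set.mem_insert _ _), ?_⟩
  have hnzd : ∀ j, k ≤ j → ∀ f ∈ 𝒜 j, f * y ∈ Q (j + 1) → f ∈ Q j := by
    intro j hj f hf hfy
    by_contra hfQ
    have hfT : (toIdeal Q).mkQ f ∈ T :=
      ⟨f, mem_toIdeal_of_mem (j := j) (by rwa [trunc_of_le _ hj]), rfl⟩
    have hmem : y ∈ ⋃ p ∈ associatedPrimes R T, (p : Set R) := by
      rw [biUnion_associatedPrimes_eq_zero_divisors]
      refine ⟨⟨_, hfT⟩, ?_, ?_⟩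
      · intro h0
        have h0' : (toIdeal Q).mkQ f = 0 := congrArg Subtype.val h0
        rw [Submodule.mkQ_apply, Submodule.Quotient.mk_eq_zero] at h0'
        exact hfQ ((mem_toIdeal_iff_of_mem hQw hf).1 h0')
      · refine Subtype.ext ?_
        change y • (toIdeal Q).mkQ f = 0
        rw [← map_smul, Submodule.mkQ_apply, Submodule.Quotient.mk_eq_zero, smul_eq_mul, mul_comm]
        exact mem_toIdeal_of_mem hfy
    obtain ⟨p, hp, hyp⟩ := Set.mem_iUnion₂.1 hmem
    exact hyS _ (Set.mem_insert_of_mem _ ⟨p, hp, rfl⟩) hyp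
  intro j hj r hr hr'
  obtain ⟨j, rfl⟩ : ∃ j', j = j' + 1 := ⟨j - 1, by omega⟩
  rw [genFam_sup, sup_apply] at hr'
  obtain ⟨l, hl, w, hw, rfl⟩ := Submodule.mem_sup.1 hr'
  obtain ⟨f, hf, rfl⟩ := mem_genFam_span_singleton.1 hw
  have hfy : f * y ∈ Q (j + 1) := by
    have := sub_mem hr (GradedFamily.le_sup_right (genFam 𝒜 k W) _ _ hl)
    rwa [add_sub_cancel_left] at this
  exact Submodule.add_mem_sup hl (map_mem_imFam (rmul y) (hnzd j (by omega) f hf hfy))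

end Poly

/-! ### Cartan cochains -/

section Division

variable {K : Type u} [Field K] {τ : Type w} [DecidableEq τ]

/-- The quotient of the division of a polynomial by the variable `X a`. -/
def divX (a : τ) : MvPolynomial τ K →ₗ[K] MvPolynomial τ K where
  toFun f := f.divMonomial (Finsupp.single a 1)
  map_add' f g := MvPolynomial.add_divMonomial f g _
  map_smul' c f := by
    ext α
    simp only [MvPolynomial.coeff_divMonomial, MvPolynomial.coeff_smul, RingHom.id_apply]

theorem coeff_divX (a : τ) (f : MvPolynomial τ K) (α : τ →₀ ℕ) :
    (divX a f).coeff α = f.coeff (Finsupp.single a 1 + α) :=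
  MvPolynomial.coeff_divMonomial _ _ _

theorem divX_X_mul_self (a : τ) (f : MvPolynomial τ K) : divX a (MvPolynomial.X a * f) = f :=
  MvPolynomial.X_mul_divMonomial a f

theorem divX_X_mul {a b : τ} (hab : b ≠ a) (f : MvPolynomial τ K) :
    divX a (MvPolynomial.X b * f) = MvPolynomial.X b * divX a f := by
  ext α
  rw [coeff_divX, MvPolynomial.coeff_X_mul', MvPolynomial.coeff_X_mul', coeff_divX]
  have h1 : b ∈ (Finsupp.single a 1 + α).support ↔ b ∈ α.support := by
    simp [hab.symm]
  simp only [h1]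
  split_ifs with h
  · congr 1
    ext c
    have hb : α b ≠ 0 := Finsupp.mem_support_iff.1 h
    simp only [Finsupp.coe_tsub, Finsupp.coe_add, Pi.sub_apply, Pi.add_apply, Finsupp.single_apply]
    by_cases hc : b = c
    · subst hc
      simp [hab.symm]
    · simp [hc]
  · rfl

/-- The remainder of the division of a polynomial by the variable `X a`. -/
def modX (a : τ) : MvPolynomial τ K →ₗ[K] MvPolynomial τ K :=
  LinearMap.id - (LinearMap.mulLeft K (MvPolynomial.X a)) ∘ₗ divX a

theorem modX_apply (a : τ) (f : MvPolynomial τ K) :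
    modX a f = f - MvPolynomial.X a * divX a f := rfl

variable (K τ) in
/-- The polynomials of degree less than `s`. -/
def degLT (s : ℕ) : Submodule K (MvPolynomial τ K) where
  carrier := {f | ∀ α : τ →₀ ℕ, s ≤ α.degree → f.coeff α = 0}
  add_mem' hf hg α hα := by rw [MvPolynomial.coeff_add, hf α hα, hg α hα, add_zero]
  zero_mem' α _ := MvPolynomial.coeff_zero α
  smul_mem' c f hf α hα := by rw [MvPolynomial.coeff_smul, hf α hα, smul_zero]

theorem degLT_zero {f : MvPolynomial τ K} (hf : f ∈ degLT K τ 0) : f = 0 := by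
  ext α
  rw [hf α (Nat.zero_le _), MvPolynomial.coeff_zero]

theorem mem_degLT_of_le {s t : ℕ} (hst : s ≤ t) {f : MvPolynomial τ K} (hf : f ∈ degLT K τ s) :
    f ∈ degLT K τ t := fun α hα => hf α (hst.trans hα)

theorem exists_mem_degLT (f : MvPolynomial τ K) : ∃ s, f ∈ degLT K τ s := by
  refine ⟨f.totalDegree + 1, fun α hα => ?_⟩
  by_contra h
  have := MvPolynomial.le_totalDegree (MvPolynomial.mem_support_iff.2 h)
  have e : α.degree = α.sum fun _ e => e := rfl
  omega

theorem divX_mem_degLT {a : τ} {s : ℕ} {f : MvPolynomial τ K} (hf : f ∈ degLT K τ (s + 1)) :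
    divX a f ∈ degLT K τ s := by
  intro α hα
  rw [coeff_divX]
  apply hf
  rw [map_add, Finsupp.degree_single]
  omega

theorem modX_mem_degLT {a : τ} {s : ℕ} {f : MvPolynomial τ K} (hf : f ∈ degLT K τ s) :
    modX a f ∈ degLT K τ s := by
  refine sub_mem hf fun α hα => ?_
  change (MvPolynomial.X a * divX a f).coeff α = 0
  rw [MvPolynomial.coeff_X_mul', coeff_divX]
  split_ifs with h
  · apply hf
    rwa [add_comm, tsub_add_cancel_of_le]
    rw [Finsupp.single_le_iff]
    exact Nat.one_le_iff_ne_zero.2 (Finsupp.mem_support_iff.1 h)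
  · rfl

end Division

section Cartan

variable {K : Type u} [Field K] {R : Type v} [Ring R] [Algebra K R]
variable {M : Type v} [AddCommGroup M] [Module K M] [Module R M] [IsScalarTower K R M]
variable {N : Type v} [AddCommGroup N] [Module K N] [Module R N] [IsScalarTower K R N]
variable {τ : Type w} [Fintype τ] [DecidableEq τ] {e : τ → R}

/-- The Cartan differential on functionals with polynomial values, `λ ↦ ∑ X_a λ(e_a x)`. -/
def cartan (e : τ → R) (l : N →ₗ[K] MvPolynomial τ K) : N →ₗ[K] MvPolynomial τ K :=
  ∑ a, LinearMap.mulLeft K (MvPolynomial.X a) ∘ₗ l ∘ₗ Algebra.lsmul K K N (e a)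

theorem cartan_apply (l : N →ₗ[K] MvPolynomial τ K) (x : N) :
    cartan e l x = ∑ a, MvPolynomial.X a * l (e a • x) := by
  simp [cartan, LinearMap.sum_apply]

theorem cartan_add (l l' : N →ₗ[K] MvPolynomial τ K) :
    cartan e (l + l') = cartan e l + cartan e l' := by
  ext1 x
  simp only [cartan_apply, LinearMap.add_apply, mul_add, Finset.sum_add_distrib]

theorem cartan_sub (l l' : N →ₗ[K] MvPolynomial τ K) :
    cartan e (l - l') = cartan e l - cartan e l' := by
  ext1 x
  simp only [cartan_apply, LinearMap.sub_apply, mul_sub, Finset.sum_sub_distrib]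

theorem cartan_cartan (hsq : ∀ a, e a * e a = 0) (hanti : ∀ a b, e a * e b + e b * e a = 0)
    (l : N →ₗ[K] MvPolynomial τ K) : cartan e (cartan e l) = 0 := by
  ext1 x
  simp only [cartan_apply, LinearMap.zero_apply, Finset.mul_sum]
  rw [← Finset.sum_product']
  refine Finset.sum_involution (fun p _ => (p.2, p.1)) ?_ ?_ (fun _ _ => by simp)
    fun _ _ => rfl
  · rintro ⟨a, b⟩ -
    rw [← mul_smul, ← mul_smul, mul_left_comm (MvPolynomial.X b), ← mul_add, ← mul_add, ← map_add,
      ← add_smul, hanti, zero_smul, map_zero, mul_zero, mul_zero]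
  · rintro ⟨a, b⟩ - h hab
    obtain rfl : b = a := congrArg Prod.fst hab
    apply h
    rw [← mul_smul, hsq, zero_smul, map_zero, mul_zero, mul_zero]

/-- Contractions, dual to the multiplications by the `e_a`, make the Cartan complex of a graded
module exact; the contracting homotopies are `λ ↦ (λ ∘ ι_a) / X_a`. -/
theorem exists_cartan_of_contraction {𝒜 : ℕ → Submodule K R} [GradedAlgebra 𝒜]
    (hspan : Submodule.span K (Set.range e) = 𝒜 1) (hsq : ∀ a, e a * e a = 0)
    (hanti : ∀ a b, e a * e b + e b * e a = 0) {ι : τ → N →ₗ[K] N}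
    (hι : ∀ a b x, ι a (e b • x) + e b • ι a x = if a = b then x else 0)
    {F : GradedFamily N 𝒜} {j : ℕ} (hF : F (j + 1) ≤ smulSpan (𝒜 1) (F j))
    (hdeg : ∀ a j, ∀ x ∈ F (j + 1), ι a x ∈ F j) {s : ℕ} {l : N →ₗ[K] MvPolynomial τ K}
    (hl : ∀ x ∈ F (j + 1), l x ∈ degLT K τ (s + 1)) (hcyc : ∀ x ∈ F j, cartan e l x = 0) :
    ∃ ν : N →ₗ[K] MvPolynomial τ K, (∀ x ∈ F (j + 2), ν x ∈ degLT K τ s) ∧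
      ∀ x ∈ F (j + 1), l x = cartan e ν x := by
  have hmem : ∀ a, e a ∈ 𝒜 1 := fun a => hspan ▸ Submodule.subset_span ⟨a, rfl⟩
  have heF : ∀ a j, ∀ x ∈ F j, e a • x ∈ F (j + 1) := fun a j x hx => by
    rw [add_comm]
    exact F.smul_mem (hmem a) hx
  -- remove the variables one at a time
  have key : ∀ t : Finset τ, ∃ ν l' : N →ₗ[K] MvPolynomial τ K,
      (∀ x ∈ F (j + 2), ν x ∈ degLT K τ s) ∧ (∀ x ∈ F (j + 1), l' x ∈ degLT K τ (s + 1)) ∧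
      (∀ x ∈ F j, cartan e l' x = 0) ∧ (∀ x ∈ F (j + 1), l x = cartan e ν x + l' x) ∧
      ∀ b ∈ t, ∀ x, l' (e b • x) = 0 := by
    intro t
    induction t using Finset.induction_on with
    | empty => exact ⟨0, l, fun _ _ => zero_mem _, hl, hcyc,
        fun x _ => by simp [cartan_apply], by simp⟩
    | insert a t ha ih =>
      obtain ⟨ν, l', hν, hl', hcyc', hsum, hzero⟩ := ih
      let l'' : N →ₗ[K] MvPolynomial τ K := modX a ∘ₗ l' ∘ₗ ι a ∘ₗ Algebra.lsmul K K N (e a)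
      let θ : N →ₗ[K] MvPolynomial τ K := divX a ∘ₗ l' ∘ₗ ι a
      have hl'' : ∀ x, l'' x = modX a (l' (ι a (e a • x))) := fun x => rfl
      have hθ : ∀ x, θ x = divX a (l' (ι a x)) := fun x => rfl
      have hhom : ∀ x ∈ F (j + 1), l' x = cartan e θ x + l'' x := by
        intro x hx
        have h0 := congrArg (divX a) (hcyc' _ (hdeg a j x hx))
        have hib : ∀ b, b ≠ a → ι a (e b • x) = -(e b • ι a x) := fun b hb => by
          rw [eq_neg_iff_add_eq_zero, hι, if_neg hb.symm]
        have hia : ι a (e a • x) = x - e a • ι a x := by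
          rw [eq_sub_iff_add_eq, hι, if_pos rfl]
        rw [cartan_apply, map_zero, ← Finset.add_sum_erase _ _ (Finset.mem_univ a), map_add, map_sum,
          divX_X_mul_self] at h0
        rw [cartan_apply, ← Finset.add_sum_erase _ _ (Finset.mem_univ a), hl'', hθ, modX_apply]
        have h1 : ∑ b ∈ Finset.univ.erase a, MvPolynomial.X b * θ (e b • x) =
            - ∑ b ∈ Finset.univ.erase a, divX a (MvPolynomial.X b * l' (e b • ι a x)) := by
          rw [← Finset.sum_neg_distrib]
          refine Finset.sum_congr rfl fun b hb => ?_
          rw [hθ, hib b (Finset.ne_of_mem_erase hb), divX_X_mul (Finset.ne_of_mem_erase hb), map_neg,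
            map_neg, mul_neg]
        rw [h1, ← eq_neg_of_add_eq_zero_left h0, hia, map_sub]
        ring
      refine ⟨ν + θ, l'', ?_, ?_, ?_, ?_, ?_⟩
      · exact fun x hx => add_mem (hν x hx) (divX_mem_degLT (hl' _ (hdeg a _ x hx)))
      · exact fun x hx => modX_mem_degLT (hl' _ (hdeg a _ _ (heF a _ x hx)))
      · intro x hx
        have h1 : cartan e l'' x = cartan e (l' - cartan e θ) x := by
          simp only [cartan_apply]
          refine Finset.sum_congr rfl fun b _ => ?_
          rw [LinearMap.sub_apply, hhom _ (heF b j x hx), add_sub_cancel_left]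
        rw [h1, cartan_sub, cartan_cartan hsq hanti, sub_zero]
        exact hcyc' x hx
      · intro x hx
        rw [hsum x hx, hhom x hx, cartan_add, LinearMap.add_apply, add_assoc]
      · intro b hb x
        rw [hl'']
        rcases Finset.mem_insert.1 hb with rfl | hb
        · rw [← mul_smul, hsq, zero_smul, map_zero, map_zero, map_zero]
        · have hba : a ≠ b := fun h => ha (h ▸ hb)
          have h1 : e a • e b • x = -(e b • e a • x) := by
            rw [eq_neg_iff_add_eq_zero, ← mul_smul, ← mul_smul, ← add_smul, hanti, zero_smul]
          have h2 : ι a (e b • e a • x) = -(e b • ι a (e a • x)) := by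
            rw [eq_neg_iff_add_eq_zero, hι, if_neg hba]
          rw [h1, map_neg, h2, neg_neg, hzero b hb, map_zero]
  obtain ⟨ν, l', hν, -, -, hsum, hzero⟩ := key Finset.univ
  refine ⟨ν, hν, fun x hx => ?_⟩
  have h0 : smulSpan (𝒜 1) (F j) ≤ LinearMap.ker l' := by
    refine smulSpan_le.2 fun r hr m _ => ?_
    rw [← hspan] at hr
    suffices h : Submodule.span K (Set.range e) ≤
      (LinearMap.ker l').comap ((Algebra.lsmul K K N).toLinearMap.flip m) from h hr
    rw [Submodule.span_le]
    rintro _ ⟨b, rfl⟩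
    exact hzero b (Finset.mem_univ b) m
  rw [hsum x hx, LinearMap.mem_ker.1 (h0 (hF hx)), add_zero]

end Cartan

/-! ### Exactness of the Cartan complex beyond the linear strand -/

section Factor

variable {K : Type*} [Field K] {V W S : Type*} [AddCommGroup V] [Module K V]
variable [AddCommGroup W] [Module K W] [AddCommGroup S] [Module K S]

theorem exists_comp_eq_of_ker_le (f : V →ₗ[K] W) (g : V →ₗ[K] S)
    (h : LinearMap.ker f ≤ LinearMap.ker g) : ∃ μ : W →ₗ[K] S, ∀ x, μ (f x) = g x := by
  obtain ⟨π, hπ⟩ := LinearMap.exists_leftInverse_of_injective ((LinearMap.ker f).liftQ f le_rfl)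
    (Submodule.ker_liftQ_eq_bot _ _ _ le_rfl)
  refine ⟨(LinearMap.ker f).liftQ g h ∘ₗ π, fun x => ?_⟩
  have := LinearMap.congr_fun hπ (Submodule.Quotient.mk x)
  rw [LinearMap.comp_apply, Submodule.liftQ_apply] at this
  rw [LinearMap.comp_apply, this, LinearMap.id_apply, Submodule.liftQ_apply]

/-- If `g` vanishes on the part of `F` that `π` maps to `Q`, then it factors on `F` through `π`, by
a map that vanishes on `Q`. -/
theorem exists_descend (π : V →ₗ[K] W) (g : V →ₗ[K] S) {F : Submodule K V} {Q : Submodule K W}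
    (h : ∀ x ∈ F, π x ∈ Q → g x = 0) :
    ∃ μ : W →ₗ[K] S, (∀ x ∈ F, μ (π x) = g x) ∧ ∀ x ∈ Q, μ x = 0 := by
  obtain ⟨μ, hμ⟩ := exists_comp_eq_of_ker_le ((π ∘ₗ F.subtype).coprod Q.subtype)
    ((g ∘ₗ F.subtype).coprod 0) (by
      intro z hxq
      obtain ⟨⟨x, hx⟩, ⟨q, hq⟩⟩ := z
      have hxq : π x + q = 0 := hxq
      change g x + 0 = 0
      rw [add_zero]
      refine h x hx ?_
      rw [eq_neg_of_add_eq_zero_left hxq]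
      exact neg_mem hq)
  refine ⟨μ, fun x hx => ?_, fun x hx => ?_⟩
  · have : μ (π x + 0) = g x + 0 := hμ (⟨x, hx⟩, 0)
    rwa [add_zero, add_zero] at this
  · have : μ (π 0 + x) = g 0 + 0 := hμ (0, ⟨x, hx⟩)
    rwa [map_zero, map_zero, zero_add, zero_add] at this

end Factor

section CartanExact

variable {K : Type u} [Field K] {R : Type v} [Ring R] [Algebra K R]
variable {M : Type v} [AddCommGroup M] [Module K M] [Module R M] [IsScalarTower K R M]
variable {𝒜 : ℕ → Submodule K R} [GradedAlgebra 𝒜] {n : ℕ} {ε η : K} {k : ℕ}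
variable {τ : Type w} [Fintype τ] [DecidableEq τ]

variable (𝒜) in
/-- The linear forms `e_a` are the generators of an exterior algebra, and `ι_a` is the contraction
with the dual of `e_a`. -/
structure HasContractions (e : τ → R) (ι : τ → R →ₗ[K] R) : Prop where
  span : Submodule.span K (Set.range e) = 𝒜 1
  sq : ∀ a, e a * e a = 0
  anti : ∀ a b, e a * e b + e b * e a = 0
  leibniz : ∀ a b x, ι a (e b * x) + e b * ι a x = if a = b then x else 0
  one : ∀ a, ι a 1 = 0
  lower : ∀ a j, ∀ x ∈ 𝒜 (j + 1), ι a x ∈ 𝒜 j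

variable {e : τ → R} {ι : τ → R →ₗ[K] R}

theorem freeFamily_le_smulSpan (h : KoszulModel 𝒜 n ε η) {U : Type v} [AddCommGroup U]
    [Module K U] {j : ℕ} (hkj : k ≤ j) :
    freeFamily 𝒜 U k (j + 1) ≤ smulSpan (𝒜 1) (freeFamily 𝒜 U k j) := by
  rw [freeFamily_le]
  intro a ha r hr u
  obtain ⟨a, rfl⟩ : ∃ b, a = b + 1 := ⟨a - 1, by omega⟩
  obtain rfl : j = a + k := by omega
  suffices h' : 𝒜 1 * 𝒜 a ≤ (smulSpan (𝒜 1) (freeFamily 𝒜 U k (a + k))).comap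
    ((TensorProduct.mk K R U).flip u) from h' (h.succ_deg a hr)
  refine Submodule.mul_le.2 fun v hv s hs => ?_
  change (v * s) ⊗ₜ[K] u ∈ smulSpan (𝒜 1) (freeFamily 𝒜 U k (a + k))
  rw [← smul_eq_mul, ← TensorProduct.smul_tmul']
  exact smul_mem_smulSpan hv (tmul_mem_freeFamily hs u)

/-- Free modules over the exterior algebra have exact Cartan complexes, with cochains of lower
polynomial degree. -/
theorem HasContractions.exists_cartan_freeFamily (hc : HasContractions 𝒜 e ι)
    (h : KoszulModel 𝒜 n ε η) {U : Type v} [AddCommGroup U] [Module K U] {j : ℕ} (hkj : k ≤ j)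
    {s : ℕ} {l : R ⊗[K] U →ₗ[K] MvPolynomial τ K}
    (hl : ∀ x ∈ freeFamily 𝒜 U k (j + 1), l x ∈ degLT K τ (s + 1))
    (hcyc : ∀ x ∈ freeFamily 𝒜 U k j, cartan e l x = 0) :
    ∃ ν : R ⊗[K] U →ₗ[K] MvPolynomial τ K,
      (∀ x ∈ freeFamily 𝒜 U k (j + 2), ν x ∈ degLT K τ s) ∧
      ∀ x ∈ freeFamily 𝒜 U k (j + 1), l x = cartan e ν x := by
  refine exists_cartan_of_contraction hc.span hc.sq hc.anti
    (ι := fun a => (ι a).rTensor U) ?_ (freeFamily_le_smulSpan h hkj) ?_ hl hcyc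
  · intro a b x
    induction x with
    | zero => simp
    | add x y hx hy =>
      rw [smul_add, map_add, map_add, smul_add, add_add_add_comm, hx, hy]
      split_ifs <;> simp
    | tmul r u =>
      rw [TensorProduct.smul_tmul', LinearMap.rTensor_tmul, LinearMap.rTensor_tmul,
        TensorProduct.smul_tmul', ← TensorProduct.add_tmul, smul_eq_mul, smul_eq_mul, hc.leibniz]
      split_ifs
      · rfl
      · rw [TensorProduct.zero_tmul]
  · intro a j x hx
    suffices h' : freeFamily 𝒜 U k (j + 1) ≤
      (freeFamily 𝒜 U k j).comap ((ι a).rTensor U) from h' hx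
    rw [freeFamily_le]
    intro c hcj r hr u
    change ι a r ⊗ₜ[K] u ∈ freeFamily 𝒜 U k j
    obtain _ | c := c
    · obtain ⟨c, rfl⟩ := Submodule.mem_span_singleton.1 (h.zero_deg hr)
      rw [map_smul, hc.one, smul_zero, TensorProduct.zero_tmul]
      exact zero_mem _
    · obtain rfl : j = c + k := by omega
      exact tmul_mem_freeFamily (hc.lower a c r hr) u

/-- Beyond the degree of its generators, a module with linear resolution has exact Cartan complex:
a functional on `P / Q` with polynomial values that is a cocycle is a coboundary. -/
theorem HasContractions.exists_cartan [∀ a, Module.Finite K (𝒜 a)] (hc : HasContractions 𝒜 e ι)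
    (h : KoszulModel 𝒜 n ε η) {P Q : GradedFamily M 𝒜} (hP : P.FinDim)
    (hlin : IsLinear k P Q) {j : ℕ} (hkj : k ≤ j) {s : ℕ} {l : M →ₗ[K] MvPolynomial τ K}
    (hlQ : ∀ x ∈ Q (j + 1), l x = 0)
    (hl : ∀ x ∈ P (j + 1), l x ∈ degLT K τ s) (hcyc : ∀ x ∈ P j, cartan e l x = 0) :
    ∃ μ : M →ₗ[K] MvPolynomial τ K, (∀ x ∈ Q (j + 2), μ x = 0) ∧
      ∀ x ∈ P (j + 1), l x = cartan e μ x := by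
  induction s generalizing M k j with
  | zero => exact ⟨0, fun _ _ => rfl, fun x hx => by
      rw [degLT_zero (hl x hx), cartan_apply]
      simp⟩
  | succ s ih =>
    have hmem : ∀ a, e a ∈ 𝒜 1 := fun a => hc.span ▸ Submodule.subset_span ⟨a, rfl⟩
    -- induction on the polynomial degree, for all modules at once: present `P / Q` as `F / A`
    obtain ⟨U, hUfin, hUP, hF1, hF2, hA0⟩ := exists_presentation h.zero_deg hP
      (h.le_genFam_sup (k := k) hP fun j hj => hlin 0 j (by rwa [zero_add]))
    set π := freeLift (R := R) U.subtype with hπ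
    set F := freeFamily 𝒜 U k with hFdef
    set A := preFam π F Q with hA
    have hFfin : F.FinDim := freeFamily_finDim
    have hAF : A ≤ F := preFam_le _ _ _
    have heF : ∀ a j, ∀ x ∈ F j, e a • x ∈ F (j + 1) := fun a j x hx => by
      rw [add_comm]
      exact F.smul_mem (hmem a) hx
    have hcomp : ∀ (l : M →ₗ[K] MvPolynomial τ K) x,
        cartan e (l ∘ₗ π.restrictScalars K) x = cartan e l (π x) := fun l x => by
      rw [cartan_apply, cartan_apply]
      refine Finset.sum_congr rfl fun a _ => ?_
      change _ * l (π (e a • x)) = _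
      rw [map_smul]
    -- the syzygies `A` have a `(k + 1)`-linear resolution
    have hAlin : IsLinear (k + 1) A ⊥ := by
      intro i c hic
      by_cases hck : c < i + (k + 1)
      · exact relBetti_eq_zero_of_lt (k := k + 1) hA0 hck
      · have h1 : relBetti F A (i + 1) c = 0 := by
          rw [hA, relBetti_preFam hF1 hF2]
          exact hlin _ _ (by omega)
        have h2 : relBetti F ⊥ i c = 0 := h.isLinear_freeFamily _ _ (by omega)
        have := relBetti_sub_le_add (GradedFamily.bot_le A) hAF hFfin i c
        omega
    -- on `F` the cocycle is the coboundary of `ν`, of lower degree; on `A` it vanishes, so `ν` is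
    -- a cocycle there, and is corrected by `ρ` to a map that descends to `P / Q`
    obtain ⟨ν, hνdeg, hν⟩ := hc.exists_cartan_freeFamily h hkj
      (l := l ∘ₗ π.restrictScalars K) (fun x hx => hl _ (hF1 _ x hx))
      (fun x hx => by rw [hcomp]; exact hcyc _ (hF1 _ x hx))
    obtain ⟨ρ, -, hρ⟩ := ih (hFfin.mono hAF) hAlin (j := j + 1) (by omega) (l := ν)
      (fun x hx => by
        rw [bot_apply, Submodule.mem_bot] at hx
        rw [hx, map_zero])
      (fun x hx => hνdeg x hx.1)
      (fun x hx => by rw [← hν x hx.1]; exact hlQ _ hx.2)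
    obtain ⟨μ, hμF, hμQ⟩ := exists_descend (π.restrictScalars K) (ν - cartan e ρ)
      (F := F (j + 2)) (Q := Q (j + 2)) (fun x hx hxQ => by
        rw [LinearMap.sub_apply, hρ x ⟨hx, hxQ⟩, sub_self])
    refine ⟨μ, hμQ, fun x hx => ?_⟩
    obtain ⟨y, hy, hyx⟩ := hF2 _ x hx
    have h1 : cartan e μ (x - π y) = 0 := by
      rw [cartan_apply]
      refine Finset.sum_eq_zero fun a _ => ?_
      have := Q.smul_mem (hmem a) hyx
      rw [add_comm 1] at this
      rw [hμQ _ this, mul_zero]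
    have h2 : cartan e μ (π y) = cartan e (ν - cartan e ρ) y := by
      rw [cartan_apply, cartan_apply]
      refine Finset.sum_congr rfl fun a _ => ?_
      have := hμF _ (heF a _ y hy)
      rw [LinearMap.coe_restrictScalars, map_smul] at this
      rw [this]
    rw [cartan_sub, cartan_cartan hc.sq hc.anti, sub_zero, ← hν y hy] at h2
    have h3 := hlQ _ hyx
    rw [map_sub, sub_eq_zero] at h1 h3
    rw [h3, h1, h2]
    rfl

end CartanExact

/-! ### Generic members of linear families of maps -/

section Generic

variable {K : Type u} [Field K] [Infinite K] {τ : Type w} [Fintype τ]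
variable {X Y : Type v} [AddCommGroup X] [Module K X] [AddCommGroup Y] [Module K Y]

/-- The member `∑ y_a A_a` of the linear family of maps spanned by the `A_a`. -/
def famMap (A : τ → X →ₗ[K] Y) (y : τ → K) : X →ₗ[K] Y := ∑ a, y a • A a

theorem famMap_apply (A : τ → X →ₗ[K] Y) (y : τ → K) (x : X) :
    famMap A y x = ∑ a, y a • A a x := by
  simp [famMap, LinearMap.sum_apply]

/-- The polynomial in `y` given by a functional on `∑ y_a A_a x`. -/
def famPoly (A : τ → X →ₗ[K] Y) (x : X) (ξ : Y →ₗ[K] K) : MvPolynomial τ K :=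
  ∑ a, MvPolynomial.X a * MvPolynomial.C (ξ (A a x))

theorem eval_famPoly (A : τ → X →ₗ[K] Y) (x : X) (ξ : Y →ₗ[K] K) (y : τ → K) :
    MvPolynomial.eval y (famPoly A x ξ) = ξ (famMap A y x) := by
  simp [famPoly, famMap_apply, map_sum]

/-- For general `y`, each vector `v` outside of the image of `A_y = ∑ y_a A_a` is detected by a
polynomial family of functionals `l` with `l_z ∘ A_z = 0` for all `z`. -/
theorem exists_generic_cocycle [Module.Finite K X] (A : τ → X →ₗ[K] Y) :
    ∃ p : MvPolynomial τ K, p ≠ 0 ∧ ∀ y, MvPolynomial.eval y p ≠ 0 → ∀ v : Y,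
      v ∉ LinearMap.range (famMap A y) → ∃ l : Y →ₗ[K] MvPolynomial τ K,
        (∀ x, ∑ a, MvPolynomial.X a * l (A a x) = 0) ∧ MvPolynomial.eval y (l v) ≠ 0 := by
  classical
  -- a member of maximal rank
  obtain ⟨y₀, hy₀⟩ : ∃ y₀, ∀ y, Module.finrank K (LinearMap.range (famMap A y)) ≤
      Module.finrank K (LinearMap.range (famMap A y₀)) := by
    have hfin : (Set.range fun y => Module.finrank K (LinearMap.range (famMap A y))).Finite :=
      (Set.finite_Iic (Module.finrank K X)).subset (by
        rintro _ ⟨y, rfl⟩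
        exact LinearMap.finrank_range_le _)
    obtain ⟨_, ⟨y₀, rfl⟩, h⟩ := hfin.exists_maximal (Set.range_nonempty _)
    refine ⟨y₀, fun y => ?_⟩
    rcases le_total (Module.finrank K (LinearMap.range (famMap A y)))
      (Module.finrank K (LinearMap.range (famMap A y₀))) with h' | h'
    · exact h'
    · exact h ⟨y, rfl⟩ h'
  set r := Module.finrank K (LinearMap.range (famMap A y₀)) with hr
  -- vectors `u_j` and functionals `φ_i` for which the matrix `φ_i (A_z u_j)` is the identity at
  -- `z = y₀`
  let b : Module.Basis (Fin r) K (LinearMap.range (famMap A y₀)) := Module.finBasis K _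
  choose u hu using fun i => LinearMap.mem_range.1 (b i).2
  obtain ⟨π, hπ⟩ := LinearMap.exists_leftInverse_of_injective
    (LinearMap.range (famMap A y₀)).subtype (Submodule.ker_subtype _)
  let φ : Fin r → Y →ₗ[K] K := fun i => b.coord i ∘ₗ π
  have hφ : ∀ i j, φ i (famMap A y₀ (u j)) = if i = j then 1 else 0 := by
    intro i j
    have h1 : π (b j : Y) = b j := LinearMap.congr_fun hπ (b j)
    change b.coord i (π (famMap A y₀ (u j))) = _
    rw [hu, h1, Module.Basis.coord_apply, b.repr_self, Finsupp.single_apply]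
    simp only [eq_comm]
  let Φ : Matrix (Fin r) (Fin r) (MvPolynomial τ K) := fun i j => famPoly A (u j) (φ i)
  let Φe : (τ → K) → Matrix (Fin r) (Fin r) K := fun y i j => φ i (famMap A y (u j))
  have hΦe : ∀ y, (MvPolynomial.eval y).mapMatrix Φ = Φe y := by
    intro y
    ext i j
    exact eval_famPoly A (u j) (φ i) y
  have hdet : ∀ y, MvPolynomial.eval y Φ.det = (Φe y).det := fun y => by
    rw [RingHom.map_det, hΦe]
  have hadj : ∀ y i j, MvPolynomial.eval y (Φ.adjugate i j) = (Φe y).adjugate i j := fun y i j => by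
    rw [← hΦe, ← RingHom.map_adjugate]
    rfl
  have hp : Φ.det ≠ 0 := by
    intro h0
    have h1 := hdet y₀
    have h2 : Φe y₀ = 1 := by
      ext i j
      rw [Matrix.one_apply]
      exact hφ i j
    rw [h0, map_zero, h2, Matrix.det_one] at h1
    exact zero_ne_one h1
  -- where the determinant does not vanish, the `A_y u_i` are a basis of the image of `A_y`
  have hspan : ∀ y, (Φe y).det ≠ 0 → ∀ x, ∃ c : Fin r → K,
      famMap A y x = ∑ i, c i • famMap A y (u i) := by
    intro y hy x
    have hli : LinearIndependent K fun i => famMap A y (u i) := by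
      rw [Fintype.linearIndependent_iff]
      intro c hc
      have h1 : (Φe y).mulVec c = 0 := by
        ext i
        have := congrArg (φ i) hc
        simp only [map_sum, map_smul, map_zero, smul_eq_mul] at this
        simp only [Matrix.mulVec, dotProduct, Pi.zero_apply]
        rw [← this]
        exact Finset.sum_congr rfl fun j _ => mul_comm _ _
      exact fun i => congrFun (Matrix.eq_zero_of_mulVec_eq_zero hy h1) i
    have hle : Submodule.span K (Set.range fun i => famMap A y (u i)) ≤
        LinearMap.range (famMap A y) := by
      rw [Submodule.span_le]
      rintro _ ⟨i, rfl⟩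
      exact ⟨u i, rfl⟩
    have heq := Submodule.eq_of_le_of_finrank_le hle (by
      rw [finrank_span_eq_card hli, Fintype.card_fin]
      exact hy₀ y)
    have hx : famMap A y x ∈ Submodule.span K (Set.range fun i => famMap A y (u i)) := by
      rw [heq]
      exact ⟨x, rfl⟩
    obtain ⟨c, hc⟩ := (Submodule.mem_span_range_iff_exists_fun K).1 hx
    exact ⟨c, hc.symm⟩
  refine ⟨Φ.det, hp, fun y hy v hv => ?_⟩
  -- a functional `ξ` that detects `v` and vanishes on the image of `A_y` is corrected by Cramer's
  -- rule to a polynomial family that vanishes on the image of `A_z` for general `z`, hence for all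
  -- `z`
  obtain ⟨ξ, hξv, hξ⟩ := Submodule.exists_dual_map_eq_bot_of_notMem hv inferInstance
  have hξA : ∀ x, ξ (famMap A y x) = 0 := fun x => by
    have : ξ (famMap A y x) ∈ (LinearMap.range (famMap A y)).map ξ := ⟨_, ⟨x, rfl⟩, rfl⟩
    rwa [hξ] at this
  let l : Y →ₗ[K] MvPolynomial τ K :=
    LinearMap.mulLeft K Φ.det ∘ₗ (Algebra.linearMap K (MvPolynomial τ K)) ∘ₗ ξ -
      ∑ i, ∑ j, LinearMap.mulLeft K (famPoly A (u i) ξ * Φ.adjugate i j) ∘ₗ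
        (Algebra.linearMap K (MvPolynomial τ K)) ∘ₗ φ j
  have hl : ∀ z w, MvPolynomial.eval z (l w) = (Φe z).det * ξ w -
      ∑ i, ξ (famMap A z (u i)) * ∑ j, (Φe z).adjugate i j * φ j w := by
    intro z w
    have h1 : l w = Φ.det * MvPolynomial.C (ξ w) - ∑ i, ∑ j,
        famPoly A (u i) ξ * Φ.adjugate i j * MvPolynomial.C (φ j w) := by
      simp only [l, LinearMap.sub_apply, LinearMap.sum_apply]
      rfl
    rw [h1]
    simp only [map_sub, map_mul, map_sum, MvPolynomial.eval_C, hdet, hadj, eval_famPoly,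
      Finset.mul_sum, mul_assoc]
  refine ⟨l, fun x => ?_, ?_⟩
  · suffices h : Φ.det * ∑ a, MvPolynomial.X a * l (A a x) = 0 from
      (mul_eq_zero.1 h).resolve_left hp
    refine MvPolynomial.funext fun z => ?_
    rw [map_mul, map_zero, hdet]
    by_cases hz : (Φe z).det = 0
    · rw [hz, zero_mul]
    refine mul_eq_zero_of_right _ ?_
    have h1 : MvPolynomial.eval z (∑ a, MvPolynomial.X a * l (A a x)) =
        MvPolynomial.eval z (l (famMap A z x)) := by
      rw [famMap_apply]
      simp only [map_sum, map_mul, MvPolynomial.eval_X, map_smul, MvPolynomial.smul_eval]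
    obtain ⟨c, hc⟩ := hspan z hz x
    have h2 : (fun j => φ j (famMap A z x)) = (Φe z).mulVec c := by
      ext j
      rw [hc]
      simp only [map_sum, map_smul, smul_eq_mul, Matrix.mulVec, dotProduct, Φe]
      exact Finset.sum_congr rfl fun j _ => mul_comm _ _
    have h3 : ∀ i, ∑ j, (Φe z).adjugate i j * φ j (famMap A z x) = (Φe z).det * c i := by
      intro i
      have : (Φe z).adjugate.mulVec (fun j => φ j (famMap A z x)) i = (Φe z).det * c i := by
        rw [h2, Matrix.mulVec_mulVec, Matrix.adjugate_mul, Matrix.smul_mulVec, Matrix.one_mulVec]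
        rfl
      exact this
    rw [h1, hl]
    simp only [h3]
    rw [hc]
    simp only [map_sum, map_smul, smul_eq_mul, Finset.mul_sum]
    rw [sub_eq_zero]
    exact Finset.sum_congr rfl fun i _ => by ring
  · rw [hl]
    simp only [hξA, zero_mul, Finset.sum_const_zero, sub_zero]
    rw [hdet] at hy
    exact mul_ne_zero hy hξv

end Generic

/-! ### General linear forms in exterior algebras -/

section GoodForm

variable {K : Type u} [Field K] [Infinite K] {R : Type v} [Ring R] [Algebra K R]
variable {M : Type v} [AddCommGroup M] [Module K M] [Module R M] [IsScalarTower K R M]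
variable {𝒜 : ℕ → Submodule K R} [GradedAlgebra 𝒜] {n : ℕ} {ε : K} {k : ℕ}
variable {τ : Type w} [Fintype τ] [DecidableEq τ] {e : τ → R} {ι : τ → R →ₗ[K] R}
variable [∀ a, Module.Finite K (𝒜 a)]

/-- Beyond the degree of its generators, a module with linear resolution is exact with respect to
multiplication by a general linear form. -/
theorem HasContractions.exists_generic_exact {η : K} (hc : HasContractions 𝒜 e ι)
    (h : KoszulModel 𝒜 n ε η) {P Q : GradedFamily M 𝒜} (hP : P.FinDim)
    (hlin : IsLinear k P Q) {j : ℕ} (hkj : k ≤ j) :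
    ∃ p : MvPolynomial τ K, p ≠ 0 ∧ ∀ y, MvPolynomial.eval y p ≠ 0 → ∀ v ∈ P (j + 1),
      (∑ a, y a • e a) • v ∈ Q (j + 2) → ∃ x ∈ P j, v - (∑ a, y a • e a) • x ∈ Q (j + 1) := by
  have := hP j
  -- the family of maps from `P_j` to `P_{j+1} / Q_{j+1}` given by multiplication with linear forms
  let A : τ → P j →ₗ[K] M ⧸ Q (j + 1) := fun a =>
    (Q (j + 1)).mkQ ∘ₗ Algebra.lsmul K K M (e a) ∘ₗ (P j).subtype
  have hA : ∀ a (x : P j), A a x = (Q (j + 1)).mkQ (e a • (x : M)) := fun a x => rfl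
  obtain ⟨p, hp, h'⟩ := exists_generic_cocycle A
  refine ⟨p, hp, fun y hy v hv hyv => ?_⟩
  by_contra hne
  push Not at hne
  -- if `v` is not a multiple of `y`, it is detected by a cocycle `l`; but `l` is a coboundary, and
  -- therefore vanishes on `v` at the point `y`, where `y v ∈ Q`
  obtain ⟨l, hl, hlv⟩ := h' y hy ((Q (j + 1)).mkQ v) (by
    rintro ⟨x, hx⟩
    apply hne x x.2
    rw [← Submodule.Quotient.eq, ← Submodule.mkQ_apply, ← Submodule.mkQ_apply, ← hx, famMap_apply,
      Finset.sum_smul, map_sum]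
    refine Finset.sum_congr rfl fun a _ => ?_
    rw [hA, smul_assoc, map_smul _ (y a)])
  have := hP (j + 1)
  obtain ⟨s, hs⟩ : ∃ s, ∀ x ∈ P (j + 1), l ((Q (j + 1)).mkQ x) ∈ degLT K τ s := by
    obtain ⟨t, ht⟩ := (Module.Finite.iff_fg.1 this : (P (j + 1)).FG)
    choose s hs using fun x : M => exists_mem_degLT (l ((Q (j + 1)).mkQ x))
    refine ⟨t.sup s, fun x hx => ?_⟩
    suffices h : P (j + 1) ≤ (degLT K τ (t.sup s)).comap (l ∘ₗ (Q (j + 1)).mkQ) from h hx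
    rw [← ht, Submodule.span_le]
    exact fun x hx => mem_degLT_of_le (Finset.le_sup (Finset.mem_coe.1 hx)) (hs x)
  obtain ⟨μ, hμQ, hμ⟩ := hc.exists_cartan h hP hlin hkj (l := l ∘ₗ (Q (j + 1)).mkQ)
    (fun x hx => by
      change l ((Q (j + 1)).mkQ x) = 0
      rw [Submodule.mkQ_apply, (Submodule.Quotient.mk_eq_zero _).2 hx, map_zero]) hs
    (fun x hx => by
      rw [cartan_apply]
      exact hl ⟨x, hx⟩)
  apply hlv
  have h1 : l ((Q (j + 1)).mkQ v) = cartan e μ v := hμ v hv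
  have h2 := hμQ _ hyv
  rw [Finset.sum_smul, map_sum] at h2
  have h3 := congrArg (MvPolynomial.eval y) h2
  rw [h1, cartan_apply, map_sum, ← (MvPolynomial.eval y).map_zero, ← h3, map_sum]
  refine Finset.sum_congr rfl fun a _ => ?_
  rw [map_mul, MvPolynomial.eval_X, smul_assoc, map_smul μ (y a), MvPolynomial.smul_eval]

variable {W Λ : Submodule K R}

/-- A general linear form is good for an ideal in an exterior algebra. -/
theorem KoszulModel.exists_isGoodForm_ext (h : KoszulModel 𝒜 n ε (1 : K))
    (hc : HasContractions 𝒜 e ι) {N : ℕ} (hN : ∀ j, N ≤ j → 𝒜 j = ⊥)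
    (hW : W ≤ 𝒜 k) (hΛ : Λ ≤ 𝒜 1) (hne : Λ ≠ 𝒜 1)
    (hlin : IsLinear k (idealSum 𝒜 k W Λ) (genFam 𝒜 1 Λ)) :
    ∃ y ∈ 𝒜 1, y ∉ Λ ∧ IsGoodForm 𝒜 k W Λ y := by
  have hmem : ∀ a, e a ∈ 𝒜 1 := fun a => hc.span ▸ Submodule.subset_span ⟨a, rfl⟩
  -- `𝒜 j = 0` for `j ≥ N`, so that the conditions in finitely many degrees suffice
  choose p hp hpy using fun c : ℕ => hc.exists_generic_exact h (idealSum_finDim hW hΛ) hlin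
    (j := k + c) (by omega)
  obtain ⟨a₀, ha₀⟩ : ∃ a, e a ∉ Λ := by
    by_contra! hall
    refine hne (_root_.le_antisymm hΛ ?_)
    rw [← hc.span, Submodule.span_le]
    rintro _ ⟨a, rfl⟩
    exact hall a
  obtain ⟨ξ, hξa, hξ⟩ := Submodule.exists_dual_map_eq_bot_of_notMem ha₀ inferInstance
  let q : MvPolynomial τ K := ∑ a, MvPolynomial.X a * MvPolynomial.C (ξ (e a))
  have hq : ∀ y, MvPolynomial.eval y q = ξ (∑ a, y a • e a) := fun y => by
    simp [q, map_sum]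
  have hq0 : q ≠ 0 := by
    intro h0
    have := hq (Pi.single a₀ 1)
    rw [h0, map_zero, Finset.sum_eq_single a₀ (fun b _ hb => by
      rw [Pi.single_eq_of_ne hb, zero_smul]) (fun h => absurd (Finset.mem_univ _) h),
      Pi.single_eq_same, one_smul] at this
    exact hξa this.symm
  have hprod : q * ∏ c ∈ Finset.range N, p c ≠ 0 :=
    mul_ne_zero hq0 (Finset.prod_ne_zero_iff.2 fun c _ => hp c)
  obtain ⟨y, hy⟩ : ∃ y, MvPolynomial.eval y (q * ∏ c ∈ Finset.range N, p c) ≠ 0 := by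
    by_contra! hall
    exact hprod (MvPolynomial.funext fun y => by rw [hall, map_zero])
  rw [map_mul, map_prod] at hy
  have hy1 := left_ne_zero_of_mul hy
  have hy2 := Finset.prod_ne_zero_iff.1 (right_ne_zero_of_mul hy)
  have hy𝒜 : ∑ a, y a • e a ∈ 𝒜 1 := sum_mem fun a _ => Submodule.smul_mem _ _ (hmem a)
  refine ⟨∑ a, y a • e a, hy𝒜, fun hyΛ => hy1 ?_, ?_⟩
  · have : ξ (∑ a, y a • e a) ∈ Λ.map ξ := ⟨_, hyΛ, rfl⟩
    rw [hξ] at this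
    rw [hq]
    exact this
  · intro j hj r hr hr'
    obtain ⟨c, rfl⟩ : ∃ c, j = k + c + 1 := ⟨j - k - 1, by omega⟩
    have hr𝒜 : r ∈ 𝒜 (k + c + 1) := idealSum_le hW hΛ _ hr
    by_cases hcN : N ≤ k + c + 1
    · rw [hN _ hcN, Submodule.mem_bot] at hr𝒜
      rw [hr𝒜]
      exact zero_mem _
    have h1 : r * (∑ a, y a • e a) ∈ genFam 𝒜 1 Λ (k + c + 1 + 1) :=
      h.mul_mem_of_mem_colon hΛ hy𝒜 (by rwa [one_smul])
    obtain ⟨x, hx, hxr⟩ := hpy c y (hy2 c (Finset.mem_range.2 (by omega))) r hr (by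
      rw [smul_eq_mul, h.comm' hr𝒜 hy𝒜]
      exact Submodule.smul_mem _ _ h1)
    rw [smul_eq_mul, h.comm' (idealSum_le hW hΛ _ hx) hy𝒜, ← smul_mul_assoc] at hxr
    rw [← sub_add_cancel r (ε ^ (k + c) • x * ∑ a, y a • e a)]
    exact Submodule.add_mem_sup hxr (map_mem_imFam (rmul (∑ a, y a • e a))
      (Submodule.smul_mem _ _ hx))

end GoodForm

/-! ### Initial monomials -/

section RevLex

variable {n : ℕ} {a b c : Fin n → ℕ}

theorem RevLexLT.irrefl (a : Fin n → ℕ) : ¬ RevLexLT a a := by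
  rintro (h | ⟨-, i, hi, -⟩)
  · exact lt_irrefl _ h
  · exact lt_irrefl _ hi

theorem RevLexLT.trans (hab : RevLexLT a b) (hbc : RevLexLT b c) : RevLexLT a c := by
  rcases hab with hab | ⟨hab, i, hi, hi'⟩
  · rcases hbc with hbc | ⟨hbc, -⟩
    · exact Or.inl (hab.trans hbc)
    · exact Or.inl (hbc ▸ hab)
  · rcases hbc with hbc | ⟨hbc, j, hj, hj'⟩
    · exact Or.inl (hab ▸ hbc)
    · refine Or.inr ⟨hab.trans hbc, ?_⟩
      rcases lt_trichotomy i j with h | rfl | h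
      · exact ⟨j, by rw [hi' j h]; exact hj, fun l hl => (hi' l (h.trans hl)).trans (hj' l hl)⟩
      · exact ⟨i, hj.trans hi, fun l hl => (hi' l hl).trans (hj' l hl)⟩
      · exact ⟨i, by rw [← hj' i h]; exact hi, fun l hl => (hi' l hl).trans (hj' l (h.trans hl))⟩

theorem RevLexLT.trichotomy (a b : Fin n → ℕ) : RevLexLT a b ∨ a = b ∨ RevLexLT b a := by
  rcases lt_trichotomy (∑ i, a i) (∑ i, b i) with h | h | h
  · exact Or.inl (Or.inl h)
  · by_cases hab : a = b
    · exact Or.inr (Or.inl hab)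
    · obtain ⟨i₀, hi₀⟩ := Function.ne_iff.1 hab
      obtain ⟨i, hi, hmax⟩ := (Finset.univ.filter fun i => a i ≠ b i).exists_max_image id
        ⟨i₀, by simpa using hi₀⟩
      have hj : ∀ j, i < j → a j = b j := fun j hj => by
        by_contra hne
        exact absurd (hmax j (by simpa using hne)) (not_le.2 hj)
      rcases lt_or_gt_of_ne (Finset.mem_filter.1 hi).2 with h' | h'
      · exact Or.inr (Or.inr (Or.inr ⟨h.symm, i, h', fun j hij => (hj j hij).symm⟩))
      · exact Or.inl (Or.inr ⟨h, i, h', hj⟩)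
  · exact Or.inr (Or.inr (Or.inl h))

theorem RevLexLT.add_right (c : Fin n → ℕ) (h : RevLexLT a b) : RevLexLT (a + c) (b + c) := by
  rcases h with h | ⟨h, i, hi, hj⟩
  · left
    simpa [Finset.sum_add_distrib] using h
  · right
    refine ⟨by simpa [Finset.sum_add_distrib] using h, i, by simpa using hi, fun j hij => ?_⟩
    simpa using hj j hij

end RevLex

section InitialSet

variable {K : Type u} [Field K] {n : ℕ} {R : Type v} [Ring R] [Algebra K R] {σ : Type w}
variable {b : Module.Basis σ K R} {expo : σ → Fin n → ℕ}

theorem exists_revLex_max (hexp : Function.Injective expo) {S : Finset σ} (hS : S.Nonempty) :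
    ∃ s ∈ S, ∀ t ∈ S, t ≠ s → RevLexLT (expo t) (expo s) := by
  classical
  induction hS using Finset.Nonempty.cons_induction with
  | singleton a => exact ⟨a, by simp, by simp⟩
  | cons a S ha hS ih =>
    obtain ⟨s, hs, hmax⟩ := ih
    rcases RevLexLT.trichotomy (expo a) (expo s) with h | h | h
    · refine ⟨s, Finset.mem_cons_of_mem hs, fun t ht hts => ?_⟩
      rcases Finset.mem_cons.1 ht with rfl | ht
      · exact h
      · exact hmax t ht hts
    · exact absurd (hexp h ▸ hs) ha
    · refine ⟨a, Finset.mem_cons_self _ _, fun t ht hta => ?_⟩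
      rcases Finset.mem_cons.1 ht with rfl | ht
      · exact absurd rfl hta
      · by_cases hts : t = s
        · exact hts ▸ h
        · exact (hmax t ht hts).trans h

theorem exists_isInitialMonomial (hexp : Function.Injective expo) {f : R} (hf : f ≠ 0) :
    ∃ s, IsInitialMonomial b expo f s := by
  obtain ⟨s, hs, hmax⟩ := exists_revLex_max hexp (S := (b.repr f).support)
    (Finsupp.support_nonempty_iff.2 fun h => hf (b.repr.map_eq_zero_iff.1 h))
  exact ⟨s, Finsupp.mem_support_iff.1 hs, fun t ht => hmax t (Finsupp.mem_support_iff.2 ht)⟩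

variable (b expo) in
/-- The initial monomials of the elements of `W`. -/
def inSet (W : Submodule K R) : Set σ := {s | ∃ f ∈ W, IsInitialMonomial b expo f s}

theorem linearIndependent_of_isInitialMonomial {A : Set σ} (hexp : Function.Injective expo)
    {v : A → R} (hv : ∀ s : A, IsInitialMonomial b expo (v s) s) : LinearIndependent K v := by
  classical
  rw [linearIndependent_iff']
  intro t c hc
  by_contra! hne
  obtain ⟨i, hi, hci⟩ := hne
  have hexp' : Function.Injective fun s : A => expo s := hexp.comp Subtype.coe_injective
  obtain ⟨s, hs, hmax⟩ := exists_revLex_max (expo := fun s : A => expo s) hexp'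
    (S := t.filter fun s => c s ≠ 0) ⟨i, Finset.mem_filter.2 ⟨hi, hci⟩⟩
  obtain ⟨hst, hcs⟩ := Finset.mem_filter.1 hs
  have h1 := congrArg (fun f => b.repr f s) hc
  simp only [map_sum, map_smul, Finsupp.finsetSum_apply, Finsupp.smul_apply, map_zero,
    Finsupp.coe_zero, Pi.zero_apply, smul_eq_mul] at h1
  rw [Finset.sum_eq_single s ?_ fun h => absurd hst h] at h1
  · exact mul_ne_zero hcs (hv s).1 h1
  · intro r hr hrs
    by_contra hne
    have h2 := (hv r).2 s (right_ne_zero_of_mul hne) fun h => hrs (Subtype.ext h.symm)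
    have h3 := hmax r (Finset.mem_filter.2 ⟨hr, left_ne_zero_of_mul hne⟩) hrs
    exact RevLexLT.irrefl _ (h2.trans h3)

open Classical in
variable (b) in
/-- The projection to the span of the monomials in `T`. -/
def monProj (T : Set σ) : R →ₗ[K] R := b.constr K fun s => if s ∈ T then b s else 0

open Classical in
theorem repr_monProj (T : Set σ) (f : R) (s : σ) :
    b.repr (monProj b T f) s = if s ∈ T then b.repr f s else 0 := by
  suffices h : b.coord s ∘ₗ monProj b T = if s ∈ T then b.coord s else 0 by
    have := LinearMap.congr_fun h f
    rw [LinearMap.comp_apply, Module.Basis.coord_apply] at this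
    rw [this]
    split_ifs <;> rfl
  refine b.ext fun t => ?_
  rw [LinearMap.comp_apply, monProj, Module.Basis.constr_basis]
  by_cases ht : t ∈ T <;> by_cases hs : s ∈ T
  · rw [if_pos ht, if_pos hs]
  · rw [if_pos ht, if_neg hs, Module.Basis.coord_apply, b.repr_self, Finsupp.single_eq_of_ne]
    · rfl
    · rintro rfl
      exact hs ht
  · rw [if_neg ht, if_pos hs, map_zero, Module.Basis.coord_apply, b.repr_self,
      Finsupp.single_eq_of_ne]
    rintro rfl
    exact ht hs
  · rw [if_neg ht, if_neg hs, map_zero]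
    rfl

theorem monProj_eq_zero_iff {T : Set σ} {f : R} :
    monProj b T f = 0 ↔ ∀ s ∈ T, b.repr f s = 0 := by
  classical
  constructor
  · intro h s hs
    have := repr_monProj (b := b) T f s
    rwa [h, map_zero, Finsupp.coe_zero, Pi.zero_apply, if_pos hs, eq_comm] at this
  · intro h
    refine b.ext_elem fun s => ?_
    rw [repr_monProj, map_zero, Finsupp.coe_zero, Pi.zero_apply]
    split_ifs with hs
    · exact h s hs
    · rfl

theorem monProj_congr {T T' D : Set σ} (h : T ∩ D = T' ∩ D) {f : R}
    (hf : ∀ s, b.repr f s ≠ 0 → s ∈ D) : monProj b T f = monProj b T' f := by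
  classical
  refine b.ext_elem fun s => ?_
  rw [repr_monProj, repr_monProj]
  by_cases hs : b.repr f s = 0
  · rw [hs, ite_self, ite_self]
  · have h1 : s ∈ T ↔ s ∈ T' := by
      have := Set.ext_iff.1 h s
      simpa [hf s hs] using this
    simp only [h1]

/-- `T` contains the monomials of `D` that are greater than an element of `T`. -/
def IsUpperIn (expo : σ → Fin n → ℕ) (D T : Set σ) : Prop :=
  ∀ s ∈ T, ∀ t ∈ D, RevLexLT (expo s) (expo t) → t ∈ T

/-- The rank of the projection of `W` to the span of an upper set `T` of monomials is the number
of initial monomials of `W` in `T`. -/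
theorem finrank_map_monProj (hexp : Function.Injective expo) {D T : Set σ}
    (hT : IsUpperIn expo D T) {W : Submodule K R} [Module.Finite K W]
    (hW : ∀ f ∈ W, ∀ s, b.repr f s ≠ 0 → s ∈ D) :
    Module.finrank K (W.map (monProj b T)) = (inSet b expo W ∩ T).ncard := by
  classical
  set A := inSet b expo W ∩ T with hA
  -- elements of `W` with distinct initial monomials in `T` have independent projections
  choose f hfW hf using fun s : A => s.2.1
  have hli : LinearIndependent K fun s : A => monProj b T (f s) := by
    refine linearIndependent_of_isInitialMonomial (b := b) hexp fun s => ?_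
    refine ⟨?_, fun t ht => (hf s).2 t ?_⟩
    · rw [repr_monProj, if_pos s.2.2]
      exact (hf s).1
    · rw [repr_monProj] at ht
      split_ifs at ht with h
      · exact ht
      · exact absurd rfl ht
  have hli' : LinearIndependent K fun s : A =>
      (⟨monProj b T (f s), Submodule.mem_map_of_mem (hfW s)⟩ : W.map (monProj b T)) :=
    LinearIndependent.of_comp (W.map (monProj b T)).subtype hli
  have hfinA : Finite A := hli'.finite
  have := Fintype.ofFinite A
  rw [← Nat.card_coe_set_eq, Nat.card_eq_fintype_card]
  refine le_antisymm ?_ hli'.fintype_card_le_finrank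
  -- conversely an element of the projection is determined by its coefficients at `A`: its initial
  -- monomial is one of `W`, because `T` is an upper set
  let c : W.map (monProj b T) →ₗ[K] A → K :=
    LinearMap.pi fun s => b.coord s ∘ₗ (W.map (monProj b T)).subtype
  have hc : Function.Injective c := by
    rw [← LinearMap.ker_eq_bot, LinearMap.ker_eq_bot']
    rintro ⟨_, g, hg, rfl⟩ h0
    by_contra hne
    have hne' : monProj b T g ≠ 0 := fun h => hne (Subtype.ext h)
    obtain ⟨s, hs, hs'⟩ := exists_isInitialMonomial (b := b) hexp hne'
    have hsT : s ∈ T := by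
      by_contra h
      rw [repr_monProj, if_neg h] at hs
      exact hs rfl
    have hsW : s ∈ inSet b expo W := by
      refine ⟨g, hg, ?_, fun t ht hts => ?_⟩
      · rwa [repr_monProj, if_pos hsT] at hs
      · by_cases htT : t ∈ T
        · refine hs' t ?_ hts
          rwa [repr_monProj, if_pos htT]
        · rcases RevLexLT.trichotomy (expo t) (expo s) with h | h | h
          · exact h
          · exact absurd (hexp h) hts
          · exact absurd (hT s hsT t (hW g hg t ht) h) htT
    exact hs (congrFun h0 ⟨s, hsW, hsT⟩)
  have := LinearMap.finrank_le_finrank_of_injective hc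
  rwa [Module.finrank_fintype_fun_eq_card] at this

theorem inSet_subset {D : Set σ} {W : Submodule K R}
    (hW : ∀ f ∈ W, ∀ s, b.repr f s ≠ 0 → s ∈ D) : inSet b expo W ⊆ D := by
  rintro s ⟨f, hf, hs, -⟩
  exact hW f hf s hs

theorem finrank_eq_ncard_inSet (hexp : Function.Injective expo) {W : Submodule K R}
    [Module.Finite K W] : Module.finrank K W = (inSet b expo W).ncard := by
  have h := finrank_map_monProj (b := b) hexp (D := Set.univ) (T := Set.univ) (W := W)
    (fun _ _ _ _ _ => Set.mem_univ _) (fun _ _ _ _ => Set.mem_univ _)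
  have e : monProj b Set.univ = LinearMap.id := by
    refine b.ext fun s => ?_
    rw [monProj, Module.Basis.constr_basis, if_pos (Set.mem_univ s)]
    rfl
  rwa [e, Submodule.map_id, Set.inter_univ] at h

/-- The ranks of the projections to spans of upper sets determine the initial monomials. -/
theorem inSet_eq_of_finrank_eq (hexp : Function.Injective expo) {D : Set σ} (hD : D.Finite)
    {W W' : Submodule K R} [Module.Finite K W] [Module.Finite K W']
    (hW : ∀ f ∈ W, ∀ s, b.repr f s ≠ 0 → s ∈ D) (hW' : ∀ f ∈ W', ∀ s, b.repr f s ≠ 0 → s ∈ D)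
    (h : ∀ T ⊆ D, IsUpperIn expo D T →
      Module.finrank K (W.map (monProj b T)) = Module.finrank K (W'.map (monProj b T))) :
    inSet b expo W = inSet b expo W' := by
  -- `s` is an initial monomial if and only if the rank jumps from the monomials greater than `s`
  -- to those that are at least `s`
  have hsplit : ∀ (V : Submodule K R) (s : σ), (s ∈ inSet b expo V ↔
      (inSet b expo V ∩ {t ∈ D | RevLexLT (expo s) (expo t)}).ncard <
        (inSet b expo V ∩ insert s {t ∈ D | RevLexLT (expo s) (expo t)}).ncard) := by
    intro V s
    have hfin : (insert s {t ∈ D | RevLexLT (expo s) (expo t)}).Finite :=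
      (hD.subset (Set.sep_subset _ _)).insert s
    constructor
    · intro hs
      refine Set.ncard_lt_ncard ?_ (hfin.subset Set.inter_subset_right)
      refine ⟨Set.inter_subset_inter_right _ (Set.subset_insert _ _), fun hsub => ?_⟩
      exact RevLexLT.irrefl _ (hsub ⟨hs, Set.mem_insert _ _⟩).2.2
    · intro hlt
      by_contra hs
      refine absurd hlt (not_lt.2 (Set.ncard_le_ncard ?_
        ((hfin.subset (Set.subset_insert _ _)).subset Set.inter_subset_right)))
      rintro t ⟨ht, rfl | ht'⟩
      · exact absurd ht hs
      · exact ⟨ht, ht'⟩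
  have hup : ∀ s ∈ D, IsUpperIn expo D {t ∈ D | RevLexLT (expo s) (expo t)} :=
    fun s _ t ht r hr htr => ⟨hr, ht.2.trans htr⟩
  have hup' : ∀ s ∈ D, IsUpperIn expo D (insert s {t ∈ D | RevLexLT (expo s) (expo t)}) := by
    rintro s hs t (rfl | ht) r hr htr
    · exact Or.inr ⟨hr, htr⟩
    · exact Or.inr (hup s hs t ht r hr htr)
  have key : ∀ s ∈ D, (s ∈ inSet b expo W ↔ s ∈ inSet b expo W') := by
    intro s hs
    have hsub : {t ∈ D | RevLexLT (expo s) (expo t)} ⊆ D := Set.sep_subset _ _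
    rw [hsplit W, hsplit W', ← finrank_map_monProj hexp (hup s hs) hW,
      ← finrank_map_monProj hexp (hup' s hs) hW, ← finrank_map_monProj hexp (hup s hs) hW',
      ← finrank_map_monProj hexp (hup' s hs) hW', h _ hsub (hup s hs),
      h _ (Set.insert_subset hs hsub) (hup' s hs)]
  ext s
  exact ⟨fun hs => (key s (inSet_subset hW hs)).1 hs, fun hs => (key s (inSet_subset hW' hs)).2 hs⟩

/-- A space spanned by monomials has these monomials as initial monomials. -/
theorem inSet_span (A : Set σ) : inSet b expo (Submodule.span K (b '' A)) = A := by
  ext s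
  constructor
  · rintro ⟨f, hf, hs, -⟩
    exact b.mem_span_image.1 hf (Finsupp.mem_support_iff.2 hs)
  · intro hs
    refine ⟨b s, Submodule.subset_span ⟨s, hs, rfl⟩, ?_, fun t ht hts => ?_⟩
    · rw [b.repr_self, Finsupp.single_eq_same]
      exact one_ne_zero
    · rw [b.repr_self, Finsupp.single_eq_of_ne hts] at ht
      exact absurd rfl ht

end InitialSet

/-! ### Monomials and coordinate changes -/

section MonomialModel

variable {K : Type u} [Field K] {n : ℕ} {R : Type v} [Ring R] [Algebra K R] {σ : Type w}

/-- The common features of the monomial bases, and of the linear coordinate changes, of polynomial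
rings and exterior algebras: the product of a monomial and a variable `x_i` is a multiple of the
monomial with the expected exponent vector, and each monomial whose exponent vector involves `x_i`
arises in this way. Monomials are squarefree unless the variables commute and `char K = 0`. -/
structure MonomialModel (𝒜 : ℕ → Submodule K R) (b : Module.Basis σ K R) (expo : σ → Fin n → ℕ)
    (x : Fin n → R) (Φ : GL (Fin n) K → R →ₐ[K] R) : Prop where
  injective : Function.Injective expo
  mem : ∀ s, b s ∈ 𝒜 (∑ i, expo s i)
  x_mem : ∀ i, x i ∈ 𝒜 1
  span_x : 𝒜 1 ≤ Submodule.span K (Set.range x)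
  mul_x : ∀ s i, b s * x i = 0 ∨ ∃ t, ∃ c : K, expo t = expo s + Pi.single i 1 ∧ b s * x i = c • b t
  div_x : ∀ t i, expo t i ≠ 0 →
    ∃ s, ∃ c : K, c ≠ 0 ∧ expo t = expo s + Pi.single i 1 ∧ b s * x i = c • b t
  coord : ∀ g j, Φ g (x j) = ∑ i, g.val i j • x i
  char_cond : (∀ s i, expo s i ≤ 1) ∨ CharZero K ∧ ∀ i j, Commute (x i) (x j)

/-- A graded submodule may be given by subspaces that are closed under multiplication by linear
forms. -/
def GradedFamily.ofLinear {𝒜 : ℕ → Submodule K R} [GradedAlgebra 𝒜] {ε η : K}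
    (h : KoszulModel 𝒜 n ε η) (N : ℕ → Submodule K R)
    (hN : ∀ j, ∀ v ∈ 𝒜 1, ∀ m ∈ N j, v * m ∈ N (j + 1)) : GradedFamily R 𝒜 where
  toFun := N
  smul_mem' := by
    intro a j r m hr hm
    induction a generalizing r with
    | zero =>
      obtain ⟨c, rfl⟩ := Submodule.mem_span_singleton.1 (h.zero_deg hr)
      rw [zero_add, smul_assoc, one_smul]
      exact Submodule.smul_mem _ c hm
    | succ a ih =>
      suffices h' : 𝒜 1 * 𝒜 a ≤ (N (a + 1 + j)).comap
        ((Algebra.lsmul K K R).toLinearMap.flip m) from h' (h.succ_deg a hr)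
      refine Submodule.mul_le.2 fun v hv s hs => ?_
      change (v * s) • m ∈ N (a + 1 + j)
      rw [smul_eq_mul, mul_assoc, show a + 1 + j = a + j + 1 by ring]
      exact hN _ v hv _ (ih hs)

variable {𝒜 : ℕ → Submodule K R} [GradedAlgebra 𝒜] {ε η : K}
variable {b : Module.Basis σ K R} {expo : σ → Fin n → ℕ} {x : Fin n → R}
variable {Φ : GL (Fin n) K → R →ₐ[K] R}

theorem KoszulModel.adjoin_eq_top (h : KoszulModel 𝒜 n ε η) {S : Subalgebra K R}
    (hS : 𝒜 1 ≤ S.toSubmodule) : S = ⊤ := by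
  have h' : ∀ a, 𝒜 a ≤ S.toSubmodule := by
    intro a
    induction a with
    | zero =>
      refine h.zero_deg.trans ?_
      rw [Submodule.span_singleton_le_iff_mem]
      exact S.one_mem
    | succ a ih => exact (h.succ_deg a).trans (Submodule.mul_le.2 fun v hv f hf =>
        S.mul_mem (hS hv) (ih hf))
  rw [eq_top_iff]
  intro f _
  classical
  rw [← DirectSum.sum_support_decompose 𝒜 f]
  exact sum_mem fun a _ => h' a (DirectSum.decompose 𝒜 f a).2

theorem MonomialModel.le_of_x_mem (h : KoszulModel 𝒜 n ε η) (hb : MonomialModel 𝒜 b expo x Φ)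
    {S : Subalgebra K R} (hS : ∀ i, x i ∈ S) : S = ⊤ :=
  h.adjoin_eq_top (hb.span_x.trans (Submodule.span_le.2 (by
    rintro _ ⟨i, rfl⟩
    exact hS i)))

theorem MonomialModel.algHom_ext (h : KoszulModel 𝒜 n ε η) (hb : MonomialModel 𝒜 b expo x Φ)
    {f g : R →ₐ[K] R} (hfg : ∀ i, f (x i) = g (x i)) : f = g := by
  have := hb.le_of_x_mem h (S := AlgHom.equalizer f g) hfg
  ext r
  have hr : r ∈ AlgHom.equalizer f g := this ▸ Algebra.mem_top
  exact hr

theorem MonomialModel.coord_mul (h : KoszulModel 𝒜 n ε η) (hb : MonomialModel 𝒜 b expo x Φ)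
    (g g' : GL (Fin n) K) : Φ (g * g') = (Φ g).comp (Φ g') := by
  refine hb.algHom_ext h fun j => ?_
  rw [AlgHom.comp_apply, hb.coord, hb.coord, map_sum]
  simp only [map_smul, hb.coord, Finset.smul_sum]
  rw [Finset.sum_comm]
  refine Finset.sum_congr rfl fun i _ => ?_
  rw [Units.val_mul, Matrix.mul_apply, Finset.sum_smul]
  refine Finset.sum_congr rfl fun l _ => ?_
  rw [smul_smul, mul_comm]

theorem MonomialModel.coord_one (h : KoszulModel 𝒜 n ε η) (hb : MonomialModel 𝒜 b expo x Φ)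
    : Φ 1 = AlgHom.id K R := by
  refine hb.algHom_ext h fun j => ?_
  rw [hb.coord, Finset.sum_eq_single j]
  · rw [Units.val_one, Matrix.one_apply_eq, one_smul]
    rfl
  · intro i _ hij
    rw [Units.val_one, Matrix.one_apply_ne hij, zero_smul]
  · exact fun hj => absurd (Finset.mem_univ j) hj

theorem MonomialModel.coord_inv_apply (h : KoszulModel 𝒜 n ε η) (hb : MonomialModel 𝒜 b expo x Φ)
    (g : GL (Fin n) K) (f : R) : Φ g⁻¹ (Φ g f) = f := by
  rw [← AlgHom.comp_apply, ← hb.coord_mul h, inv_mul_cancel, hb.coord_one h, AlgHom.id_apply]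

theorem MonomialModel.coord_apply_inv (h : KoszulModel 𝒜 n ε η) (hb : MonomialModel 𝒜 b expo x Φ)
    (g : GL (Fin n) K) (f : R) : Φ g (Φ g⁻¹ f) = f := by
  rw [← AlgHom.comp_apply, ← hb.coord_mul h, mul_inv_cancel, hb.coord_one h, AlgHom.id_apply]

theorem MonomialModel.coord_mem (h : KoszulModel 𝒜 n ε η) (hb : MonomialModel 𝒜 b expo x Φ)
    (g : GL (Fin n) K) {a : ℕ} {f : R} (hf : f ∈ 𝒜 a) :
    Φ g f ∈ 𝒜 a := by
  induction a generalizing f with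
  | zero =>
    obtain ⟨c, rfl⟩ := Submodule.mem_span_singleton.1 (h.zero_deg hf)
    rw [map_smul, map_one]
    exact hf
  | succ a ih =>
    have h1 : 𝒜 1 ≤ (𝒜 1).comap (Φ g).toLinearMap := by
      refine hb.span_x.trans (Submodule.span_le.2 ?_)
      rintro _ ⟨j, rfl⟩
      change Φ g (x j) ∈ 𝒜 1
      rw [hb.coord]
      exact sum_mem fun i _ => Submodule.smul_mem _ _ (hb.x_mem i)
    suffices h' : 𝒜 1 * 𝒜 a ≤ (𝒜 (a + 1)).comap (Φ g).toLinearMap from h' (h.succ_deg a hf)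
    refine Submodule.mul_le.2 fun v hv s hs => ?_
    change Φ g (v * s) ∈ 𝒜 (a + 1)
    rw [map_mul, add_comm]
    exact SetLike.mul_mem_graded (h1 hv) (ih hs)

theorem MonomialModel.coord_injective (h : KoszulModel 𝒜 n ε η) (hb : MonomialModel 𝒜 b expo x Φ)
    (g : GL (Fin n) K) : Function.Injective (Φ g) :=
  Function.LeftInverse.injective (hb.coord_inv_apply h g)

/-- The image of a graded submodule under a coordinate change. -/
def MonomialModel.mapFam (h : KoszulModel 𝒜 n ε η) (hb : MonomialModel 𝒜 b expo x Φ)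
    (g : GL (Fin n) K) (P : GradedFamily R 𝒜) : GradedFamily R 𝒜 where
  toFun j := (P j).map (Φ g).toLinearMap
  smul_mem' := by
    rintro a j r _ hr ⟨m, hm, rfl⟩
    refine ⟨Φ g⁻¹ r * m, P.smul_mem (hb.coord_mem h _ hr) hm, ?_⟩
    change Φ g (Φ g⁻¹ r * m) = r • Φ g m
    rw [map_mul, hb.coord_apply_inv h, smul_eq_mul]

theorem MonomialModel.mapFam_le (h : KoszulModel 𝒜 n ε η) (hb : MonomialModel 𝒜 b expo x Φ)
    {g : GL (Fin n) K} {P : GradedFamily R 𝒜} (hP : P ≤ wholeFam 𝒜) :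
    hb.mapFam h g P ≤ wholeFam 𝒜 := by
  rintro j _ ⟨f, hf, rfl⟩
  exact hb.coord_mem h g (hP j hf)

theorem MonomialModel.map_toIdeal (h : KoszulModel 𝒜 n ε η) (hb : MonomialModel 𝒜 b expo x Φ)
    (g : GL (Fin n) K) (P : GradedFamily R 𝒜) :
    (toIdeal P).map (Φ g) = toIdeal (hb.mapFam h g P) := by
  refine _root_.le_antisymm ?_ (Ideal.span_le.2 ?_)
  · rw [Ideal.map_le_iff_le_comap, toIdeal, Ideal.span_le]
    rintro f ⟨j, hf⟩
    exact mem_toIdeal_of_mem (P := hb.mapFam h g P) (j := j) ⟨f, hf, rfl⟩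
  · rintro _ ⟨j, f, hf, rfl⟩
    exact Ideal.mem_map_of_mem (Φ g) (mem_toIdeal_of_mem hf)

theorem MonomialModel.finrank_map_coord (h : KoszulModel 𝒜 n ε η) (hb : MonomialModel 𝒜 b expo x Φ)
    (g : GL (Fin n) K) (W : Submodule K R) :
    Module.finrank K (W.map (Φ g).toLinearMap) = Module.finrank K W :=
  (Submodule.equivMapOfInjective _ (hb.coord_injective h g) W).finrank_eq.symm

open Classical in
theorem MonomialModel.decompose_eq (hb : MonomialModel 𝒜 b expo x Φ)
    (f : R) (d : ℕ) (s : σ) :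
    b.repr (DirectSum.decompose 𝒜 f d : R) s =
      if ∑ i, expo s i = d then b.repr f s else 0 := by
  have hadd : ∀ f g : R, DirectSum.decompose 𝒜 (f + g) d =
      DirectSum.decompose 𝒜 f d + DirectSum.decompose 𝒜 g d := fun f g => by
    rw [DirectSum.decompose_add, DirectSum.add_apply]
  induction b.mem_span f using Submodule.span_induction with
  | zero =>
    rw [DirectSum.decompose_zero]
    simp
  | mem f hf =>
    obtain ⟨t, rfl⟩ := hf
    by_cases htd : ∑ i, expo t i = d
    · rw [DirectSum.decompose_of_mem_same 𝒜 (htd ▸ hb.mem t)]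
      by_cases hts : t = s
      · rw [if_pos (hts ▸ htd)]
      · rw [b.repr_self, Finsupp.single_eq_of_ne (Ne.symm hts), ite_self]
    · rw [DirectSum.decompose_of_mem_ne 𝒜 (hb.mem t) htd, map_zero, Finsupp.coe_zero, Pi.zero_apply]
      split_ifs with hs
      · rw [b.repr_self, Finsupp.single_eq_of_ne]
        rintro rfl
        exact htd hs
      · rfl
  | add f g _ _ hf hg =>
    rw [hadd, Submodule.coe_add, map_add, map_add, Finsupp.add_apply, Finsupp.add_apply, hf, hg]
    split_ifs
    · rfl
    · rw [add_zero]
  | smul c f _ hf =>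
    rw [DirectSum.decompose_smul]
    change b.repr (c • (DirectSum.decompose 𝒜 f d : R)) s = _
    rw [map_smul, map_smul, Finsupp.smul_apply, Finsupp.smul_apply, hf]
    split_ifs
    · rfl
    · rw [smul_zero]

theorem MonomialModel.sum_expo_eq (hb : MonomialModel 𝒜 b expo x Φ)
    {d : ℕ} {f : R} (hf : f ∈ 𝒜 d) {s : σ} (hs : b.repr f s ≠ 0) :
    ∑ i, expo s i = d := by
  classical
  by_contra hne
  have := hb.decompose_eq f d s
  rw [if_neg hne, DirectSum.decompose_of_mem_same 𝒜 hf] at this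
  exact hs this

theorem MonomialModel.finite_degree (hb : MonomialModel 𝒜 b expo x Φ)
    (d : ℕ) : {s | ∑ i, expo s i = d}.Finite := by
  refine ((Set.finite_Iic (fun _ : Fin n => d)).preimage hb.injective.injOn).subset ?_
  intro s hs i
  have hs : ∑ i, expo s i = d := hs
  exact (Finset.single_le_sum (f := expo s) (fun _ _ => Nat.zero_le _) (Finset.mem_univ i)).trans
    hs.le

theorem MonomialModel.repr_mul_x (hb : MonomialModel 𝒜 b expo x Φ)
    {f : R} {i : Fin n} {t : σ} (ht : b.repr (f * x i) t ≠ 0) :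
    ∃ s, b.repr f s ≠ 0 ∧ expo t = expo s + Pi.single i 1 := by
  have e : f * x i = ∑ s ∈ (b.repr f).support, b.repr f s • (b s * x i) := by
    conv_lhs => rw [← b.linearCombination_repr f, Finsupp.linearCombination_apply, Finsupp.sum,
      Finset.sum_mul]
    simp only [smul_mul_assoc]
  rw [e, map_sum, Finsupp.finsetSum_apply] at ht
  obtain ⟨s, hs, hst⟩ := Finset.exists_ne_zero_of_sum_ne_zero ht
  refine ⟨s, Finsupp.mem_support_iff.1 hs, ?_⟩
  rw [map_smul, Finsupp.smul_apply] at hst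
  have hst := right_ne_zero_of_mul hst
  rcases hb.mul_x s i with h0 | ⟨r, c, hr, hrc⟩
  · rw [h0, map_zero] at hst
    exact absurd rfl hst
  · rw [hrc, map_smul, Finsupp.smul_apply, b.repr_self] at hst
    have := right_ne_zero_of_mul hst
    obtain rfl : t = r := by
      by_contra hne
      exact this (Finsupp.single_eq_of_ne hne)
    exact hr

theorem MonomialModel.isInitialMonomial_mul_x (hb : MonomialModel 𝒜 b expo x Φ)
    {f : R} {s t : σ} {i : Fin n} {c : K} (hc : c ≠ 0)
    (hf : IsInitialMonomial b expo f s) (ht : expo t = expo s + Pi.single i 1)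
    (hst : b s * x i = c • b t) : IsInitialMonomial b expo (f * x i) t := by
  constructor
  · -- only the term of `f` at `s` contributes
    have e : f * x i = b.repr f s • (b s * x i) + (f - b.repr f s • b s) * x i := by
      rw [← smul_mul_assoc, ← add_mul, add_sub_cancel]
    rw [e, map_add, Finsupp.add_apply, hst, smul_smul, map_smul, Finsupp.smul_apply, b.repr_self,
      Finsupp.single_eq_same, smul_eq_mul, mul_one]
    have h0 : b.repr ((f - b.repr f s • b s) * x i) t = 0 := by
      by_contra hne
      obtain ⟨r, hr, hrt⟩ := hb.repr_mul_x hne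
      obtain rfl : r = s := hb.injective (add_right_cancel (hrt.symm.trans ht))
      apply hr
      rw [map_sub, map_smul, Finsupp.sub_apply, Finsupp.smul_apply, b.repr_self,
        Finsupp.single_eq_same, smul_eq_mul, mul_one, sub_self]
    rw [h0, add_zero]
    exact mul_ne_zero hf.1 hc
  · intro r hr hrt
    obtain ⟨q, hq, hqr⟩ := hb.repr_mul_x hr
    rw [hqr, ht]
    refine (hf.2 q hq ?_).add_right _
    rintro rfl
    exact hrt (hb.injective (hqr.trans ht.symm))

/-! ### Initial ideals -/

/-- The initial ideal of a graded ideal. -/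
def MonomialModel.inFam (h : KoszulModel 𝒜 n ε η) (hb : MonomialModel 𝒜 b expo x Φ)
    (P : GradedFamily R 𝒜) (hP : P ≤ wholeFam 𝒜) : GradedFamily R 𝒜 :=
  GradedFamily.ofLinear h (fun d => Submodule.span K (b '' inSet b expo (P d))) (by
    intro j v hv m hm
    have h1 : Submodule.span K (b '' inSet b expo (P j)) ≤ 𝒜 j := by
      rw [Submodule.span_le]
      rintro _ ⟨s, ⟨f, hf, hs, -⟩, rfl⟩
      rw [← hb.sum_expo_eq (hP j hf) hs]
      exact hb.mem s
    rw [h.comm' (h1 hm) hv]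
    refine Submodule.smul_mem _ _ ?_
    suffices h2 : Submodule.span K (b '' inSet b expo (P j)) * 𝒜 1 ≤
      Submodule.span K (b '' inSet b expo (P (j + 1))) from h2 (Submodule.mul_mem_mul hm hv)
    refine (mul_le_mul_right hb.span_x _).trans ?_
    rw [Submodule.span_mul_span, Submodule.span_le]
    rintro _ ⟨_, ⟨s, ⟨f, hf, hs⟩, rfl⟩, _, ⟨i, rfl⟩, rfl⟩
    change b s * x i ∈ _
    rcases hb.mul_x s i with h0 | ⟨t, c, ht, hc⟩
    · rw [h0]
      exact zero_mem _
    · rw [hc]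
      by_cases hc0 : c = 0
      · rw [hc0, zero_smul]
        exact zero_mem _
      exact Submodule.smul_mem _ _ (Submodule.subset_span ⟨t, ⟨f * x i,
        h.mul_mem hP hf (hb.x_mem i), hb.isInitialMonomial_mul_x hc0 hs ht hc⟩, rfl⟩))

theorem MonomialModel.inFam_apply (h : KoszulModel 𝒜 n ε η) (hb : MonomialModel 𝒜 b expo x Φ)
    {P : GradedFamily R 𝒜} (hP : P ≤ wholeFam 𝒜) (d : ℕ) :
    hb.inFam h P hP d = Submodule.span K (b '' inSet b expo (P d)) := rfl

theorem MonomialModel.inFam_le (h : KoszulModel 𝒜 n ε η) (hb : MonomialModel 𝒜 b expo x Φ)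
    {P : GradedFamily R 𝒜} (hP : P ≤ wholeFam 𝒜) :
    hb.inFam h P hP ≤ wholeFam 𝒜 := by
  intro d
  rw [hb.inFam_apply, Submodule.span_le]
  rintro _ ⟨s, ⟨f, hf, hs, -⟩, rfl⟩
  have := hb.mem s
  rwa [hb.sum_expo_eq (hP d hf) hs] at this

theorem MonomialModel.initialIdeal_toIdeal (h : KoszulModel 𝒜 n ε η) (hb : MonomialModel 𝒜 b expo x Φ)
    {P : GradedFamily R 𝒜} (hP : P ≤ wholeFam 𝒜) :
    initialIdeal b expo (toIdeal P) = toIdeal (hb.inFam h P hP) := by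
  classical
  refine _root_.le_antisymm (Ideal.span_le.2 ?_) (Ideal.span_le.2 ?_)
  · rintro _ ⟨s, ⟨f, hf, hs, hs'⟩, rfl⟩
    refine mem_toIdeal_of_mem (P := hb.inFam h P hP) (j := ∑ i, expo s i)
      (Submodule.subset_span ⟨s, ⟨_, decompose_mem_of_mem_toIdeal hP hf _, ?_, fun t ht => ?_⟩, rfl⟩)
    · rwa [hb.decompose_eq, if_pos rfl]
    · rw [hb.decompose_eq] at ht
      split_ifs at ht with hd
      · exact hs' t ht
      · exact absurd rfl ht
  · rintro f ⟨d, hf⟩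
    suffices h' : hb.inFam h P hP d ≤ (initialIdeal b expo (toIdeal P)).restrictScalars K from h' hf
    rw [hb.inFam_apply, Submodule.span_le]
    rintro _ ⟨s, ⟨f, hf, hs⟩, rfl⟩
    exact Ideal.subset_span ⟨s, ⟨f, mem_toIdeal_of_mem hf, hs⟩, rfl⟩

theorem MonomialModel.finrank_inFam (h : KoszulModel 𝒜 n ε η) (hb : MonomialModel 𝒜 b expo x Φ)
    [∀ a, Module.Finite K (𝒜 a)] {P : GradedFamily R 𝒜}
    (hP : P ≤ wholeFam 𝒜) (d : ℕ) :
    Module.finrank K (hb.inFam h P hP d) = Module.finrank K (P d) := by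
  have := wholeFam_finDim.mono hP d
  have := wholeFam_finDim.mono (hb.inFam_le h hP) d
  rw [finrank_eq_ncard_inSet (b := b) hb.injective, finrank_eq_ncard_inSet (b := b) hb.injective,
    hb.inFam_apply, inSet_span]

end MonomialModel

/-! ### Polynomial families of vectors -/

section PolyFun

variable {K : Type u} [Field K] {G ν Y : Type*} {R : Type v} [Ring R] [Algebra K R]
variable [AddCommGroup Y] [Module K Y] (ev : G → ν → K)

/-- The functions with values in `R` that are polynomial in the coordinates `ev` of the argument. -/
def polyFun (R : Type v) [Ring R] [Algebra K R] : Submodule K (G → R) :=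
  Submodule.span K {v | ∃ (p : MvPolynomial ν K) (r : R), v = fun g => MvPolynomial.eval (ev g) p • r}

variable {ev}

theorem const_mem_polyFun (r : R) : (fun _ => r) ∈ polyFun ev R :=
  Submodule.subset_span ⟨1, r, by simp⟩

theorem eval_smul_mem_polyFun (p : MvPolynomial ν K) {v : G → R} (hv : v ∈ polyFun ev R) :
    (fun g => MvPolynomial.eval (ev g) p • v g) ∈ polyFun ev R := by
  induction hv using Submodule.span_induction with
  | mem v hv =>
    obtain ⟨q, r, rfl⟩ := hv
    exact Submodule.subset_span ⟨p * q, r, by simp [mul_smul]⟩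
  | zero =>
    simp only [Pi.zero_apply, smul_zero]
    exact zero_mem (polyFun ev R)
  | add v w _ _ hv hw =>
    simp only [Pi.add_apply, smul_add]
    exact add_mem hv hw
  | smul c v _ hv =>
    have := Submodule.smul_mem _ c hv
    convert this using 1
    ext g
    simp only [Pi.smul_apply]
    rw [smul_comm]

theorem mul_mem_polyFun {v w : G → R} (hv : v ∈ polyFun ev R) (hw : w ∈ polyFun ev R) :
    (fun g => v g * w g) ∈ polyFun ev R := by
  induction hv using Submodule.span_induction with
  | mem v hv =>
    obtain ⟨q, r, rfl⟩ := hv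
    induction hw using Submodule.span_induction with
    | mem w hw =>
      obtain ⟨q', r', rfl⟩ := hw
      refine Submodule.subset_span ⟨q * q', r * r', ?_⟩
      ext g
      rw [map_mul, smul_mul_smul_comm]
    | zero =>
      simp only [Pi.zero_apply, mul_zero]
      exact zero_mem (polyFun ev R)
    | add v w _ _ hv hw =>
      simp only [Pi.add_apply, mul_add]
      exact add_mem hv hw
    | smul c v _ hv =>
      have := Submodule.smul_mem _ c hv
      convert this using 1
      ext g
      simp only [Pi.smul_apply, mul_smul_comm]
  | zero =>
    simp only [Pi.zero_apply, zero_mul]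
    exact zero_mem (polyFun ev R)
  | add v w _ _ hv hw =>
    simp only [Pi.add_apply, add_mul]
    exact add_mem hv hw
  | smul c v _ hv =>
    have := Submodule.smul_mem _ c hv
    convert this using 1
    ext g
    simp only [Pi.smul_apply, smul_mul_assoc]

theorem exists_eval_eq_of_mem_polyFun {v : G → R} (hv : v ∈ polyFun ev R) (ξ : R →ₗ[K] K) :
    ∃ p : MvPolynomial ν K, ∀ g, ξ (v g) = MvPolynomial.eval (ev g) p := by
  induction hv using Submodule.span_induction with
  | mem v hv =>
    obtain ⟨q, r, rfl⟩ := hv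
    exact ⟨q * MvPolynomial.C (ξ r), fun g => by simp⟩
  | zero => exact ⟨0, fun g => by simp⟩
  | add v w _ _ hv hw =>
    obtain ⟨p, hp⟩ := hv
    obtain ⟨q, hq⟩ := hw
    exact ⟨p + q, fun g => by simp [hp, hq]⟩
  | smul c v _ hv =>
    obtain ⟨p, hp⟩ := hv
    exact ⟨MvPolynomial.C c * p, fun g => by simp [hp]⟩

/-- Linear independence is an open condition. -/
theorem exists_eval_ne_zero_linearIndependent {ι : Type*} [Finite ι] {v : ι → G → R}
    (hv : ∀ i, v i ∈ polyFun ev R) (π : R →ₗ[K] Y) {g₀ : G}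
    (hli : LinearIndependent K fun i => π (v i g₀)) :
    ∃ p : MvPolynomial ν K, MvPolynomial.eval (ev g₀) p ≠ 0 ∧
      ∀ g, MvPolynomial.eval (ev g) p ≠ 0 → LinearIndependent K fun i => π (v i g) := by
  classical
  have := Fintype.ofFinite ι
  obtain ⟨φ, hφ⟩ := LinearMap.exists_leftInverse_of_injective
    (Fintype.linearCombination K fun i => π (v i g₀))
    (LinearMap.ker_eq_bot.2 hli.fintypeLinearCombination_injective)
  choose p hp using fun i j => exists_eval_eq_of_mem_polyFun (hv j) (LinearMap.proj i ∘ₗ φ ∘ₗ π)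
  let Φ : Matrix ι ι (MvPolynomial ν K) := fun i j => p i j
  have hΦ : ∀ g, MvPolynomial.eval (ev g) Φ.det = (Matrix.of fun i j => φ (π (v j g)) i).det := by
    intro g
    rw [RingHom.map_det]
    congr 1
    ext i j
    exact (hp i j g).symm
  refine ⟨Φ.det, ?_, fun g hg => ?_⟩
  · have h1 : (Matrix.of fun i j => φ (π (v j g₀)) i) = 1 := by
      ext i j
      have := LinearMap.congr_fun hφ (Pi.single j 1)
      rw [LinearMap.comp_apply, Fintype.linearCombination_apply_single, one_smul] at this
      rw [Matrix.of_apply, this, LinearMap.id_apply, Matrix.one_apply, Pi.single_apply]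
    rw [hΦ, h1, Matrix.det_one]
    exact one_ne_zero
  · rw [hΦ] at hg
    rw [Fintype.linearIndependent_iff]
    intro c hc
    have h1 : (Matrix.of fun i j => φ (π (v j g)) i).mulVec c = 0 := by
      ext i
      have := congrFun (congrArg φ hc) i
      rw [map_sum, map_zero, Finset.sum_apply] at this
      rw [← this]
      simp only [Matrix.mulVec, dotProduct, Matrix.of_apply, map_smul, Pi.smul_apply, smul_eq_mul]
      exact Finset.sum_congr rfl fun j _ => mul_comm _ _
    exact fun i => congrFun (Matrix.eq_zero_of_mulVec_eq_zero hg h1) i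

end PolyFun

/-! ### Generic coordinates -/

section Generic

variable {K : Type u} [Field K] {n : ℕ} {R : Type v} [Ring R] [Algebra K R] {σ : Type w}
variable {𝒜 : ℕ → Submodule K R} [GradedAlgebra 𝒜] {ε η : K}
variable {b : Module.Basis σ K R} {expo : σ → Fin n → ℕ} {x : Fin n → R}
variable {Φ : GL (Fin n) K → R →ₐ[K] R}

/-- The coordinates of a matrix. -/
abbrev glCoord (g : GL (Fin n) K) : Fin n × Fin n → K := fun ij => g.val ij.1 ij.2

theorem exists_glCoord_ne_zero [Infinite K] {p : MvPolynomial (Fin n × Fin n) K} (hp : p ≠ 0) :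
    ∃ g : GL (Fin n) K, MvPolynomial.eval (glCoord g) p ≠ 0 := by
  have hdet := Matrix.det_mvPolynomialX_ne_zero (Fin n) K
  obtain ⟨y, hy⟩ : ∃ y, MvPolynomial.eval y
      (p * (Matrix.mvPolynomialX (Fin n) (Fin n) K).det) ≠ 0 := by
    by_contra! hall
    exact mul_ne_zero hp hdet (MvPolynomial.funext fun y => by rw [hall, map_zero])
  rw [map_mul] at hy
  have h1 : MvPolynomial.eval y (Matrix.mvPolynomialX (Fin n) (Fin n) K).det =
      (Matrix.of fun i j => y (i, j)).det := by
    rw [RingHom.map_det]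
    congr 1
    ext i j
    simp [Matrix.mvPolynomialX]
  have h2 := right_ne_zero_of_mul hy
  rw [h1] at h2
  exact ⟨Matrix.GeneralLinearGroup.mkOfDetNeZero _ h2, left_ne_zero_of_mul hy⟩

theorem MonomialModel.coord_mem_polyFun (h : KoszulModel 𝒜 n ε η)
    (hb : MonomialModel 𝒜 b expo x Φ) (f : R) : (fun g => Φ g f) ∈ polyFun glCoord R := by
  let S : Subalgebra K R :=
    { carrier := {f | (fun g => Φ g f) ∈ polyFun glCoord R}
      mul_mem' := fun {f f'} hf hf' => by
        change (fun g => Φ g (f * f')) ∈ polyFun glCoord R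
        simp only [map_mul]
        exact mul_mem_polyFun hf hf'
      add_mem' := fun {f f'} hf hf' => by
        change (fun g => Φ g (f + f')) ∈ polyFun glCoord R
        simp only [map_add]
        exact (polyFun glCoord R).add_mem hf hf'
      algebraMap_mem' := fun c => by
        change (fun g => Φ g (algebraMap K R c)) ∈ polyFun glCoord R
        simp only [AlgHom.commutes]
        exact const_mem_polyFun _ }
  have hS : S = ⊤ := hb.le_of_x_mem h fun j => by
    change (fun g => Φ g (x j)) ∈ polyFun glCoord R
    have : (fun g : GL (Fin n) K => Φ g (x j)) =
        ∑ i, fun g : GL (Fin n) K => MvPolynomial.eval (glCoord g) (MvPolynomial.X (i, j)) • x i := by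
      ext g
      rw [hb.coord, Finset.sum_apply]
      simp only [MvPolynomial.eval_X]
    rw [this]
    exact sum_mem fun i _ => eval_smul_mem_polyFun _ (const_mem_polyFun _)
  have : f ∈ S := hS ▸ Algebra.mem_top
  exact this

variable (b Φ) in
/-- The coordinate change `g` is general for `W`: all the ranks that determine the initial monomials
of `g W` are as large as possible. -/
def IsGenericCoord (W : Submodule K R) (g : GL (Fin n) K) : Prop :=
  ∀ (T : Set σ) (g' : GL (Fin n) K),
    Module.finrank K ((W.map (Φ g').toLinearMap).map (monProj b T)) ≤
      Module.finrank K ((W.map (Φ g).toLinearMap).map (monProj b T))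

theorem exists_linearIndependent_of_finrank_map {Y : Type*} [AddCommGroup Y] [Module K Y]
    (W : Submodule K R) [Module.Finite K W] (π : R →ₗ[K] Y) :
    ∃ f : Fin (Module.finrank K (W.map π)) → R, (∀ i, f i ∈ W) ∧
      LinearIndependent K (fun i => π (f i)) := by
  let c := Module.finBasis K (W.map π)
  choose f hf using fun i => (c i).2
  refine ⟨f, fun i => (hf i).1, ?_⟩
  have e : (fun i => π (f i)) = fun i => ((c i : W.map π) : Y) := funext fun i => (hf i).2
  rw [e]
  exact c.linearIndependent.map' (W.map π).subtype (Submodule.ker_subtype _)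

theorem card_le_finrank_of_linearIndependent {Y : Type*} [AddCommGroup Y] [Module K Y]
    (W : Submodule K R) [Module.Finite K W] (π : R →ₗ[K] Y) {r : ℕ} {f : Fin r → R}
    (hf : ∀ i, f i ∈ W) (hli : LinearIndependent K fun i => π (f i)) :
    r ≤ Module.finrank K (W.map π) := by
  let v : Fin r → W.map π := fun i => ⟨π (f i), Submodule.mem_map_of_mem (hf i)⟩
  have hv : LinearIndependent K v := LinearIndependent.of_comp (W.map π).subtype hli
  have := hv.fintype_card_le_finrank
  rwa [Fintype.card_fin] at this

/-- General coordinate changes form a nonempty Zariski open set: this is a condition for each of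
the finitely many sets of monomials of degree `d`. -/
theorem MonomialModel.exists_isGenericCoord [∀ a, Module.Finite K (𝒜 a)]
    (h : KoszulModel 𝒜 n ε η) (hb : MonomialModel 𝒜 b expo x Φ) {d : ℕ} {W : Submodule K R}
    (hW : W ≤ 𝒜 d) : ∃ p : MvPolynomial (Fin n × Fin n) K, p ≠ 0 ∧
      ∀ g : GL (Fin n) K, MvPolynomial.eval (glCoord g) p ≠ 0 → IsGenericCoord b Φ W g := by
  classical
  have hWfin := finite_of_le_deg hW
  have key : ∀ T : Set σ, ∃ p : MvPolynomial (Fin n × Fin n) K, p ≠ 0 ∧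
      ∀ g : GL (Fin n) K, MvPolynomial.eval (glCoord g) p ≠ 0 → ∀ g' : GL (Fin n) K,
        Module.finrank K ((W.map (Φ g').toLinearMap).map (monProj b T)) ≤
          Module.finrank K ((W.map (Φ g).toLinearMap).map (monProj b T)) := by
    intro T
    have hfin : (Set.range fun g : GL (Fin n) K =>
        Module.finrank K ((W.map (Φ g).toLinearMap).map (monProj b T))).Finite :=
      (Set.finite_Iic (Module.finrank K W)).subset (by
        rintro _ ⟨g, rfl⟩
        exact (Submodule.finrank_map_le _ _).trans (Submodule.finrank_map_le _ _))
    obtain ⟨_, ⟨g₀, rfl⟩, hg₀⟩ := hfin.exists_maximal (Set.range_nonempty _)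
    obtain ⟨f, hfW, hf⟩ := exists_linearIndependent_of_finrank_map (W.map (Φ g₀).toLinearMap)
      (monProj b T)
    choose f' hf'W hf' using hfW
    have hf₀ : LinearIndependent K fun i => monProj b T (Φ g₀ (f' i)) := by
      have : (fun i => monProj b T (Φ g₀ (f' i))) = fun i => monProj b T (f i) :=
        funext fun i => congrArg _ (hf' i)
      rwa [this]
    obtain ⟨p, hp, hp'⟩ := exists_eval_ne_zero_linearIndependent
      (fun i => hb.coord_mem_polyFun h (f' i)) (monProj b T) hf₀
    refine ⟨p, fun h0 => hp (by rw [h0, map_zero]), fun g hg g' => ?_⟩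
    have hle := card_le_finrank_of_linearIndependent (W.map (Φ g).toLinearMap) (monProj b T)
      (fun i => Submodule.mem_map_of_mem (hf'W i)) (hp' g hg)
    refine le_trans ?_ hle
    rcases le_total (Module.finrank K ((W.map (Φ g').toLinearMap).map (monProj b T)))
      (Module.finrank K ((W.map (Φ g₀).toLinearMap).map (monProj b T))) with h' | h'
    · exact h'
    · exact hg₀ ⟨g', rfl⟩ h'
  choose p hp hp' using key
  -- only the monomials of degree `d` matter, so there are finitely many conditions
  let D := (hb.finite_degree d).toFinset
  refine ⟨∏ T ∈ D.powerset, p T, Finset.prod_ne_zero_iff.2 fun T _ => hp T, fun g hg T g' => ?_⟩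
  rw [map_prod] at hg
  have hcong : ∀ g : GL (Fin n) K, (W.map (Φ g).toLinearMap).map (monProj b T) =
      (W.map (Φ g).toLinearMap).map (monProj b ↑(D.filter (· ∈ T))) := by
    intro g
    ext y
    simp only [Submodule.mem_map]
    have : ∀ f ∈ W, monProj b T ((Φ g).toLinearMap f) =
        monProj b ↑(D.filter (· ∈ T)) ((Φ g).toLinearMap f) := fun f hf =>
      monProj_congr (D := D) (by ext s; simp [and_comm]) fun s hs => by
        rw [Set.Finite.coe_toFinset]
        exact hb.sum_expo_eq (hb.coord_mem h g (hW hf)) hs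
    constructor
    · rintro ⟨_, ⟨f, hf, rfl⟩, rfl⟩
      exact ⟨_, ⟨f, hf, rfl⟩, (this f hf).symm⟩
    · rintro ⟨_, ⟨f, hf, rfl⟩, rfl⟩
      exact ⟨_, ⟨f, hf, rfl⟩, this f hf⟩
  rw [hcong, hcong]
  exact hp' _ g (Finset.prod_ne_zero_iff.1 hg _
    (Finset.mem_powerset.2 (Finset.filter_subset _ _))) g'

/-- All general coordinate changes give the same initial monomials. -/
theorem MonomialModel.inSet_eq_of_isGenericCoord [∀ a, Module.Finite K (𝒜 a)]
    (h : KoszulModel 𝒜 n ε η) (hb : MonomialModel 𝒜 b expo x Φ) {d : ℕ} {W : Submodule K R}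
    (hW : W ≤ 𝒜 d) {g g' : GL (Fin n) K} (hg : IsGenericCoord b Φ W g)
    (hg' : IsGenericCoord b Φ W g') :
    inSet b expo (W.map (Φ g).toLinearMap) = inSet b expo (W.map (Φ g').toLinearMap) := by
  have := finite_of_le_deg hW
  have hsupp : ∀ g : GL (Fin n) K, ∀ f ∈ W.map (Φ g).toLinearMap, ∀ s, b.repr f s ≠ 0 →
      s ∈ {s | ∑ i, expo s i = d} := by
    rintro g _ ⟨f, hf, rfl⟩ s hs
    exact hb.sum_expo_eq (hb.coord_mem h g (hW hf)) hs
  exact inSet_eq_of_finrank_eq hb.injective (hb.finite_degree d) (hsupp g) (hsupp g')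
    fun T _ _ => _root_.le_antisymm (hg' T g) (hg T g')

/-! ### Existence and uniqueness of the generic initial ideal -/

variable [Infinite K]

theorem IsZariskiOpen.exists_subset {U : Set (GL (Fin n) K)} (hU : IsZariskiOpen U)
    (hne : U.Nonempty) : ∃ p : MvPolynomial (Fin n × Fin n) K, p ≠ 0 ∧
      ∀ g : GL (Fin n) K, MvPolynomial.eval (glCoord g) p ≠ 0 → g ∈ U := by
  obtain ⟨P, rfl⟩ := hU
  obtain ⟨g, p, hp, hg⟩ := hne
  exact ⟨p, fun h0 => hg (by rw [h0, map_zero]), fun g hg => ⟨p, hp, hg⟩⟩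

/-- Nonempty Zariski open subsets of `GL n K` intersect. -/
theorem IsGenericInitialIdeal.unique {I J J' : Ideal R}
    (hJ : IsGenericInitialIdeal b expo Φ I J) (hJ' : IsGenericInitialIdeal b expo Φ I J') :
    J = J' := by
  obtain ⟨U, hU, hne, hUJ⟩ := hJ
  obtain ⟨U', hU', hne', hUJ'⟩ := hJ'
  obtain ⟨p, hp, hpU⟩ := hU.exists_subset hne
  obtain ⟨p', hp', hpU'⟩ := hU'.exists_subset hne'
  obtain ⟨g, hg⟩ := exists_glCoord_ne_zero (mul_ne_zero hp hp')
  rw [map_mul] at hg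
  rw [← hUJ g (hpU g (left_ne_zero_of_mul hg)), hUJ' g (hpU' g (right_ne_zero_of_mul hg))]

variable [∀ a, Module.Finite K (𝒜 a)]

/-- Existence of the generic initial ideal. Coordinates can be general in all degrees up to `D` at
once, and by noetherianity the monomials found in these degrees generate those of all degrees; a
comparison of dimensions shows that no further initial monomials occur. -/
theorem MonomialModel.exists_isGenericInitialIdeal [IsNoetherianRing R]
    (h : KoszulModel 𝒜 n ε η) (hb : MonomialModel 𝒜 b expo x Φ) {P : GradedFamily R 𝒜}
    (hP : P ≤ wholeFam 𝒜) : ∃ J, IsGenericInitialIdeal b expo Φ (toIdeal P) J := by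
  choose p hp hpg using fun d => hb.exists_isGenericCoord h (hP d)
  choose g₀ hg₀ using fun d => exists_glCoord_ne_zero (hp d)
  -- the monomials of degree `d` of the generic initial ideal
  let N : ℕ → Set σ := fun d => inSet b expo ((P d).map (Φ (g₀ d)).toLinearMap)
  have hN : ∀ d g, MvPolynomial.eval (glCoord g) (p d) ≠ 0 →
      inSet b expo (hb.mapFam h g P d) = N d := fun d g hg =>
    hb.inSet_eq_of_isGenericCoord h (hP d) (hpg d g hg) (hpg d _ (hg₀ d))
  -- the ideal generated by these monomials up to degree `D`
  let A : ℕ →o Ideal R :=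
    { toFun := fun D => Ideal.span {r | ∃ d ≤ D, ∃ s ∈ N d, b s = r}
      monotone' := fun D D' hDD' => Ideal.span_mono fun r ⟨d, hd, hr⟩ => ⟨d, hd.trans hDD', hr⟩ }
  obtain ⟨D, hD⟩ := monotone_stabilizes_iff_noetherian.2 ‹IsNoetherianRing R› A
  have hmemA : ∀ d, ∀ s ∈ N d, b s ∈ A D := by
    intro d s hs
    have h1 : b s ∈ A (max D d) := Ideal.subset_span ⟨d, le_max_right _ _, s, hs, rfl⟩
    rwa [← hD _ (le_max_left _ _)] at h1
  have hprod : ∏ d ∈ Finset.range (D + 1), p d ≠ 0 := Finset.prod_ne_zero_iff.2 fun d _ => hp d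
  obtain ⟨g₁, hg₁⟩ := exists_glCoord_ne_zero hprod
  refine ⟨A D, {g | MvPolynomial.eval (glCoord g) (∏ d ∈ Finset.range (D + 1), p d) ≠ 0},
    ⟨{∏ d ∈ Finset.range (D + 1), p d}, ?_⟩, ⟨g₁, hg₁⟩, fun g hg => ?_⟩
  · ext g
    simp
  · have hg : MvPolynomial.eval (glCoord g) (∏ d ∈ Finset.range (D + 1), p d) ≠ 0 := hg
    rw [map_prod] at hg
    have hgP := hb.mapFam_le h (g := g) hP
    rw [hb.map_toIdeal h, hb.initialIdeal_toIdeal h hgP]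
    have hle : A D ≤ toIdeal (hb.inFam h _ hgP) := by
      refine Ideal.span_le.2 ?_
      rintro _ ⟨d, hd, s, hs, rfl⟩
      rw [← hN d g (Finset.prod_ne_zero_iff.1 hg d (Finset.mem_range.2 (by omega)))] at hs
      exact mem_toIdeal_of_mem (P := hb.inFam h _ hgP) (Submodule.subset_span ⟨s, hs, rfl⟩)
    refine _root_.le_antisymm (Ideal.span_le.2 ?_) hle
    rintro f ⟨d, hf⟩
    suffices h' : hb.inFam h _ hgP d ≤ (A D).restrictScalars K from h' hf
    rw [hb.inFam_apply, Submodule.span_le]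
    rintro _ ⟨s, hs, rfl⟩
    refine hmemA d s ?_
    -- `N d` is contained in the set of initial monomials, and has the same number of elements
    have hdeg : ∀ V : GL (Fin n) K, ∀ s ∈ inSet b expo ((P d).map (Φ V).toLinearMap),
        ∑ i, expo s i = d := by
      rintro V s ⟨_, ⟨f, hf, rfl⟩, hs, -⟩
      exact hb.sum_expo_eq (hb.coord_mem h V (hP d hf)) hs
    have hsub : N d ⊆ inSet b expo (hb.mapFam h g P d) := by
      intro t ht
      have h1 := hle (hmemA d t ht)
      have h2 : b t ∈ 𝒜 d := by
        have := hb.mem t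
        rwa [hdeg _ t ht] at this
      rw [mem_toIdeal_iff_of_mem (hb.inFam_le h hgP) h2, hb.inFam_apply, b.mem_span_image] at h1
      apply h1
      rw [b.repr_self, Finset.mem_coe, Finsupp.mem_support_iff, Finsupp.single_eq_same]
      exact one_ne_zero
    have hfin : (inSet b expo (hb.mapFam h g P d)).Finite :=
      (hb.finite_degree d).subset (hdeg g)
    have hPfin := wholeFam_finDim.mono hP d
    have : Module.Finite K (hb.mapFam h g P d) :=
      Module.Finite.map (P d) (Φ g).toLinearMap
    rw [Set.eq_of_subset_of_ncard_le hsub ?_ hfin]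
    · exact hs
    · rw [← finrank_eq_ncard_inSet hb.injective, ← finrank_eq_ncard_inSet hb.injective,
        hb.finrank_map_coord h]
      exact (hb.finrank_map_coord h _ _).le

/-- The generic initial ideal may be computed with coordinates that are general for the component
of a given degree. -/
theorem MonomialModel.exists_isGenericCoord_of_gin (h : KoszulModel 𝒜 n ε η)
    (hb : MonomialModel 𝒜 b expo x Φ) {P : GradedFamily R 𝒜} (hP : P ≤ wholeFam 𝒜) {J : Ideal R}
    (hJ : IsGenericInitialIdeal b expo Φ (toIdeal P) J) (d : ℕ) :
    ∃ g, IsGenericCoord b Φ (P d) g ∧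
      J = toIdeal (hb.inFam h (hb.mapFam h g P) (hb.mapFam_le h hP)) := by
  obtain ⟨U, hU, hne, hUJ⟩ := hJ
  obtain ⟨p, hp, hpU⟩ := hU.exists_subset hne
  obtain ⟨q, hq, hqg⟩ := hb.exists_isGenericCoord h (hP d)
  obtain ⟨g, hg⟩ := exists_glCoord_ne_zero (mul_ne_zero hp hq)
  rw [map_mul] at hg
  refine ⟨g, hqg g (right_ne_zero_of_mul hg), ?_⟩
  rw [← hUJ g (hpU g (left_ne_zero_of_mul hg)), hb.map_toIdeal h, hb.initialIdeal_toIdeal h]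

end Generic

/-! ### Strong stability of generic initial ideals -/

section Transvection

variable {K : Type u} [Field K] {n : ℕ} {R : Type v} [Ring R] [Algebra K R] {σ : Type w}
variable {𝒜 : ℕ → Submodule K R} [GradedAlgebra 𝒜] {ε η : K}
variable {b : Module.Basis σ K R} {expo : σ → Fin n → ℕ} {x : Fin n → R}
variable {Φ : GL (Fin n) K → R →ₐ[K] R}

/-- The matrix of the coordinate change `x_m ↦ x_m + c x_a`. -/
def transGL {a m : Fin n} (ham : a ≠ m) (c : K) : GL (Fin n) K where
  val := Matrix.transvection a m c
  inv := Matrix.transvection a m (-c)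
  val_inv := by rw [Matrix.transvection_mul_transvection_same _ _ ham, add_neg_cancel,
    Matrix.transvection_zero]
  inv_val := by rw [Matrix.transvection_mul_transvection_same _ _ ham, neg_add_cancel,
    Matrix.transvection_zero]

theorem transGL_zero {a m : Fin n} (ham : a ≠ m) : transGL (K := K) ham 0 = 1 :=
  Units.ext (Matrix.transvection_zero a m)

theorem MonomialModel.coord_transGL (hb : MonomialModel 𝒜 b expo x Φ) {a m : Fin n} (ham : a ≠ m)
    (c : K) (j : Fin n) :
    Φ (transGL ham c) (x j) = x j + if j = m then c • x a else 0 := by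
  rw [hb.coord]
  change ∑ i, (Matrix.transvection a m c) i j • x i = _
  simp only [Matrix.transvection, Matrix.add_apply, add_smul, Finset.sum_add_distrib]
  congr 1
  · rw [Finset.sum_eq_single j]
    · rw [Matrix.one_apply_eq, one_smul]
    · intro i _ hij
      rw [Matrix.one_apply_ne hij, zero_smul]
    · exact fun hj => absurd (Finset.mem_univ j) hj
  · rw [Finset.sum_eq_single a]
    · by_cases hj : j = m
      · rw [if_pos hj, hj, Matrix.single_apply_same]
      · rw [if_neg hj, Matrix.single_apply_of_ne _ _ _ _ _ (fun h => hj h.2.symm), zero_smul]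
    · intro i _ hia
      rw [Matrix.single_apply_of_ne _ _ _ _ _ (fun h => hia h.1.symm), zero_smul]
    · exact fun ha => absurd (Finset.mem_univ a) ha

theorem MonomialModel.coord_transGL_of_expo_eq_zero (h : KoszulModel 𝒜 n ε η)
    (hb : MonomialModel 𝒜 b expo x Φ) {a m : Fin n} (ham : a ≠ m) (c : K) {t : σ}
    (ht : expo t m = 0) : Φ (transGL ham c) (b t) = b t := by
  induction hd : ∑ i, expo t i generalizing t with
  | zero =>
    have h0 := hb.mem t
    rw [hd] at h0
    obtain ⟨c', hc'⟩ := Submodule.mem_span_singleton.1 (h.zero_deg h0)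
    rw [← hc', map_smul, map_one]
  | succ d ih =>
    obtain ⟨i, -, hi⟩ := Finset.exists_ne_zero_of_sum_ne_zero (hd.trans_ne (Nat.succ_ne_zero d))
    obtain ⟨s, c', hc', hst, e⟩ := hb.div_x t i hi
    have him : i ≠ m := by
      rintro rfl
      exact hi ht
    have hs : expo s m = 0 := by
      rw [hst, Pi.add_apply] at ht
      omega
    have hsd : ∑ i, expo s i = d := by
      rw [hst] at hd
      simp only [Pi.add_apply, Finset.sum_add_distrib, Finset.sum_pi_single', Finset.mem_univ,
        if_true] at hd
      omega
    have e' : b t = c'⁻¹ • (b s * x i) := by rw [e, smul_smul, inv_mul_cancel₀ hc', one_smul]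
    rw [e', map_smul, map_mul, ih hs hsd, hb.coord_transGL, if_neg him, add_zero]

theorem MonomialModel.exists_mul_pow (hb : MonomialModel 𝒜 b expo x Φ) (m : Fin n) {e : ℕ} {t : σ}
    (ht : expo t m = e) : ∃ s, ∃ c : K, c ≠ 0 ∧ expo s m = 0 ∧ b s * x m ^ e = c • b t := by
  induction e generalizing t with
  | zero => exact ⟨t, 1, one_ne_zero, ht, by simp⟩
  | succ e ih =>
    obtain ⟨r, c, hc, hrt, hr⟩ := hb.div_x t m (by omega)
    obtain ⟨s, c', hc', hs, hs'⟩ := ih (t := r) (by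
      rw [hrt, Pi.add_apply, Pi.single_eq_same] at ht
      omega)
    exact ⟨s, c' * c, mul_ne_zero hc' hc, hs, by
      rw [pow_succ, ← mul_assoc, hs', smul_mul_assoc, hr, smul_smul]⟩

/-- The parameter of a one-parameter family, as the argument of a polynomial. -/
abbrev paramCoord (c : K) : Unit → K := fun _ => c

theorem smul_mem_polyFun_param {v : K → R} (hv : v ∈ polyFun paramCoord R) :
    (fun c => c • v c) ∈ polyFun paramCoord R := by
  have := eval_smul_mem_polyFun (MvPolynomial.X ()) hv
  simpa only [MvPolynomial.eval_X] using this

/-- The binomial formula for `(y + c z) ^ e` to first order in `c`, with polynomial remainder. -/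
theorem exists_add_pow_expansion {y z : R} {e : ℕ} (he : e ≤ 1 ∨ Commute y z) :
    ∃ κ ∈ polyFun (paramCoord (K := K)) R, ∀ c : K,
      (y + c • z) ^ e = y ^ e + c • ((e : K) • (y ^ (e - 1) * z)) + c ^ 2 • κ c := by
  rcases he with he | he
  · refine ⟨0, zero_mem _, fun c => ?_⟩
    obtain rfl | rfl : e = 0 ∨ e = 1 := by omega
    · simp
    · simp
  · induction e with
    | zero => exact ⟨0, zero_mem _, fun c => by simp⟩
    | succ e ih =>
      obtain ⟨κ, hκ, hκ'⟩ := ih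
      refine ⟨fun c => (e : K) • (y ^ (e - 1) * z) * z + (κ c * y + c • (κ c * z)), ?_, fun c => ?_⟩
      · refine (polyFun paramCoord R).add_mem (const_mem_polyFun _)
          ((polyFun paramCoord R).add_mem (mul_mem_polyFun hκ (const_mem_polyFun _))
          (smul_mem_polyFun_param (mul_mem_polyFun hκ (const_mem_polyFun _))))
      · have h1 : (e : K) • (y ^ (e - 1) * z) * y = (e : K) • (y ^ e * z) := by
          obtain _ | e := e
          · simp
          · rw [Nat.add_sub_cancel, smul_mul_assoc, mul_assoc, ← he.eq, ← mul_assoc, pow_succ]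
        have h2 : ∀ A B k : R, (A + c • B + c ^ 2 • k) * (y + c • z) =
            A * y + c • (A * z) + c • (B * y) + c ^ 2 • (B * z + (k * y + c • (k * z))) := by
          intro A B k
          simp only [add_mul, mul_add, smul_mul_assoc, mul_smul_comm]
          module
        rw [pow_succ, hκ', h2, h1, ← pow_succ, Nat.add_sub_cancel, Nat.cast_succ, add_smul, one_smul,
          smul_add c ((e : K) • (y ^ e * z))]
        abel

/-- Expansion of the coordinate change `x_m ↦ x_m + c x_a` to first order in `c`. -/
theorem MonomialModel.exists_transGL_expansion (h : KoszulModel 𝒜 n ε η)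
    (hb : MonomialModel 𝒜 b expo x Φ) {a m : Fin n} (ham : a ≠ m) (w : σ) :
    ∃ δ : R, ∃ κ ∈ polyFun (paramCoord (K := K)) R,
      (∀ c : K, Φ (transGL ham c) (b w) = b w + c • δ + c ^ 2 • κ c) ∧
      (∀ t, b.repr δ t ≠ 0 → expo t + Pi.single m 1 = expo w + Pi.single a 1) ∧
      ∀ t, expo t + Pi.single m 1 = expo w + Pi.single a 1 → b.repr δ t ≠ 0 := by
  obtain he | ⟨e, he⟩ : expo w m = 0 ∨ ∃ e, expo w m = e + 1 := by
    rcases Nat.eq_zero_or_pos (expo w m) with h0 | h0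
    · exact Or.inl h0
    · exact Or.inr ⟨expo w m - 1, by omega⟩
  · refine ⟨0, 0, zero_mem _, fun c => ?_, fun t ht => ?_, fun t ht => ?_⟩
    · rw [hb.coord_transGL_of_expo_eq_zero h ham c he]
      simp
    · rw [map_zero] at ht
      exact absurd rfl ht
    · have := congrFun ht m
      rw [Pi.add_apply, Pi.add_apply, he, Pi.single_eq_same, Pi.single_eq_of_ne ham.symm] at this
      omega
  · obtain ⟨r, c₁, hc₁, hrw, hr⟩ := hb.div_x w m (by omega)
    have hre : expo r m = e := by
      rw [hrw, Pi.add_apply, Pi.single_eq_same] at he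
      omega
    obtain ⟨s, c₂, hc₂, hs, hs'⟩ := hb.exists_mul_pow m hre
    have hcond : e + 1 ≤ 1 ∨ Commute (x m) (x a) := by
      rcases hb.char_cond with h1 | ⟨-, h1⟩
      · exact Or.inl (he ▸ h1 w m)
      · exact Or.inr (h1 m a)
    have hcast : ((e + 1 : ℕ) : K) ≠ 0 := by
      rcases hb.char_cond with h1 | ⟨h1, -⟩
      · have := h1 w m
        obtain rfl : e = 0 := by omega
        simp
      · exact Nat.cast_ne_zero.2 (Nat.succ_ne_zero e)
    obtain ⟨κ, hκ, hκ'⟩ := exists_add_pow_expansion (K := K) hcond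
    have hbw : b w = (c₂ * c₁)⁻¹ • (b s * x m ^ (e + 1)) := by
      rw [pow_succ, ← mul_assoc, hs', smul_mul_assoc, hr, smul_smul, smul_smul, mul_assoc,
        inv_mul_cancel₀ (mul_ne_zero hc₂ hc₁), one_smul]
    have hδ : b s * (x m ^ e * x a) = c₂ • (b r * x a) := by
      rw [← mul_assoc, hs', smul_mul_assoc]
    refine ⟨(c₂ * c₁)⁻¹ • ((e + 1 : ℕ) : K) • c₂ • (b r * x a),
      fun c => (c₂ * c₁)⁻¹ • (b s * κ c), ?_,
      fun c => ?_, fun t ht => ?_, fun t ht => ?_⟩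
    · exact (polyFun paramCoord R).smul_mem _ (mul_mem_polyFun (const_mem_polyFun _) hκ)
    · rw [hbw, map_smul, map_mul, map_pow, hb.coord_transGL_of_expo_eq_zero h ham c hs,
        hb.coord_transGL, if_pos rfl, hκ', Nat.add_sub_cancel, mul_add, mul_add, mul_smul_comm,
        mul_smul_comm, mul_smul_comm, hδ]
      module
    · rw [map_smul, map_smul, map_smul, Finsupp.smul_apply, Finsupp.smul_apply,
        Finsupp.smul_apply] at ht
      have ht := right_ne_zero_of_mul (right_ne_zero_of_mul (right_ne_zero_of_mul ht))
      rcases hb.mul_x r a with h0 | ⟨q, c, hq, hqc⟩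
      · rw [h0, map_zero] at ht
        exact absurd rfl ht
      · rw [hqc, map_smul, Finsupp.smul_apply, b.repr_self] at ht
        obtain rfl : t = q := by
          by_contra hne
          exact right_ne_zero_of_mul ht (Finsupp.single_eq_of_ne hne)
        rw [hq, hrw]
        abel
    · have hta : expo t = expo r + Pi.single a 1 := by
        refine add_right_cancel (b := Pi.single m 1) ?_
        rw [ht, hrw]
        abel
      obtain ⟨q, c, hc, hq, hqc⟩ := hb.div_x t a (by
        rw [hta, Pi.add_apply, Pi.single_eq_same]
        omega)
      obtain rfl : q = r := hb.injective (add_right_cancel (hq.symm.trans hta))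
      rw [hqc]
      simp only [map_smul, Finsupp.smul_apply, b.repr_self, Finsupp.single_eq_same, smul_eq_mul,
        mul_one]
      exact mul_ne_zero (inv_ne_zero (mul_ne_zero hc₂ hc₁)) (mul_ne_zero hcast (mul_ne_zero hc₂ hc))

/-- The first-order term of the coordinate change `x_m ↦ x_m + c x_a` applied to `f`: its monomials
are exactly the ones that arise from monomials of `f` on exchanging `x_m` for `x_a`. -/
theorem MonomialModel.exists_transGL_expansion' (h : KoszulModel 𝒜 n ε η)
    (hb : MonomialModel 𝒜 b expo x Φ) {a m : Fin n} (ham : a ≠ m) (f : R) :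
    ∃ δ : R, ∃ κ ∈ polyFun (paramCoord (K := K)) R,
      (∀ c : K, Φ (transGL ham c) f = f + c • δ + c ^ 2 • κ c) ∧
      (∀ t, b.repr δ t ≠ 0 → ∃ w, b.repr f w ≠ 0 ∧
        expo t + Pi.single m 1 = expo w + Pi.single a 1) ∧
      ∀ t w, b.repr f w ≠ 0 → expo t + Pi.single m 1 = expo w + Pi.single a 1 →
        b.repr δ t ≠ 0 := by
  classical
  choose δ κ hκ hexp hδ hδ' using fun w => hb.exists_transGL_expansion h ham w
  have hf : f = ∑ w ∈ (b.repr f).support, b.repr f w • b w := by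
    conv_lhs => rw [← b.linearCombination_repr f, Finsupp.linearCombination_apply, Finsupp.sum]
  have hrepr : ∀ t, b.repr (∑ w ∈ (b.repr f).support, b.repr f w • δ w) t =
      ∑ w ∈ (b.repr f).support, b.repr f w * b.repr (δ w) t := fun t => by
    rw [map_sum, Finsupp.finsetSum_apply]
    simp only [map_smul, Finsupp.smul_apply, smul_eq_mul]
  refine ⟨∑ w ∈ (b.repr f).support, b.repr f w • δ w,
    fun c => ∑ w ∈ (b.repr f).support, b.repr f w • κ w c, ?_, fun c => ?_, fun t ht => ?_,
    fun t w hw ht => ?_⟩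
  · have : (fun c => ∑ w ∈ (b.repr f).support, b.repr f w • κ w c) =
        ∑ w ∈ (b.repr f).support, b.repr f w • κ w := by
      ext c
      simp [Finset.sum_apply]
    rw [this]
    exact sum_mem fun w _ => Submodule.smul_mem _ _ (hκ w)
  · conv_lhs => rw [hf, map_sum]
    conv_rhs => enter [1, 1]; rw [hf]
    rw [Finset.smul_sum, Finset.smul_sum, ← Finset.sum_add_distrib, ← Finset.sum_add_distrib]
    refine Finset.sum_congr rfl fun w _ => ?_
    rw [map_smul, hexp]
    module
  · rw [hrepr] at ht
    obtain ⟨w, hw, hwt⟩ := Finset.exists_ne_zero_of_sum_ne_zero ht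
    exact ⟨w, Finsupp.mem_support_iff.1 hw, hδ w t (right_ne_zero_of_mul hwt)⟩
  · rw [hrepr, Finset.sum_eq_single w]
    · exact mul_ne_zero hw (hδ' w t ht)
    · intro w' _ hne
      by_contra h0
      have := hδ w' t (right_ne_zero_of_mul h0)
      exact hne (hb.injective (add_right_cancel (this.symm.trans ht)))
    · exact fun h0 => absurd (Finsupp.mem_support_iff.2 hw) h0

variable [Infinite K] [∀ a, Module.Finite K (𝒜 a)]

/-- In general coordinates the initial monomials are strongly stable: an exchange of `x_m` for an
`x_a` with `a < m` leads from initial monomials to initial monomials. Otherwise the coordinate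
change `x_m ↦ x_m + c x_a`, for general `c`, would raise the rank of the projection to the
monomials that are at least the new one. -/
theorem MonomialModel.mem_inSet_of_exchange (h : KoszulModel 𝒜 n ε η)
    (hb : MonomialModel 𝒜 b expo x Φ) {d : ℕ} {W : Submodule K R} (hW : W ≤ 𝒜 d)
    {g : GL (Fin n) K} (hg : IsGenericCoord b Φ W g) {a m : Fin n} (ham : a < m) {s t : σ}
    (hs : s ∈ inSet b expo (W.map (Φ g).toLinearMap))
    (hst : expo t + Pi.single m 1 = expo s + Pi.single a 1) :
    t ∈ inSet b expo (W.map (Φ g).toLinearMap) := by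
  classical
  by_contra htN
  set N := W.map (Φ g).toLinearMap with hN
  have hWfin := finite_of_le_deg hW
  obtain ⟨f, hfN, hf⟩ := hs
  -- the monomials that are at least `t`; the projection of `f` to their span vanishes, since
  -- `s < t`
  let T : Set σ := {r | r = t ∨ RevLexLT (expo t) (expo r)}
  have hlt : RevLexLT (expo s) (expo t) := by
    refine Or.inr ⟨?_, m, ?_, fun j hj => ?_⟩
    · have := congrArg (fun p : Fin n → ℕ => ∑ i, p i) hst
      simp only [Pi.add_apply, Finset.sum_add_distrib, Finset.sum_pi_single', Finset.mem_univ,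
        if_true] at this
      omega
    · have := congrFun hst m
      rw [Pi.add_apply, Pi.add_apply, Pi.single_eq_same, Pi.single_eq_of_ne ham.ne'] at this
      omega
    · have := congrFun hst j
      rw [Pi.add_apply, Pi.add_apply, Pi.single_eq_of_ne hj.ne',
        Pi.single_eq_of_ne (ham.trans hj).ne'] at this
      omega
  have hTf : monProj b T f = 0 := by
    rw [monProj_eq_zero_iff]
    intro r hr
    by_contra hne
    have hrt : RevLexLT (expo r) (expo t) := by
      by_cases hrs : r = s
      · exact hrs ▸ hlt
      · exact (hf.2 r hne hrs).trans hlt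
    rcases hr with rfl | hr
    · exact RevLexLT.irrefl _ hrt
    · exact RevLexLT.irrefl _ (hr.trans hrt)
  obtain ⟨δ, κ, hκ, hexp, hδ, hδ'⟩ := hb.exists_transGL_expansion' h ham.ne f
  -- `t` is the only monomial of the first-order term `δ` that lies in `T`, so an element of `N`
  -- with the same projection as `δ` would have initial monomial `t`
  have hδT : ∀ r ∈ T, b.repr δ r ≠ 0 → r = t := by
    intro r hr hne
    obtain ⟨w, hw, hrw⟩ := hδ r hne
    by_cases hws : w = s
    · rw [hws, ← hst] at hrw
      exact hb.injective (add_right_cancel hrw)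
    · have h1 := (hf.2 w hw hws).add_right (Pi.single a 1)
      rw [← hst, ← hrw] at h1
      rcases hr with rfl | hr
      · rfl
      · exact absurd (h1.trans (hr.add_right _)) (RevLexLT.irrefl _)
  have hnot : monProj b T δ ∉ N.map (monProj b T) := by
    rintro ⟨f', hf', hff'⟩
    have hcoef : ∀ r ∈ T, b.repr f' r = b.repr δ r := fun r hr => by
      have := congrArg (fun p => b.repr p r) hff'
      simpa only [repr_monProj, if_pos hr] using this
    refine htN ⟨f', hf', ?_, fun r hr hrt => ?_⟩
    · rw [hcoef t (Or.inl rfl)]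
      exact hδ' t s hf.1 hst
    · rcases RevLexLT.trichotomy (expo r) (expo t) with h1 | h1 | h1
      · exact h1
      · exact absurd (hb.injective h1) hrt
      · rw [hcoef r (Or.inr h1)] at hr
        exact absurd (hδT r (Or.inr h1) hr) hrt
  obtain ⟨F, hFN, hF⟩ := exists_linearIndependent_of_finrank_map N (monProj b T)
  have hpoly : ∀ f' : R, (fun c => Φ (transGL ham.ne c) f') ∈ polyFun (paramCoord (K := K)) R := by
    intro f'
    obtain ⟨δ', κ', hκ', hexp', -⟩ := hb.exists_transGL_expansion' h ham.ne f'
    have e : (fun c => Φ (transGL ham.ne c) f') =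
        (fun _ => f') + (fun c : K => c • δ') + fun c : K => c • c • κ' c := by
      ext c
      rw [hexp', pow_two, mul_smul]
      rfl
    rw [e]
    exact add_mem (add_mem (const_mem_polyFun _) (smul_mem_polyFun_param (const_mem_polyFun _)))
      (smul_mem_polyFun_param (smul_mem_polyFun_param hκ'))
  -- the vector `c⁻¹ Φ_c f` has projection `δ + c κ c`, and specializes to `δ` at `c = 0`; together
  -- with the images under `Φ_c` of vectors in `N` whose projections form a basis, it is
  -- independent for `c = 0`, hence for general `c`
  let v : Fin (Module.finrank K (N.map (monProj b T)) + 1) → K → R :=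
    Fin.cons (fun c => δ + c • κ c) fun i c => Φ (transGL ham.ne c) (F i)
  have hv : ∀ i, v i ∈ polyFun (paramCoord (K := K)) R := by
    intro i
    refine Fin.cases ?_ (fun i => ?_) i
    · exact (polyFun paramCoord R).add_mem (const_mem_polyFun _) (smul_mem_polyFun_param hκ)
    · exact hpoly (F i)
  have hv0 : LinearIndependent K fun i => monProj b T (v i 0) := by
    have e : (fun i => monProj b T (v i 0)) =
        Fin.cons (monProj b T δ) fun i => monProj b T (F i) := by
      ext i
      refine Fin.cases ?_ (fun i => ?_) i
      · simp [v]
      · simp [v, transGL_zero, hb.coord_one h]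
    rw [e, linearIndependent_finCons]
    refine ⟨hF, fun hmem => hnot (Submodule.span_le.2 ?_ hmem)⟩
    rintro _ ⟨i, rfl⟩
    exact Submodule.mem_map_of_mem (hFN i)
  obtain ⟨p, hp, hp'⟩ := exists_eval_ne_zero_linearIndependent hv (monProj b T) hv0
  have hpX : p * MvPolynomial.X () ≠ 0 := mul_ne_zero
    (fun h0 => hp (by rw [h0, map_zero])) (MvPolynomial.X_ne_zero _)
  obtain ⟨y, hy⟩ : ∃ y, MvPolynomial.eval y (p * MvPolynomial.X ()) ≠ 0 := by
    by_contra! hall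
    exact hpX (MvPolynomial.funext fun y => by rw [hall, map_zero])
  rw [map_mul, MvPolynomial.eval_X] at hy
  have hc := right_ne_zero_of_mul hy
  have hli := hp' (y ()) (left_ne_zero_of_mul hy)
  have hmap : W.map (Φ (transGL ham.ne (y ()) * g)).toLinearMap =
      N.map (Φ (transGL ham.ne (y ()))).toLinearMap := by
    rw [hb.coord_mul h, hN, ← Submodule.map_comp]
    rfl
  have hle := card_le_finrank_of_linearIndependent
    (W.map (Φ (transGL ham.ne (y ()) * g)).toLinearMap) (monProj b T)
    (f := Fin.cons ((y ())⁻¹ • Φ (transGL ham.ne (y ())) f)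
      fun i => Φ (transGL ham.ne (y ())) (F i))
    (by
      rw [hmap]
      intro i
      refine Fin.cases ?_ (fun i => ?_) i
      · exact Submodule.smul_mem _ _ ⟨f, hfN, rfl⟩
      · exact ⟨F i, hFN i, rfl⟩) (by
      convert hli using 1
      ext i
      refine Fin.cases ?_ (fun i => ?_) i
      · rw [Fin.cons_zero]
        simp only [v, Fin.cons_zero]
        rw [hexp, map_smul, map_add, map_add, hTf, zero_add, map_add, pow_two, mul_smul]
        simp only [map_smul]
        rw [← smul_add, smul_smul, inv_mul_cancel₀ hc, one_smul]
      · simp only [v, Fin.cons_succ])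
  exact absurd hle (not_le.2 (Nat.lt_succ_of_le (hg T (transGL ham.ne (y ()) * g))))

end Transvection

/-! ### The flag of the last variables -/

section StandardFlag

variable {K : Type u} [Field K] {n : ℕ} {R : Type v} [Ring R] [Algebra K R] {σ : Type w}
variable {𝒜 : ℕ → Submodule K R} [GradedAlgebra 𝒜] {ε η : K}
variable {b : Module.Basis σ K R} {expo : σ → Fin n → ℕ} {x : Fin n → R}
variable {Φ : GL (Fin n) K → R →ₐ[K] R} [∀ a, Module.Finite K (𝒜 a)]

/-- The variables in the order `x_n, x_{n-1}, …, x_1`. -/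
def lastVars (x : Fin n → R) (j : ℕ) : R := if hj : j < n then x (Fin.rev ⟨j, hj⟩) else 0

theorem lastVars_rev (l : Fin n) : lastVars x (Fin.rev l) = x l := by
  rw [lastVars, dif_pos (Fin.rev l).2, Fin.rev_rev]

theorem MonomialModel.span_eq (hb : MonomialModel 𝒜 b expo x Φ) :
    Submodule.span K (Set.range x) = 𝒜 1 :=
  _root_.le_antisymm (Submodule.span_le.2 (by
    rintro _ ⟨i, rfl⟩
    exact hb.x_mem i)) hb.span_x

theorem MonomialModel.linearIndependent_x (h : KoszulModel 𝒜 n ε η)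
    (hb : MonomialModel 𝒜 b expo x Φ) : LinearIndependent K x := by
  rw [linearIndependent_iff_card_eq_finrank_span, Set.finrank, hb.span_eq, h.finrank_one,
    Fintype.card_fin]

theorem flagSpan_lastVars {i : ℕ} (hi : i ≤ n) :
    flagSpan (K := K) (lastVars x) i = Submodule.span K (x '' {l | n ≤ l + i}) := by
  rw [flagSpan]
  congr 1
  ext y
  constructor
  · rintro ⟨j, hj, rfl⟩
    have hj : j < i := hj
    refine ⟨Fin.rev ⟨j, by omega⟩, ?_, ?_⟩
    · change n ≤ (Fin.rev (⟨j, by omega⟩ : Fin n) : ℕ) + i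
      rw [Fin.val_rev]
      change n ≤ n - (j + 1) + i
      omega
    · rw [lastVars, dif_pos]
  · rintro ⟨l, hl, rfl⟩
    have hl : n ≤ l + i := hl
    refine ⟨Fin.rev l, ?_, lastVars_rev l⟩
    change (Fin.rev l : ℕ) < i
    rw [Fin.val_rev]
    omega

theorem MonomialModel.isFlag_lastVars (h : KoszulModel 𝒜 n ε η)
    (hb : MonomialModel 𝒜 b expo x Φ) : IsFlag 𝒜 n (lastVars x) := by
  intro i hi
  have e : lastVars x i = x (Fin.rev ⟨i, hi⟩) := by rw [lastVars, dif_pos hi]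
  rw [e, flagSpan_lastVars hi.le]
  refine ⟨hb.x_mem _, (hb.linearIndependent_x h).notMem_span_image fun hmem => ?_⟩
  have hmem : n ≤ (Fin.rev (⟨i, hi⟩ : Fin n) : ℕ) + i := hmem
  rw [Fin.val_rev] at hmem
  change n ≤ n - (i + 1) + i at hmem
  omega

/-- The ideal generated by the last `i` variables is spanned by the monomials that involve one of
these variables. -/
theorem MonomialModel.genFam_flagSpan_lastVars
    (hb : MonomialModel 𝒜 b expo x Φ) {i : ℕ} (hi : i ≤ n) (d : ℕ) :
    genFam 𝒜 1 (flagSpan (lastVars x) i) d = Submodule.span K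
      (b '' {s | ∑ l, expo s l = d ∧ ∃ l : Fin n, n ≤ l + i ∧ expo s l ≠ 0}) := by
  refine _root_.le_antisymm (genFam_le_iff.2 ?_) (Submodule.span_le.2 ?_)
  · rintro a rfl r hr m hm
    have h1 : 𝒜 a ≤ Submodule.span K (b '' {s | ∑ l, expo s l = a}) := fun f hf =>
      b.mem_span_image.2 fun s hs => hb.sum_expo_eq hf (Finsupp.mem_support_iff.1 hs)
    rw [flagSpan_lastVars hi] at hm
    have h2 := Submodule.mul_mem_mul (h1 hr) hm
    rw [Submodule.span_mul_span] at h2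
    refine Submodule.span_le.2 ?_ h2
    rintro _ ⟨_, ⟨s, hs, rfl⟩, _, ⟨l, hl, rfl⟩, rfl⟩
    change b s * x l ∈ _
    rcases hb.mul_x s l with h0 | ⟨t, c, ht, hc⟩
    · rw [h0]
      exact zero_mem _
    · rw [hc]
      have hs : ∑ l, expo s l = a := hs
      refine Submodule.smul_mem _ _ (Submodule.subset_span ⟨t, ⟨?_, l, hl, ?_⟩, rfl⟩)
      · rw [ht]
        simp only [Pi.add_apply, Finset.sum_add_distrib, Finset.sum_pi_single', Finset.mem_univ,
          if_true, hs]
      · rw [ht, Pi.add_apply, Pi.single_eq_same]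
        omega
  · rintro _ ⟨t, ⟨hd, l, hl, hlt⟩, rfl⟩
    obtain ⟨s, c, hc, hst, e⟩ := hb.div_x t l hlt
    have e' : b t = c⁻¹ • (b s * x l) := by rw [e, smul_smul, inv_mul_cancel₀ hc, one_smul]
    have hsd : ∑ l, expo s l + 1 = d := by
      rw [← hd, hst]
      simp only [Pi.add_apply, Finset.sum_add_distrib, Finset.sum_pi_single', Finset.mem_univ,
        if_true]
    rw [e', ← hsd]
    refine Submodule.smul_mem _ _ (smul_mem_genFam (𝒜 := 𝒜) (hb.mem s) ?_)
    rw [flagSpan_lastVars hi]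
    exact Submodule.subset_span ⟨l, hl, rfl⟩

/-- The monomials that do not involve the last `i` variables. -/
def noLast (expo : σ → Fin n → ℕ) (i : ℕ) : Set σ := {s | ∀ l : Fin n, n ≤ l + i → expo s l = 0}

theorem MonomialModel.restrictedRank_lastVars (h : KoszulModel 𝒜 n ε η)
    (hb : MonomialModel 𝒜 b expo x Φ) {i : ℕ} (hi : i ≤ n) {d : ℕ} {W : Submodule K R}
    (hW : W ≤ 𝒜 d) : restrictedRank 𝒜 d W (flagSpan (lastVars x) i) =
      Module.finrank K (W.map (monProj b (noLast expo i))) := by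
  have hWfin := finite_of_le_deg hW
  have h1 := restrictedRank_add_inf hW ((hb.isFlag_lastVars h).flagSpan_le hi)
  have h2 := finrank_map_add_inf_ker (monProj b (noLast expo i)) W
  have h3 : W ⊓ genFam 𝒜 1 (flagSpan (lastVars x) i) d =
      W ⊓ LinearMap.ker (monProj b (noLast expo i)) := by
    ext f
    rw [Submodule.mem_inf, Submodule.mem_inf, LinearMap.mem_ker, monProj_eq_zero_iff,
      hb.genFam_flagSpan_lastVars hi, b.mem_span_image]
    refine and_congr_right fun hf => ⟨fun hsub s hs => ?_, fun hzero s hs => ?_⟩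
    · by_contra hne
      obtain ⟨-, l, hl, hls⟩ := hsub (Finsupp.mem_support_iff.2 hne)
      exact hls (hs l hl)
    · have hs := Finsupp.mem_support_iff.1 hs
      refine ⟨hb.sum_expo_eq (hW hf) hs, ?_⟩
      by_contra! hall
      exact hs (hzero s hall)
  rw [h3] at h1
  omega

theorem isUpperIn_noLast (d i : ℕ) :
    IsUpperIn expo {s | ∑ l, expo s l = d} (noLast expo i ∩ {s | ∑ l, expo s l = d}) := by
  rintro s ⟨hs, hsd⟩ t htd hst
  have hsd : ∑ l, expo s l = d := hsd
  have htd' : ∑ l, expo t l = d := htd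
  refine ⟨fun l hl => ?_, htd⟩
  rcases hst with h1 | ⟨-, m, hm, hm'⟩
  · omega
  · by_cases hml : m < l
    · rw [← hm' l hml]
      exact hs l hl
    · have : expo s m = 0 := hs m (by
        have : (l : ℕ) ≤ m := not_lt.1 hml
        omega)
      omega

/-- Passing to the initial monomials preserves the dimensions modulo the last variables. -/
theorem MonomialModel.restrictedRank_inSet (h : KoszulModel 𝒜 n ε η)
    (hb : MonomialModel 𝒜 b expo x Φ) {i : ℕ} (hi : i ≤ n) {d : ℕ} {W : Submodule K R}
    (hW : W ≤ 𝒜 d) (hW' : Submodule.span K (b '' inSet b expo W) ≤ 𝒜 d) :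
    restrictedRank 𝒜 d (Submodule.span K (b '' inSet b expo W)) (flagSpan (lastVars x) i) =
      restrictedRank 𝒜 d W (flagSpan (lastVars x) i) := by
  have key : ∀ V : Submodule K R, V ≤ 𝒜 d → restrictedRank 𝒜 d V (flagSpan (lastVars x) i) =
      (inSet b expo V ∩ (noLast expo i ∩ {s | ∑ l, expo s l = d})).ncard := by
    intro V hV
    have hVfin := finite_of_le_deg hV
    have hsupp : ∀ f ∈ V, ∀ s, b.repr f s ≠ 0 → s ∈ {s | ∑ l, expo s l = d} :=
      fun f hf s hs => hb.sum_expo_eq (hV hf) hs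
    rw [hb.restrictedRank_lastVars h hi hV,
      ← finrank_map_monProj hb.injective (isUpperIn_noLast d i) hsupp]
    have e : V.map (monProj b (noLast expo i)) =
        V.map (monProj b (noLast expo i ∩ {s | ∑ l, expo s l = d})) := by
      ext y
      simp only [Submodule.mem_map]
      have : ∀ f ∈ V, monProj b (noLast expo i) f =
          monProj b (noLast expo i ∩ {s | ∑ l, expo s l = d}) f := fun f hf =>
        monProj_congr (D := {s | ∑ l, expo s l = d})
          (by rw [Set.inter_assoc, Set.inter_self]) (hsupp f hf)
      exact ⟨fun ⟨f, hf, e⟩ => ⟨f, hf, this f hf ▸ e⟩,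
        fun ⟨f, hf, e⟩ => ⟨f, hf, (this f hf).symm ▸ e⟩⟩
    rw [e]
  rw [key _ hW', key _ hW, inSet_span]

/-- A strongly stable set of monomials satisfies the star condition for the last variables. -/
theorem MonomialModel.starCond_of_stable (h : KoszulModel 𝒜 n ε η)
    (hb : MonomialModel 𝒜 b expo x Φ) {d : ℕ} {A : Set σ} (hA : ∀ s ∈ A, ∑ l, expo s l = d)
    (hstable : ∀ a m, a < m → ∀ s ∈ A, ∀ t,
      expo t + Pi.single m 1 = expo s + Pi.single a 1 → t ∈ A) {i : ℕ} (hi : i < n) :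
    StarCond 𝒜 d (Submodule.span K (b '' A)) (flagSpan (lastVars x) i) (lastVars x i) := by
  intro r hr hr'
  rw [← flagSpan_succ] at hr'
  have hAd : Submodule.span K (b '' A) ≤ 𝒜 d := by
    rw [Submodule.span_le]
    rintro _ ⟨s, hs, rfl⟩
    have := hb.mem s
    rwa [hA s hs] at this
  have h1 : smulSpan (𝒜 1) (Submodule.span K (b '' A)) ≤
      Submodule.span K (b '' {t | ∃ s ∈ A, ∃ l, expo t = expo s + Pi.single l 1}) := by
    refine smulSpan_le.2 fun v hv f hf => ?_
    rw [smul_eq_mul, h.comm' (hAd hf) hv]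
    refine Submodule.smul_mem _ _ ?_
    have h2 := Submodule.mul_mem_mul hf (hb.span_x hv)
    rw [Submodule.span_mul_span] at h2
    refine Submodule.span_le.2 ?_ h2
    rintro _ ⟨_, ⟨s, hs, rfl⟩, _, ⟨l, rfl⟩, rfl⟩
    change b s * x l ∈ _
    rcases hb.mul_x s l with h0 | ⟨t, c, ht, hc⟩
    · rw [h0]
      exact zero_mem _
    · rw [hc]
      exact Submodule.smul_mem _ _ (Submodule.subset_span ⟨t, ⟨s, hs, l, ht⟩, rfl⟩)
  rw [hb.genFam_flagSpan_lastVars hi, b.mem_span_image] at hr'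
  have hr2 := sup_le_sup_right h1 (genFam 𝒜 1 (flagSpan (lastVars x) i) (d + 1)) hr
  rw [hb.genFam_flagSpan_lastVars hi.le, ← Submodule.span_union, ← Set.image_union,
    b.mem_span_image] at hr2
  rw [← b.linearCombination_repr r, Finsupp.linearCombination_apply]
  refine Submodule.sum_mem _ fun s hs => Submodule.smul_mem _ _ ?_
  obtain ⟨hsd, l, hl, hls⟩ := hr' hs
  by_cases hlast : ∃ l : Fin n, n ≤ l + i ∧ expo s l ≠ 0
  · refine Submodule.mem_sup_right ?_
    rw [hb.genFam_flagSpan_lastVars hi.le]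
    exact Submodule.subset_span ⟨s, ⟨hsd, hlast⟩, rfl⟩
  · push Not at hlast
    -- `x_l` is the last variable that divides `b s`, and it can be split off within `A`
    have hli : (l : ℕ) + i + 1 = n := by
      by_contra hne
      exact hls (hlast l (by omega))
    rcases hr2 hs with ⟨u, hu, l', hul⟩ | ⟨-, l', hl', hne⟩
    · obtain ⟨u', c, hc, hu', e⟩ := hb.div_x s l hls
      have hu'A : u' ∈ A := by
        rcases lt_trichotomy l' l with h' | rfl | h'
        · exact hstable l' l h' u hu u' (hu'.symm.trans hul)
        · rwa [hb.injective (add_right_cancel (hu'.symm.trans hul))]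
        · refine absurd (hlast l' (by have : (l : ℕ) < l' := h'; omega)) ?_
          rw [hul, Pi.add_apply, Pi.single_eq_same]
          omega
      refine Submodule.mem_sup_left ⟨c⁻¹ • b u',
        Submodule.smul_mem _ _ (Submodule.subset_span ⟨u', hu'A, rfl⟩), ?_⟩
      have hlv : lastVars x i = x l := by
        rw [← lastVars_rev (x := x) l, Fin.val_rev]
        congr 1
        omega
      change (c⁻¹ • b u') * lastVars x i = b s
      rw [hlv, smul_mul_assoc, e, smul_smul, inv_mul_cancel₀ hc, one_smul]
    · exact absurd (hlast l' hl') hne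

/-! ### Coordinate changes of flags -/

theorem MonomialModel.genFam_map (h : KoszulModel 𝒜 n ε η) (hb : MonomialModel 𝒜 b expo x Φ)
    (g : GL (Fin n) K) (k : ℕ) (N : Submodule K R) (d : ℕ) :
    genFam 𝒜 k (N.map (Φ g).toLinearMap) d = (genFam 𝒜 k N d).map (Φ g).toLinearMap := by
  refine _root_.le_antisymm ?_ ?_
  · exact genFam_le (P := hb.mapFam h g (genFam 𝒜 k N))
      (Submodule.map_mono fun m hm => mem_genFam hm) d
  · rw [Submodule.map_le_iff_le_comap, genFam_le_iff]
    rintro a rfl r hr m hm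
    change Φ g (r * m) ∈ genFam 𝒜 k (N.map (Φ g).toLinearMap) (a + k)
    rw [map_mul]
    exact smul_mem_genFam (𝒜 := 𝒜) (hb.coord_mem h g hr) ⟨m, hm, rfl⟩

theorem MonomialModel.restrictedRank_map (h : KoszulModel 𝒜 n ε η)
    (hb : MonomialModel 𝒜 b expo x Φ) (g : GL (Fin n) K) (d : ℕ) (W Λ : Submodule K R) :
    restrictedRank 𝒜 d (W.map (Φ g).toLinearMap) (Λ.map (Φ g).toLinearMap) =
      restrictedRank 𝒜 d W Λ := by
  rw [restrictedRank, restrictedRank, hb.genFam_map h, ← Submodule.map_sup, hb.finrank_map_coord h,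
    hb.finrank_map_coord h]

theorem map_flagSpan (f : R →ₗ[K] R) (z : ℕ → R) (i : ℕ) :
    (flagSpan z i).map f = flagSpan (fun j => f (z j)) i := by
  rw [flagSpan, flagSpan, Submodule.map_span, Set.image_image]

theorem MonomialModel.isFlag_coord (h : KoszulModel 𝒜 n ε η) (hb : MonomialModel 𝒜 b expo x Φ)
    {z : ℕ → R} (hz : IsFlag 𝒜 n z) (g : GL (Fin n) K) : IsFlag 𝒜 n fun j => Φ g (z j) := by
  intro i hi
  refine ⟨hb.coord_mem h g (hz i hi).1, fun hmem => (hz i hi).2 ?_⟩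
  have e := map_flagSpan (Φ g).toLinearMap z i
  change Φ g (z i) ∈ flagSpan (fun j => (Φ g).toLinearMap (z j)) i at hmem
  rw [← e] at hmem
  obtain ⟨m, hm, hmz⟩ := hmem
  rwa [hb.coord_injective h g hmz] at hm

theorem flagSpan_congr {z z' : ℕ → R} {i : ℕ} (hzz' : ∀ j < i, z j = z' j) :
    flagSpan (K := K) z i = flagSpan z' i := by
  rw [flagSpan, flagSpan, Set.image_congr (s := Set.Iio i) fun j hj => hzz' j hj]

/-- All flags are images of the flag of the last variables. -/
theorem MonomialModel.exists_coord_lastVars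
    (hb : MonomialModel 𝒜 b expo x Φ) {y : ℕ → R} (hy : IsFlag 𝒜 n y) :
    ∃ g : GL (Fin n) K, ∀ j < n, Φ g (lastVars x j) = y j := by
  have hy1 : ∀ l : Fin n, y (Fin.rev l) ∈ Submodule.span K (Set.range x) := fun l =>
    hb.span_x (hy _ (Fin.rev l).2).1
  choose c hc using fun l => (Submodule.mem_span_range_iff_exists_fun K).1 (hy1 l)
  let G : Matrix (Fin n) (Fin n) K := Matrix.of fun i l => c l i
  have hli : LinearIndependent K fun l : Fin n => y l := by
    rw [linearIndependent_iff_card_eq_finrank_span, Fintype.card_fin, Set.finrank]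
    have e : Submodule.span K (Set.range fun l : Fin n => y l) = flagSpan y n := by
      rw [flagSpan]
      congr 1
      ext r
      exact ⟨fun ⟨l, hl⟩ => ⟨l, l.2, hl⟩, fun ⟨j, hj, hjr⟩ => ⟨⟨j, hj⟩, hjr⟩⟩
    rw [e, hy.finrank_flagSpan le_rfl]
  have hdet : G.det ≠ 0 := by
    intro h0
    obtain ⟨v, hv, hGv⟩ := Matrix.exists_mulVec_eq_zero_iff.2 h0
    apply hv
    have hli' : LinearIndependent K fun l : Fin n => y (Fin.rev l) :=
      hli.comp _ Fin.rev_injective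
    rw [Fintype.linearIndependent_iff] at hli'
    refine funext (hli' v ?_)
    simp only [← hc, Finset.smul_sum, smul_smul]
    rw [Finset.sum_comm]
    refine Finset.sum_eq_zero fun i _ => ?_
    rw [← Finset.sum_smul]
    have := congrFun hGv i
    simp only [Matrix.mulVec, dotProduct, G, Matrix.of_apply, Pi.zero_apply] at this
    have e : ∑ l, v l * c l i = 0 := by
      rw [← this]
      exact Finset.sum_congr rfl fun l _ => mul_comm _ _
    rw [e, zero_smul]
  refine ⟨Matrix.GeneralLinearGroup.mkOfDetNeZero G hdet, fun j hj => ?_⟩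
  rw [lastVars, dif_pos hj, hb.coord]
  have := hc (Fin.rev ⟨j, hj⟩)
  rw [Fin.rev_rev] at this
  exact this

end StandardFlag

/-! ### Comparison of an ideal with its generic initial ideal -/

section Comparison

variable {K : Type u} [Field K] [Infinite K] {n : ℕ} {R : Type v} [Ring R] [Algebra K R]
variable {σ : Type w} {𝒜 : ℕ → Submodule K R} [GradedAlgebra 𝒜] {ε η : K}
variable {b : Module.Basis σ K R} {expo : σ → Fin n → ℕ} {x : Fin n → R}
variable {Φ : GL (Fin n) K → R →ₐ[K] R} [∀ a, Module.Finite K (𝒜 a)]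

theorem eq_of_toIdeal_eq {P Q : GradedFamily R 𝒜} (hP : P ≤ wholeFam 𝒜) (hQ : Q ≤ wholeFam 𝒜)
    (hPQ : toIdeal P = toIdeal Q) : P = Q := by
  refine GradedFamily.le_antisymm (fun j f hf => ?_) fun j f hf => ?_
  · exact (mem_toIdeal_iff_of_mem hQ (hP j hf)).1 (hPQ ▸ mem_toIdeal_of_mem hf)
  · exact (mem_toIdeal_iff_of_mem hP (hQ j hf)).1 (hPQ ▸ mem_toIdeal_of_mem hf)

theorem idealSum_flagSpan_zero (k : ℕ) (W : Submodule K R) (z : ℕ → R) :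
    idealSum 𝒜 k W (flagSpan z 0) = genFam 𝒜 k W := by
  rw [flagSpan_zero, idealSum, genFam_bot, GradedFamily.sup_eq_left (GradedFamily.bot_le _)]

theorem genFam_flagSpan_zero (z : ℕ → R) : genFam 𝒜 1 (flagSpan (K := K) z 0) = ⊥ := by
  rw [flagSpan_zero, genFam_bot]

variable {d : ℕ} {W : Submodule K R} {g : GL (Fin n) K}

theorem MonomialModel.span_inSet_le (h : KoszulModel 𝒜 n ε η) (hb : MonomialModel 𝒜 b expo x Φ)
    (hW : W ≤ 𝒜 d) :
    Submodule.span K (b '' inSet b expo (W.map (Φ g).toLinearMap)) ≤ 𝒜 d := by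
  rw [Submodule.span_le]
  rintro _ ⟨s, ⟨_, ⟨f, hf, rfl⟩, hs, -⟩, rfl⟩
  have := hb.mem s
  rwa [hb.sum_expo_eq (hb.coord_mem h g (hW hf)) hs] at this

/-- The initial monomials in general coordinates satisfy the star condition. -/
theorem MonomialModel.starCond_inSet (h : KoszulModel 𝒜 n ε η) (hb : MonomialModel 𝒜 b expo x Φ)
    (hW : W ≤ 𝒜 d) (hg : IsGenericCoord b Φ W g) {i : ℕ} (hi : i < n) :
    StarCond 𝒜 d (Submodule.span K (b '' inSet b expo (W.map (Φ g).toLinearMap)))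
      (flagSpan (lastVars x) i) (lastVars x i) := by
  refine hb.starCond_of_stable h ?_ (fun a m ham s hs t hst =>
    hb.mem_inSet_of_exchange h hW hg ham hs hst) hi
  rintro s ⟨_, ⟨f, hf, rfl⟩, hs, -⟩
  exact hb.sum_expo_eq (hb.coord_mem h g (hW hf)) hs

/-- Modulo the last variables, in the coordinates `g`, the dimension of `W` is the number of
initial monomials of `g W` that do not involve these variables. -/
theorem MonomialModel.restrictedRank_eq (h : KoszulModel 𝒜 n ε η)
    (hb : MonomialModel 𝒜 b expo x Φ) (hW : W ≤ 𝒜 d) {i : ℕ} (hi : i ≤ n) :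
    restrictedRank 𝒜 d W (flagSpan (fun j => Φ g⁻¹ (lastVars x j)) i) =
      restrictedRank 𝒜 d (Submodule.span K (b '' inSet b expo (W.map (Φ g).toLinearMap)))
        (flagSpan (lastVars x) i) := by
  have hWg : W.map (Φ g).toLinearMap ≤ 𝒜 d := by
    rintro _ ⟨f, hf, rfl⟩
    exact hb.coord_mem h g (hW hf)
  rw [hb.restrictedRank_inSet h hi hWg (hb.span_inSet_le h hW), ← hb.restrictedRank_map h g d W,
    map_flagSpan]
  congr 1
  exact flagSpan_congr fun j _ => hb.coord_apply_inv h g _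

/-- In general coordinates the flag of the last variables has the largest possible restricted ranks
among all flags. -/
theorem MonomialModel.restrictedRank_le (h : KoszulModel 𝒜 n ε η)
    (hb : MonomialModel 𝒜 b expo x Φ) (hW : W ≤ 𝒜 d) (hg : IsGenericCoord b Φ W g) {y : ℕ → R}
    (hy : IsFlag 𝒜 n y) {i : ℕ} (hi : i ≤ n) : restrictedRank 𝒜 d W (flagSpan y i) ≤
      restrictedRank 𝒜 d (Submodule.span K (b '' inSet b expo (W.map (Φ g).toLinearMap)))
        (flagSpan (lastVars x) i) := by
  have hWg : ∀ g, W.map (Φ g).toLinearMap ≤ 𝒜 d := by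
    rintro g _ ⟨f, hf, rfl⟩
    exact hb.coord_mem h g (hW hf)
  obtain ⟨g₁, hg₁⟩ := hb.exists_coord_lastVars hy
  rw [hb.restrictedRank_inSet h hi (hWg g) (hb.span_inSet_le h hW),
    ← hb.restrictedRank_map h g₁⁻¹ d W, map_flagSpan]
  have e : flagSpan (K := K) (fun j => (Φ g₁⁻¹).toLinearMap (y j)) i = flagSpan (lastVars x) i :=
    flagSpan_congr fun j hj => by
      change Φ g₁⁻¹ (y j) = lastVars x j
      rw [← hg₁ j (by omega), hb.coord_inv_apply h]
  rw [e, hb.restrictedRank_lastVars h hi (hWg _), hb.restrictedRank_lastVars h hi (hWg _)]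
  exact hg _ _

/-- If `(W)` has a linear resolution, then `W` and its initial monomials in general coordinates
generate spaces of the same dimension in the next degree. -/
theorem MonomialModel.finrank_smulSpan_eq (h : KoszulModel 𝒜 n ε η)
    (hb : MonomialModel 𝒜 b expo x Φ)
    (hgood : ∀ {k : ℕ} {W Λ : Submodule K R}, W ≤ 𝒜 k → Λ ≤ 𝒜 1 → Λ ≠ 𝒜 1 →
      IsLinear k (idealSum 𝒜 k W Λ) (genFam 𝒜 1 Λ) → ∃ y ∈ 𝒜 1, y ∉ Λ ∧ IsGoodForm 𝒜 k W Λ y)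
    (hW : W ≤ 𝒜 d) (hg : IsGenericCoord b Φ W g) (hlin : IsLinear d (genFam 𝒜 d W) ⊥) :
    Module.finrank K (smulSpan (𝒜 1) W) = Module.finrank K (smulSpan (𝒜 1)
      (Submodule.span K (b '' inSet b expo (W.map (Φ g).toLinearMap)))) := by
  set W' := Submodule.span K (b '' inSet b expo (W.map (Φ g).toLinearMap)) with hW'
  have hlast := hb.isFlag_lastVars h
  have hW'd : W' ≤ 𝒜 d := hb.span_inSet_le h hW
  have e' := (h.flagSum_le hW'd hlast).2.2 fun i hi => hb.starCond_inSet h hW hg hi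
  obtain ⟨y, hy, hstar⟩ := h.exists_flag hW hlin fun Λ hΛ hne hl => hgood hW hΛ hne hl
  -- a chain of inequalities `dim 𝒜_1 W = Σ_y ≤ Σ_{last} ≤ Σ_{g⁻¹ last} ≤ dim 𝒜_1 W`, where the
  -- second sum is `dim 𝒜_1 W'`
  have e1 := (h.flagSum_le hW hy).2.2 hstar
  have e2 : flagSum 𝒜 n η d W y ≤ flagSum 𝒜 n η d W' (lastVars x) :=
    h.flagSum_mono fun i hi => hb.restrictedRank_le h hW hg hy hi
  have e3 : flagSum 𝒜 n η d W' (lastVars x) ≤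
      flagSum 𝒜 n η d W (fun j => Φ g⁻¹ (lastVars x j)) :=
    h.flagSum_mono fun i hi => (hb.restrictedRank_eq h hW hi).ge
  have e4 := (h.flagSum_le hW (hb.isFlag_coord h hlast g⁻¹)).1
  omega

/-- Conversely, if these dimensions agree, then `(W)` has a linear resolution, with the same graded
Betti numbers as the ideal generated by the initial monomials. -/
theorem MonomialModel.isLinear_of_finrank_eq (h : KoszulModel 𝒜 n ε η)
    (hb : MonomialModel 𝒜 b expo x Φ) (hW : W ≤ 𝒜 d) (hg : IsGenericCoord b Φ W g)
    (hdim : Module.finrank K (smulSpan (𝒜 1) W) = Module.finrank K (smulSpan (𝒜 1)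
      (Submodule.span K (b '' inSet b expo (W.map (Φ g).toLinearMap))))) :
    IsLinear d (genFam 𝒜 d W) ⊥ ∧ strandBetti 𝒜 d W = strandBetti 𝒜 d
      (Submodule.span K (b '' inSet b expo (W.map (Φ g).toLinearMap))) := by
  set W' := Submodule.span K (b '' inSet b expo (W.map (Φ g).toLinearMap)) with hW'
  have hlast := hb.isFlag_lastVars h
  have hW'd : W' ≤ 𝒜 d := hb.span_inSet_le h hW
  have hstar' : ∀ i < n, StarCond 𝒜 d W' (flagSpan (lastVars x) i) (lastVars x i) :=
    fun i hi => hb.starCond_inSet h hW hg hi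
  have hz := hb.isFlag_coord h hlast g⁻¹
  have hrank : ∀ i ≤ n, restrictedRank 𝒜 d W (flagSpan (fun j => Φ g⁻¹ (lastVars x j)) i) =
      restrictedRank 𝒜 d W' (flagSpan (lastVars x) i) := fun i hi => hb.restrictedRank_eq h hW hi
  have e' := (h.flagSum_le hW'd hlast).2.2 hstar'
  have e : flagSum 𝒜 n η d W (fun j => Φ g⁻¹ (lastVars x j)) =
      flagSum 𝒜 n η d W' (lastVars x) :=
    _root_.le_antisymm (h.flagSum_mono fun i hi => (hrank i hi).le)
      (h.flagSum_mono fun i hi => (hrank i hi).ge)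
  have hstar := (h.flagSum_le hW hz).2.1 (by rw [e, e', hdim])
  constructor
  · have := h.isLinear_of_starCond hW hz hstar (Nat.zero_le n)
    rwa [idealSum_flagSpan_zero, genFam_flagSpan_zero] at this
  · funext i
    have := h.relBetti_eq_of_starCond hW hW'd hz hlast hstar hstar' hrank (Nat.zero_le n) i
    rwa [idealSum_flagSpan_zero, idealSum_flagSpan_zero, genFam_flagSpan_zero,
      genFam_flagSpan_zero] at this

/-- The equivalence of the three conditions in terms of relative Betti numbers. The assumption
`hgood` is the existence of general linear forms. -/
theorem MonomialModel.tfae_of_isGenericInitialIdeal (h : KoszulModel 𝒜 n ε η)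
    (hb : MonomialModel 𝒜 b expo x Φ)
    (hgood : ∀ {k : ℕ} {W Λ : Submodule K R}, W ≤ 𝒜 k → Λ ≤ 𝒜 1 → Λ ≠ 𝒜 1 →
      IsLinear k (idealSum 𝒜 k W Λ) (genFam 𝒜 1 Λ) → ∃ y ∈ 𝒜 1, y ∉ Λ ∧ IsGoodForm 𝒜 k W Λ y)
    {I : GradedFamily R 𝒜} (hI : I ≤ wholeFam 𝒜) {J : Ideal R}
    (hJ : IsGenericInitialIdeal b expo Φ (toIdeal I) J) (k : ℕ) :
    ∃ J' : GradedFamily R 𝒜, J' ≤ wholeFam 𝒜 ∧ J = toIdeal J' ∧ List.TFAE [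
      ∀ i, 1 ≤ i → relBetti (wholeFam 𝒜) I i (i + k) = relBetti (wholeFam 𝒜) J' i (i + k),
      IsLinear k (genFam 𝒜 k (I k)) ⊥ ∧ IsLinear (k + 1) (genFam 𝒜 (k + 1) (I (k + 1))) ⊥,
      relBetti (wholeFam 𝒜) I 1 (k + 1) = relBetti (wholeFam 𝒜) J' 1 (k + 1) ∧
        relBetti (wholeFam 𝒜) I 1 (k + 2) = relBetti (wholeFam 𝒜) J' 1 (k + 2)] := by
  -- the coordinates `g d` that are general in degree `d` may vary with `d`, but they all give the
  -- same ideal `J`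
  choose g hg hJg using hb.exists_isGenericCoord_of_gin h hI hJ
  have hin : ∀ d, hb.inFam h (hb.mapFam h (g d) I) (hb.mapFam_le h hI) ≤ wholeFam 𝒜 :=
    fun d => hb.inFam_le h _
  set J' := hb.inFam h (hb.mapFam h (g 0) I) (hb.mapFam_le h hI) with hJ'
  have hJ'd : ∀ d, J' d =
      Submodule.span K (b '' inSet b expo ((I d).map (Φ (g d)).toLinearMap)) := fun d => by
    have e : J' = hb.inFam h (hb.mapFam h (g d) I) (hb.mapFam_le h hI) :=
      eq_of_toIdeal_eq (hin 0) (hin d) ((hJg 0).symm.trans (hJg d))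
    rw [e]
    rfl
  refine ⟨J', hin 0, hJg 0, h.tfae_of_strand hI (hin 0) ?_ ?_ ?_ k⟩
  · intro d
    rw [hb.finrank_inFam h]
    exact (hb.finrank_map_coord h (g 0) (I d)).symm
  · intro d hlin
    rw [hJ'd]
    exact hb.finrank_smulSpan_eq h hgood (hI d) (hg d) hlin
  · intro d hdim
    rw [hJ'd] at hdim ⊢
    exact hb.isLinear_of_finrank_eq h (hI d) (hg d) hdim

end Comparison

/-! ### Graded Betti numbers of graded ideals -/

section Connection

variable {K : Type u} [Field K] {R : Type v} [Ring R] [Algebra K R]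
variable {M : Type v} [AddCommGroup M] [Module K M] [Module R M] [IsScalarTower K R M]
variable {𝒜 : ℕ → Submodule K R}

/-- The graded Betti numbers of a graded module are those of the pair `(P, 0)`. -/
theorem betti_eq_relBetti (P : GradedFamily M 𝒜) (i j : ℕ) :
    betti K 𝒜 P i j = relBetti P ⊥ i j := by
  have hZ : barCycles K 𝒜 P i j = relCycles P ⊥ i j := by
    cases i with
    | zero => exact inf_top_eq _
    | succ i =>
      change barDeg K 𝒜 P (i + 1) j ⊓ LinearMap.ker (barDiff K R M i) =
        barDeg K 𝒜 P (i + 1) j ⊓ (barDeg K 𝒜 (⊥ : GradedFamily M 𝒜) i j).comap (barDiff K R M i)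
      rw [barDeg_bot]
      rfl
  have hB : barBoundaries K 𝒜 P i j = relBoundaries P ⊥ i j := by
    rw [relBoundaries, barDeg_bot, sup_bot_eq]
    rfl
  unfold betti TorDeg relBetti RelTor
  rw [hZ, hB]

variable [GradedAlgebra 𝒜]

variable (𝒜) in
/-- The homogeneous elements of an ideal, as a graded submodule of `R`. -/
def idealFam (I : Ideal R) : GradedFamily R 𝒜 where
  toFun j := 𝒜 j ⊓ I.restrictScalars K
  smul_mem' hr hm := ⟨SetLike.mul_mem_graded hr hm.1, I.mul_mem_left _ hm.2⟩

theorem idealFam_le (I : Ideal R) : idealFam 𝒜 I ≤ wholeFam 𝒜 := fun _ _ hf => hf.1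

theorem toIdeal_idealFam {I : Ideal R} (hI : I.IsHomogeneous 𝒜) :
    toIdeal (idealFam 𝒜 I) = I := by
  refine _root_.le_antisymm (Ideal.span_le.2 ?_) fun _ hf => ?_
  · rintro _ ⟨_, hf⟩
    exact hf.2
  · exact (mem_toIdeal_iff (idealFam_le I)).2 fun j =>
      ⟨(DirectSum.decompose 𝒜 _ j).2, hI j hf⟩

theorem idealFam_toIdeal {P : GradedFamily R 𝒜} (hP : P ≤ wholeFam 𝒜) :
    idealFam 𝒜 (toIdeal P) = P :=
  GradedFamily.ext fun j => Submodule.ext fun _ =>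
    ⟨fun hf => (mem_toIdeal_iff_of_mem hP hf.1).1 hf.2,
      fun hf => ⟨hP j hf, mem_toIdeal_of_mem hf⟩⟩

variable (𝒜) in
/-- The residue class ring `R / I`, as a graded module. -/
def quotFam (I : Ideal R) : GradedFamily (R ⧸ I) 𝒜 where
  toFun := quotGrading 𝒜 I
  smul_mem' := by
    rintro a c r _ hr ⟨f, hf, rfl⟩
    exact ⟨r * f, SetLike.mul_mem_graded hr hf, rfl⟩

theorem bettiQuot_eq_relBetti (I : Ideal R) (i j : ℕ) :
    bettiQuot (K := K) 𝒜 I i j = relBetti (wholeFam 𝒜) (idealFam 𝒜 I) i j := by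
  rw [← relBetti_eq_of_bijective_zero (P' := quotFam 𝒜 I) (Q' := ⊥) (Submodule.mkQ I)
    (idealFam_le I) (fun j f hf => ⟨f, hf, rfl⟩) ?_ ?_ i j]
  · exact betti_eq_relBetti (quotFam 𝒜 I) i j
  · intro j f hf
    rw [bot_apply, Submodule.mem_bot, Submodule.mkQ_apply, Submodule.Quotient.mk_eq_zero]
    exact ⟨fun h => ⟨hf, h⟩, fun h => h.2⟩
  · rintro j _ ⟨f, hf, rfl⟩
    refine ⟨f, hf, ?_⟩
    rw [bot_apply, Submodule.mem_bot]
    exact sub_self _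

variable (𝒜) in
/-- The ideal `I`, as a graded module. -/
def idealSelfFam (I : Ideal R) : GradedFamily I 𝒜 where
  toFun := idealGrading 𝒜 I
  smul_mem' {_ _ _ f} hr hf := by
    change _ * (f : R) ∈ 𝒜 _
    exact SetLike.mul_mem_graded hr hf

theorem betti_idealGrading (I : Ideal R) (i j : ℕ) :
    betti K 𝒜 (idealGrading 𝒜 I) i j = relBetti (idealFam 𝒜 I) ⊥ i j := by
  rw [relBetti_eq_of_bijective_zero (P := idealSelfFam 𝒜 I) (Q := ⊥) (P' := idealFam 𝒜 I)
    (Q' := ⊥) (Submodule.subtype I)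
    (GradedFamily.bot_le _) (fun j f hf => ⟨hf, f.2⟩) ?_ ?_ i j]
  · exact betti_eq_relBetti (idealSelfFam 𝒜 I) i j
  · intro j f _
    rw [bot_apply, bot_apply, Submodule.mem_bot, Submodule.mem_bot]
    exact Submodule.coe_eq_zero
  · rintro j f hf
    refine ⟨⟨f, hf.2⟩, hf.1, ?_⟩
    rw [bot_apply, Submodule.mem_bot]
    exact sub_self f

theorem component_eq_toIdeal (I : Ideal R) (d : ℕ) :
    component 𝒜 I d = toIdeal (genFam 𝒜 d (idealFam 𝒜 I d)) := by
  refine _root_.le_antisymm (Ideal.span_le.2 ?_) (Ideal.span_le.2 ?_)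
  · rintro f ⟨hI, hd⟩
    exact mem_toIdeal_of_mem (mem_genFam (𝒜 := 𝒜) ⟨hd, hI⟩)
  · rintro f ⟨j, hf⟩
    refine (genFam_le_iff (S := (component 𝒜 I d).restrictScalars K)).2 ?_ hf
    intro a _ r _ m hm
    exact Ideal.mul_mem_left _ _ (Ideal.subset_span ⟨hm.2, hm.1⟩)

theorem hasLinearResolution_component_iff (I : Ideal R) (d : ℕ) :
    HasLinearResolution 𝒜 (component 𝒜 I d) d ↔ IsLinear d (genFam 𝒜 d (idealFam 𝒜 I d)) ⊥ := by
  have hle : genFam 𝒜 d (idealFam 𝒜 I d) ≤ wholeFam 𝒜 :=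
    genFam_le_wholeFam (𝒜 := 𝒜) (idealFam_le (𝒜 := 𝒜) I d)
  have e : idealFam 𝒜 (component 𝒜 I d) = genFam 𝒜 d (idealFam 𝒜 I d) := by
    rw [component_eq_toIdeal, idealFam_toIdeal hle]
  rw [← e]
  exact forall₃_congr fun i j _ => by rw [betti_idealGrading]

end Connection

section Main

variable {K : Type u} [Field K] [Infinite K] {n : ℕ} {R : Type v} [Ring R] [Algebra K R]
variable {σ : Type w} {𝒜 : ℕ → Submodule K R} [GradedAlgebra 𝒜] {ε η : K}
variable {b : Module.Basis σ K R} {expo : σ → Fin n → ℕ} {x : Fin n → R}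
variable {Φ : GL (Fin n) K → R →ₐ[K] R} [∀ a, Module.Finite K (𝒜 a)] [IsNoetherianRing R]

/-- The comparison of a graded ideal with its generic initial ideal, for polynomial rings and
exterior algebras alike; `hgood` provides general linear forms. -/
theorem MonomialModel.existsUnique_and_tfae (h : KoszulModel 𝒜 n ε η)
    (hb : MonomialModel 𝒜 b expo x Φ)
    (hgood : ∀ {k : ℕ} {W Λ : Submodule K R}, W ≤ 𝒜 k → Λ ≤ 𝒜 1 → Λ ≠ 𝒜 1 →
      IsLinear k (idealSum 𝒜 k W Λ) (genFam 𝒜 1 Λ) → ∃ y ∈ 𝒜 1, y ∉ Λ ∧ IsGoodForm 𝒜 k W Λ y)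
    {I : Ideal R} (hI : I.IsHomogeneous 𝒜) (k : ℕ) :
    (∃! J, IsGenericInitialIdeal b expo Φ I J) ∧
    ∀ J, IsGenericInitialIdeal b expo Φ I J → List.TFAE [
      ∀ i, 1 ≤ i → bettiQuot (K := K) 𝒜 I i (i + k) = bettiQuot (K := K) 𝒜 J i (i + k),
      HasLinearResolution 𝒜 (component 𝒜 I k) k ∧
        HasLinearResolution 𝒜 (component 𝒜 I (k + 1)) (k + 1),
      bettiQuot (K := K) 𝒜 I 1 (k + 1) = bettiQuot (K := K) 𝒜 J 1 (k + 1) ∧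
        bettiQuot (K := K) 𝒜 I 1 (k + 2) = bettiQuot (K := K) 𝒜 J 1 (k + 2)] := by
  have hI' := toIdeal_idealFam (𝒜 := 𝒜) hI
  constructor
  · obtain ⟨J, hJ⟩ := hb.exists_isGenericInitialIdeal h (idealFam_le (𝒜 := 𝒜) I)
    rw [hI'] at hJ
    exact ⟨J, hJ, fun J' hJ' => hJ'.unique hJ⟩
  · intro J hJ
    rw [← hI'] at hJ
    obtain ⟨J', hJ', rfl, ht⟩ :=
      hb.tfae_of_isGenericInitialIdeal h hgood (idealFam_le (𝒜 := 𝒜) I) hJ k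
    simp only [bettiQuot_eq_relBetti, hasLinearResolution_component_iff, idealFam_toIdeal hJ']
    exact ht

end Main

/-! ### The polynomial ring -/

section PolynomialRing

open MvPolynomial

variable {K : Type u} [Field K]

/-- A vector outside `Λ` is fixed by some linear map that kills `Λ` and is the identity
modulo `Λ`. -/
theorem exists_projection_fixing {V : Type v} [AddCommGroup V] [Module K V] {Λ : Submodule K V}
    {y : V} (hy : y ∉ Λ) :
    ∃ q : V →ₗ[K] V, (∀ v ∈ Λ, q v = 0) ∧ q y = y ∧ ∀ v, v - q v ∈ Λ := by
  obtain ⟨s, hs⟩ := Λ.mkQ.exists_rightInverse_of_surjective Λ.range_mkQ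
  have hy' : Λ.mkQ y ≠ 0 := fun h => hy ((Submodule.Quotient.mk_eq_zero Λ).1 h)
  obtain ⟨φ, hφ⟩ := Module.Projective.exists_dual_eq_one K hy'
  have hs' : ∀ z, Λ.mkQ (s z) = z := fun z => LinearMap.congr_fun hs z
  refine ⟨(s + φ.smulRight (y - s (Λ.mkQ y))) ∘ₗ Λ.mkQ, fun v hv => ?_, ?_, fun v => ?_⟩
  · rw [LinearMap.comp_apply, show Λ.mkQ v = 0 from (Submodule.Quotient.mk_eq_zero Λ).2 hv,
      map_zero]
  · rw [LinearMap.comp_apply, LinearMap.add_apply, LinearMap.smulRight_apply, hφ, one_smul,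
      add_sub_cancel]
  · refine (Submodule.Quotient.mk_eq_zero Λ).1 ?_
    change Λ.mkQ (v - (s (Λ.mkQ v) + φ (Λ.mkQ v) • (y - s (Λ.mkQ y)))) = 0
    rw [map_sub, map_add, map_smul, map_sub, hs', hs', sub_self, smul_zero, add_zero, sub_self]

variable {n : ℕ}

theorem polyGrading_succ (a : ℕ) :
    polyGrading K n (a + 1) = polyGrading K n 1 * polyGrading K n a := by
  change homogeneousSubmodule (Fin n) K (a + 1) =
    homogeneousSubmodule (Fin n) K 1 * homogeneousSubmodule (Fin n) K a
  rw [← homogeneousSubmodule_one_pow K (a + 1), ← homogeneousSubmodule_one_pow K a, pow_succ']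

theorem polyGrading_one : polyGrading K n 1 = Submodule.span K (Set.range X) :=
  homogeneousSubmodule_one_eq_span_X

instance polyGrading_finite (a : ℕ) : Module.Finite K (polyGrading K n a) :=
  Module.Finite.iff_fg.2 (homogeneousSubmodule_fg (Fin n) K a)

theorem polyGrading_zero_le : polyGrading K n 0 ≤ Submodule.span K {1} := by
  intro f hf
  have h0 := (totalDegree_zero_iff_isHomogeneous (Fin n)).2 hf
  rw [totalDegree_eq_zero_iff_eq_C.1 h0, ← mul_one (C _), ← smul_eq_C_mul]
  exact Submodule.smul_mem _ _ (Submodule.mem_span_singleton_self 1)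

/-- Linear forms are regular modulo linear forms that do not involve them. -/
theorem poly_colon {Λ : Submodule K (MvPolynomial (Fin n) K)} {y f : MvPolynomial (Fin n) K}
    {j : ℕ} (hΛ : Λ ≤ polyGrading K n 1) (hy : y ∈ polyGrading K n 1) (hyΛ : y ∉ Λ)
    (hf : f ∈ polyGrading K n j) (hfy : f * y ∈ smulSpan (polyGrading K n j) Λ) :
    f ∈ genFam (polyGrading K n) 1 Λ j := by
  obtain ⟨q, hq0, hqy, hq⟩ := exists_projection_fixing hyΛ
  let Θ : MvPolynomial (Fin n) K →ₐ[K] MvPolynomial (Fin n) K := aeval fun i => q (X i)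
  have hΘ : ∀ v ∈ polyGrading K n 1, Θ v = q v := by
    intro v hv
    rw [polyGrading_one] at hv
    suffices h : Submodule.span K (Set.range X) ≤ LinearMap.eqLocus Θ.toLinearMap q from h hv
    rw [Submodule.span_le]
    rintro _ ⟨i, rfl⟩
    exact aeval_X _ _
  have hq1 : ∀ v ∈ polyGrading K n 1, q v ∈ polyGrading K n 1 := fun v hv => by
    have := sub_mem hv (hΛ (hq v))
    rwa [sub_sub_cancel] at this
  have hsub : ∀ j, ∀ g ∈ polyGrading K n j, g - Θ g ∈ genFam (polyGrading K n) 1 Λ j := by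
    intro j
    induction j with
    | zero =>
      intro g hg
      obtain ⟨c, rfl⟩ := Submodule.mem_span_singleton.1 (polyGrading_zero_le hg)
      rw [map_smul, map_one, sub_self]
      exact zero_mem _
    | succ j ih =>
      intro g hg
      rw [polyGrading_succ] at hg
      suffices h : polyGrading K n 1 * polyGrading K n j ≤
          (genFam (polyGrading K n) 1 Λ (j + 1)).comap (LinearMap.id - Θ.toLinearMap) from h hg
      refine Submodule.mul_le.2 fun v hv g hg => ?_
      change v * g - Θ (v * g) ∈ genFam (polyGrading K n) 1 Λ (j + 1)
      have e : v * g - Θ (v * g) = g • (v - q v) + q v • (g - Θ g) := by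
        rw [map_mul, hΘ v hv, smul_eq_mul, smul_eq_mul]
        ring
      rw [e]
      refine add_mem (smul_mem_genFam hg (hq v)) ?_
      have := (genFam (polyGrading K n) 1 Λ).smul_mem (hq1 v hv) (ih g hg)
      rwa [add_comm 1 j] at this
  have h0 : Θ f * y = 0 := by
    rw [← hqy, ← hΘ y hy, ← map_mul]
    suffices h : smulSpan (polyGrading K n j) Λ ≤ LinearMap.ker Θ.toLinearMap from h hfy
    refine smulSpan_le.2 fun r _ m hm => ?_
    change Θ (r * m) = 0
    rw [map_mul, hΘ m (hΛ hm), hq0 m hm, mul_zero]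
  have hy0 : y ≠ 0 := fun h => hyΛ (h ▸ zero_mem Λ)
  have := hsub j f hf
  rwa [(mul_eq_zero.1 h0).resolve_right hy0, sub_zero] at this

/-- Polynomial rings have `ε = 1` and `η = 0`: a linear form outside `Λ` is a nonzerodivisor modulo
`(Λ)`. -/
theorem koszulModel_poly : KoszulModel (polyGrading K n) n (1 : K) 0 where
  zero_deg := polyGrading_zero_le
  succ_deg a := (polyGrading_succ a).le
  finrank_one := by
    rw [polyGrading_one, finrank_span_eq_card (linearIndependent_X (Fin n) K), Fintype.card_fin]
  comm {a f v} _ _ := by rw [one_pow, one_smul, mul_comm]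
  sign := one_mul 1
  eta := Or.inl rfl
  sq v _ := zero_smul K _
  colon {Λ y f j} hΛ hy hyΛ hf hfy := by
    rw [zero_smul, Submodule.span_zero_singleton, sup_bot_eq]
    exact poly_colon hΛ hy hyΛ hf hfy

theorem monomialModel_poly [CharZero K] : MonomialModel (polyGrading K n)
    (basisMonomials (Fin n) K) (fun a => ⇑a) X polyCoordChange where
  injective := DFunLike.coe_injective
  mem s := by
    rw [coe_basisMonomials]
    exact isHomogeneous_monomial _ (Finsupp.degree_eq_sum s)
  x_mem := isHomogeneous_X K
  span_x := polyGrading_one.le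
  mul_x s i := Or.inr ⟨s + Finsupp.single i 1, 1, by
    rw [Finsupp.coe_add, Finsupp.single_eq_pi_single], by
    rw [coe_basisMonomials, one_smul, X, monomial_mul, mul_one]⟩
  div_x t i ht := by
    have e : t = t - Finsupp.single i 1 + Finsupp.single i 1 :=
      (tsub_add_cancel_of_le (Finsupp.single_le_iff.2 (Nat.one_le_iff_ne_zero.2 ht))).symm
    refine ⟨t - Finsupp.single i 1, 1, one_ne_zero, ?_, ?_⟩
    · rw [← Finsupp.single_eq_pi_single, ← Finsupp.coe_add, ← e]
    · rw [coe_basisMonomials, one_smul, X, monomial_mul, mul_one, ← e]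
  coord g j := by
    rw [polyCoordChange, aeval_X]
    exact Finset.sum_congr rfl fun i _ => (smul_eq_C_mul _ _).symm
  char_cond := Or.inr ⟨inferInstance, fun i j => Commute.all _ _⟩

end PolynomialRing

/-! ### The exterior algebra -/

section ExteriorAlgebra

open ExteriorAlgebra CliffordAlgebra

variable {K : Type u} [Field K] {n : ℕ} {V : Type v} [AddCommGroup V] [Module K V]

theorem mem_extGrading_one {v : ExteriorAlgebra K V} :
    v ∈ extGrading K V 1 ↔ ∃ u, ExteriorAlgebra.ι K u = v := by
  change v ∈ LinearMap.range (ExteriorAlgebra.ι K (M := V)) ^ 1 ↔ _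
  rw [pow_one]
  rfl

theorem extGrading_succ (a : ℕ) :
    extGrading K V (a + 1) = extGrading K V 1 * extGrading K V a := by
  change LinearMap.range (ExteriorAlgebra.ι K (M := V)) ^ (a + 1) = LinearMap.range _ ^ 1 *
    LinearMap.range _ ^ a
  rw [pow_one, pow_succ']

theorem extGrading_succ' (a : ℕ) :
    extGrading K V (a + 1) = extGrading K V a * extGrading K V 1 := by
  change LinearMap.range (ExteriorAlgebra.ι K (M := V)) ^ (a + 1) = LinearMap.range _ ^ a *
    LinearMap.range _ ^ 1
  rw [pow_one, pow_succ]

theorem extGrading_zero_le : extGrading K V 0 ≤ Submodule.span K {1} := by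
  change LinearMap.range (ExteriorAlgebra.ι K (M := V)) ^ 0 ≤ _
  rw [pow_zero, Submodule.one_eq_span]

theorem ext_mul_linear {a : ℕ} {f v : ExteriorAlgebra K V} (hf : f ∈ extGrading K V a)
    (hv : v ∈ extGrading K V 1) : f * v = (-1 : K) ^ a • (v * f) := by
  induction a generalizing f with
  | zero =>
    obtain ⟨c, rfl⟩ := Submodule.mem_span_singleton.1 (extGrading_zero_le hf)
    rw [pow_zero, one_smul, smul_mul_assoc, one_mul, mul_smul_comm, mul_one]
  | succ a ih =>
    rw [extGrading_succ] at hf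
    suffices h : extGrading K V 1 * extGrading K V a ≤ LinearMap.eqLocus
        (LinearMap.mulRight K v) ((-1 : K) ^ (a + 1) • LinearMap.mulLeft K v) from h hf
    refine Submodule.mul_le.2 fun w hw g hg => ?_
    change w * g * v = (-1 : K) ^ (a + 1) • (v * (w * g))
    obtain ⟨v, rfl⟩ := mem_extGrading_one.1 hv
    obtain ⟨w, rfl⟩ := mem_extGrading_one.1 hw
    rw [mul_assoc, ih hg, mul_smul_comm, ← mul_assoc, ← mul_assoc,
      eq_neg_of_add_eq_zero_left (ExteriorAlgebra.ι_add_mul_swap w v), neg_mul, pow_succ, mul_neg_one,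
      neg_smul, smul_neg]

theorem contractLeft_mem_extGrading (d : Module.Dual K V) (j : ℕ) {f : ExteriorAlgebra K V}
    (hf : f ∈ extGrading K V (j + 1)) : contractLeft d f ∈ extGrading K V j := by
  induction j generalizing f with
  | zero =>
    obtain ⟨u, rfl⟩ := mem_extGrading_one.1 hf
    rw [contractLeft_ι, Algebra.algebraMap_eq_smul_one]
    exact Submodule.smul_mem _ _ (SetLike.GradedOne.one_mem (A := extGrading K V))
  | succ j ih =>
    rw [extGrading_succ] at hf
    suffices h : extGrading K V 1 * extGrading K V (j + 1) ≤
      (extGrading K V (j + 1)).comap (contractLeft d) from h hf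
    refine Submodule.mul_le.2 fun w hw g hg => ?_
    obtain ⟨w, rfl⟩ := mem_extGrading_one.1 hw
    change contractLeft d (CliffordAlgebra.ι 0 w * g) ∈ extGrading K V (j + 1)
    rw [contractLeft_ι_mul]
    refine sub_mem (Submodule.smul_mem _ _ hg) ?_
    rw [extGrading_succ]
    exact Submodule.mul_mem_mul (mem_extGrading_one.2 ⟨w, rfl⟩) (ih hg)

theorem contractRight_mem_extGrading (d : Module.Dual K V) (j : ℕ) {f : ExteriorAlgebra K V}
    (hf : f ∈ extGrading K V (j + 1)) : contractRight f d ∈ extGrading K V j := by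
  induction j generalizing f with
  | zero =>
    obtain ⟨u, rfl⟩ := mem_extGrading_one.1 hf
    rw [contractRight_ι, Algebra.algebraMap_eq_smul_one]
    exact Submodule.smul_mem _ _ (SetLike.GradedOne.one_mem (A := extGrading K V))
  | succ j ih =>
    rw [extGrading_succ'] at hf
    suffices h : extGrading K V (j + 1) * extGrading K V 1 ≤
      (extGrading K V (j + 1)).comap (contractRight.flip d) from h hf
    refine Submodule.mul_le.2 fun g hg w hw => ?_
    obtain ⟨w, rfl⟩ := mem_extGrading_one.1 hw
    change contractRight (g * CliffordAlgebra.ι 0 w) d ∈ extGrading K V (j + 1)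
    rw [contractRight_mul_ι]
    refine sub_mem (Submodule.smul_mem _ _ hg) ?_
    rw [extGrading_succ']
    exact Submodule.mul_mem_mul (ih hg) (mem_extGrading_one.2 ⟨w, rfl⟩)

/-- The annihilator of `y` modulo linear forms that do not involve `y` is generated by `y`: if
`φ` is the right contraction with a linear form on `V` that takes the value `1` at `y` and kills
`Λ`, then `f = φ (f y) + φ (f) y`. -/
theorem ext_colon {Λ : Submodule K (ExteriorAlgebra K V)} {y f : ExteriorAlgebra K V}
    {j : ℕ} (hΛ : Λ ≤ extGrading K V 1) (hy : y ∈ extGrading K V 1) (hyΛ : y ∉ Λ)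
    (hf : f ∈ extGrading K V j) (hfy : f * y ∈ smulSpan (extGrading K V j) Λ) :
    f ∈ genFam (extGrading K V) 1 (Λ ⊔ Submodule.span K {y}) j := by
  obtain ⟨y, rfl⟩ := mem_extGrading_one.1 hy
  obtain ⟨d, hdy, hd⟩ : ∃ d : Module.Dual K V, d y = 1 ∧
      ∀ u, ExteriorAlgebra.ι K u ∈ Λ → d u = 0 := by
    have hy' : (Λ.comap (ExteriorAlgebra.ι K)).mkQ y ≠ 0 := fun h =>
      hyΛ ((Submodule.Quotient.mk_eq_zero (Λ.comap (ExteriorAlgebra.ι K))).1 h)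
    obtain ⟨φ, hφ⟩ := Module.Projective.exists_dual_eq_one K hy'
    refine ⟨φ ∘ₗ (Λ.comap (ExteriorAlgebra.ι K)).mkQ, hφ, fun u hu => ?_⟩
    rw [LinearMap.comp_apply, show (Λ.comap (ExteriorAlgebra.ι K)).mkQ u = 0 from
      (Submodule.Quotient.mk_eq_zero (Λ.comap (ExteriorAlgebra.ι K))).2 hu, map_zero]
  set Q := genFam (extGrading K V) 1 (Λ ⊔ Submodule.span K {ExteriorAlgebra.ι K y}) with hQ
  have e : f = contractRight (f * ExteriorAlgebra.ι K y) d +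
      contractRight f d * ExteriorAlgebra.ι K y := by
    have := contractRight_mul_ι (Q := (0 : QuadraticForm K V)) d y f
    rw [hdy, one_smul] at this
    exact (add_eq_of_eq_sub this).symm
  -- In degree zero the contraction vanishes, so that the degrees below need no truncation.
  have hmem : ∀ g ∈ extGrading K V j, ∀ l ∈ Λ ⊔ Submodule.span K {ExteriorAlgebra.ι K y},
      contractRight g d * l ∈ Q j := by
    intro g hg l hl
    cases j with
    | zero =>
      obtain ⟨c, rfl⟩ := Submodule.mem_span_singleton.1 (extGrading_zero_le hg)
      have : contractRight (c • (1 : ExteriorAlgebra K V)) d = 0 := by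
        rw [← Algebra.algebraMap_eq_smul_one]
        exact contractRight_algebraMap (Q := (0 : QuadraticForm K V)) d c
      rw [this, zero_mul]
      exact zero_mem _
    | succ j => exact smul_mem_genFam (contractRight_mem_extGrading d j hg) hl
  rw [e]
  refine add_mem ?_ (hmem f hf _ (Submodule.mem_sup_right (Submodule.mem_span_singleton_self _)))
  suffices h : smulSpan (extGrading K V j) Λ ≤ (Q j).comap (contractRight.flip d) from h hfy
  refine smulSpan_le.2 fun g hg l hl => ?_
  obtain ⟨u, rfl⟩ := mem_extGrading_one.1 (hΛ hl)
  change contractRight (g * CliffordAlgebra.ι 0 u) d ∈ Q j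
  rw [contractRight_mul_ι, hd u hl, zero_smul, zero_sub]
  exact neg_mem (hmem g hg _ (Submodule.mem_sup_left hl))

variable (e : Module.Basis (Fin n) K V)

theorem extGrading_one_eq_span :
    Submodule.span K (Set.range fun i => ExteriorAlgebra.ι K (e i)) = extGrading K V 1 := by
  rw [Set.range_comp' (ExteriorAlgebra.ι K) e, ← Submodule.map_span, e.span_eq]
  ext v
  rw [mem_extGrading_one]
  simp

/-- Exterior algebras have `ε = -1` and `η = 1`: the annihilator of a linear form `y` modulo `(Λ)`
is generated by `y`. -/
theorem koszulModel_ext (e : Module.Basis (Fin n) K V) :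
    KoszulModel (extGrading K V) n (-1 : K) 1 where
  zero_deg := extGrading_zero_le
  succ_deg a := (extGrading_succ a).le
  finrank_one := by
    rw [← extGrading_one_eq_span e, finrank_span_eq_card, Fintype.card_fin]
    exact e.linearIndependent.map' _
      (LinearMap.ker_eq_bot.2 ExteriorAlgebra.ι_leftInverse.injective)
  comm := ext_mul_linear
  sign := by ring
  eta := Or.inr rfl
  sq v hv := by
    obtain ⟨u, rfl⟩ := mem_extGrading_one.1 hv
    rw [ExteriorAlgebra.ι_sq_zero, smul_zero]
  colon {Λ y f j} hΛ hy hyΛ hf hfy := by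
    rw [one_smul]
    exact ext_colon hΛ hy hyΛ hf hfy

theorem hasContractions_ext : HasContractions (extGrading K V)
    (fun i => ExteriorAlgebra.ι K (e i)) (fun i => contractLeft (e.coord i)) where
  span := extGrading_one_eq_span e
  sq i := ExteriorAlgebra.ι_sq_zero _
  anti i j := ExteriorAlgebra.ι_add_mul_swap _ _
  leibniz i j f := by
    have := contractLeft_ι_mul (Q := (0 : QuadraticForm K V)) (e.coord i) (e j) f
    refine (eq_sub_iff_add_eq.1 this).trans ?_
    rw [Module.Basis.coord_apply, e.repr_self, Finsupp.single_apply]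
    simp only [eq_comm (a := i), ite_smul, one_smul, zero_smul]
  one i := contractLeft_one _ _
  lower i j _ hf := contractLeft_mem_extGrading _ j hf

theorem extBasis_singleton (i : Fin n) : e.ExteriorAlgebra {i} = ExteriorAlgebra.ι K (e i) := by
  rw [ExteriorAlgebra.basis_apply_ofCard e (Finset.card_singleton i)]
  obtain ⟨a, ha⟩ := (Set.powersetCard.mem_range_ofFinEmbEquiv_symm_iff_mem
    (Set.powersetCard.ofCard (Finset.card_singleton i)) i).2 (Finset.mem_singleton_self i)
  obtain rfl := Subsingleton.elim a 0
  change ExteriorAlgebra.ιMulti K 1 _ = _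
  rw [ExteriorAlgebra.ιMulti_apply]
  simp [ha]

theorem extBasis_mul_of_mem {s : Finset (Fin n)} {i : Fin n} (hi : i ∈ s) :
    e.ExteriorAlgebra s * ExteriorAlgebra.ι K (e i) = 0 := by
  rw [← extBasis_singleton]
  refine ExteriorAlgebra.basis_mul_of_not_disjoint e (Set.powersetCard.ofCard (s := s) rfl)
    (Set.powersetCard.ofCard (Finset.card_singleton i)) fun h => ?_
  exact Finset.disjoint_singleton_right.1 h hi

theorem extBasis_mul_of_notMem {s : Finset (Fin n)} {i : Fin n} (hi : i ∉ s) :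
    ∃ c : K, c ≠ 0 ∧
      e.ExteriorAlgebra s * ExteriorAlgebra.ι K (e i) = c • e.ExteriorAlgebra (insert i s) := by
  have hd : Disjoint (Set.powersetCard.ofCard (s := s) rfl).val
      (Set.powersetCard.ofCard (Finset.card_singleton i)).val :=
      Finset.disjoint_singleton_right.2 hi
  have h := ExteriorAlgebra.basis_mul_of_disjoint e _ _ hd
  have e1 : (Set.powersetCard.disjUnion hd : Finset (Fin n)) = insert i s := by
    ext a
    rw [Set.powersetCard.coe_disjUnion, Finset.mem_disjUnion, Finset.mem_insert, or_comm]
    exact or_congr_left Finset.mem_singleton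
  rw [e1] at h
  rw [← extBasis_singleton]
  rcases Int.units_eq_one_or (Set.powersetCard.permOfDisjoint hd).sign with h1 | h1
  · exact ⟨1, one_ne_zero, h.trans (by rw [h1, one_smul, one_smul])⟩
  · refine ⟨-1, neg_ne_zero.2 one_ne_zero, h.trans ?_⟩
    rw [h1, neg_smul, Units.neg_smul, one_smul, one_smul]

theorem indicator_insert {s : Finset (Fin n)} {i : Fin n} (hi : i ∉ s) :
    (fun a => if a ∈ insert i s then 1 else 0 : Fin n → ℕ) =
      (fun a => if a ∈ s then 1 else 0) + Pi.single i 1 := by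
  funext a
  by_cases ha : a = i
  · subst ha
    simp [hi]
  · simp [ha]

theorem monomialModel_ext : MonomialModel (extGrading K V) e.ExteriorAlgebra
    (fun S i => if i ∈ S then 1 else 0) (fun i => ExteriorAlgebra.ι K (e i))
    (extCoordChange e) where
  injective s t h := by
    ext i
    have := congrFun h i
    by_cases hs : i ∈ s <;> by_cases ht : i ∈ t <;> simp_all
  mem s := by
    have : ∑ i, (if i ∈ s then 1 else 0) = s.card := by simp
    rw [this, ExteriorAlgebra.basis_apply]
    exact ExteriorAlgebra.ιMulti_range K _ ⟨_, rfl⟩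
  x_mem i := mem_extGrading_one.2 ⟨_, rfl⟩
  span_x := (extGrading_one_eq_span e).ge
  mul_x s i := by
    by_cases hi : i ∈ s
    · exact Or.inl (extBasis_mul_of_mem e hi)
    · obtain ⟨c, -, h⟩ := extBasis_mul_of_notMem e hi
      exact Or.inr ⟨insert i s, c, indicator_insert hi, h⟩
  div_x t i ht := by
    have hi : i ∈ t := by
      by_contra hi
      exact ht (if_neg hi)
    obtain ⟨c, hc, h⟩ := extBasis_mul_of_notMem e (Finset.notMem_erase i t)
    have h' := indicator_insert (Finset.notMem_erase i t)
    rw [Finset.insert_erase hi] at h h'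
    exact ⟨t.erase i, c, hc, h', h⟩
  coord g j := by
    rw [extCoordChange, ExteriorAlgebra.map_apply_ι, Matrix.toLin_self, map_sum]
    exact Finset.sum_congr rfl fun i _ => map_smul _ _ _
  char_cond := Or.inl fun s i => by
    split_ifs <;> simp

theorem extGrading_finite (e : Module.Basis (Fin n) K V) (a : ℕ) :
    Module.Finite K (extGrading K V a) :=
  have := Module.Finite.of_basis e
  inferInstanceAs (Module.Finite K (⋀[K]^a V))

theorem extGrading_eq_bot (e : Module.Basis (Fin n) K V) {j : ℕ} (hj : n < j) :
    extGrading K V j = ⊥ := by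
  have := Module.Finite.of_basis e
  have := extGrading_finite e j
  refine Submodule.finrank_eq_zero.1 ((exteriorPower.finrank_eq K j).trans ?_)
  rw [Module.finrank_eq_card_basis e, Fintype.card_fin, Nat.choose_eq_zero_of_lt hj]

theorem isNoetherianRing_ext (e : Module.Basis (Fin n) K V) :
    IsNoetherianRing (ExteriorAlgebra K V) :=
  have := Module.Finite.of_basis e.ExteriorAlgebra
  isNoetherian_of_tower K inferInstance

end ExteriorAlgebra

end LinearStrand

end

theorem theorem0p1 {K : Type u} [Field K] (n k : ℕ) :
    (CharZero K → ∀ I : Ideal (MvPolynomial (Fin n) K),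
      I.IsHomogeneous (LinearStrand.polyGrading K n) →
      (∃! J, LinearStrand.IsPolyGin I J) ∧
      ∀ J, LinearStrand.IsPolyGin I J →
        List.TFAE [
          ∀ i, 1 ≤ i →
            LinearStrand.bettiQuot (LinearStrand.polyGrading K n) I i (i + k) =
              LinearStrand.bettiQuot (LinearStrand.polyGrading K n) J i (i + k),
          LinearStrand.HasLinearResolution (LinearStrand.polyGrading K n)
              (LinearStrand.component (LinearStrand.polyGrading K n) I k) k ∧
            LinearStrand.HasLinearResolution (LinearStrand.polyGrading K n)
              (LinearStrand.component (LinearStrand.polyGrading K n) I (k + 1)) (k + 1),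
          LinearStrand.bettiQuot (LinearStrand.polyGrading K n) I 1 (k + 1) =
              LinearStrand.bettiQuot (LinearStrand.polyGrading K n) J 1 (k + 1) ∧
            LinearStrand.bettiQuot (LinearStrand.polyGrading K n) I 1 (k + 2) =
              LinearStrand.bettiQuot (LinearStrand.polyGrading K n) J 1 (k + 2)]) ∧
    (Infinite K → ∀ (V : Type v) [AddCommGroup V] [Module K V] (e : Module.Basis (Fin n) K V)
      (I : Ideal (ExteriorAlgebra K V)),
      I.IsHomogeneous (LinearStrand.extGrading K V) →
      (∃! J, LinearStrand.IsExtGin e I J) ∧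
      ∀ J, LinearStrand.IsExtGin e I J →
        List.TFAE [
          ∀ i, 1 ≤ i →
            LinearStrand.bettiQuot (LinearStrand.extGrading K V) I i (i + k) =
              LinearStrand.bettiQuot (LinearStrand.extGrading K V) J i (i + k),
          LinearStrand.HasLinearResolution (LinearStrand.extGrading K V)
              (LinearStrand.component (LinearStrand.extGrading K V) I k) k ∧
            LinearStrand.HasLinearResolution (LinearStrand.extGrading K V)
              (LinearStrand.component (LinearStrand.extGrading K V) I (k + 1)) (k + 1),
          LinearStrand.bettiQuot (LinearStrand.extGrading K V) I 1 (k + 1) =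
              LinearStrand.bettiQuot (LinearStrand.extGrading K V) J 1 (k + 1) ∧
            LinearStrand.bettiQuot (LinearStrand.extGrading K V) I 1 (k + 2) =
              LinearStrand.bettiQuot (LinearStrand.extGrading K V) J 1 (k + 2)]) := by
  constructor
  · intro _ I hI
    have : Infinite K := Infinite.of_injective _ (Nat.cast_injective (R := K))
    exact LinearStrand.monomialModel_poly.existsUnique_and_tfae LinearStrand.koszulModel_poly
      (fun hW hΛ hne hlin => LinearStrand.koszulModel_poly.exists_isGoodForm_poly hW hΛ hne hlin)
      hI k
  · intro _ V _ _ e I hI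
    have := LinearStrand.extGrading_finite e
    have := LinearStrand.isNoetherianRing_ext e
    have h := LinearStrand.koszulModel_ext e
    exact (LinearStrand.monomialModel_ext e).existsUnique_and_tfae h
      (fun hW hΛ hne hlin => h.exists_isGoodForm_ext (LinearStrand.hasContractions_ext e)
        (fun _ hj => LinearStrand.extGrading_eq_bot e (Nat.lt_of_succ_le hj)) hW hΛ hne hlin)
      hI k
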